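/- **Conventions.** Let $q\in\mathbb C\setminus\{0\}$ be not a root of unity, and let $M,N$ be integers with $MN>0$ and $M\neq N$ ($M,N\ge 1$). Put $I=\{1,\dots,M+N-1\}$; $l_i=1$ for $i\le M$ and $l_i=-1$ for $i>M$; $q_i=q^{l_i}$; $(\epsilon_i,\epsilon_j)=l_i\delta_{ij}$; $c_{ij}=(\epsilon_i-\epsilon_{i+1},\epsilon_j-\epsilon_{j+1})$; $[n]_u=\frac{u^n-u^{-n}}{u-u^{-1}}$; $[a,b]_u=ab-(-1)^{|a||b|}u\,ba$ for homogeneous $a,b$, and $[a,b]=[a,b]_1$. **The algebras.** $U=U_q(\mathcal L\mathfrak{sl}(M,N))$ is the superalgebra over $\mathbb C$ generated by $X^\pm_{i,n},K_i^{\pm1},h_{i,s}$ ($i\in I$, $n\in\mathbb Z$, $s\in\mathbb Z\setminus\{0\}$), where the $X^\pm_{M,n}$ are odd and all other generators are even, with the relations (for all admissible indices) $$K_iK_i^{-1}=1=K_i^{-1}K_i,\quad [K_i,K_j]=[K_i,h_{j,s}]=[h_{i,s},h_{j,t}]=0,$$ $$K_iX^\pm_{j,n}K_i^{-1}=q^{\pm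 c_{ij}}X^\pm_{j,n},\quad [h_{i,s},X^\pm_{j,n}]=\pm\tfrac{[s\,l_ic_{ij}]_{q_i}}{s}X^\pm_{j,n+s},\quad [X^+_{i,m},X^-_{j,n}]=\delta_{ij}\frac{\phi^+_{i,m+n}-\phi^-_{i,m+n}}{q_i-q_i^{-1}},$$ $$[X^\pm_{i,m},X^\pm_{j,n}]=0\ \text{ if } c_{ij}=0,$$ $$X^\pm_{i,m+1}X^\pm_{j,n}-q^{\pm c_{ij}}X^\pm_{j,n}X^\pm_{i,m+1}=q^{\pm c_{ij}}X^\pm_{i,m}X^\pm_{j,n+1}-X^\pm_{j,n+1}X^\pm_{i,m}\ \text{ if } c_{ij}\neq0,$$ $$[X^\pm_{i,m},[X^\pm_{i,n},X^\pm_{j,k}]_{q^{-1}}]_q+[X^\pm_{i,n},[X^\pm_{i,m},X^\pm_{j,k}]_{q^{-1}}]_q=0\ \text{ if } c_{ij}=\pm1,\ i\neq M,$$ $$[[[X^\pm_{M-1,m},X^\pm_{M,n}]_{q^{-1}},X^\pm_{M+1,k}]_q,X^\pm_{M,u}]+[[[X^\pm_{M-1,m},X^\pm_{M,u}]_{q^{-1}},X^\pm_{M+1,k}]_q,X^\pm_{M,n}]=0\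 \text{ if } M,N>1,$$ where $\sum_{n}\phi^\pm_{i,n}z^n=K_i^{\pm1}\exp\bigl(\pm(q_i-q_i^{-1})\sum_{s>0}h_{i,\pm s}z^{\pm s}\bigr)$. Let $U'=U_q(\mathcal L'\mathfrak{sl}(M,N))=U\rtimes\mathbb C[K_0,K_0^{-1}]$, where $K_0$ is even, commutes with all $K_i,h_{i,s}$, and $K_0X^\pm_{i,n}K_0^{-1}=q^{\pm\delta_{i,1}}X^\pm_{i,n}$; let $\iota:U\to U'$ be the canonical injection. Let $\tilde D$ be the set of automorphisms of $U'$ of the form $K_0\mapsto tK_0$, $K_i\mapsto\varepsilon_iK_i$, $h_{i,s}\mapsto h_{i,s}$, $X^+_{i,n}\mapsto\varepsilon_iX^+_{i,n}$, $X^-_{i,n}\mapsto X^-_{i,n}$ with $t\in\mathbb C\setminus\{0\}$, $\varepsilon_i\in\{\pm1\}$, $\varepsilon_M=1$, and let $D$ be the set of their restrictions to $U$. Modules are $\mathbb Z_2$-graded modules, morphisms preserve the grading, and a module is simple if it is non-zero and has no $\mathbb Z_2$-graded submodule except $0$ and itself. **Highest weights.** $\mathcal R_{M,N}$ is the set of triples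 $(\underline P,f,c)$ with $\underline P=(P_i)_{i\in I,\,i\ne M}$, $P_i\in1+z\mathbb C[z]$; $f=\sum_{n\in\mathbb Z}f_nz^n\in\mathbb C[[z,z^{-1}]]$ annihilated by a non-zero polynomial; $c\in\mathbb C\setminus\{0\}$ with $\frac{c-c^{-1}}{q-q^{-1}}=f_0$. $\tilde{\mathcal R}_{M,N}$ is the set of $(\underline P,f,c;Q)$ with $(\underline P,f,c)\in\mathcal R_{M,N}$, $Q\in1+z\mathbb C[z]$ and $Qf=0$. **Modules.** For $(\underline P,f,c)\in\mathcal R_{M,N}$ the Verma module $\mathbf M(\underline P,f,c)$ is the $U$-module generated by an even vector $v$ subject to $$X^+_{i,n}v=0\ (i\in I,\,n\in\mathbb Z),\qquad \sum_n\phi^\pm_{i,n}z^nv=q_i^{\deg P_i}\frac{P_i(zq_i^{-1})}{P_i(zq_i)}v\in\mathbb Cv[[z^{\pm1}]]\ (i\neq M),$$ $$K_Mv=cv,\qquad \sum_n\frac{\phi^+_{M,n}-\phi^-_{M,n}}{q-q^{-1}}z^nv=f(z)v.$$ It is a $U'$-module through $K_0v=v$, and $\mathbf S'(\underline P,f,c)$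 is its unique simple quotient as a $U'$-module. For $(\underline P,f,c;Q)\in\tilde{\mathcal R}_{M,N}$ with $Q=\sum_{s=0}^da_sz^s$, $d=\deg Q$, the Weyl module $\mathbf W(\underline P,f,c;Q)$ is the quotient of $\mathbf M(\underline P,f,c)$ by the relations $$(X^-_{i,0})^{1+\deg P_i}v=0\ (i\neq M),\qquad \sum_{s=0}^da_{d-s}X^-_{M,s}v=0.$$ **Proposition.** (a) Every finite-dimensional simple $U$-module is, up to a shift of parity, isomorphic to $\pi^*\iota^*\mathbf S'(\underline P,f,c)$ for some $(\underline P,f,c)\in\mathcal R_{M,N}$ and $\pi\in D$. (b) Let $(\underline P,f,c)\in\mathcal R_{M,N}$, let $V$ be a finite-dimensional $U$-module and $\theta:\mathbf M(\underline P,f,c)\twoheadrightarrow V$ an epimorphism of $U$-modules. Then there is $Q\in\mathbb C[z]$ with $(\underline P,f,c;Q)\in\tilde{\mathcal R}_{M,N}$ such that $\theta$ factorizes through the canonical epimorphism $\mathbf M(\underline P,f,c)\twoheadrightarrow\mathbf W(\underline P,f,c;Q)$. (c) For $(\underline P,f,c;Q_1),(\underline P,f,c;Q_2)\in\tilde{\mathcal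 R}_{M,N}$, the canonical epimorphism $\mathbf M(\underline P,f,c)\twoheadrightarrow\mathbf W(\underline P,f,c;Q_1)$ factorizes through $\mathbf M(\underline P,f,c)\twoheadrightarrow\mathbf W(\underline P,f,c;Q_2)$ if and only if $Q_1$ divides $Q_2$ in $\mathbb C[z]$. -/

import Mathlib

open scoped Polynomial

noncomputable section

namespace QAffine

/-! ## Superspaces, supermodules -/

section Super

variable {A B V W : Type*} [Ring A] [Algebra ℂ A] [Ring B] [Algebra ℂ B]
  [AddCommGroup V] [Module ℂ V] [Module A V] [AddCommGroup W] [Module ℂ W]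

/-- The super-bracket `[a, b]_u = a b - (-1)^{p p'} u b a` of elements `a`, `b` of parities
`p`, `p'`. -/
def sbr (p p' : ZMod 2) (u : ℂ) (a b : A) : A :=
  a * b - ((-1) ^ (p.val * p'.val) * u) • (b * a)

/-- The `ℤ/2`-grading of an algebra generated by elements `gen g` of prescribed parity `par g`:
the part of degree `i` is spanned by the words in the generators of total parity `i`. -/
def wordGrading {G : Type*} (gen : G → A) (par : G → ZMod 2) (i : ZMod 2) : Submodule ℂ A :=
  Submodule.span ℂ {x | ∃ l : List G, (l.map par).sum = i ∧ x = (l.map gen).prod}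

/-- `V = V_0 ⊕ V_1` is a module over the superalgebra `A = A_0 ⊕ A_1`, in the super sense. -/
structure IsSuperModule (𝒜 : ZMod 2 → Submodule ℂ A) (𝒱 : ZMod 2 → Submodule ℂ V) : Prop where
  isInternal : DirectSum.IsInternal 𝒱
  smul_mem : ∀ (i j : ZMod 2) (a : A) (v : V), a ∈ 𝒜 i → v ∈ 𝒱 j → a • v ∈ 𝒱 (i + j)

/-- A submodule is a sub-supermodule if it contains the homogeneous components of its elements. -/
def IsHomogeneousSub (𝒱 : ZMod 2 → Submodule ℂ V) (S : Submodule A V) : Prop :=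
  ∀ x ∈ S, ∃ y ∈ S, ∃ z ∈ S, y ∈ 𝒱 0 ∧ z ∈ 𝒱 1 ∧ x = y + z

variable (A) in
/-- A supermodule is simple if it is non-zero and has no sub-supermodules but `0` and itself. -/
def IsSimpleSuper (𝒱 : ZMod 2 → Submodule ℂ V) : Prop :=
  Nontrivial V ∧ ∀ S : Submodule A V, IsHomogeneousSub 𝒱 S → S = ⊥ ∨ S = ⊤

/-- A map of superspaces that preserves the grading. -/
def IsEvenMap (𝒱 : ZMod 2 → Submodule ℂ V) (𝒲 : ZMod 2 → Submodule ℂ W) (f : V → W) : Prop :=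
  ∀ i v, v ∈ 𝒱 i → f v ∈ 𝒲 i

/-- The `A`-supermodule `V` is isomorphic to the pullback `ρ^* W` of the `B`-supermodule `W`
along `ρ : A → B`, by an isomorphism that either preserves the parity or reverses it
(so `V` is `ρ^* W` or its parity shift). -/
def IsoPullback [Module B W] (ρ : A →ₐ[ℂ] B)
    (𝒱 : ZMod 2 → Submodule ℂ V) (𝒲 : ZMod 2 → Submodule ℂ W) : Prop :=
  ∃ (e : V ≃ₗ[ℂ] W) (p : ZMod 2),
    (∀ (a : A) (v : V), e (a • v) = ρ a • e v) ∧ ∀ i v, v ∈ 𝒱 i ↔ e v ∈ 𝒲 (i + p)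

/-- The grading induced on the quotient of a superspace by a submodule. -/
def quotGrading [IsScalarTower ℂ A V] (𝒱 : ZMod 2 → Submodule ℂ V) (S : Submodule A V)
    (i : ZMod 2) : Submodule ℂ (V ⧸ S) :=
  (𝒱 i).map (S.mkQ.restrictScalars ℂ)

end Super

/-! ## Drinfel'd generators and relations -/

/-- The nodes `1, …, M + N - 1` of the Dynkin diagram of `sl(M, N)`. -/
abbrev Node (M N : ℕ) : Type := {i : ℕ // 1 ≤ i ∧ i ≤ M + N - 1}

/-- `l_i`: equal to `1` for `i ≤ M` and to `-1` for `i > M`. -/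
def ell (M i : ℕ) : ℤ := if i ≤ M then 1 else -1

/-- The form `(ε_i, ε_j) = l_i δ_{ij}`. -/
def epsForm (M i j : ℕ) : ℤ := if i = j then ell M i else 0

/-- `c_{ij} = (ε_i - ε_{i+1}, ε_j - ε_{j+1})`. -/
def cartan (M i j : ℕ) : ℤ :=
  epsForm M i j - epsForm M i (j + 1) - epsForm M (i + 1) j + epsForm M (i + 1) (j + 1)

/-- `q_i = q^{l_i}`. -/
def qi (q : ℂ) (M i : ℕ) : ℂ := q ^ ell M i

/-- `[n]_q = (q^n - q^{-n}) / (q - q^{-1})`. -/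
def qInt (q : ℂ) (n : ℤ) : ℂ := (q ^ n - q ^ (-n)) / (q - q⁻¹)

/-- The parity of a node: only the node `M` is odd. -/
def nodePar (M i : ℕ) : ZMod 2 := if i = M then 1 else 0

/-- The Drinfel'd generators `X_{i,n}^ε`, `K_i^ε` and `h_{i,s}` (`s ≠ 0`), for signs `ε = ±1`. -/
inductive Gen (M N : ℕ) : Type
  | X (ε : ℤˣ) (i : Node M N) (n : ℤ) : Gen M N
  | K (ε : ℤˣ) (i : Node M N) : Gen M N
  | H (i : Node M N) (s : ℤ) (hs : s ≠ 0) : Gen M N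

/-- The parity of the generators. -/
def Gen.par {M N : ℕ} : Gen M N → ZMod 2
  | .X _ i _ => nodePar M i
  | .K _ _ => 0
  | .H _ _ _ => 0

/-- The free algebra on the generators. -/
abbrev FreeU (M N : ℕ) : Type := FreeAlgebra ℂ (Gen M N)

section Relations

variable {M N : ℕ}

/-- `X_{i,n}^ε` in the free algebra. -/
def fX (ε : ℤˣ) (i : Node M N) (n : ℤ) : FreeU M N := FreeAlgebra.ι ℂ (.X ε i n)

/-- `K_i^ε` in the free algebra. -/
def fK (ε : ℤˣ) (i : Node M N) : FreeU M N := FreeAlgebra.ι ℂ (.K ε i)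

/-- `h_{i,s}` in the free algebra. -/
def fH (i : Node M N) (s : ℤ) (hs : s ≠ 0) : FreeU M N := FreeAlgebra.ι ℂ (.H i s hs)

/-- The series `ε (q_i - q_i⁻¹) ∑_{s > 0} h_{i, ε s} w^s` (with `w = z^ε`). -/
def hSeries (q : ℂ) (ε : ℤˣ) (i : Node M N) : PowerSeries (FreeU M N) :=
  PowerSeries.mk fun s : ℕ =>
    if hs : s = 0 then 0
    else (((ε : ℤ) : ℂ) * (qi q M i - (qi q M i)⁻¹)) •
      fH i ((ε : ℤ) * (s : ℤ)) (mul_ne_zero ε.ne_zero (Int.natCast_ne_zero.mpr hs))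

/-- The coefficient of `w^n` in `exp g = ∑_k g^k / k!`, for a series `g` without constant term
(so that only the `k ≤ n` contribute). -/
def expCoeff {A : Type*} [Ring A] [Algebra ℂ A] (g : PowerSeries A) (n : ℕ) : A :=
  ∑ k ∈ Finset.range (n + 1), ((Nat.factorial k : ℂ)⁻¹) • PowerSeries.coeff n (g ^ k)

/-- `φ_{i,n}^ε`, defined by
`∑_n φ_{i,n}^ε z^n = K_i^ε exp (ε (q_i - q_i⁻¹) ∑_{s > 0} h_{i, ε s} z^{ε s})`. -/
def fphi (q : ℂ) (ε : ℤˣ) (i : Node M N) (n : ℤ) : FreeU M N :=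
  if 0 ≤ (ε : ℤ) * n then fK ε i * expCoeff (hSeries q ε i) ((ε : ℤ) * n).toNat else 0

/-- The defining relations of `U_q(L sl(M, N))`. -/
inductive Rel (q : ℂ) (M N : ℕ) : FreeU M N → FreeU M N → Prop
  | K_inv (ε : ℤˣ) (i : Node M N) : Rel q M N (fK ε i * fK (-ε) i) 1
  | K_K (ε ε' : ℤˣ) (i j : Node M N) : Rel q M N (fK ε i * fK ε' j) (fK ε' j * fK ε i)
  | K_H (ε : ℤˣ) (i j : Node M N) (s : ℤ) (hs : s ≠ 0) :
      Rel q M N (fK ε i * fH j s hs) (fH j s hs * fK ε i)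
  | H_H (i j : Node M N) (s t : ℤ) (hs : s ≠ 0) (ht : t ≠ 0) :
      Rel q M N (fH i s hs * fH j t ht) (fH j t ht * fH i s hs)
  | K_X (ε : ℤˣ) (i j : Node M N) (n : ℤ) :
      Rel q M N (fK 1 i * fX ε j n * fK (-1) i) (q ^ ((ε : ℤ) * cartan M i j) • fX ε j n)
  | H_X (ε : ℤˣ) (i j : Node M N) (s n : ℤ) (hs : s ≠ 0) :
      Rel q M N (fH i s hs * fX ε j n - fX ε j n * fH i s hs)
        ((((ε : ℤ) : ℂ) * (qInt (qi q M i) (s * ell M i * cartan M i j) / (s : ℂ))) •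
          fX ε j (n + s))
  | X_X_opp (i j : Node M N) (m n : ℤ) :
      Rel q M N (sbr (nodePar M i) (nodePar M j) 1 (fX 1 i m) (fX (-1) j n))
        (if i = j then
          (qi q M i - (qi q M i)⁻¹)⁻¹ • (fphi q 1 i (m + n) - fphi q (-1) i (m + n)) else 0)
  | X_X_zero (ε : ℤˣ) (i j : Node M N) (m n : ℤ) : cartan M i j = 0 →
      Rel q M N (sbr (nodePar M i) (nodePar M j) 1 (fX ε i m) (fX ε j n)) 0
  | X_X (ε : ℤˣ) (i j : Node M N) (m n : ℤ) : cartan M i j ≠ 0 →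
      Rel q M N
        (fX ε i (m + 1) * fX ε j n -
          q ^ ((ε : ℤ) * cartan M i j) • (fX ε j n * fX ε i (m + 1)))
        (q ^ ((ε : ℤ) * cartan M i j) • (fX ε i m * fX ε j (n + 1)) -
          fX ε j (n + 1) * fX ε i m)
  | serre (ε : ℤˣ) (i j : Node M N) (m n k : ℤ) :
      cartan M i j = 1 ∨ cartan M i j = -1 → (i : ℕ) ≠ M →
      Rel q M N
        (sbr 0 (nodePar M j) q (fX ε i m) (sbr 0 (nodePar M j) q⁻¹ (fX ε i n) (fX ε j k)) +
         sbr 0 (nodePar M j) q (fX ε i n) (sbr 0 (nodePar M j) q⁻¹ (fX ε i m) (fX ε j k))) 0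
  | oscillation (ε : ℤˣ) (a b d : Node M N) (m n k u : ℤ) :
      1 < M → 1 < N → (a : ℕ) + 1 = M → (b : ℕ) = M → (d : ℕ) = M + 1 →
      Rel q M N
        (sbr 1 1 1 (sbr 1 0 q (sbr 0 1 q⁻¹ (fX ε a m) (fX ε b n)) (fX ε d k)) (fX ε b u) +
         sbr 1 1 1 (sbr 1 0 q (sbr 0 1 q⁻¹ (fX ε a m) (fX ε b u)) (fX ε d k)) (fX ε b n)) 0

end Relations

/-! ## The quantum affine superalgebra and its enlargement -/

/-- The quantum affine superalgebra `U_q(L sl(M, N))`. -/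
def U (q : ℂ) (M N : ℕ) : Type := RingQuot (Rel q M N)

instance (q : ℂ) (M N : ℕ) : Ring (U q M N) := inferInstanceAs (Ring (RingQuot (Rel q M N)))

instance (q : ℂ) (M N : ℕ) : Algebra ℂ (U q M N) :=
  inferInstanceAs (Algebra ℂ (RingQuot (Rel q M N)))

/-- The projection of the free algebra. -/
def mkU (q : ℂ) (M N : ℕ) : FreeU M N →ₐ[ℂ] U q M N := RingQuot.mkAlgHom ℂ (Rel q M N)

/-- The `ℤ/2`-grading of `U_q(L sl(M, N))`. -/
def gradU (q : ℂ) (M N : ℕ) : ZMod 2 → Submodule ℂ (U q M N) :=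
  wordGrading (fun g : Gen M N => mkU q M N (FreeAlgebra.ι ℂ g)) Gen.par

/-- The exponent of `q` by which `K_0` rescales a generator: `K_0 X_{i,n}^± K_0⁻¹ =
q^{± δ_{i,1}} X_{i,n}^±`, while `K_0` commutes with the `K_i` and the `h_{i,s}`. -/
def Gen.wt0 {M N : ℕ} : Gen M N → ℤ
  | .X ε i _ => if (i : ℕ) = 1 then (ε : ℤ) else 0
  | .K _ _ => 0
  | .H _ _ _ => 0

/-- The generators of `U_q(L' sl(M, N))`: those of `U_q(L sl(M, N))`, and `K_0^ε`. -/
abbrev Gen' (M N : ℕ) : Type := Gen M N ⊕ ℤˣ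

/-- The inclusion of free algebras. -/
def freeIncl (M N : ℕ) : FreeU M N →ₐ[ℂ] FreeAlgebra ℂ (Gen' M N) :=
  FreeAlgebra.lift ℂ fun g => FreeAlgebra.ι ℂ (Sum.inl g)

/-- The relations of the semi-direct product `U_q(L sl(M, N)) ⋊ ℂ[K_0, K_0⁻¹]`. -/
inductive Rel' (q : ℂ) (M N : ℕ) :
    FreeAlgebra ℂ (Gen' M N) → FreeAlgebra ℂ (Gen' M N) → Prop
  | base (a b : FreeU M N) : Rel q M N a b → Rel' q M N (freeIncl M N a) (freeIncl M N b)
  | K0_inv (ε : ℤˣ) :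
      Rel' q M N (FreeAlgebra.ι ℂ (Sum.inr ε) * FreeAlgebra.ι ℂ (Sum.inr (-ε))) 1
  | K0_conj (g : Gen M N) :
      Rel' q M N
        (FreeAlgebra.ι ℂ (Sum.inr 1) * FreeAlgebra.ι ℂ (Sum.inl g) *
          FreeAlgebra.ι ℂ (Sum.inr (-1)))
        (q ^ g.wt0 • FreeAlgebra.ι ℂ (Sum.inl g))

/-- The enlargement `U_q(L' sl(M, N)) = U_q(L sl(M, N)) ⋊ ℂ[K_0, K_0⁻¹]`. -/
def U' (q : ℂ) (M N : ℕ) : Type := RingQuot (Rel' q M N)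

instance (q : ℂ) (M N : ℕ) : Ring (U' q M N) := inferInstanceAs (Ring (RingQuot (Rel' q M N)))

instance (q : ℂ) (M N : ℕ) : Algebra ℂ (U' q M N) :=
  inferInstanceAs (Algebra ℂ (RingQuot (Rel' q M N)))

/-- The projection of the free algebra. -/
def mkU' (q : ℂ) (M N : ℕ) : FreeAlgebra ℂ (Gen' M N) →ₐ[ℂ] U' q M N :=
  RingQuot.mkAlgHom ℂ (Rel' q M N)

/-- The `ℤ/2`-grading of `U_q(L' sl(M, N))`; the `K_0^{±1}` are even. -/
def gradU' (q : ℂ) (M N : ℕ) : ZMod 2 → Submodule ℂ (U' q M N) :=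
  wordGrading (fun g : Gen' M N => mkU' q M N (FreeAlgebra.ι ℂ g)) (Sum.elim Gen.par fun _ => 0)

/-- The canonical map `ι : U_q(L sl(M, N)) → U_q(L' sl(M, N))`. -/
def iota (q : ℂ) (M N : ℕ) : U q M N →ₐ[ℂ] U' q M N :=
  RingQuot.liftAlgHom ℂ
    ⟨(mkU' q M N).comp (freeIncl M N), fun _ _ h => RingQuot.mkAlgHom_rel ℂ (Rel'.base _ _ h)⟩

section Generators

variable (q : ℂ) {M N : ℕ}

/-- `X_{i,n}^ε`. -/
def X (ε : ℤˣ) (i : Node M N) (n : ℤ) : U q M N := mkU q M N (fX ε i n)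

/-- `K_i^ε`. -/
def K (ε : ℤˣ) (i : Node M N) : U q M N := mkU q M N (fK ε i)

/-- `h_{i,s}`. -/
def H (i : Node M N) (s : ℤ) (hs : s ≠ 0) : U q M N := mkU q M N (fH i s hs)

/-- `φ_{i,n}^ε`. -/
def phi (ε : ℤˣ) (i : Node M N) (n : ℤ) : U q M N := mkU q M N (fphi q ε i n)

/-- `K_0^ε`. -/
def K0 (M N : ℕ) (ε : ℤˣ) : U' q M N := mkU' q M N (FreeAlgebra.ι ℂ (Sum.inr ε))

end Generators

/-- The set `D̃` of automorphisms of `U_q(L' sl(M, N))` of the form `K_0 ↦ t K_0`,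
`K_i ↦ ε_i K_i`, `h_{i,s} ↦ h_{i,s}`, `X_{i,n}^+ ↦ ε_i X_{i,n}^+`, `X_{i,n}^- ↦ X_{i,n}^-`
with `t ≠ 0`, `ε_i = ±1` and `ε_M = 1`. -/
def Dtilde (q : ℂ) (M N : ℕ) : Set (U' q M N ≃ₐ[ℂ] U' q M N) :=
  {π | ∃ (t : ℂ) (ε : Node M N → ℤˣ), t ≠ 0 ∧ (∀ i : Node M N, (i : ℕ) = M → ε i = 1) ∧
    π (K0 q M N 1) = t • K0 q M N 1 ∧
    (∀ i, π (iota q M N (K q 1 i)) = ((ε i : ℤ) : ℂ) • iota q M N (K q 1 i)) ∧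
    (∀ i s hs, π (iota q M N (H q i s hs)) = iota q M N (H q i s hs)) ∧
    (∀ i n, π (iota q M N (X q 1 i n)) = ((ε i : ℤ) : ℂ) • iota q M N (X q 1 i n)) ∧
    (∀ i n, π (iota q M N (X q (-1) i n)) = iota q M N (X q (-1) i n))}

/-- The set `D` of the restrictions to `U_q(L sl(M, N))` of the elements of `D̃`. -/
def D (q : ℂ) (M N : ℕ) : Set (U q M N ≃ₐ[ℂ] U q M N) :=
  {π | ∃ π' ∈ Dtilde q M N, ∀ x, iota q M N (π x) = π' (iota q M N x)}

/-! ## Highest weights -/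

/-- A triple `(P, f, c)`: polynomials `P_i` for the nodes `i ≠ M`, a formal series
`f = ∑_{n ∈ ℤ} f_n z^n` and a number `c`. -/
structure HW (M N : ℕ) : Type where
  P : {i : Node M N // (i : ℕ) ≠ M} → ℂ[X]
  f : ℤ → ℂ
  c : ℂ

/-- The product of a polynomial and a formal series in `ℂ[[z, z⁻¹]]`. -/
def polyMul (Q : ℂ[X]) (f : ℤ → ℂ) : ℤ → ℂ :=
  fun n => ∑ s ∈ Finset.range (Q.natDegree + 1), Q.coeff s * f (n - s)

/-- The set `R_{M,N}` of highest weights. -/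
def R (q : ℂ) (M N : ℕ) : Set (HW M N) :=
  {w | (∃ Q : ℂ[X], Q ≠ 0 ∧ polyMul Q w.f = 0) ∧
    w.c ≠ 0 ∧ (w.c - w.c⁻¹) / (q - q⁻¹) = w.f 0 ∧
    ∀ i, (w.P i).coeff 0 = 1}

/-- The set `R̃_{M,N}` of the `(P, f, c; Q)` with `(P, f, c) ∈ R_{M,N}`, `Q ∈ 1 + z ℂ[z]` and
`Q f = 0`. -/
def Rtilde (q : ℂ) (M N : ℕ) : Set (HW M N × ℂ[X]) :=
  {w | w.1 ∈ R q M N ∧ w.2.coeff 0 = 1 ∧ polyMul w.2 w.1.f = 0}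

/-- `P (a z)`. -/
def rescale (a : ℂ) (P : ℂ[X]) : ℂ[X] := P.comp (Polynomial.C a * Polynomial.X)

/-- The expansion in `ℂ[[z]]` of `a^{deg P} P(z a⁻¹) / P(z a)`. -/
def evenWeightZero (a : ℂ) (P : ℂ[X]) : PowerSeries ℂ :=
  PowerSeries.C (a ^ P.natDegree) * (rescale a⁻¹ P : PowerSeries ℂ) *
    (rescale a P : PowerSeries ℂ)⁻¹

/-- The expansion in `ℂ[[w]]`, `w = z⁻¹`, of `a^{deg P} P(z a⁻¹) / P(z a)`: numerator and
denominator are multiplied by `w^{deg P}`, which reverses their coefficients. -/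
def evenWeightInfty (a : ℂ) (P : ℂ[X]) : PowerSeries ℂ :=
  PowerSeries.C (a ^ P.natDegree) * ((rescale a⁻¹ P).reverse : PowerSeries ℂ) *
    ((rescale a P).reverse : PowerSeries ℂ)⁻¹

/-! ## Verma modules, Weyl modules, simple modules -/

section Modules

variable (q : ℂ) {M N : ℕ} (w : HW M N)

/-- The elements of `U_q(L sl(M, N))` that have to annihilate a vector of highest weight
`(P, f, c)`. -/
inductive VermaRel : U q M N → Prop
  | raise (i : Node M N) (n : ℤ) : VermaRel (X q 1 i n)
  | evenZero (i : Node M N) (hi : (i : ℕ) ≠ M) (n : ℕ) :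
      VermaRel (phi q 1 i n -
        algebraMap ℂ _ (PowerSeries.coeff n (evenWeightZero (qi q M i) (w.P ⟨i, hi⟩))))
  | evenInfty (i : Node M N) (hi : (i : ℕ) ≠ M) (n : ℕ) :
      VermaRel (phi q (-1) i (-(n : ℤ)) -
        algebraMap ℂ _ (PowerSeries.coeff n (evenWeightInfty (qi q M i) (w.P ⟨i, hi⟩))))
  | oddK (i : Node M N) (hi : (i : ℕ) = M) : VermaRel (K q 1 i - algebraMap ℂ _ w.c)
  | oddPhi (i : Node M N) (hi : (i : ℕ) = M) (n : ℤ) :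
      VermaRel ((q - q⁻¹)⁻¹ • (phi q 1 i n - phi q (-1) i n) - algebraMap ℂ _ (w.f n))

/-- The additional relations of the Weyl module attached to `Q = ∑_{s = 0}^d a_s z^s`
(for `(M, N) ≠ (1, 1)`). -/
inductive WeylRel (Q : ℂ[X]) : U q M N → Prop
  | even (i : Node M N) (hi : (i : ℕ) ≠ M) :
      WeylRel Q (X q (-1) i 0 ^ (1 + (w.P ⟨i, hi⟩).natDegree))
  | odd (i : Node M N) (hi : (i : ℕ) = M) :
      WeylRel Q (∑ s ∈ Finset.range (Q.natDegree + 1), Q.coeff (Q.natDegree - s) • X q (-1) i s)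

/-- The left ideal defining the Verma module. -/
def vermaIdeal : Submodule (U q M N) (U q M N) := Submodule.span _ {x | VermaRel q w x}

/-- The left ideal defining the Weyl module. -/
def weylIdeal (Q : ℂ[X]) : Submodule (U q M N) (U q M N) :=
  Submodule.span _ {x | VermaRel q w x ∨ WeylRel q w Q x}

theorem vermaIdeal_le_weylIdeal (Q : ℂ[X]) : vermaIdeal q w ≤ weylIdeal q w Q :=
  Submodule.span_mono fun _ h => Or.inl h

/-- The Verma module `M(P, f, c)`; the generator `v` is the class of `1`. -/
abbrev Verma : Type := U q M N ⧸ vermaIdeal q w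

/-- The grading of the Verma module, with `v` even. -/
def gradVerma : ZMod 2 → Submodule ℂ (Verma q w) := quotGrading (gradU q M N) (vermaIdeal q w)

/-- The Weyl module `W(P, f, c; Q)`; the generator `v` is the class of `1`. -/
abbrev Weyl (Q : ℂ[X]) : Type := U q M N ⧸ weylIdeal q w Q

/-- The grading of the Weyl module, with `v` even. -/
def gradWeyl (Q : ℂ[X]) : ZMod 2 → Submodule ℂ (Weyl q w Q) :=
  quotGrading (gradU q M N) (weylIdeal q w Q)

/-- The canonical epimorphism `M(P, f, c) → W(P, f, c; Q)`, `v ↦ v`. -/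
def vermaToWeyl (Q : ℂ[X]) : Verma q w →ₗ[U q M N] Weyl q w Q :=
  Submodule.factor (vermaIdeal_le_weylIdeal q w Q)

/-- The left ideal defining the Verma module as a `U_q(L' sl(M, N))`-module: the relations
above and `K_0 v = v`. -/
def vermaIdeal' : Submodule (U' q M N) (U' q M N) :=
  Submodule.span _ ((iota q M N '' {x | VermaRel q w x}) ∪ {K0 q M N 1 - 1})

/-- `M(P, f, c)` as a `U_q(L' sl(M, N))`-module. -/
abbrev Verma' : Type := U' q M N ⧸ vermaIdeal' q w

/-- The grading of `M(P, f, c)` as a `U_q(L' sl(M, N))`-module. -/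
def gradVerma' : ZMod 2 → Submodule ℂ (Verma' q w) :=
  quotGrading (gradU' q M N) (vermaIdeal' q w)

/-- The largest proper sub-`U_q(L' sl(M, N))`-supermodule of `M(P, f, c)`: the sum of all the
proper ones. -/
def maxSub : Submodule (U' q M N) (Verma' q w) :=
  sSup {S | IsHomogeneousSub (gradVerma' q w) S ∧ S ≠ ⊤}

/-- The simple quotient `S'(P, f, c)` of the `U_q(L' sl(M, N))`-module `M(P, f, c)`. -/
abbrev SimpleQ : Type := Verma' q w ⧸ maxSub q w

/-- The grading of `S'(P, f, c)`. -/
def gradSimpleQ : ZMod 2 → Submodule ℂ (SimpleQ q w) :=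
  quotGrading (gradVerma' q w) (maxSub q w)

end Modules

end QAffine

end

open QAffine

noncomputable section
set_option linter.unusedSectionVars false
namespace QAffine

/-! ## The coefficients of the exponential of a series -/

section Exp

variable {A B : Type*} [Ring A] [Algebra ℂ A] [Ring B] [Algebra ℂ B]

theorem expCoeff_zero (g : PowerSeries A) : expCoeff g 0 = 1 := by
  simp [expCoeff]

theorem map_expCoeff (f : A →ₐ[ℂ] B) (g : PowerSeries A) (n : ℕ) :
    f (expCoeff g n) = expCoeff (PowerSeries.map (f : A →+* B) g) n := by
  simp only [expCoeff, map_sum, map_smul, ← map_pow, PowerSeries.coeff_map]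
  rfl

theorem commute_coeff_pow {c : A} {g : PowerSeries A}
    (h : ∀ n, Commute c (PowerSeries.coeff n g)) (k n : ℕ) :
    Commute c (PowerSeries.coeff n (g ^ k)) := by
  induction k generalizing n with
  | zero =>
    rw [pow_zero, PowerSeries.coeff_one]
    split_ifs
    · exact Commute.one_right c
    · exact Commute.zero_right c
  | succ k ih =>
    rw [pow_succ, PowerSeries.coeff_mul]
    exact Commute.sum_right _ _ _ fun p _ => (ih p.1).mul_right (h p.2)

theorem commute_expCoeff {c : A} {g : PowerSeries A}
    (h : ∀ n, Commute c (PowerSeries.coeff n g)) (n : ℕ) : Commute c (expCoeff g n) :=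
  Commute.sum_right _ _ _ fun k _ => (commute_coeff_pow h k n).smul_right _

section Eigen

variable {C W : Type*} [CommRing C] [Algebra ℂ C] [AddCommGroup W] [Module ℂ W] [Module C W]
  [IsScalarTower ℂ C W]

theorem coeff_pow_eigen_right (e : A →ₗ[ℂ] W) (g : PowerSeries A) (θ : PowerSeries C)
    (h : ∀ a s, e (a * PowerSeries.coeff s g) = PowerSeries.coeff s θ • e a) (k n : ℕ) (a : A) :
    e (a * PowerSeries.coeff n (g ^ k)) = PowerSeries.coeff n (θ ^ k) • e a := by
  induction k generalizing n a with
  | zero =>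
    simp only [pow_zero, PowerSeries.coeff_one]
    split_ifs <;> simp
  | succ k ih =>
    rw [pow_succ, pow_succ, PowerSeries.coeff_mul, PowerSeries.coeff_mul, Finset.mul_sum, map_sum,
      Finset.sum_smul]
    refine Finset.sum_congr rfl fun p _ => ?_
    rw [← mul_assoc, h, ih, smul_smul, mul_comm]

theorem expCoeff_eigen_right (e : A →ₗ[ℂ] W) (g : PowerSeries A) (θ : PowerSeries C)
    (h : ∀ a s, e (a * PowerSeries.coeff s g) = PowerSeries.coeff s θ • e a) (n : ℕ) :
    e (expCoeff g n) = expCoeff θ n • e 1 := by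
  simp only [expCoeff, map_sum, Finset.sum_smul, map_smul]
  refine Finset.sum_congr rfl fun k _ => ?_
  rw [← one_mul (PowerSeries.coeff n (g ^ k)), coeff_pow_eigen_right e g θ h, smul_assoc]

theorem coeff_pow_eigen_left (e : A →ₗ[ℂ] W) (g : PowerSeries A) (θ : PowerSeries C)
    (h : ∀ a s, e (PowerSeries.coeff s g * a) = PowerSeries.coeff s θ • e a) (k n : ℕ) (a : A) :
    e (PowerSeries.coeff n (g ^ k) * a) = PowerSeries.coeff n (θ ^ k) • e a := by
  induction k generalizing n a with
  | zero =>
    simp only [pow_zero, PowerSeries.coeff_one]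
    split_ifs <;> simp
  | succ k ih =>
    rw [pow_succ, pow_succ, PowerSeries.coeff_mul, PowerSeries.coeff_mul, Finset.sum_mul, map_sum,
      Finset.sum_smul]
    refine Finset.sum_congr rfl fun p _ => ?_
    rw [mul_assoc, ih, h, smul_smul]

theorem expCoeff_eigen_left (e : A →ₗ[ℂ] W) (g : PowerSeries A) (θ : PowerSeries C)
    (h : ∀ a s, e (PowerSeries.coeff s g * a) = PowerSeries.coeff s θ • e a) (n : ℕ) :
    e (expCoeff g n) = expCoeff θ n • e 1 := by
  simp only [expCoeff, map_sum, Finset.sum_smul, map_smul]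
  refine Finset.sum_congr rfl fun k _ => ?_
  rw [← mul_one (PowerSeries.coeff n (g ^ k)), coeff_pow_eigen_left e g θ h, smul_assoc]

end Eigen

section Comm

variable {C : Type*} [CommRing C] [Algebra ℂ C]

/-- The exponential of a series without constant term. -/
def expSeries (g : PowerSeries C) : PowerSeries C := PowerSeries.mk (expCoeff g)

@[simp] theorem coeff_expSeries (g : PowerSeries C) (n : ℕ) :
    PowerSeries.coeff n (expSeries g) = expCoeff g n := PowerSeries.coeff_mk _ _

theorem constantCoeff_expSeries (g : PowerSeries C) :
    PowerSeries.constantCoeff (expSeries g) = 1 := by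
  rw [← PowerSeries.coeff_zero_eq_constantCoeff_apply, coeff_expSeries, expCoeff_zero]

theorem coeff_pow_eq_zero {g : PowerSeries C} (hg : PowerSeries.constantCoeff g = 0) {n k : ℕ}
    (h : n < k) : PowerSeries.coeff n (g ^ k) = 0 := by
  have h1 : (PowerSeries.X : PowerSeries C) ^ k ∣ g ^ k :=
    pow_dvd_pow_of_dvd (PowerSeries.X_dvd_iff.2 hg) k
  exact PowerSeries.X_pow_dvd_iff.1 h1 n h

theorem smul_eq_algebraMap_smul (r : ℂ) (f : PowerSeries C) :
    r • f = (algebraMap ℂ C r) • f := (algebraMap_smul C r f).symm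

theorem expCoeff_eq_sum {g : PowerSeries C} (hg : PowerSeries.constantCoeff g = 0) {n N : ℕ}
    (h : n < N) : expCoeff g n =
      PowerSeries.coeff n (∑ k ∈ Finset.range N, ((Nat.factorial k : ℂ)⁻¹) • g ^ k) := by
  rw [expCoeff, map_sum]
  simp only [PowerSeries.coeff_smul]
  refine Finset.sum_subset (Finset.range_mono h) fun k _ hk => ?_
  rw [coeff_pow_eq_zero hg (by simpa using hk), smul_zero]

theorem derivative_expSeries {g : PowerSeries C} (hg : PowerSeries.constantCoeff g = 0) :
    PowerSeries.derivative C (expSeries g) = expSeries g * PowerSeries.derivative C g := by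
  ext n
  have key : PowerSeries.derivative C
      (∑ k ∈ Finset.range (n + 2), ((Nat.factorial k : ℂ)⁻¹) • g ^ k) =
      (∑ k ∈ Finset.range (n + 1), ((Nat.factorial k : ℂ)⁻¹) • g ^ k) *
        PowerSeries.derivative C g := by
    rw [Finset.sum_range_succ', map_add, map_sum, Finset.sum_mul]
    have h0 : PowerSeries.derivative C (((Nat.factorial 0 : ℂ)⁻¹) • g ^ 0) = 0 := by
      simp
    rw [h0, add_zero]
    refine Finset.sum_congr rfl fun k _ => ?_
    have this : ((Nat.factorial (k + 1) : ℂ)⁻¹) * ((k + 1 : ℕ) : ℂ) = (Nat.factorial k : ℂ)⁻¹ := by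
      rw [Nat.factorial_succ]
      have h1 : (Nat.factorial k : ℂ) ≠ 0 := Nat.cast_ne_zero.2 (Nat.factorial_ne_zero k)
      have h2 : (((k + 1 : ℕ)) : ℂ) ≠ 0 := by exact_mod_cast Nat.succ_ne_zero k
      rw [Nat.cast_mul, mul_inv, mul_comm _ (Nat.factorial k : ℂ)⁻¹, mul_assoc,
        inv_mul_cancel₀ h2, mul_one]
    rw [smul_eq_algebraMap_smul, Derivation.map_smul, ← smul_eq_algebraMap_smul,
      PowerSeries.derivative_pow, Nat.add_sub_cancel, ← this, mul_smul, smul_mul_assoc,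
      smul_mul_assoc, Nat.cast_smul_eq_nsmul, nsmul_eq_mul, mul_assoc]
  rw [PowerSeries.coeff_derivative, coeff_expSeries, expCoeff_eq_sum hg (Nat.lt_succ_self (n + 1)),
    ← PowerSeries.coeff_derivative, key, PowerSeries.coeff_mul, PowerSeries.coeff_mul]
  refine Finset.sum_congr rfl fun p hp => ?_
  rw [coeff_expSeries, expCoeff_eq_sum hg]
  have := Finset.HasAntidiagonal.mem_antidiagonal.1 hp
  omega

theorem natCast_smul_inj {x y : C} (n : ℕ) (h : x * ((n : C) + 1) = y * ((n : C) + 1)) : x = y := by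
  have h2 : ((n : ℂ) + 1) ≠ 0 := by exact_mod_cast Nat.succ_ne_zero n
  have h3 : (algebraMap ℂ C ((n : ℂ) + 1)) * algebraMap ℂ C (((n : ℂ) + 1)⁻¹) = 1 := by
    rw [← map_mul, mul_inv_cancel₀ h2, map_one]
  have h4 : (algebraMap ℂ C ((n : ℂ) + 1)) = (n : C) + 1 := by simp
  rw [h4] at h3
  calc x = x * ((n : C) + 1) * algebraMap ℂ C (((n : ℂ) + 1)⁻¹) := by rw [mul_assoc, h3, mul_one]
    _ = y := by rw [h, mul_assoc, h3, mul_one]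

theorem eq_of_derivative_eq_mul {F G h : PowerSeries C}
    (h0 : PowerSeries.constantCoeff F = PowerSeries.constantCoeff G)
    (hF : PowerSeries.derivative C F = F * h) (hG : PowerSeries.derivative C G = G * h) :
    F = G := by
  ext n
  induction n using Nat.strong_induction_on with
  | _ n ih =>
    cases n with
    | zero => simpa using h0
    | succ n =>
      apply natCast_smul_inj n
      rw [← PowerSeries.coeff_derivative, ← PowerSeries.coeff_derivative, hF, hG,
        PowerSeries.coeff_mul, PowerSeries.coeff_mul]
      refine Finset.sum_congr rfl fun p hp => ?_
      rw [ih]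
      have := Finset.HasAntidiagonal.mem_antidiagonal.1 hp
      omega

theorem eq_expSeries {F g : PowerSeries C} (hg : PowerSeries.constantCoeff g = 0)
    (h0 : PowerSeries.constantCoeff F = 1)
    (hF : PowerSeries.derivative C F = F * PowerSeries.derivative C g) : F = expSeries g :=
  eq_of_derivative_eq_mul (by rw [h0, constantCoeff_expSeries]) hF (derivative_expSeries hg)

theorem expSeries_add {g h : PowerSeries C} (hg : PowerSeries.constantCoeff g = 0)
    (hh : PowerSeries.constantCoeff h = 0) :
    expSeries (g + h) = expSeries g * expSeries h := by
  refine (eq_expSeries (by rw [map_add, hg, hh, add_zero]) ?_ ?_).symm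
  · rw [map_mul, constantCoeff_expSeries, constantCoeff_expSeries, one_mul]
  · rw [Derivation.leibniz, derivative_expSeries hg, derivative_expSeries hh, map_add]
    simp only [smul_eq_mul]
    ring

theorem expSeries_zero : expSeries (0 : PowerSeries C) = 1 :=
  (eq_expSeries (map_zero _) (map_one _) (by simp)).symm

theorem expSeries_sum {ι : Type*} (S : Finset ι) {g : ι → PowerSeries C}
    (hg : ∀ i, PowerSeries.constantCoeff (g i) = 0) :
    expSeries (∑ i ∈ S, g i) = ∏ i ∈ S, expSeries (g i) := by
  classical
  induction S using Finset.induction_on with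
  | empty => simp [expSeries_zero]
  | insert a S ha ih =>
    rw [Finset.sum_insert ha, Finset.prod_insert ha, expSeries_add (hg a), ih]
    rw [map_sum]
    exact Finset.sum_eq_zero fun i _ => hg i

/-- The series `∑_{s > 0} (x^s - y^s) X^s / s`. -/
def powDiff (x y : C) : PowerSeries C :=
  PowerSeries.mk fun s : ℕ => ((s : ℂ)⁻¹) • (x ^ s - y ^ s)

theorem constantCoeff_powDiff (x y : C) : PowerSeries.constantCoeff (powDiff x y) = 0 := by
  simp [← PowerSeries.coeff_zero_eq_constantCoeff_apply, powDiff]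

theorem derivative_powDiff (x y : C) :
    PowerSeries.derivative C (powDiff x y) * (1 - PowerSeries.C x * PowerSeries.X) *
      (1 - PowerSeries.C y * PowerSeries.X) = PowerSeries.C (x - y) := by
  have h1 : PowerSeries.derivative C (powDiff x y) =
      PowerSeries.C x * PowerSeries.mk (fun s => x ^ s) -
        PowerSeries.C y * PowerSeries.mk (fun s => y ^ s) := by
    ext n
    rw [PowerSeries.coeff_derivative, powDiff, PowerSeries.coeff_mk, map_sub,
      PowerSeries.coeff_C_mul, PowerSeries.coeff_C_mul, PowerSeries.coeff_mk,
      PowerSeries.coeff_mk, ← pow_succ', ← pow_succ']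
    have h2 : ((n : ℂ) + 1) ≠ 0 := by exact_mod_cast Nat.succ_ne_zero n
    have h4 : (algebraMap ℂ C ((n : ℂ) + 1)) = (n : C) + 1 := by simp
    rw [← h4, mul_comm, ← Algebra.smul_def, smul_smul]
    push_cast
    rw [mul_inv_cancel₀ h2, one_smul]
  have h2 : ∀ x : C, PowerSeries.mk (fun s => x ^ s) * (1 - PowerSeries.C x * PowerSeries.X) = 1 := by
    intro x
    ext n
    rw [mul_sub, mul_one, map_sub, ← mul_assoc, mul_comm _ (PowerSeries.C x)]
    cases n with
    | zero => simp
    | succ n =>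
      rw [PowerSeries.coeff_succ_mul_X, PowerSeries.coeff_C_mul, PowerSeries.coeff_mk,
        PowerSeries.coeff_mk, pow_succ', sub_self, PowerSeries.coeff_one, if_neg (Nat.succ_ne_zero n)]
  rw [h1, map_sub]
  linear_combination (PowerSeries.C x * (1 - PowerSeries.C y * PowerSeries.X)) * h2 x -
    (PowerSeries.C y * (1 - PowerSeries.C x * PowerSeries.X)) * h2 y

theorem expSeries_powDiff (x y : C) :
    expSeries (powDiff x y) * (1 - PowerSeries.C x * PowerSeries.X) =
      1 - PowerSeries.C y * PowerSeries.X := by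
  have hu : IsUnit (1 - PowerSeries.C x * PowerSeries.X : PowerSeries C) := by
    rw [PowerSeries.isUnit_iff_constantCoeff]; simp
  have hv : IsUnit (1 - PowerSeries.C y * PowerSeries.X : PowerSeries C) := by
    rw [PowerSeries.isUnit_iff_constantCoeff]; simp
  obtain ⟨ui, hinv⟩ := hu.exists_right_inv
  have key : expSeries (powDiff x y) = (1 - PowerSeries.C y * PowerSeries.X) * ui := by
    refine (eq_expSeries (constantCoeff_powDiff x y) ?_ ?_).symm
    · have := congrArg PowerSeries.constantCoeff hinv
      simpa using this
    · apply hu.mul_left_cancel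
      apply hv.mul_left_cancel
      apply hu.mul_left_cancel
      have hd := derivative_powDiff x y
      have hdinv : PowerSeries.derivative C ui *
          (1 - PowerSeries.C x * PowerSeries.X) = ui * PowerSeries.C x := by
        have := congrArg (PowerSeries.derivative C) hinv
        rw [Derivation.leibniz, PowerSeries.derivative_one, map_sub, PowerSeries.derivative_one,
          Derivation.leibniz, PowerSeries.derivative_X, PowerSeries.derivative_C] at this
        simp only [smul_eq_mul] at this
        linear_combination this
      rw [Derivation.leibniz, map_sub, PowerSeries.derivative_one,
          Derivation.leibniz, PowerSeries.derivative_X, PowerSeries.derivative_C]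
      simp only [smul_eq_mul, mul_zero, mul_one, add_zero, zero_sub]
      rw [map_sub] at hd
      set X := (PowerSeries.X : PowerSeries C)
      set cx := PowerSeries.C x
      set cy := PowerSeries.C y
      set D := PowerSeries.derivative C (powDiff x y)
      set D' := PowerSeries.derivative C ui
      linear_combination (1 - cy * X) ^ 2 * (1 - cx * X) * hdinv -
        (1 - cy * X) * ((1 - cx * X) * ui) * hd
  rw [key, mul_assoc, mul_comm ui, hinv, mul_one]

theorem exists_expCoeff_eq (u : ℕ → C) (hu : u 0 = 1) :
    ∃ g : ℕ → C, ∀ n, expCoeff (PowerSeries.mk fun s => if s = 0 then 0 else g s) n = u n := by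
  set F : PowerSeries C := PowerSeries.mk u
  have hF0 : PowerSeries.constantCoeff F = 1 := by
    rw [← PowerSeries.coeff_zero_eq_constantCoeff_apply, PowerSeries.coeff_mk, hu]
  obtain ⟨v, hv⟩ : IsUnit F := by
    rw [PowerSeries.isUnit_iff_constantCoeff, hF0]; exact isUnit_one
  set h := PowerSeries.derivative C F * ↑v⁻¹
  refine ⟨fun s => ((s : ℂ)⁻¹) • PowerSeries.coeff (s - 1) h, fun n => ?_⟩
  set g : PowerSeries C := PowerSeries.mk fun s => if s = 0 then 0 else
    ((s : ℂ)⁻¹) • PowerSeries.coeff (s - 1) h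
  have hg0 : PowerSeries.constantCoeff g = 0 := by
    rw [← PowerSeries.coeff_zero_eq_constantCoeff_apply, PowerSeries.coeff_mk, if_pos rfl]
  have hg : PowerSeries.derivative C g = h := by
    ext n
    have h2 : ((n : ℂ) + 1) ≠ 0 := by exact_mod_cast Nat.succ_ne_zero n
    have h4 : (algebraMap ℂ C ((n : ℂ) + 1)) = (n : C) + 1 := by simp
    rw [PowerSeries.coeff_derivative, PowerSeries.coeff_mk, if_neg (Nat.succ_ne_zero n), ← h4,
      mul_comm, ← Algebra.smul_def, smul_smul]
    push_cast
    rw [mul_inv_cancel₀ h2, one_smul]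
  have hF : F = expSeries g := by
    refine eq_expSeries hg0 hF0 ?_
    rw [hg, mul_comm, mul_assoc, ← hv, Units.inv_mul, mul_one]
  rw [← coeff_expSeries, ← hF, PowerSeries.coeff_mk]

end Comm

end Exp

end QAffine

end

noncomputable section
set_option linter.unusedSectionVars false
namespace QAffine

/-! ## The free highest weight module -/

/-- The eigenvalues `c_i` of `K_i` and `η_{i,s}` of `h_{i,s}` on a vector of highest weight. -/
structure CartanWeight (M N : ℕ) (A : Type*) [CommRing A] where
  c : Node M N → Aˣ
  η : Node M N → ℤ → A

/-- The number `[s l_i c_{ij}]_{q_i} / s`. -/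
def hCoeff (q : ℂ) (M i j : ℕ) (s : ℤ) : ℂ :=
  qInt (qi q M i) (s * ell M i * cartan M i j) / (s : ℂ)

/-- The sign `(-1)^{|i| |j|}`. -/
def nodeSign (M i j : ℕ) : ℂ := (-1) ^ ((nodePar M i).val * (nodePar M j).val)

/-- The free module on the words in the lowering operators. -/
abbrev FreeVerma (M N : ℕ) (A : Type*) [CommRing A] : Type _ := List (Node M N × ℤ) →₀ A

section FreeVerma

variable (q : ℂ) {M N : ℕ} {A : Type*} [CommRing A] [Algebra ℂ A] (ϖ : CartanWeight M N A)

/-- The basis vector attached to a word. -/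
abbrev word (w : List (Node M N × ℤ)) : FreeVerma M N A := Finsupp.single w 1

/-- The operator that adds a letter to a word. -/
def consOp (x : Node M N × ℤ) : Module.End A (FreeVerma M N A) :=
  Finsupp.lmapDomain A A (List.cons x)

theorem consOp_word (x : Node M N × ℤ) (w : List (Node M N × ℤ)) :
    consOp x (word w : FreeVerma M N A) = word (x :: w) := by
  simp [consOp]

theorem end_ext_word {W : Type*} [AddCommGroup W] [Module A W] {f g : FreeVerma M N A →ₗ[A] W}
    (h : ∀ w, f (word w) = g (word w)) : f = g :=
  Finsupp.lhom_ext' fun w => LinearMap.ext_ring (h w)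

/-- The linear map with prescribed values on words. -/
def ofWord {W : Type*} [AddCommGroup W] [Module A W] (f : List (Node M N × ℤ) → W) :
    FreeVerma M N A →ₗ[A] W := Finsupp.linearCombination A f

@[simp] theorem ofWord_word {W : Type*} [AddCommGroup W] [Module A W]
    (f : List (Node M N × ℤ) → W) (w : List (Node M N × ℤ)) :
    ofWord (A := A) f (word w) = f w := by
  simp [ofWord]

/-- The pairing of the `i`-th coroot with the weight of a word. -/
def wordWt (i : Node M N) : List (Node M N × ℤ) → ℤ
  | [] => 0
  | x :: w => cartan M i x.1 + wordWt i w

/-- The operator `K_i^ε`. -/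
def kOp (ε : ℤˣ) (i : Node M N) : Module.End A (FreeVerma M N A) :=
  ofWord fun w =>
    ((ϖ.c i ^ (ε : ℤ) : Aˣ) * algebraMap ℂ A (q ^ (-(ε : ℤ) * wordWt i w)) : A) • word w

/-- The value of `h_{i,s}` on words. -/
def hWord (i : Node M N) (s : ℤ) : List (Node M N × ℤ) → FreeVerma M N A
  | [] => ϖ.η i s • word []
  | x :: w => consOp x (hWord i s w) - hCoeff q M i x.1 s • word ((x.1, x.2 + s) :: w)

/-- The operator `h_{i,s}`. -/
def hOp (i : Node M N) (s : ℤ) : Module.End A (FreeVerma M N A) := ofWord (hWord q ϖ i s)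

/-- The series `ε (q_i - q_i⁻¹) ∑_{s > 0} h_{i, ε s} w^s` of operators. -/
def hOpSeries (ε : ℤˣ) (i : Node M N) : PowerSeries (Module.End A (FreeVerma M N A)) :=
  PowerSeries.mk fun s : ℕ =>
    if s = 0 then 0
    else (((ε : ℤ) : ℂ) * (qi q M i - (qi q M i)⁻¹)) • hOp q ϖ i ((ε : ℤ) * (s : ℤ))

/-- The operator `φ_{i,n}^ε`. -/
def phiOp (ε : ℤˣ) (i : Node M N) (n : ℤ) : Module.End A (FreeVerma M N A) :=
  if 0 ≤ (ε : ℤ) * n then kOp q ϖ ε i * expCoeff (hOpSeries q ϖ ε i) ((ε : ℤ) * n).toNat else 0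

/-- The value on words of the `φ^ε`-part of the raising operators. -/
def raiseWord (ε : ℤˣ) (i : Node M N) (m : ℤ) : List (Node M N × ℤ) → FreeVerma M N A
  | [] => 0
  | x :: w => nodeSign M i x.1 • consOp x (raiseWord ε i m w) +
      if x.1 = i then phiOp q ϖ ε i (m + x.2) (word w) else 0

/-- The `φ^ε`-part of the raising operators. -/
def raiseHalf (ε : ℤˣ) (i : Node M N) (m : ℤ) : Module.End A (FreeVerma M N A) :=
  ofWord (raiseWord q ϖ ε i m)

/-- The raising operator `X_{i,m}^+`. -/
def raiseOp (i : Node M N) (m : ℤ) : Module.End A (FreeVerma M N A) :=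
  (qi q M i - (qi q M i)⁻¹)⁻¹ • (raiseHalf q ϖ 1 i m - raiseHalf q ϖ (-1) i m)

theorem hOp_nil (i : Node M N) (s : ℤ) : hOp q ϖ i s (word []) = ϖ.η i s • word [] := by
  simp [hOp, hWord]

theorem hOp_consOp (i : Node M N) (s : ℤ) (x : Node M N × ℤ) (y : FreeVerma M N A) :
    hOp q ϖ i s (consOp x y) =
      consOp x (hOp q ϖ i s y) - hCoeff q M i x.1 s • consOp (x.1, x.2 + s) y := by
  have : hOp q ϖ i s ∘ₗ consOp x = consOp x ∘ₗ hOp q ϖ i s -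
      hCoeff q M i x.1 s • consOp (x.1, x.2 + s) := by
    refine end_ext_word fun w => ?_
    simp [consOp_word, hOp, hWord]
  exact LinearMap.congr_fun this y

theorem kOp_word (ε : ℤˣ) (i : Node M N) (w : List (Node M N × ℤ)) :
    kOp q ϖ ε i (word w) =
      ((ϖ.c i ^ (ε : ℤ) : Aˣ) * algebraMap ℂ A (q ^ (-(ε : ℤ) * wordWt i w)) : A) • word w := by
  rw [kOp, ofWord_word]

theorem kOp_consOp (hq0 : q ≠ 0) (ε : ℤˣ) (i : Node M N) (x : Node M N × ℤ)
    (y : FreeVerma M N A) :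
    kOp q ϖ ε i (consOp x y) = q ^ (-(ε : ℤ) * cartan M i x.1) • consOp x (kOp q ϖ ε i y) := by
  have : kOp q ϖ ε i ∘ₗ consOp x =
      q ^ (-(ε : ℤ) * cartan M i x.1) • (consOp x ∘ₗ kOp q ϖ ε i) := by
    refine end_ext_word fun w => ?_
    rw [LinearMap.comp_apply, consOp_word, kOp_word, LinearMap.smul_apply, LinearMap.comp_apply,
      kOp_word, map_smul, consOp_word, wordWt, mul_add, zpow_add₀ hq0, map_mul,
      ← algebraMap_smul A (q ^ (-(ε : ℤ) * cartan M i x.1)), smul_smul]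
    congr 1
    ring
  exact LinearMap.congr_fun this y

theorem raiseHalf_nil (ε : ℤˣ) (i : Node M N) (m : ℤ) : raiseHalf q ϖ ε i m (word []) = 0 := by
  simp [raiseHalf, raiseWord]

theorem raiseHalf_consOp (ε : ℤˣ) (i : Node M N) (m : ℤ) (x : Node M N × ℤ)
    (y : FreeVerma M N A) :
    raiseHalf q ϖ ε i m (consOp x y) = nodeSign M i x.1 • consOp x (raiseHalf q ϖ ε i m y) +
      if x.1 = i then phiOp q ϖ ε i (m + x.2) y else 0 := by
  have : raiseHalf q ϖ ε i m ∘ₗ consOp x = nodeSign M i x.1 • (consOp x ∘ₗ raiseHalf q ϖ ε i m) +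
      if x.1 = i then phiOp q ϖ ε i (m + x.2) else 0 := by
    refine end_ext_word fun w => ?_
    rw [LinearMap.comp_apply, consOp_word, raiseHalf, ofWord_word, raiseWord]
    split_ifs <;> simp
  have h := LinearMap.congr_fun this y
  simp only [LinearMap.comp_apply, LinearMap.add_apply, LinearMap.smul_apply] at h
  rw [h]
  split_ifs <;> rfl

theorem kOp_mul_kOp_neg (hq0 : q ≠ 0) (ε : ℤˣ) (i : Node M N) :
    kOp q ϖ ε i * kOp q ϖ (-ε) i = 1 := by
  refine end_ext_word fun w => ?_
  rw [Module.End.mul_apply, kOp_word, map_smul, kOp_word, smul_smul, Module.End.one_apply]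
  have h1 : ((ϖ.c i ^ ((-ε : ℤˣ) : ℤ) : Aˣ) : A) * ((ϖ.c i ^ (ε : ℤ) : Aˣ) : A) = 1 := by
    rw [← Units.val_mul, ← zpow_add, Units.val_neg, neg_add_cancel, zpow_zero, Units.val_one]
  have h2 : algebraMap ℂ A (q ^ (-((-ε : ℤˣ) : ℤ) * wordWt i w)) *
      algebraMap ℂ A (q ^ (-(ε : ℤ) * wordWt i w)) = 1 := by
    rw [← map_mul, ← zpow_add₀ hq0, Units.val_neg, ← add_mul, neg_neg, add_neg_cancel, zero_mul,
      zpow_zero, map_one]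
  rw [mul_mul_mul_comm, h1, h2, one_mul, one_smul]

theorem kOp_comm_kOp (ε ε' : ℤˣ) (i j : Node M N) : Commute (kOp q ϖ ε i) (kOp q ϖ ε' j) := by
  refine end_ext_word fun w => ?_
  simp only [Module.End.mul_apply, kOp_word, map_smul, smul_smul]
  rw [mul_comm]

theorem hOp_comm_hOp (i j : Node M N) (s t : ℤ) : Commute (hOp q ϖ i s) (hOp q ϖ j t) := by
  refine end_ext_word fun w => ?_
  rw [Module.End.mul_apply, Module.End.mul_apply]
  induction w with
  | nil => simp only [hOp_nil, map_smul, smul_smul]; rw [mul_comm]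
  | cons x w ih =>
    rw [← consOp_word]
    simp only [hOp_consOp, map_sub, LinearMap.map_smul_of_tower, ih]
    rw [add_right_comm x.2 s t, smul_sub, smul_sub, smul_smul, smul_smul,
      mul_comm (hCoeff q M j _ _)]
    abel

theorem kOp_comm_hOp (hq0 : q ≠ 0) (ε : ℤˣ) (i j : Node M N) (s : ℤ) :
    Commute (kOp q ϖ ε i) (hOp q ϖ j s) := by
  refine end_ext_word fun w => ?_
  rw [Module.End.mul_apply, Module.End.mul_apply]
  induction w with
  | nil => simp only [hOp_nil, kOp_word, map_smul, smul_smul]; rw [mul_comm]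
  | cons x w ih =>
    rw [← consOp_word]
    simp only [hOp_consOp, map_sub, LinearMap.map_smul_of_tower, kOp_consOp q ϖ hq0, ih]
    rw [smul_sub, smul_comm (hCoeff q M _ _ _)]

theorem phiOp_comm {T : Module.End A (FreeVerma M N A)} {i : Node M N}
    (hK : ∀ ε, Commute T (kOp q ϖ ε i)) (hH : ∀ s, Commute T (hOp q ϖ i s)) (ε : ℤˣ) (n : ℤ) :
    Commute T (phiOp q ϖ ε i n) := by
  rw [phiOp]
  split_ifs
  · refine (hK ε).mul_right (commute_expCoeff (fun s => ?_) _)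
    rw [hOpSeries, PowerSeries.coeff_mk]
    split_ifs
    · exact Commute.zero_right _
    · exact (hH _).smul_right _
  · exact Commute.zero_right _

theorem hOp_comm_phiOp (hq0 : q ≠ 0) (ε : ℤˣ) (i j : Node M N) (s n : ℤ) :
    Commute (hOp q ϖ j s) (phiOp q ϖ ε i n) :=
  phiOp_comm q ϖ (fun ε => (kOp_comm_hOp q ϖ hq0 ε i j s).symm) (fun t => hOp_comm_hOp q ϖ j i s t)
    ε n

theorem kOp_comm_phiOp (hq0 : q ≠ 0) (ε ε' : ℤˣ) (i j : Node M N) (n : ℤ) :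
    Commute (kOp q ϖ ε' j) (phiOp q ϖ ε i n) :=
  phiOp_comm q ϖ (fun ε => kOp_comm_kOp q ϖ ε' ε j i) (fun t => kOp_comm_hOp q ϖ hq0 ε' j i t)
    ε n

theorem hOp_raiseHalf (hq0 : q ≠ 0) (ε : ℤˣ) (i j : Node M N) (s m : ℤ) (y : FreeVerma M N A) :
    hOp q ϖ i s (raiseHalf q ϖ ε j m y) = raiseHalf q ϖ ε j m (hOp q ϖ i s y) +
      hCoeff q M i j s • raiseHalf q ϖ ε j (m + s) y := by
  have : hOp q ϖ i s ∘ₗ raiseHalf q ϖ ε j m = raiseHalf q ϖ ε j m ∘ₗ hOp q ϖ i s +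
      hCoeff q M i j s • raiseHalf q ϖ ε j (m + s) := by
    refine end_ext_word fun w => ?_
    simp only [LinearMap.comp_apply, LinearMap.add_apply, LinearMap.smul_apply]
    induction w with
    | nil => simp only [raiseHalf_nil, hOp_nil, map_smul, map_zero, smul_zero, add_zero]
    | cons x w ih =>
      rw [← consOp_word]
      have hc : ∀ n y, hOp q ϖ i s (phiOp q ϖ ε j n y) = phiOp q ϖ ε j n (hOp q ϖ i s y) :=
        fun n y => LinearMap.congr_fun (hOp_comm_phiOp q ϖ hq0 ε j i s n).eq y
      have e1 : m + s + x.2 = m + x.2 + s := by ring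
      have e2 : m + (x.2 + s) = m + x.2 + s := by ring
      by_cases hx : x.1 = j
      · simp only [raiseHalf_consOp, hOp_consOp, map_add, map_sub, LinearMap.map_smul_of_tower, ih,
          hx, if_true, hc, e1, e2]
        module
      · simp only [raiseHalf_consOp, hOp_consOp, map_add, map_sub, LinearMap.map_smul_of_tower, ih,
          hx, if_false, add_zero]
        module
  exact LinearMap.congr_fun this y

theorem kOp_raiseHalf (hq0 : q ≠ 0) (ε ε' : ℤˣ) (i j : Node M N) (m : ℤ)
    (y : FreeVerma M N A) :
    kOp q ϖ ε' i (raiseHalf q ϖ ε j m y) =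
      q ^ ((ε' : ℤ) * cartan M i j) • raiseHalf q ϖ ε j m (kOp q ϖ ε' i y) := by
  have : kOp q ϖ ε' i ∘ₗ raiseHalf q ϖ ε j m =
      q ^ ((ε' : ℤ) * cartan M i j) • (raiseHalf q ϖ ε j m ∘ₗ kOp q ϖ ε' i) := by
    refine end_ext_word fun w => ?_
    simp only [LinearMap.comp_apply, LinearMap.smul_apply]
    induction w with
    | nil => simp only [raiseHalf_nil, kOp_word, map_smul, map_zero, smul_zero]
    | cons x w ih =>
      rw [← consOp_word]
      have hc : ∀ n y, kOp q ϖ ε' i (phiOp q ϖ ε j n y) = phiOp q ϖ ε j n (kOp q ϖ ε' i y) :=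
        fun n y => LinearMap.congr_fun (kOp_comm_phiOp q ϖ hq0 ε ε' j i n).eq y
      by_cases hx : x.1 = j
      · have e : q ^ (((ε' : ℤ)) * cartan M i j) * q ^ (-(ε' : ℤ) * cartan M i j) = 1 := by
          rw [← zpow_add₀ hq0, ← add_mul, add_neg_cancel, zero_mul, zpow_zero]
        simp only [raiseHalf_consOp, kOp_consOp q ϖ hq0, map_add, LinearMap.map_smul_of_tower, ih,
          hx, if_true, hc, smul_add, smul_smul]
        rw [e, one_smul]
        congr 2
        ring
      · simp only [raiseHalf_consOp, kOp_consOp q ϖ hq0, LinearMap.map_smul_of_tower, ih,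
          hx, if_false, add_zero, smul_smul]
        congr 1
        ring
  exact LinearMap.congr_fun this y

theorem raiseOp_nil (i : Node M N) (m : ℤ) : raiseOp q ϖ i m (word []) = 0 := by
  simp [raiseOp, raiseHalf_nil]

theorem raiseOp_consOp (i : Node M N) (m : ℤ) (x : Node M N × ℤ) (y : FreeVerma M N A) :
    raiseOp q ϖ i m (consOp x y) = nodeSign M i x.1 • consOp x (raiseOp q ϖ i m y) +
      if x.1 = i then (qi q M i - (qi q M i)⁻¹)⁻¹ •
        (phiOp q ϖ 1 i (m + x.2) y - phiOp q ϖ (-1) i (m + x.2) y) else 0 := by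
  simp only [raiseOp, LinearMap.smul_apply, LinearMap.sub_apply, raiseHalf_consOp,
    LinearMap.map_smul_of_tower, map_sub]
  split_ifs <;> module

theorem hOp_raiseOp (hq0 : q ≠ 0) (i j : Node M N) (s m : ℤ) (y : FreeVerma M N A) :
    hOp q ϖ i s (raiseOp q ϖ j m y) = raiseOp q ϖ j m (hOp q ϖ i s y) +
      hCoeff q M i j s • raiseOp q ϖ j (m + s) y := by
  simp only [raiseOp, LinearMap.smul_apply, LinearMap.sub_apply, hOp_raiseHalf q ϖ hq0,
    LinearMap.map_smul_of_tower, map_sub]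
  module

theorem kOp_raiseOp (hq0 : q ≠ 0) (ε' : ℤˣ) (i j : Node M N) (m : ℤ) (y : FreeVerma M N A) :
    kOp q ϖ ε' i (raiseOp q ϖ j m y) =
      q ^ ((ε' : ℤ) * cartan M i j) • raiseOp q ϖ j m (kOp q ϖ ε' i y) := by
  simp only [raiseOp, LinearMap.smul_apply, LinearMap.sub_apply, kOp_raiseHalf q ϖ hq0,
    LinearMap.map_smul_of_tower, map_sub]
  module

/-! ### The contravariant form -/

/-- The contravariant pairing with a word. -/
def pairWord : List (Node M N × ℤ) → FreeVerma M N A →ₗ[A] A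
  | [] => Finsupp.lapply []
  | x :: w => pairWord w ∘ₗ raiseOp q ϖ x.1 x.2

/-- The contravariant form. -/
def pairing : FreeVerma M N A →ₗ[A] FreeVerma M N A →ₗ[A] A := ofWord (pairWord q ϖ)

theorem pairing_nil (y : FreeVerma M N A) : pairing q ϖ (word []) y = y [] := by
  simp [pairing, pairWord]

theorem pairing_consOp (x : Node M N × ℤ) (w y : FreeVerma M N A) :
    pairing q ϖ (consOp x w) y = pairing q ϖ w (raiseOp q ϖ x.1 x.2 y) := by
  have : (pairing q ϖ).flip y ∘ₗ consOp x = (pairing q ϖ).flip (raiseOp q ϖ x.1 x.2 y) := by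
    refine end_ext_word fun w => ?_
    simp [consOp_word, pairing, pairWord]
  exact LinearMap.congr_fun this w

theorem consOp_apply_nil (x : Node M N × ℤ) (y : FreeVerma M N A) : consOp x y [] = 0 := by
  have : Finsupp.lapply [] ∘ₗ consOp x = (0 : FreeVerma M N A →ₗ[A] A) := by
    refine end_ext_word fun w => ?_
    simp [consOp_word]
  exact LinearMap.congr_fun this y

theorem hOp_apply_nil (i : Node M N) (s : ℤ) (y : FreeVerma M N A) :
    hOp q ϖ i s y [] = ϖ.η i s * y [] := by
  have : Finsupp.lapply [] ∘ₗ hOp q ϖ i s = ϖ.η i s • (Finsupp.lapply [] : FreeVerma M N A →ₗ[A] A) := by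
    refine end_ext_word fun w => ?_
    cases w with
    | nil => simp [hOp_nil]
    | cons x w =>
      rw [← consOp_word, LinearMap.comp_apply, hOp_consOp]
      simp [consOp_apply_nil]
  exact LinearMap.congr_fun this y

theorem kOp_apply_nil (ε : ℤˣ) (i : Node M N) (y : FreeVerma M N A) :
    kOp q ϖ ε i y [] = ((ϖ.c i ^ (ε : ℤ) : Aˣ) : A) * y [] := by
  have : Finsupp.lapply [] ∘ₗ kOp q ϖ ε i =
      ((ϖ.c i ^ (ε : ℤ) : Aˣ) : A) • (Finsupp.lapply [] : FreeVerma M N A →ₗ[A] A) := by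
    refine end_ext_word fun w => ?_
    rw [LinearMap.comp_apply, kOp_word]
    cases w with
    | nil => simp [wordWt]
    | cons x w => simp
  exact LinearMap.congr_fun this y

theorem pairing_hOp (hq0 : q ≠ 0) (i : Node M N) (s : ℤ) (w y : FreeVerma M N A) :
    pairing q ϖ (hOp q ϖ i s w) y = pairing q ϖ w (hOp q ϖ i s y) := by
  suffices h : ∀ w y, pairing q ϖ (hOp q ϖ i s (word w)) y =
      pairing q ϖ (word w) (hOp q ϖ i s y) by
    have : (pairing q ϖ).flip y ∘ₗ hOp q ϖ i s = (pairing q ϖ).flip (hOp q ϖ i s y) :=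
      end_ext_word fun w => h w y
    exact LinearMap.congr_fun this w
  intro w
  induction w with
  | nil =>
    intro y
    rw [hOp_nil, map_smul, LinearMap.smul_apply, pairing_nil, pairing_nil, hOp_apply_nil,
      smul_eq_mul]
  | cons x w ih =>
    intro y
    rw [← consOp_word, hOp_consOp, map_sub, LinearMap.map_smul_of_tower, LinearMap.sub_apply,
      LinearMap.smul_apply, pairing_consOp, pairing_consOp, pairing_consOp, ih,
      hOp_raiseOp q ϖ hq0, map_add, LinearMap.map_smul_of_tower, add_sub_cancel_right]

theorem pairing_kOp (hq0 : q ≠ 0) (ε : ℤˣ) (i : Node M N) (w y : FreeVerma M N A) :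
    pairing q ϖ (kOp q ϖ ε i w) y = pairing q ϖ w (kOp q ϖ ε i y) := by
  suffices h : ∀ w y, pairing q ϖ (kOp q ϖ ε i (word w)) y =
      pairing q ϖ (word w) (kOp q ϖ ε i y) by
    have : (pairing q ϖ).flip y ∘ₗ kOp q ϖ ε i = (pairing q ϖ).flip (kOp q ϖ ε i y) :=
      end_ext_word fun w => h w y
    exact LinearMap.congr_fun this w
  intro w
  induction w with
  | nil =>
    intro y
    rw [kOp_word, map_smul, LinearMap.smul_apply, pairing_nil, pairing_nil, kOp_apply_nil,
      smul_eq_mul]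
    simp [wordWt]
  | cons x w ih =>
    intro y
    rw [← consOp_word, kOp_consOp q ϖ hq0, LinearMap.map_smul_of_tower,
      LinearMap.smul_apply, pairing_consOp, pairing_consOp, ih,
      kOp_raiseOp q ϖ hq0, LinearMap.map_smul_of_tower, smul_smul, ← zpow_add₀ hq0, ← add_mul,
      neg_add_cancel, zero_mul, zpow_zero, one_smul]

theorem pairing_phiOp (hq0 : q ≠ 0) (ε : ℤˣ) (i : Node M N) (n : ℤ) (w y : FreeVerma M N A) :
    pairing q ϖ (phiOp q ϖ ε i n w) y = pairing q ϖ w (phiOp q ϖ ε i n y) := by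
  have hs : ∀ s w y, pairing q ϖ (PowerSeries.coeff s (hOpSeries q ϖ ε i) w) y =
      pairing q ϖ w (PowerSeries.coeff s (hOpSeries q ϖ ε i) y) := by
    intro s w y
    rw [hOpSeries, PowerSeries.coeff_mk]
    split_ifs
    · simp
    · rw [LinearMap.smul_apply, LinearMap.smul_apply, LinearMap.map_smul_of_tower,
        LinearMap.smul_apply, LinearMap.map_smul_of_tower, pairing_hOp q ϖ hq0]
  have hp : ∀ (k s : ℕ) (w y : FreeVerma M N A), pairing q ϖ (PowerSeries.coeff s (hOpSeries q ϖ ε i ^ k) w) y =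
      pairing q ϖ w (PowerSeries.coeff s (hOpSeries q ϖ ε i ^ k) y) := by
    intro k
    induction k with
    | zero =>
      intro s w y
      rw [pow_zero, PowerSeries.coeff_one]
      split_ifs <;> simp
    | succ k ih =>
      intro s w y
      conv_lhs => rw [pow_succ]
      conv_rhs => rw [pow_succ', PowerSeries.coeff_mul, ← Finset.Nat.sum_antidiagonal_swap]
      rw [PowerSeries.coeff_mul]
      simp only [LinearMap.sum_apply, map_sum, Module.End.mul_apply, Prod.fst_swap, Prod.snd_swap,
        ih, hs]
  rw [phiOp]
  split_ifs
  · have hc := (commute_expCoeff (g := hOpSeries q ϖ ε i) (c := kOp q ϖ ε i) (fun s => by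
      rw [hOpSeries, PowerSeries.coeff_mk]
      split_ifs
      · exact Commute.zero_right _
      · exact (kOp_comm_hOp q ϖ hq0 ε i i _).smul_right _) ((ε : ℤ) * n).toNat).eq
    conv_rhs => rw [hc]
    rw [Module.End.mul_apply, Module.End.mul_apply, pairing_kOp q ϖ hq0, expCoeff]
    simp only [LinearMap.sum_apply, map_sum, LinearMap.smul_apply, LinearMap.map_smul_of_tower, hp]
  · simp

theorem nodeSign_comm (i j : ℕ) : nodeSign M i j = nodeSign M j i := by
  rw [nodeSign, nodeSign, mul_comm]

theorem pairing_raiseOp (hq0 : q ≠ 0) (i : Node M N) (m : ℤ) (w y : FreeVerma M N A) :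
    pairing q ϖ (raiseOp q ϖ i m w) y = pairing q ϖ w (consOp (i, m) y) := by
  suffices h : ∀ w m y, pairing q ϖ (raiseOp q ϖ i m (word w)) y =
      pairing q ϖ (word w) (consOp (i, m) y) by
    have : (pairing q ϖ).flip y ∘ₗ raiseOp q ϖ i m = (pairing q ϖ).flip (consOp (i, m) y) :=
      end_ext_word fun w => h w m y
    exact LinearMap.congr_fun this w
  intro w
  induction w with
  | nil =>
    intro m y
    rw [raiseOp_nil, map_zero, LinearMap.zero_apply, pairing_nil, consOp_apply_nil]
  | cons x w ih =>
    intro m y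
    rw [← consOp_word, raiseOp_consOp, pairing_consOp, raiseOp_consOp, map_add, LinearMap.add_apply,
      LinearMap.map_smul_of_tower, LinearMap.smul_apply, pairing_consOp, ih, map_add,
      LinearMap.map_smul_of_tower, nodeSign_comm]
    congr 1
    by_cases hx : x.1 = i
    · rw [if_pos hx, if_pos hx.symm, LinearMap.map_smul_of_tower, LinearMap.smul_apply,
        LinearMap.map_smul_of_tower, map_sub, map_sub, LinearMap.sub_apply,
        pairing_phiOp q ϖ hq0, pairing_phiOp q ϖ hq0, hx, add_comm x.2]
    · rw [if_neg hx, if_neg (Ne.symm hx), map_zero, map_zero, LinearMap.zero_apply]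

end FreeVerma

end QAffine

end

noncomputable section
set_option linter.unusedSectionVars false
namespace QAffine

/-! ## Shuffle operators attached to a finite system of coloured points -/

theorem cartan_self (M i : ℕ) : cartan M i i = ell M i + ell M (i + 1) := by
  simp [cartan, epsForm]

theorem cartan_succ (M i : ℕ) : cartan M i (i + 1) = -ell M (i + 1) := by
  have h : i ≠ i + 1 + 1 := by omega
  simp [cartan, epsForm, h]

theorem succ_cartan (M i : ℕ) : cartan M (i + 1) i = -ell M (i + 1) := by
  have h : i + 1 + 1 ≠ i := by omega
  simp [cartan, epsForm, h]

theorem cartan_far {M i j : ℕ} (h : i ≠ j) (h1 : j ≠ i + 1) (h2 : i ≠ j + 1) :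
    cartan M i j = 0 := by
  have h3 : i + 1 ≠ j + 1 := by omega
  have h4 : i + 1 ≠ j := fun h => h1 h.symm
  simp [cartan, epsForm, h, h2, h4]

theorem cartan_comm (M i j : ℕ) : cartan M i j = cartan M j i := by
  by_cases h : i = j
  · rw [h]
  by_cases h1 : j = i + 1
  · rw [h1, cartan_succ, succ_cartan]
  by_cases h2 : i = j + 1
  · rw [h2, cartan_succ, succ_cartan]
  rw [cartan_far h h1 h2, cartan_far (Ne.symm h) h2 h1]

theorem ell_eq (M i : ℕ) : (i ≤ M ∧ ell M i = 1) ∨ (M < i ∧ ell M i = -1) := by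
  unfold ell
  by_cases h : i ≤ M
  · exact Or.inl ⟨h, if_pos h⟩
  · exact Or.inr ⟨not_le.1 h, if_neg h⟩

theorem cartan_self_odd (M : ℕ) : cartan M M M = 0 := by
  rw [cartan_self]
  rcases ell_eq M M with h | h <;> rcases ell_eq M (M + 1) with h' | h' <;> omega

theorem cartan_eq_zero_par {M i : ℕ} (h : cartan M i i = 0) : i = M := by
  rw [cartan_self] at h
  rcases ell_eq M i with h1 | h1 <;> rcases ell_eq M (i + 1) with h2 | h2 <;> omega

theorem cartan_adjacent {M i j : ℕ} (h : cartan M i j = 1 ∨ cartan M i j = -1) (hi : i ≠ M) :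
    i ≠ j ∧ cartan M i i = -2 * cartan M i j := by
  rcases ell_eq M i with h1 | h1 <;> rcases ell_eq M (i + 1) with h2 | h2
  all_goals
    by_cases hij : i = j
    · subst hij
      rw [cartan_self] at h
      omega
    · refine ⟨hij, ?_⟩
      rw [cartan_self]
      by_cases h3 : j = i + 1
      · subst h3
        rw [cartan_succ]
        omega
      by_cases h4 : i = j + 1
      · subst h4
        rw [succ_cartan]
        omega
      rw [cartan_far hij h3 h4] at h
      omega

theorem eq_zero_of_mem_span {R E X : Type*} [Semiring R] [AddCommMonoid E] [Module R E]
    [AddCommMonoid X] [Module R X] {s : Set E} (T : E → X) (h : ∀ x ∈ s, T x = 0)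
    (hadd : ∀ x y, T (x + y) = T x + T y) (hsmul : ∀ (r : R) x, T (r • x) = r • T x) {x : E}
    (hx : x ∈ Submodule.span R s) : T x = 0 := by
  induction hx using Submodule.span_induction with
  | mem x hx => exact h x hx
  | zero => rw [← zero_smul R (0 : E), hsmul, zero_smul]
  | add x y _ _ hx hy => rw [hadd, hx, hy, add_zero]
  | smul r x _ hx => rw [hsmul, hx, smul_zero]

section Shuffle

variable (q : ℂ) (M : ℕ) {ι B : Type*} [Fintype ι] [DecidableEq ι] [CommRing B] [Algebra ℂ B]

/-- The factor of the shuffle product attached to points `z`, `w` of colours `i`, `j`. -/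
def shuffleFactor (i j : ℕ) (z w : B) : B :=
  (if i ≤ j then 1 else -1) * (algebraMap ℂ B (q ^ (-cartan M i j)) * z - w) *
    (if i = j ∧ i ≠ M then z - w else 1)

variable (col : ι → ℕ) (z : ι → Bˣ)

/-- The shuffle factor of two points of the system. -/
abbrev ptFactor (a b : ι) : B := shuffleFactor q M (col a) (col b) (z a : B) (z b)

/-- The insertion of a set of points. -/
def insSet (T : Finset ι) : Module.End B (Finset ι → B) where
  toFun F S := if T ⊆ S then (∏ t ∈ T, ∏ c ∈ S \ T, ptFactor q M col z t c) * F (S \ T) else 0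
  map_add' F G := by
    ext S
    simp only [Pi.add_apply]
    split_ifs <;> ring
  map_smul' r F := by
    ext S
    simp only [Pi.smul_apply, smul_eq_mul, RingHom.id_apply]
    split_ifs <;> ring

/-- The insertion of a point. -/
def insPt (a : ι) : Module.End B (Finset ι → B) := insSet q M col z {a}

theorem insPt_apply (a : ι) (F : Finset ι → B) (S : Finset ι) : insPt q M col z a F S =
    if a ∈ S then (∏ c ∈ S.erase a, ptFactor q M col z a c) * F (S.erase a) else 0 := by
  simp [insPt, insSet, Finset.sdiff_singleton_eq_erase]

theorem insPt_mul_insSet_of_mem {a : ι} {T : Finset ι} (h : a ∈ T) :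
    insPt q M col z a * insSet q M col z T = 0 := by
  refine LinearMap.ext fun F => funext fun S => ?_
  rw [Module.End.mul_apply, insPt_apply]
  split_ifs with h1
  · have : ¬ T ⊆ S.erase a := fun h2 => (Finset.notMem_erase a S) (h2 h)
    simp [insSet, this]
  · rfl

theorem insPt_mul_insSet {a : ι} {T : Finset ι} (h : a ∉ T) :
    insPt q M col z a * insSet q M col z T =
      (∏ t ∈ T, ptFactor q M col z a t) • insSet q M col z (insert a T) := by
  refine LinearMap.ext fun F => funext fun S => ?_
  rw [Module.End.mul_apply, insPt_apply, LinearMap.smul_apply, Pi.smul_apply]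
  simp only [insSet, LinearMap.coe_mk, AddHom.coe_mk, smul_eq_mul]
  by_cases h1 : a ∈ S
  · by_cases h2 : T ⊆ S
    · have h3 : T ⊆ S.erase a := fun t ht =>
        Finset.mem_erase.2 ⟨fun e => h (e ▸ ht), h2 ht⟩
      have h4 : insert a T ⊆ S := Finset.insert_subset h1 h2
      have h5 : S.erase a \ T = S \ insert a T := by
        ext x; simp only [Finset.mem_sdiff, Finset.mem_erase, Finset.mem_insert]; tauto
      have h6 : S.erase a = T ∪ (S \ insert a T) := by
        ext x
        simp only [Finset.mem_sdiff, Finset.mem_erase, Finset.mem_insert, Finset.mem_union]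
        constructor
        · tauto
        · rintro (hx | hx)
          · exact ⟨fun e => h (e ▸ hx), h2 hx⟩
          · tauto
      rw [if_pos h1, if_pos h3, if_pos h4, h5, Finset.prod_insert h, h6, Finset.prod_union]
      · ring
      · rw [Finset.disjoint_left]
        intro x hx hx'
        simp only [Finset.mem_sdiff, Finset.mem_insert] at hx'
        tauto
    · have h3 : ¬ T ⊆ S.erase a := fun h3 => h2 (h3.trans (Finset.erase_subset a S))
      have h4 : ¬ insert a T ⊆ S := fun h4 => h2 ((Finset.subset_insert a T).trans h4)
      rw [if_pos h1, if_neg h3, if_neg h4, mul_zero, mul_zero]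
  · have h4 : ¬ insert a T ⊆ S := fun h4 => h1 (h4 (Finset.mem_insert_self a T))
    rw [if_neg h1, if_neg h4, mul_zero]

theorem insPt_mul_insPt_self (a : ι) : insPt q M col z a * insPt q M col z a = 0 :=
  insPt_mul_insSet_of_mem q M col z (Finset.mem_singleton_self a)

theorem insPt_mul_insPt_self_mul (a : ι) (T : Module.End B (Finset ι → B)) :
    insPt q M col z a * (insPt q M col z a * T) = 0 := by
  rw [← mul_assoc, insPt_mul_insPt_self, zero_mul]

theorem insPt_mul_insPt {a b : ι} (h : a ≠ b) : insPt q M col z a * insPt q M col z b =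
    ptFactor q M col z a b • insSet q M col z {a, b} := by
  rw [insPt.eq_def q M col z b, insPt_mul_insSet q M col z (by simpa using h),
    Finset.prod_singleton]

theorem insPt_mul₃ {a b d : ι} (hab : a ≠ b) (had : a ≠ d) (hbd : b ≠ d) :
    insPt q M col z a * (insPt q M col z b * insPt q M col z d) =
      (ptFactor q M col z a b * ptFactor q M col z a d * ptFactor q M col z b d) •
        insSet q M col z {a, b, d} := by
  rw [insPt_mul_insPt q M col z hbd, mul_smul_comm, insPt_mul_insSet q M col z (by simp [hab, had]),
    Finset.prod_pair hbd, smul_smul]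
  congr 1
  ring

theorem insPt_mul₄ {a b d e : ι} (hab : a ≠ b) (had : a ≠ d) (hae : a ≠ e) (hbd : b ≠ d)
    (hbe : b ≠ e) (hde : d ≠ e) :
    insPt q M col z a * (insPt q M col z b * (insPt q M col z d * insPt q M col z e)) =
      (ptFactor q M col z a b * ptFactor q M col z a d * ptFactor q M col z a e *
        (ptFactor q M col z b d * ptFactor q M col z b e * ptFactor q M col z d e)) •
        insSet q M col z {a, b, d, e} := by
  rw [insPt_mul₃ q M col z hbd hbe hde, mul_smul_comm,
    insPt_mul_insSet q M col z (by simp [hab, had, hae]),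
    Finset.prod_insert (by simp [hbd, hbe]), Finset.prod_pair hde, smul_smul]
  congr 1
  ring

/-- The shuffle operator of `X_{i,n}^-`. -/
def lowPt (i : ℕ) (n : ℤ) : Module.End B (Finset ι → B) :=
  ∑ a, if col a = i then ((z a ^ n : Bˣ) : B) • insPt q M col z a else 0

theorem lowPt_mem_span (i : ℕ) (n : ℤ) : lowPt q M col z i n ∈
    Submodule.span B {x | ∃ a, col a = i ∧ x = insPt q M col z a} := by
  refine Submodule.sum_mem _ fun a _ => ?_
  split_ifs with h
  · exact Submodule.smul_mem _ _ (Submodule.subset_span ⟨a, h, rfl⟩)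
  · exact Submodule.zero_mem _

theorem lowPt_pair_mem_span (i : ℕ) (n : ℤ) : (lowPt q M col z i n, lowPt q M col z i (n + 1)) ∈
    Submodule.span B {x : Module.End B (Finset ι → B) × Module.End B (Finset ι → B) |
      ∃ a, col a = i ∧ x = (insPt q M col z a, (z a : B) • insPt q M col z a)} := by
  have : (lowPt q M col z i n, lowPt q M col z i (n + 1)) = ∑ a, if col a = i then
      ((z a ^ n : Bˣ) : B) • (insPt q M col z a, (z a : B) • insPt q M col z a) else 0 := by
    refine Prod.ext ?_ ?_
    · rw [Prod.fst_sum]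
      refine Finset.sum_congr rfl fun a _ => ?_
      split_ifs <;> rfl
    · rw [Prod.snd_sum]
      refine Finset.sum_congr rfl fun a _ => ?_
      split_ifs
      · rw [Prod.smul_mk, smul_smul, zpow_add_one, Units.val_mul]
      · rfl
  rw [this]
  refine Submodule.sum_mem _ fun a _ => ?_
  split_ifs with h
  · exact Submodule.smul_mem _ _ (Submodule.subset_span ⟨a, h, rfl⟩)
  · exact Submodule.zero_mem _

theorem ptFactor_swap_of_cartan_zero {a b : ι} (h : cartan M (col a) (col b) = 0) :
    ptFactor q M col z a b = nodeSign M (col a) (col b) • ptFactor q M col z b a := by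
  unfold ptFactor shuffleFactor nodeSign nodePar
  rw [cartan_comm M (col b), h]
  have hz : ((1 : ZMod 2)).val = 1 := rfl
  rcases lt_trichotomy (col a) (col b) with h1 | h1 | h1
  · have h2 : ¬ (col b ≤ col a) := not_le.2 h1
    have h3 : ¬ (col a = M ∧ col b = M) := fun h => by omega
    by_cases ha : col a = M
    · have hb : col b ≠ M := fun hb => h3 ⟨ha, hb⟩
      have hb' : M ≠ col b := fun h => hb h.symm
      subst ha
      simp [h2, h1.le, hb, hb']
    · simp [h1.le, h2, h1.ne, h1.ne', ha]
  · have := cartan_eq_zero_par (h1 ▸ h)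
    simp [h1, this, hz]
  · have h2 : ¬ (col a ≤ col b) := not_le.2 h1
    by_cases ha : col a = M
    · have hb : col b ≠ M := by omega
      have hb' : M ≠ col b := fun h => hb h.symm
      subst ha
      simp [h2, h1.le, hb, hb']
    · simp [h1.le, h2, h1.ne, h1.ne', ha]

theorem lowPt_comm (i j : ℕ) (m n : ℤ) (h : cartan M i j = 0) :
    sbr (nodePar M i) (nodePar M j) 1 (lowPt q M col z i m) (lowPt q M col z j n) = 0 := by
  have key : ∀ a b : ι, col a = i → col b = j →
      sbr (nodePar M i) (nodePar M j) 1 (insPt q M col z a) (insPt q M col z b) = 0 := by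
    intro a b ha hb
    rw [sbr, mul_one]
    by_cases hab : a = b
    · subst hab
      rw [insPt_mul_insPt_self, smul_zero, sub_zero]
    · have e := ptFactor_swap_of_cartan_zero q M col z (a := a) (b := b) (by rw [ha, hb, h])
      rw [insPt_mul_insPt q M col z hab, insPt_mul_insPt q M col z (Ne.symm hab), e, ha, hb,
        Finset.pair_comm b a, smul_assoc]
      exact sub_self _
  refine eq_zero_of_mem_span (fun x => sbr (nodePar M i) (nodePar M j) 1 x (lowPt q M col z j n))
    ?_ ?_ ?_ (lowPt_mem_span q M col z i m)
  · rintro _ ⟨a, ha, rfl⟩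
    refine eq_zero_of_mem_span (fun y => sbr (nodePar M i) (nodePar M j) 1 (insPt q M col z a) y)
      ?_ ?_ ?_ (lowPt_mem_span q M col z j n)
    · rintro _ ⟨b, hb, rfl⟩
      exact key a b ha hb
    · intro x y; simp only [sbr, mul_add, add_mul]; module
    · intro r x; simp only [sbr, mul_smul_comm, smul_mul_assoc, smul_sub]; rw [smul_comm r]
  · intro x y; simp only [sbr, mul_add, add_mul]; module
  · intro r x; simp only [sbr, mul_smul_comm, smul_mul_assoc, smul_sub]; rw [smul_comm r]

theorem ptFactor_swap {a b : ι} (h : cartan M (col a) (col b) ≠ 0) :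
    ((z a : B) - algebraMap ℂ B (q ^ (-cartan M (col a) (col b))) * z b) *
      ptFactor q M col z a b =
    (algebraMap ℂ B (q ^ (-cartan M (col a) (col b))) * z a - z b) * ptFactor q M col z b a := by
  unfold ptFactor shuffleFactor
  rw [cartan_comm M (col b)]
  have hM : col a = col b → col b ≠ M := fun h1 h2 => h (by rw [h1, h2, cartan_self_odd])
  generalize algebraMap ℂ B (q ^ (-cartan M (col a) (col b))) = Q
  rcases lt_trichotomy (col a) (col b) with h1 | h1 | h1
  · have h2 : ¬ (col b ≤ col a) := not_le.2 h1
    simp only [h1.le, h2, h1.ne, h1.ne', if_true, if_false, false_and]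
    ring
  · simp only [h1, hM h1, le_refl, if_true, ne_eq, not_false_eq_true, and_true]
    ring
  · have h2 : ¬ (col a ≤ col b) := not_le.2 h1
    simp only [h1.le, h2, h1.ne, h1.ne', if_true, if_false, false_and]
    ring

theorem lowPt_quadratic (i j : ℕ) (m n : ℤ) (h : cartan M i j ≠ 0) :
    lowPt q M col z i (m + 1) * lowPt q M col z j n -
        q ^ (-cartan M i j) • (lowPt q M col z j n * lowPt q M col z i (m + 1)) =
      q ^ (-cartan M i j) • (lowPt q M col z i m * lowPt q M col z j (n + 1)) -
        lowPt q M col z j (n + 1) * lowPt q M col z i m := by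
  rw [← sub_eq_zero]
  let T : Module.End B (Finset ι → B) × Module.End B (Finset ι → B) →
      Module.End B (Finset ι → B) × Module.End B (Finset ι → B) →
      Module.End B (Finset ι → B) := fun x y =>
    x.2 * y.1 - q ^ (-cartan M i j) • (y.1 * x.2) -
      (q ^ (-cartan M i j) • (x.1 * y.2) - y.2 * x.1)
  change T (lowPt q M col z i m, lowPt q M col z i (m + 1))
    (lowPt q M col z j n, lowPt q M col z j (n + 1)) = 0
  refine eq_zero_of_mem_span (fun x => T x _) ?_ ?_ ?_ (lowPt_pair_mem_span q M col z i m)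
  · rintro _ ⟨a, ha, rfl⟩
    refine eq_zero_of_mem_span (fun x => T _ x) ?_ ?_ ?_ (lowPt_pair_mem_span q M col z j n)
    · rintro _ ⟨b, hb, rfl⟩
      simp only [T]
      by_cases hab : a = b
      · subst hab
        simp only [smul_mul_assoc, mul_smul_comm, insPt_mul_insPt_self, smul_zero, sub_zero]
      · have e := ptFactor_swap q M col z (a := a) (b := b) (by rw [ha, hb]; exact h)
        rw [ha, hb] at e
        simp only [smul_mul_assoc, mul_smul_comm]
        rw [insPt_mul_insPt q M col z hab, insPt_mul_insPt q M col z (Ne.symm hab),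
          Finset.pair_comm b a, ← algebraMap_smul B (q ^ (-cartan M i j)),
          ← algebraMap_smul B (q ^ (-cartan M i j))]
        simp only [smul_smul, ← sub_smul]
        convert zero_smul B _ using 2
        linear_combination e
    · intro x y; simp only [T, Prod.fst_add, Prod.snd_add, mul_add, add_mul]; module
    · intro r x
      simp only [T, Prod.smul_fst, Prod.smul_snd, mul_smul_comm, smul_mul_assoc]
      module
  · intro x y; simp only [T, Prod.fst_add, Prod.snd_add, mul_add, add_mul]; module
  · intro r x
    simp only [T, Prod.smul_fst, Prod.smul_snd, mul_smul_comm, smul_mul_assoc]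
    module

theorem serre_factor_identity {P P' s a b d : B} (hP : P * P' = 1)
    {ab ba ad da bd db : B}
    (hab : ab = (P' * P' * a - b) * (a - b)) (hba : ba = (P' * P' * b - a) * (b - a))
    (had : ad = s * (P * a - d)) (hda : da = -s * (P * d - a))
    (hbd : bd = s * (P * b - d)) (hdb : db = -s * (P * d - b)) :
    ab * ad * bd - (P + P') * (ad * ab * db) + da * db * ab + (ba * bd * ad -
      (P + P') * (bd * ba * da) + db * da * ba) = 0 := by
  have key : ∀ a b : B, (P * a - d) * (P * b - d) + (P + P') * (P * a - d) * (P * d - b) +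
      (P * d - a) * (P * d - b) = d * (P * P - 1) * (P * a - P' * b) := by
    intro a b
    linear_combination (P * a * d - a * b - d * d + P * b * d) * hP
  have h3 : (P' * P' * a - b) * (P * a - P' * b) - (P' * P' * b - a) * (P * b - P' * a) = 0 := by
    linear_combination P' * (a * a - b * b) * hP
  subst hab hba had hda hbd hdb
  linear_combination (P' * P' * a - b) * (a - b) * s * s * key a b -
    (P' * P' * b - a) * (a - b) * s * s * key b a +
    s * s * (a - b) * d * (P * P - 1) * h3

theorem oscillation_factor_identity {P P' t a b d e : B} (hP : P * P' = 1) :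
    (b - e) * t * (P * a - e) * (e - P' * d) *
      ((P * a - b) * (P' * b - d) - P' * ((a - P * b) * (P' * b - d)) -
        P * ((P * a - b) * (b - P' * d)) + (a - P * b) * (b - P' * d)) -
    (b - e) * t * (a - P * e) * (P' * e - d) *
      ((P * a - b) * (P' * b - d) - P' * ((a - P * b) * (P' * b - d)) -
        P * ((P * a - b) * (b - P' * d)) + (a - P * b) * (b - P' * d)) =
    -(P - P') ^ 3 * ((b - e) * t * a * b * e * (a - d)) := by
  have h1 : (P * a - b) * (P' * b - d) - P' * ((a - P * b) * (P' * b - d)) -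
        P * ((P * a - b) * (b - P' * d)) + (a - P * b) * (b - P' * d) =
        -(P - P') ^ 2 * (a * b) := by
    grind
  have h2 : (P * a - e) * (e - P' * d) - (a - P * e) * (P' * e - d) = (P - P') * e * (a - d) := by
    grind
  rw [h1]
  linear_combination (b - e) * t * (-(P - P') ^ 2 * (a * b)) * h2

theorem insPt_mul_insPt_mul_insPt_self (a d : ι) :
    insPt q M col z a * (insPt q M col z d * insPt q M col z a) = 0 := by
  by_cases h : d = a
  · rw [h, insPt_mul_insPt_self, mul_zero]
  · rw [insPt_mul_insPt q M col z h, mul_smul_comm,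
      insPt_mul_insSet_of_mem q M col z (by simp), smul_zero]

theorem insPt_serre (hq0 : q ≠ 0) {i j : ℕ} (h : cartan M i j = 1 ∨ cartan M i j = -1)
    (hi : i ≠ M) {a b d : ι} (ha : col a = i) (hb : col b = i) (hd : col d = j) (hab : a ≠ b) :
    insPt q M col z a * (insPt q M col z b * insPt q M col z d) -
      (q + q⁻¹) • (insPt q M col z a * (insPt q M col z d * insPt q M col z b)) +
      insPt q M col z d * (insPt q M col z a * insPt q M col z b) +
    (insPt q M col z b * (insPt q M col z a * insPt q M col z d) -
      (q + q⁻¹) • (insPt q M col z b * (insPt q M col z d * insPt q M col z a)) +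
      insPt q M col z d * (insPt q M col z b * insPt q M col z a)) = 0 := by
  obtain ⟨hij, hii⟩ := cartan_adjacent h hi
  have had : a ≠ d := fun e => hij (by rw [← ha, ← hd, e])
  have hbd : b ≠ d := fun e => hij (by rw [← hb, ← hd, e])
  have e1 : ({a, d, b} : Finset ι) = {a, b, d} := by ext; simp; tauto
  have e2 : ({d, a, b} : Finset ι) = {a, b, d} := by ext; simp; tauto
  have e3 : ({b, a, d} : Finset ι) = {a, b, d} := by ext; simp; tauto
  have e4 : ({b, d, a} : Finset ι) = {a, b, d} := by ext; simp; tauto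
  have e5 : ({d, b, a} : Finset ι) = {a, b, d} := by ext; simp; tauto
  rw [insPt_mul₃ q M col z hab had hbd, insPt_mul₃ q M col z had hab hbd.symm,
    insPt_mul₃ q M col z had.symm hbd.symm hab, insPt_mul₃ q M col z hab.symm hbd had,
    insPt_mul₃ q M col z hbd hab.symm had.symm, insPt_mul₃ q M col z hbd.symm had.symm hab.symm,
    e1, e2, e3, e4, e5, ← algebraMap_smul B (q + q⁻¹), ← algebraMap_smul B (q + q⁻¹)]
  generalize insSet q M col z {a, b, d} = Y
  set P := algebraMap ℂ B (q ^ (-cartan M i j)) with hPdef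
  set P' := algebraMap ℂ B (q ^ (cartan M i j)) with hPdef'
  have hP : P * P' = 1 := by
    rw [hPdef, hPdef', ← map_mul, ← zpow_add₀ hq0, neg_add_cancel, zpow_zero, map_one]
  have hsum : algebraMap ℂ B (q + q⁻¹) = P + P' := by
    rw [hPdef, hPdef', ← map_add]
    congr 1
    rcases h with h | h <;> rw [h] <;> simp [add_comm]
  have hP2 : algebraMap ℂ B (q ^ (-cartan M i i)) = P' * P' := by
    rw [hPdef', ← map_mul, ← zpow_add₀ hq0, hii]
    congr 2
    ring
  have hfar : ∀ {x y : ι}, col x = i → col y = j → ptFactor q M col z x y =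
      (if i ≤ j then 1 else -1) * (P * z x - z y) := by
    intro x y hx hy
    simp only [ptFactor, shuffleFactor, hx, hy, hij, false_and, if_false, mul_one, ← hPdef]
  have hfar' : ∀ {x y : ι}, col x = i → col y = j → ptFactor q M col z y x =
      -(if i ≤ j then 1 else -1) * (P * z y - z x) := by
    intro x y hx hy
    simp only [ptFactor, shuffleFactor, hx, hy, hij.symm, false_and, if_false, mul_one,
      cartan_comm M j i, ← hPdef]
    rcases lt_or_gt_of_ne hij with h1 | h1
    · simp [h1.le, not_le.2 h1]
    · simp [h1.le, not_le.2 h1]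
  have hnear : ∀ {x y : ι}, col x = i → col y = i → ptFactor q M col z x y =
      (P' * P' * z x - z y) * (z x - z y) := by
    intro x y hx hy
    simp only [ptFactor, shuffleFactor, hx, hy, le_refl, if_true, hi, ne_eq, not_false_eq_true,
      and_self, one_mul, hP2]
  have key := serre_factor_identity hP (hnear ha hb) (hnear hb ha) (hfar ha hd) (hfar' ha hd)
    (hfar hb hd) (hfar' hb hd)
  rw [hsum]
  match_scalars
  linear_combination key

theorem lowPt_serre (hq0 : q ≠ 0) (i j : ℕ) (m n k : ℤ)
    (h : cartan M i j = 1 ∨ cartan M i j = -1) (hi : i ≠ M) :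
    sbr 0 (nodePar M j) q (lowPt q M col z i m)
        (sbr 0 (nodePar M j) q⁻¹ (lowPt q M col z i n) (lowPt q M col z j k)) +
      sbr 0 (nodePar M j) q (lowPt q M col z i n)
        (sbr 0 (nodePar M j) q⁻¹ (lowPt q M col z i m) (lowPt q M col z j k)) = 0 := by
  let T : Module.End B (Finset ι → B) → Module.End B (Finset ι → B) →
      Module.End B (Finset ι → B) → Module.End B (Finset ι → B) := fun x y w =>
    x * (y * w) - (q + q⁻¹) • (x * (w * y)) + w * (x * y) +
    (y * (x * w) - (q + q⁻¹) • (y * (w * x)) + w * (y * x))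
  have hT : ∀ x y w, sbr 0 (nodePar M j) q x (sbr 0 (nodePar M j) q⁻¹ y w) +
      sbr 0 (nodePar M j) q y (sbr 0 (nodePar M j) q⁻¹ x w) = T x y w := by
    intro x y w
    have hv : (0 : ZMod 2).val = 0 := rfl
    simp only [sbr, T, hv, zero_mul, pow_zero, one_mul, mul_sub, sub_mul, mul_smul_comm,
      smul_mul_assoc, smul_sub, smul_smul, mul_inv_cancel₀ hq0, mul_assoc]
    module
  rw [hT]
  refine eq_zero_of_mem_span (fun x => T x _ _) ?_ ?_ ?_ (lowPt_mem_span q M col z i m)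
  · rintro _ ⟨a, ha, rfl⟩
    refine eq_zero_of_mem_span (fun x => T _ x _) ?_ ?_ ?_ (lowPt_mem_span q M col z i n)
    · rintro _ ⟨b, hb, rfl⟩
      refine eq_zero_of_mem_span (fun x => T _ _ x) ?_ ?_ ?_ (lowPt_mem_span q M col z j k)
      · rintro _ ⟨d, hd, rfl⟩
        by_cases hab : a = b
        · subst hab
          simp only [T, insPt_mul_insPt_self, insPt_mul_insPt_mul_insPt_self,
            insPt_mul_insPt_self_mul, mul_zero, smul_zero, sub_zero, add_zero]
        · exact insPt_serre q M col z hq0 h hi ha hb hd hab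
      · intro x y; simp only [T, mul_add, add_mul]; module
      · intro r x; simp only [T, mul_smul_comm, smul_mul_assoc]; module
    · intro x y; simp only [T, mul_add, add_mul]; module
    · intro r x; simp only [T, mul_smul_comm, smul_mul_assoc]; module
  · intro x y; simp only [T, mul_add, add_mul]; module
  · intro r x; simp only [T, mul_smul_comm, smul_mul_assoc]; module

/-- The combination of words underlying the oscillation relation. -/
def oscWord {E : Type*} [Ring E] [Algebra ℂ E] (q : ℂ) (a b d e : E) : E :=
  a * (b * (d * e)) - q⁻¹ • (b * (a * (d * e))) - q • (d * (a * (b * e))) + d * (b * (a * e)) +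
    (e * (a * (b * d)) - q⁻¹ • (e * (b * (a * d))) - q • (e * (d * (a * b))) + e * (d * (b * a)))

theorem sbr_oscillation {E : Type*} [Ring E] [Algebra ℂ E] {q : ℂ} (hq0 : q ≠ 0) (a b d e : E) :
    sbr 1 1 1 (sbr 1 0 q (sbr 0 1 q⁻¹ a b) d) e = oscWord q a b d e := by
  have hv : (0 : ZMod 2).val = 0 := rfl
  have hz : (1 : ZMod 2).val = 1 := rfl
  simp only [sbr, oscWord, hv, hz, mul_zero, mul_one, pow_one, pow_zero, one_mul, mul_sub,
    sub_mul, mul_smul_comm, smul_mul_assoc, smul_sub, smul_smul, mul_inv_cancel₀ hq0, mul_assoc,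
    neg_smul, one_smul]
  module

theorem insPt_oscillation (hq0 : q ≠ 0) {i k : ℕ} (hi : i + 1 = M) (hk : k = M + 1)
    {a b d e : ι} (ha : col a = i) (hb : col b = M) (hd : col d = k) (he : col e = M)
    (hbe : b ≠ e) :
    oscWord q (insPt q M col z a) (insPt q M col z b) (insPt q M col z d) (insPt q M col z e) =
    algebraMap ℂ B (-(q - q⁻¹) ^ 3) • (((z b - z e : B) * (z a - z d) * z a * z b * z e * (z a - z d)) •
      insSet q M col z {a, b, d, e}) := by
  have hab : a ≠ b := by rintro rfl; omega
  have had : a ≠ d := by rintro rfl; omega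
  have hae : a ≠ e := by rintro rfl; omega
  have hbd : b ≠ d := by rintro rfl; omega
  have hed : e ≠ d := by rintro rfl; omega
  have e1 : ({b, a, d, e} : Finset ι) = {a, b, d, e} := by ext; simp; tauto
  have e2 : ({d, a, b, e} : Finset ι) = {a, b, d, e} := by ext; simp; tauto
  have e3 : ({d, b, a, e} : Finset ι) = {a, b, d, e} := by ext; simp; tauto
  have e4 : ({e, a, b, d} : Finset ι) = {a, b, d, e} := by ext; simp; tauto
  have e5 : ({e, b, a, d} : Finset ι) = {a, b, d, e} := by ext; simp; tauto
  have e6 : ({e, d, a, b} : Finset ι) = {a, b, d, e} := by ext; simp; tauto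
  have e7 : ({e, d, b, a} : Finset ι) = {a, b, d, e} := by ext; simp; tauto
  rw [oscWord, insPt_mul₄ q M col z hab had hae hbd hbe hed.symm,
    insPt_mul₄ q M col z hab.symm hbd hbe had hae hed.symm,
    insPt_mul₄ q M col z had.symm hbd.symm hed.symm hab hae hbe,
    insPt_mul₄ q M col z hbd.symm had.symm hed.symm hab.symm hbe hae,
    insPt_mul₄ q M col z hae.symm hbe.symm hed hab had hbd,
    insPt_mul₄ q M col z hbe.symm hae.symm hed hab.symm hbd had,
    insPt_mul₄ q M col z hed hae.symm hbe.symm had.symm hbd.symm hab,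
    insPt_mul₄ q M col z hed hbe.symm hae.symm hbd.symm had.symm hab.symm,
    e1, e2, e3, e4, e5, e6, e7]
  simp only [← algebraMap_smul B (_ : ℂ) (_ : Module.End B (Finset ι → B))]
  generalize insSet q M col z {a, b, d, e} = Y
  set P := algebraMap ℂ B q with hPdef
  set P' := algebraMap ℂ B q⁻¹ with hPdef'
  have hP : P * P' = 1 := by
    rw [hPdef, hPdef', ← map_mul, mul_inv_cancel₀ hq0, map_one]
  have hR : algebraMap ℂ B (-(q - q⁻¹) ^ 3) = -(P - P') ^ 3 := by
    rw [map_neg, map_pow, map_sub]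
  have cab : cartan M i M = -1 := by
    subst hi
    rw [cartan_succ]
    simp [ell]
  have cbd : cartan M M k = 1 := by
    subst hk
    rw [cartan_succ]
    simp [ell]
  have cad : cartan M i k = 0 := cartan_far (by omega) (by omega) (by omega)
  have f1 : ∀ {x}, col x = M → ptFactor q M col z a x = P * z a - z x := by
    intro x hx
    have h1 : i ≤ M := by omega
    have h2 : i ≠ M := by omega
    simp [ptFactor, shuffleFactor, ha, hx, cab, h1, h2, hPdef]
  have f2 : ∀ {x}, col x = M → ptFactor q M col z x a = z a - P * z x := by
    intro x hx
    have h1 : ¬ M ≤ i := by omega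
    have h2 : M ≠ i := by omega
    simp [ptFactor, shuffleFactor, ha, hx, cartan_comm M M i, cab, h1, h2, hPdef]
  have f3 : ∀ {x}, col x = M → ptFactor q M col z x d = P' * z x - z d := by
    intro x hx
    have h1 : M ≤ k := by omega
    have h2 : M ≠ k := by omega
    simp [ptFactor, shuffleFactor, hd, hx, cbd, h1, h2, hPdef']
  have f4 : ∀ {x}, col x = M → ptFactor q M col z d x = z x - P' * z d := by
    intro x hx
    have h1 : ¬ k ≤ M := by omega
    have h2 : k ≠ M := by omega
    simp [ptFactor, shuffleFactor, hd, hx, cartan_comm M k M, cbd, h1, h2, hPdef']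
  have f5 : ptFactor q M col z a d = z a - z d := by
    have h1 : i ≤ k := by omega
    have h2 : i ≠ k := by omega
    simp [ptFactor, shuffleFactor, ha, hd, cad, h1, h2]
  have f6 : ptFactor q M col z d a = z a - z d := by
    have h1 : ¬ k ≤ i := by omega
    have h2 : k ≠ i := by omega
    simp [ptFactor, shuffleFactor, ha, hd, cartan_comm M k i, cad, h1, h2]
  have f7 : ∀ {x y}, col x = M → col y = M → ptFactor q M col z x y = z x - z y := by
    intro x y hx hy
    simp [ptFactor, shuffleFactor, hx, hy, cartan_self_odd]
  rw [f1 hb, f1 he, f2 hb, f2 he, f3 hb, f3 he, f4 hb, f4 he, f5, f6, f7 hb he, f7 he hb, hR]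
  have key := oscillation_factor_identity (t := (z a - z d : B)) (a := (z a : B)) (b := z b)
    (d := z d) (e := z e) hP
  match_scalars
  linear_combination key

theorem lowPt_oscillation (hq0 : q ≠ 0) (i k : ℕ) (m n s u : ℤ) (hi : i + 1 = M)
    (hk : k = M + 1) :
    sbr 1 1 1 (sbr 1 0 q (sbr 0 1 q⁻¹ (lowPt q M col z i m) (lowPt q M col z M n))
        (lowPt q M col z k s)) (lowPt q M col z M u) +
      sbr 1 1 1 (sbr 1 0 q (sbr 0 1 q⁻¹ (lowPt q M col z i m) (lowPt q M col z M u))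
        (lowPt q M col z k s)) (lowPt q M col z M n) = 0 := by
  rw [sbr_oscillation hq0, sbr_oscillation hq0]
  let T : Module.End B (Finset ι → B) → Module.End B (Finset ι → B) →
      Module.End B (Finset ι → B) → Module.End B (Finset ι → B) →
      Module.End B (Finset ι → B) := fun a b d e => oscWord q a b d e + oscWord q a e d b
  change T _ _ _ _ = 0
  refine eq_zero_of_mem_span (fun x => T x _ _ _) ?_ ?_ ?_ (lowPt_mem_span q M col z i m)
  · rintro _ ⟨a, ha, rfl⟩
    refine eq_zero_of_mem_span (fun x => T _ x _ _) ?_ ?_ ?_ (lowPt_mem_span q M col z M n)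
    · rintro _ ⟨b, hb, rfl⟩
      refine eq_zero_of_mem_span (fun x => T _ _ x _) ?_ ?_ ?_ (lowPt_mem_span q M col z k s)
      · rintro _ ⟨d, hd, rfl⟩
        refine eq_zero_of_mem_span (fun x => T _ _ _ x) ?_ ?_ ?_ (lowPt_mem_span q M col z M u)
        · rintro _ ⟨e, he, rfl⟩
          by_cases hbe : b = e
          · subst hbe
            have had : a ≠ d := by rintro rfl; omega
            have h4 : ∀ x y w : ι, y ≠ w → insPt q M col z x * (insPt q M col z y *
                (insPt q M col z w * insPt q M col z x)) = 0 := by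
              intro x y w hyw
              by_cases hw : w = x
              · rw [hw, insPt_mul_insPt_self, mul_zero, mul_zero]
              by_cases hy : y = x
              · rw [hy, ← mul_assoc, insPt_mul_insPt_self, zero_mul]
              rw [insPt_mul₃ q M col z hyw hy hw, mul_smul_comm,
                insPt_mul_insSet_of_mem q M col z (by simp), smul_zero]
            have h6 : ∀ x y w : ι, x ≠ y → insPt q M col z x * (insPt q M col z y *
                (insPt q M col z x * insPt q M col z w)) = 0 := by
              intro x y w hxy
              by_cases hw : x = w
              · rw [← hw, insPt_mul_insPt_self, mul_zero, mul_zero]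
              by_cases hy : y = w
              · rw [hy, insPt_mul_insPt_mul_insPt_self, mul_zero]
              rw [insPt_mul₃ q M col z hxy.symm hy hw, mul_smul_comm,
                insPt_mul_insSet_of_mem q M col z (by simp), smul_zero]
            have hba : b ≠ a := by rintro rfl; omega
            have hbd : b ≠ d := by rintro rfl; omega
            simp only [T, oscWord, insPt_mul_insPt_self, insPt_mul_insPt_mul_insPt_self,
              insPt_mul_insPt_self_mul, h4 b a d had, h4 b d a had.symm, h6 b a d hba, h6 b d a hbd, mul_zero, smul_zero, sub_zero, add_zero]
          · have e1 : ({a, e, d, b} : Finset ι) = {a, b, d, e} := by ext; simp; tauto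
            simp only [T]
            rw [insPt_oscillation q M col z hq0 hi hk ha hb hd he hbe,
              insPt_oscillation q M col z hq0 hi hk ha he hd hb (Ne.symm hbe), e1, ← smul_add,
              ← add_smul]
            convert smul_zero _
            convert zero_smul B _ using 2
            ring
        · intro x y; simp only [T, oscWord, mul_add, add_mul]; module
        · intro r x; simp only [T, oscWord, mul_smul_comm, smul_mul_assoc]; module
      · intro x y; simp only [T, oscWord, mul_add, add_mul]; module
      · intro r x; simp only [T, oscWord, mul_smul_comm, smul_mul_assoc]; module
    · intro x y; simp only [T, oscWord, mul_add, add_mul]; module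
    · intro r x; simp only [T, oscWord, mul_smul_comm, smul_mul_assoc]; module
  · intro x y; simp only [T, oscWord, mul_add, add_mul]; module
  · intro r x; simp only [T, oscWord, mul_smul_comm, smul_mul_assoc]; module

end Shuffle

end QAffine

end

noncomputable section
set_option linter.unusedSectionVars false
namespace QAffine

/-! ## The shuffle realization of the free highest weight module -/

section ShuffleRealization

variable (q : ℂ) {M N : ℕ} {A : Type*} [CommRing A] [Algebra ℂ A] (ϖ : CartanWeight M N A)
variable {ι B : Type*} [Fintype ι] [DecidableEq ι] [CommRing B] [Algebra ℂ B]
  [Algebra A B] [IsScalarTower ℂ A B] (col : ι → ℕ) (z : ι → Bˣ)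

theorem lowPt_apply (i : ℕ) (n : ℤ) (F : Finset ι → B) (S : Finset ι) :
    lowPt q M col z i n F S = ∑ a ∈ S, if col a = i then
      ((z a ^ n : Bˣ) : B) * ((∏ c ∈ S.erase a, ptFactor q M col z a c) * F (S.erase a)) else 0 := by
  rw [lowPt, LinearMap.sum_apply, Finset.sum_apply, ← Finset.sum_subset (Finset.subset_univ S)]
  · refine Finset.sum_congr rfl fun a ha => ?_
    split_ifs
    · rw [LinearMap.smul_apply, Pi.smul_apply, insPt_apply, if_pos ha, smul_eq_mul]
    · rfl
  · intro a _ ha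
    split_ifs
    · rw [LinearMap.smul_apply, Pi.smul_apply, insPt_apply, if_neg ha, smul_zero]
    · rfl

/-- The value on words of the shuffle realization. -/
def shuffleWord : List (Node M N × ℤ) → Finset ι → B
  | [] => Pi.single ∅ 1
  | x :: w => lowPt q M col z x.1 x.2 (shuffleWord w)

/-- The shuffle realization. -/
def shuffle : FreeVerma M N A →ₗ[A] (Finset ι → B) := ofWord (shuffleWord q col z)

theorem shuffle_nil : shuffle q col z (word [] : FreeVerma M N A) = Pi.single ∅ 1 := by
  rw [shuffle, ofWord_word, shuffleWord]

theorem shuffle_consOp (x : Node M N × ℤ) (y : FreeVerma M N A) :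
    shuffle q col z (consOp x y) = lowPt q M col z x.1 x.2 (shuffle q col z y) := by
  have : shuffle q col z ∘ₗ consOp x =
      (lowPt q M col z x.1 x.2).restrictScalars A ∘ₗ shuffle q col z := by
    refine end_ext_word fun w => ?_
    simp [consOp_word, shuffle, shuffleWord]
  exact LinearMap.congr_fun this y

theorem shuffle_apply_empty (y : FreeVerma M N A) :
    shuffle q col z y ∅ = algebraMap A B (y []) := by
  have : LinearMap.proj ∅ ∘ₗ shuffle q col z =
      Algebra.linearMap A B ∘ₗ (Finsupp.lapply [] : FreeVerma M N A →ₗ[A] A) := by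
    refine end_ext_word fun w => ?_
    cases w with
    | nil => simp [shuffle_nil]
    | cons x w =>
      rw [← consOp_word, LinearMap.comp_apply, LinearMap.comp_apply, shuffle_consOp]
      simp [consOp_apply_nil, lowPt_apply]
  exact LinearMap.congr_fun this y

/-- The eigenvalue of `h_{i,s}` at a set of points. -/
def hValue (i : Node M N) (s : ℤ) (S : Finset ι) : B :=
  algebraMap A B (ϖ.η i s) - ∑ b ∈ S, hCoeff q M i (col b) s • ((z b ^ s : Bˣ) : B)

theorem shuffle_hOp (i : Node M N) (s : ℤ) (y : FreeVerma M N A) (S : Finset ι) :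
    shuffle q col z (hOp q ϖ i s y) S = hValue q ϖ col z i s S * shuffle q col z y S := by
  suffices h : ∀ w S, shuffle q col z (hOp q ϖ i s (word w)) S =
      hValue q ϖ col z i s S * shuffle q col z (word w : FreeVerma M N A) S by
    have : LinearMap.proj S ∘ₗ shuffle q col z ∘ₗ hOp q ϖ i s =
        (hValue q ϖ col z i s S) • (LinearMap.proj S ∘ₗ shuffle (B := B) q col z) :=
      end_ext_word fun w => h w S
    exact LinearMap.congr_fun this y
  intro w
  induction w with
  | nil =>
    intro S
    rw [hOp_nil, map_smul, Pi.smul_apply, shuffle_nil, Pi.single_apply]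
    split_ifs with h
    · simp [hValue, h, Algebra.smul_def]
    · simp
  | cons x w ih =>
    intro S
    rw [← consOp_word, hOp_consOp, map_sub, LinearMap.map_smul_of_tower, shuffle_consOp,
      shuffle_consOp, shuffle_consOp, Pi.sub_apply, Pi.smul_apply, lowPt_apply, lowPt_apply,
      lowPt_apply, Finset.smul_sum, ← Finset.sum_sub_distrib, Finset.mul_sum]
    refine Finset.sum_congr rfl fun a ha => ?_
    split_ifs with hc
    · have h1 : hValue q ϖ col z i s S = hValue q ϖ col z i s (S.erase a) -
          hCoeff q M i x.1 s • ((z a ^ s : Bˣ) : B) := by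
        rw [hValue, hValue, ← Finset.add_sum_erase S _ ha, hc]
        ring
      rw [ih, h1, zpow_add, Units.val_mul, Algebra.smul_def, Algebra.smul_def]
      ring
    · simp

/-- The eigenvalue of `K_i^ε` at a set of points. -/
def kValue (ε : ℤˣ) (i : Node M N) (S : Finset ι) : B :=
  algebraMap A B ((ϖ.c i ^ (ε : ℤ) : Aˣ) : A) *
    ∏ b ∈ S, algebraMap ℂ B (q ^ (-(ε : ℤ) * cartan M i (col b)))

theorem shuffle_kOp (hq0 : q ≠ 0) (ε : ℤˣ) (i : Node M N) (y : FreeVerma M N A) (S : Finset ι) :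
    shuffle q col z (kOp q ϖ ε i y) S = kValue q ϖ col ε i S * shuffle q col z y S := by
  suffices h : ∀ w S, shuffle q col z (kOp q ϖ ε i (word w)) S =
      kValue q ϖ col ε i S * shuffle q col z (word w : FreeVerma M N A) S by
    have : LinearMap.proj S ∘ₗ shuffle q col z ∘ₗ kOp q ϖ ε i =
        (kValue q ϖ (B := B) col ε i S) • (LinearMap.proj S ∘ₗ shuffle (B := B) q col z) :=
      end_ext_word fun w => h w S
    exact LinearMap.congr_fun this y
  intro w
  induction w with
  | nil =>
    intro S
    rw [kOp_word, map_smul, Pi.smul_apply, shuffle_nil, Pi.single_apply]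
    split_ifs with h
    · simp [kValue, h, Algebra.smul_def, wordWt]
    · simp
  | cons x w ih =>
    intro S
    rw [← consOp_word, kOp_consOp q ϖ hq0, LinearMap.map_smul_of_tower, shuffle_consOp,
      shuffle_consOp, Pi.smul_apply, lowPt_apply, lowPt_apply, Finset.smul_sum, Finset.mul_sum]
    refine Finset.sum_congr rfl fun a ha => ?_
    split_ifs with hc
    · have h1 : kValue q ϖ col ε i S = kValue q ϖ (B := B) col ε i (S.erase a) *
          algebraMap ℂ B (q ^ (-(ε : ℤ) * cartan M i x.1)) := by
        rw [kValue, kValue, ← Finset.mul_prod_erase S _ ha, hc]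
        ring
      rw [ih, h1, Algebra.smul_def]
      ring
    · simp

/-- The exponent of the eigenvalue of `φ_i^ε` at a set of points. -/
def hValueSeries (ε : ℤˣ) (i : Node M N) (S : Finset ι) : PowerSeries B :=
  PowerSeries.mk fun s : ℕ =>
    if s = 0 then 0
    else (((ε : ℤ) : ℂ) * (qi q M i - (qi q M i)⁻¹)) • hValue q ϖ col z i ((ε : ℤ) * (s : ℤ)) S

/-- The eigenvalue of `φ_i^ε` at a set of points. -/
def phiValue (ε : ℤˣ) (i : Node M N) (S : Finset ι) : PowerSeries B :=
  PowerSeries.C (kValue q ϖ col ε i S) * expSeries (hValueSeries q ϖ col z ε i S)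

theorem ofPowerSeries_coeff (f : PowerSeries B) (n : ℤ) :
    (HahnSeries.ofPowerSeries ℤ B f).coeff n =
      if 0 ≤ n then PowerSeries.coeff n.toNat f else 0 := by
  split_ifs with h
  · obtain ⟨k, rfl⟩ := Int.eq_ofNat_of_zero_le h
    exact LaurentSeries.coeff_coe_powerSeries f k
  · rw [HahnSeries.ofPowerSeries_apply]
    refine HahnSeries.embDomain_of_notMem_range ?_
    rintro ⟨k, hk⟩
    have : (k : ℤ) = n := hk
    omega

theorem shuffle_phiOp (hq0 : q ≠ 0) (ε : ℤˣ) (i : Node M N) (n : ℤ) (y : FreeVerma M N A)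
    (S : Finset ι) : shuffle q col z (phiOp q ϖ ε i n y) S =
      (HahnSeries.ofPowerSeries ℤ B (phiValue q ϖ col z ε i S)).coeff ((ε : ℤ) * n) *
        shuffle q col z y S := by
  rw [ofPowerSeries_coeff, phiOp]
  split_ifs with h
  · rw [Module.End.mul_apply, shuffle_kOp q ϖ col z hq0, phiValue, PowerSeries.coeff_C_mul,
      coeff_expSeries, mul_assoc]
    congr 1
    let e : Module.End A (FreeVerma M N A) →ₗ[ℂ] B :=
      { toFun := fun T => shuffle q col z (T y) S
        map_add' := fun _ _ => by simp
        map_smul' := fun r T => by simp [LinearMap.map_smul_of_tower] }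
    refine expCoeff_eigen_left e (hOpSeries q ϖ ε i) (hValueSeries q ϖ col z ε i S) ?_ _
    intro T s
    change shuffle q col z ((PowerSeries.coeff s (hOpSeries q ϖ ε i) * T) y) S = _
    rw [hOpSeries, PowerSeries.coeff_mk, hValueSeries, PowerSeries.coeff_mk]
    split_ifs
    · simp
    · rw [Module.End.mul_apply, LinearMap.smul_apply, LinearMap.map_smul_of_tower, Pi.smul_apply,
        shuffle_hOp, smul_assoc]
      rfl
  · simp

theorem smul_hCoeff (hq2 : q - q⁻¹ ≠ 0) (i j : ℕ) (s : ℤ) :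
    (qi q M i - (qi q M i)⁻¹) * hCoeff q M i j s =
      (q ^ (s * cartan M i j) - q ^ (-(s * cartan M i j))) / (s : ℂ) := by
  have hl : ell M i = 1 ∨ ell M i = -1 := (ell_eq M i).imp And.right And.right
  have hd : qi q M i - (qi q M i)⁻¹ ≠ 0 := by
    rcases hl with h | h
    · rw [qi, h, zpow_one]; exact hq2
    · rw [qi, h, zpow_neg_one, inv_inv, ← neg_sub]; exact neg_ne_zero.2 hq2
  have he : ell M i * (s * ell M i * cartan M i j) = s * cartan M i j := by
    rcases hl with h | h <;> rw [h] <;> ring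
  rw [hCoeff, qInt, mul_div_assoc', mul_div_cancel₀ _ hd]
  rw [qi, ← zpow_mul, ← zpow_mul, mul_neg, he]

theorem qi_sub_inv_ne_zero (hq2 : q - q⁻¹ ≠ 0) (i : ℕ) : qi q M i - (qi q M i)⁻¹ ≠ 0 := by
  rcases ell_eq M i with ⟨_, h⟩ | ⟨_, h⟩
  · rw [qi, h, zpow_one]; exact hq2
  · rw [qi, h, zpow_neg_one, inv_inv, ← neg_sub]; exact neg_ne_zero.2 hq2

/-- The contribution of a point `u` of colour `j` to the eigenvalue of `φ_i^ε`. -/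
def ptSeries (i j : ℕ) (ε : ℤˣ) (u : Bˣ) : PowerSeries B :=
  PowerSeries.C (algebraMap ℂ B (q ^ (-(ε : ℤ) * cartan M i j))) *
    expSeries (powDiff (algebraMap ℂ B (q ^ (-(ε : ℤ) * cartan M i j)) * ((u ^ (ε : ℤ) : Bˣ) : B))
      (algebraMap ℂ B (q ^ ((ε : ℤ) * cartan M i j)) * ((u ^ (ε : ℤ) : Bˣ) : B)))

theorem phiValue_eq (hq2 : q - q⁻¹ ≠ 0) (ε : ℤˣ) (i : Node M N) (S : Finset ι) :
    phiValue q ϖ col z ε i S =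
      phiValue q ϖ col z ε i ∅ * ∏ b ∈ S, ptSeries q (M := M) i (col b) ε (z b) := by
  have h0 : PowerSeries.constantCoeff (hValueSeries q ϖ col z ε i ∅) = 0 := by
    simp [← PowerSeries.coeff_zero_eq_constantCoeff_apply, hValueSeries]
  have hs : hValueSeries q ϖ col z ε i S = hValueSeries q ϖ col z ε i ∅ +
      ∑ b ∈ S, powDiff
        (algebraMap ℂ B (q ^ (-(ε : ℤ) * cartan M i (col b))) * ((z b ^ (ε : ℤ) : Bˣ) : B))
        (algebraMap ℂ B (q ^ ((ε : ℤ) * cartan M i (col b))) * ((z b ^ (ε : ℤ) : Bˣ) : B)) := by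
    ext s
    rw [map_add, map_sum]
    simp only [hValueSeries, powDiff, PowerSeries.coeff_mk]
    split_ifs with h
    · simp [h]
    · have hv : hValue q ϖ col z i ((ε : ℤ) * s) S = hValue q ϖ col z i ((ε : ℤ) * s) ∅ +
          ∑ b ∈ S, -(hCoeff q M i (col b) ((ε : ℤ) * s) • ((z b ^ ((ε : ℤ) * s) : Bˣ) : B)) := by
        rw [hValue, hValue, Finset.sum_empty, sub_zero, Finset.sum_neg_distrib, sub_eq_add_neg]
      rw [hv, smul_add, Finset.smul_sum]
      congr 1
      refine Finset.sum_congr rfl fun b _ => ?_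
      have hz : (z b ^ ((ε : ℤ) * (s : ℤ)) : Bˣ) = (z b ^ (ε : ℤ)) ^ s := by
        rw [zpow_mul, zpow_natCast]
      have e1 : q ^ (((ε : ℤ) * (s : ℤ)) * cartan M i (col b)) =
          (q ^ ((ε : ℤ) * cartan M i (col b))) ^ s := by
        rw [← zpow_natCast, ← zpow_mul]; congr 1; ring
      have e2 : q ^ (-(((ε : ℤ) * (s : ℤ)) * cartan M i (col b))) =
          (q ^ (-(ε : ℤ) * cartan M i (col b))) ^ s := by
        rw [← zpow_natCast, ← zpow_mul]; congr 1; ring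
      have hε : ((ε : ℤ) : ℂ) * ((ε : ℤ) : ℂ) = 1 := by
        rw [← Int.cast_mul, ← Units.val_mul, Int.units_mul_self]; simp
      have hεi : ((ε : ℤ) : ℂ) ≠ 0 := left_ne_zero_of_mul_eq_one hε
      rw [mul_pow, mul_pow, ← map_pow, ← map_pow, hz, Units.val_pow_eq_pow_val,
        ← sub_mul, ← map_sub, ← Algebra.smul_def, smul_smul, smul_neg, smul_smul, ← neg_smul, mul_assoc,
        smul_hCoeff q hq2, e1, e2]
      congr 1
      have hsn : (s : ℂ) ≠ 0 := Nat.cast_ne_zero.2 h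
      push_cast
      field_simp
      ring
  rw [phiValue, phiValue, hs, expSeries_add h0, expSeries_sum _ fun b => constantCoeff_powDiff _ _]
  · simp only [ptSeries, Finset.prod_mul_distrib, kValue, Finset.prod_empty, mul_one, map_mul,
      map_prod]
    ring
  · rw [map_sum]
    exact Finset.sum_eq_zero fun b _ => constantCoeff_powDiff _ _

/-! ### Adding a variable point -/

theorem shuffleFactor_swap (i j : ℕ) (u v : B) :
    shuffleFactor q M i j u v * (u - algebraMap ℂ B (q ^ (-cartan M i j)) * v) =
      nodeSign M i j • ((algebraMap ℂ B (q ^ (-cartan M i j)) * u - v) *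
        shuffleFactor q M j i v u) := by
  unfold shuffleFactor
  have hz : (1 : ZMod 2).val = 1 := rfl
  rw [cartan_comm M j]
  have hM : i = j → j = M → cartan M i j = 0 := fun h1 h2 => by rw [h1, h2, cartan_self_odd]
  by_cases hs : i = M ∧ j = M
  · have h0 := hM (hs.1.trans hs.2.symm) hs.2
    have hn : nodeSign M i j = -1 := by simp [nodeSign, nodePar, hs.1, hs.2, hz]
    rw [h0, hn]
    simp only [hs.1, hs.2, neg_zero, zpow_zero, map_one, le_refl, if_true, ne_eq, not_true,
      and_false, if_false, neg_smul, one_smul]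
    ring
  · have hn : nodeSign M i j = 1 := by
      by_cases h : i = M
      · have : j ≠ M := fun h' => hs ⟨h, h'⟩
        simp [nodeSign, nodePar, this]
      · simp [nodeSign, nodePar, h]
    rw [hn, one_smul]
    generalize algebraMap ℂ B (q ^ (-cartan M i j)) = Q
    rcases lt_trichotomy i j with h1 | h1 | h1
    · have h2 : ¬ (j ≤ i) := not_le.2 h1
      simp only [h1.le, h2, h1.ne, h1.ne', if_true, if_false, false_and]
      ring
    · have h3 : j ≠ M := fun h => hs ⟨h1.trans h, h⟩
      simp only [h1, h3, le_refl, if_true, ne_eq, not_false_eq_true, and_true]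
      ring
    · have h2 : ¬ (i ≤ j) := not_le.2 h1
      simp only [h1.le, h2, h1.ne, h1.ne', if_true, if_false, false_and]
      ring

/-- The algebra structure on Laurent series given by the constants. -/
instance laurentAlgebra {R C : Type*} [CommSemiring R] [CommRing C] [Algebra R C] :
    Algebra R (HahnSeries ℤ C) := HahnSeries.instAlgebra

/-- The unit `X^k` of the ring of Laurent series. -/
def laurentX : Multiplicative ℤ →* (LaurentSeries B)ˣ :=
  MonoidHom.toHomUnits
    { toFun := fun k => HahnSeries.single k.toAdd 1
      map_one' := rfl
      map_mul' := fun a b => by simp }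

theorem laurentX_zpow (k n : ℤ) : ((laurentX (B := B) (.ofAdd k) ^ n : (LaurentSeries B)ˣ) :
    LaurentSeries B) = HahnSeries.single (n * k) 1 := by
  rw [← map_zpow, ← ofAdd_zsmul]
  rfl

theorem isUnit_C_mul_sub_X {R : Type*} [CommRing R] (u : Rˣ) (ε : ℤˣ) :
    IsUnit (HahnSeries.C (u : R) - HahnSeries.single (-(ε : ℤ)) 1 : LaurentSeries R) := by
  have key : ∀ v : R, IsUnit (1 - HahnSeries.C v * HahnSeries.single 1 1 : LaurentSeries R) := by
    intro v
    have h : IsUnit (1 - PowerSeries.C v * PowerSeries.X : PowerSeries R) := by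
      rw [PowerSeries.isUnit_iff_constantCoeff]; simp
    have := h.map (HahnSeries.ofPowerSeries ℤ R)
    simpa using this
  have hs : ∀ k : ℤ, IsUnit (HahnSeries.single k (1 : R) : LaurentSeries R) := fun k =>
    ⟨laurentX (.ofAdd k), by simp [laurentX]⟩
  rcases Int.units_eq_one_or ε with rfl | rfl
  · have : (HahnSeries.C (u : R) - HahnSeries.single (-((1 : ℤˣ) : ℤ)) 1 : LaurentSeries R) =
        -(HahnSeries.single (-1) 1 * (1 - HahnSeries.C (u : R) * HahnSeries.single 1 1)) := by
      have h1 : (HahnSeries.single (-1) (1 : R) : LaurentSeries R) * HahnSeries.single 1 1 = 1 := by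
        rw [HahnSeries.single_mul_single]; simp
      rw [Units.val_one]
      linear_combination (-HahnSeries.C (u : R) : LaurentSeries R) * h1
    rw [this]
    exact ((hs _).mul (key _)).neg
  · have : (HahnSeries.C (u : R) - HahnSeries.single (-((-1 : ℤˣ) : ℤ)) 1 : LaurentSeries R) =
        HahnSeries.C (u : R) * (1 - HahnSeries.C ((u⁻¹ : Rˣ) : R) * HahnSeries.single 1 1) := by
      have h1 : (HahnSeries.C (u : R) : LaurentSeries R) * HahnSeries.C ((u⁻¹ : Rˣ) : R) = 1 := by
        rw [← map_mul, Units.mul_inv, map_one]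
      rw [Units.val_neg, Units.val_one, neg_neg]
      linear_combination (HahnSeries.single 1 1 : LaurentSeries R) * h1
    rw [this]
    exact (u.isUnit.map _).mul (key _)

/-- The image of a unit in the ring of Laurent series. -/
abbrev laurentC : Bˣ →* (LaurentSeries B)ˣ := Units.map (HahnSeries.C : B →+* LaurentSeries B)

theorem isUnit_shuffleFactor_X (hq0 : q ≠ 0) (i j : ℕ) (u : Bˣ) (ε : ℤˣ) :
    IsUnit (shuffleFactor q M i j (laurentC u : LaurentSeries B)
      (laurentX (B := B) (.ofAdd (-(ε : ℤ)))).val) := by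
  have h1 : ∀ v : Bˣ, IsUnit (HahnSeries.C (v : B) -
      (laurentX (B := B) (.ofAdd (-(ε : ℤ)))).val) := fun v => isUnit_C_mul_sub_X v ε
  have hQ : IsUnit (algebraMap ℂ B (q ^ (-cartan M i j))) :=
    (IsUnit.mk0 _ (zpow_ne_zero _ hq0)).map _
  have h2 : (algebraMap ℂ (LaurentSeries B) (q ^ (-cartan M i j)) * (laurentC u : LaurentSeries B))
      = HahnSeries.C ((hQ.unit * u : Bˣ) : B) := by
    rw [Units.val_mul, map_mul, HahnSeries.algebraMap_apply]; rfl
  unfold shuffleFactor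
  refine (IsUnit.mul ?_ ?_).mul ?_
  · split_ifs
    · exact isUnit_one
    · exact isUnit_one.neg
  · rw [h2]; exact h1 _
  · split_ifs
    · exact h1 u
    · exact isUnit_one

theorem ptSeries_mul (hq0 : q ≠ 0) (i j : ℕ) (ε : ℤˣ) (u : Bˣ) :
    HahnSeries.ofPowerSeries ℤ B (ptSeries q (M := M) i j ε u) *
      ((laurentX (B := B) (.ofAdd (-(ε : ℤ)))).val -
        algebraMap ℂ _ (q ^ (-cartan M i j)) * (laurentC u : LaurentSeries B)) =
      algebraMap ℂ _ (q ^ (-cartan M i j)) * (laurentX (B := B) (.ofAdd (-(ε : ℤ)))).val -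
        (laurentC u : LaurentSeries B) := by
  set E := HahnSeries.ofPowerSeries ℤ B (expSeries (powDiff
    (algebraMap ℂ B (q ^ (-(ε : ℤ) * cartan M i j)) * ((u ^ (ε : ℤ) : Bˣ) : B))
    (algebraMap ℂ B (q ^ ((ε : ℤ) * cartan M i j)) * ((u ^ (ε : ℤ) : Bˣ) : B)))) with hE
  have h := congrArg (HahnSeries.ofPowerSeries ℤ B) (expSeries_powDiff
    (algebraMap ℂ B (q ^ (-(ε : ℤ) * cartan M i j)) * ((u ^ (ε : ℤ) : Bˣ) : B))
    (algebraMap ℂ B (q ^ ((ε : ℤ) * cartan M i j)) * ((u ^ (ε : ℤ) : Bˣ) : B)))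
  rw [map_mul, ← hE] at h
  simp only [map_mul, map_sub, map_one, HahnSeries.ofPowerSeries_C, HahnSeries.ofPowerSeries_X] at h
  rw [ptSeries, map_mul, ← hE, HahnSeries.ofPowerSeries_C]
  have hC : ∀ r : ℂ, algebraMap ℂ (LaurentSeries B) r = HahnSeries.C (algebraMap ℂ B r) :=
    fun _ => HahnSeries.algebraMap_apply
  rw [hC]
  have hQ : (HahnSeries.C (algebraMap ℂ B (q ^ (-cartan M i j))) : LaurentSeries B) *
      HahnSeries.C (algebraMap ℂ B (q ^ (cartan M i j))) = 1 := by
    rw [← map_mul, ← map_mul, ← zpow_add₀ hq0, neg_add_cancel, zpow_zero, map_one, map_one]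
  have ht : (HahnSeries.single 1 (1 : B) : LaurentSeries B) * HahnSeries.single (-1) 1 = 1 := by
    rw [HahnSeries.single_mul_single]; simp
  have hu : (HahnSeries.C (u : B) : LaurentSeries B) * HahnSeries.C ((u⁻¹ : Bˣ) : B) = 1 := by
    rw [← map_mul, Units.mul_inv, map_one]
  clear_value E
  rcases Int.units_eq_one_or ε with rfl | rfl
  · have e : (laurentX (B := B) (.ofAdd (-((1 : ℤˣ) : ℤ)))).val = HahnSeries.single (-1) 1 := rfl
    rw [e]
    simp only [Units.val_one, one_mul, zpow_one, neg_mul] at h ⊢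
    change _ * (_ - _ * HahnSeries.C (u : B)) = _ - HahnSeries.C (u : B)
    generalize (HahnSeries.C (u : B) : LaurentSeries B) = Cu at *
    generalize (HahnSeries.C (algebraMap ℂ B (q ^ (-cartan M i j))) : LaurentSeries B) = Q at *
    generalize (HahnSeries.C (algebraMap ℂ B (q ^ (cartan M i j))) : LaurentSeries B) = Q' at *
    generalize (HahnSeries.single 1 (1 : B) : LaurentSeries B) = t at *
    generalize (HahnSeries.single (-1) (1 : B) : LaurentSeries B) = t' at *
    linear_combination Q * t' * h + (Q * E * Q * Cu - Cu * Q * Q') * ht - Cu * hQ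
  · have e : (laurentX (B := B) (.ofAdd (-((-1 : ℤˣ) : ℤ)))).val = HahnSeries.single 1 1 := rfl
    rw [e]
    simp only [Units.val_one, Units.val_neg, one_mul, zpow_neg, zpow_one, neg_mul, neg_neg] at h ⊢
    change _ * (_ - _ * HahnSeries.C (u : B)) = _ - HahnSeries.C (u : B)
    simp only [← zpow_neg] at h ⊢
    generalize (HahnSeries.C (u : B) : LaurentSeries B) = Cu at *
    generalize (HahnSeries.C ((u⁻¹ : Bˣ) : B) : LaurentSeries B) = Cu' at *
    generalize (HahnSeries.C (algebraMap ℂ B (q ^ (-cartan M i j))) : LaurentSeries B) = Q at *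
    generalize (HahnSeries.C (algebraMap ℂ B (q ^ (cartan M i j))) : LaurentSeries B) = Q' at *
    generalize (HahnSeries.single 1 (1 : B) : LaurentSeries B) = t at *
    linear_combination (-Cu) * h + (Q * t - Q' * E * t) * hu - E * Cu * hQ

theorem shuffle_map {ι' L : Type*} [Fintype ι'] [DecidableEq ι'] [CommRing L] [Algebra ℂ L]
    [Algebra A L] [IsScalarTower ℂ A L] (f : ι ↪ ι') (g : B →ₐ[A] L) (col' : ι' → ℕ)
    (z' : ι' → Lˣ) (hcol : ∀ a, col' (f a) = col a) (hz : ∀ a, z' (f a) = Units.map g (z a))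
    (y : FreeVerma M N A) (S : Finset ι) :
    shuffle q col' z' y (S.map f) = g (shuffle q col z y S) := by
  suffices h : ∀ w S, shuffle q col' z' (word w : FreeVerma M N A) (S.map f) =
      g (shuffle q col z (word w : FreeVerma M N A) S) by
    have : LinearMap.proj (S.map f) ∘ₗ shuffle q col' z' =
        g.toLinearMap ∘ₗ LinearMap.proj S ∘ₗ shuffle (A := A) q col z :=
      end_ext_word fun w => h w S
    exact LinearMap.congr_fun this y
  intro w
  induction w with
  | nil =>
    intro S
    rw [shuffle_nil, shuffle_nil, Pi.single_apply, Pi.single_apply]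
    simp only [Finset.map_eq_empty]
    split_ifs <;> simp
  | cons x w ih =>
    intro S
    rw [← consOp_word, shuffle_consOp, shuffle_consOp, lowPt_apply, lowPt_apply, Finset.sum_map,
      map_sum]
    refine Finset.sum_congr rfl fun a ha => ?_
    rw [hcol]
    split_ifs with h
    · rw [← Finset.map_erase, ih, Finset.prod_map, map_mul, map_mul, map_prod, hz, ← map_zpow]
      congr 2
      refine Finset.prod_congr rfl fun c hc => ?_
      have hQ : ∀ r : ℂ, algebraMap ℂ L r = g (algebraMap ℂ B r) := fun r => by
        rw [IsScalarTower.algebraMap_apply ℂ A B, g.commutes, ← IsScalarTower.algebraMap_apply]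
      simp only [ptFactor, shuffleFactor, hcol, hz, hQ, Units.coe_map, MonoidHom.coe_coe]
      split_ifs <;> simp
    · rw [map_zero]

/-- The points of a system with an additional variable point. -/
def addPoint (ε : ℤˣ) : Option ι → (LaurentSeries B)ˣ
  | none => laurentX (.ofAdd (-(ε : ℤ)))
  | some a => laurentC (z a)

/-- The colours of a system with an additional point. -/
def addColor (i : ℕ) : Option ι → ℕ
  | none => i
  | some a => col a

/-- The inclusion of the constants in the ring of Laurent series. -/
def laurentConst (A : Type*) [CommRing A] [Algebra A B] : B →ₐ[A] LaurentSeries B :=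
  { (HahnSeries.C : B →+* LaurentSeries B) with
    commutes' := fun _ => HahnSeries.algebraMap_apply.symm }

theorem shuffle_addPoint (ε : ℤˣ) (i : ℕ) (y : FreeVerma M N A) (S : Finset ι) :
    shuffle q (addColor col i) (addPoint z ε) y (S.map Function.Embedding.some) =
      HahnSeries.C (shuffle q col z y S) :=
  shuffle_map q col z Function.Embedding.some (laurentConst A) _ _ (fun _ => rfl) (fun _ => rfl) y S

theorem exists_shuffle_raiseHalf (hq0 : q ≠ 0) (hq2 : q - q⁻¹ ≠ 0) (ε : ℤˣ) (i : Node M N) :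
    ∃ G : Finset ι → LaurentSeries B, ∀ m S, ∀ y : FreeVerma M N A,
      shuffle q col z (raiseHalf q ϖ ε i m y) S =
        (G S * shuffle q (addColor col i) (addPoint z ε) y
          (insert none (S.map Function.Embedding.some))).coeff ((ε : ℤ) * m) := by
  set X : LaurentSeries B := (laurentX (B := B) (.ofAdd (-(ε : ℤ)))).val with hX
  have hinv : ∀ b : ι, ∃ V : LaurentSeries B,
      shuffleFactor q M (col b) i (laurentC (z b) : LaurentSeries B) X * V =
        algebraMap ℂ _ (nodeSign M i (col b)) := by
    intro b
    obtain ⟨V, hV⟩ := (isUnit_shuffleFactor_X q (M := M) hq0 (col b) i (z b) ε).exists_right_inv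
    exact ⟨algebraMap ℂ _ (nodeSign M i (col b)) * V, by rw [mul_left_comm, hV, mul_one]⟩
  choose V hV using hinv
  have hV' : ∀ b, shuffleFactor q M i (col b) X (laurentC (z b) : LaurentSeries B) * V b =
      HahnSeries.ofPowerSeries ℤ B (ptSeries q (M := M) i (col b) ε (z b)) := by
    intro b
    have hu : IsUnit (X - algebraMap ℂ _ (q ^ (-cartan M i (col b))) *
        (laurentC (z b) : LaurentSeries B)) := by
      have hQ : IsUnit (algebraMap ℂ B (q ^ (-cartan M i (col b)))) :=
        (IsUnit.mk0 _ (zpow_ne_zero _ hq0)).map _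
      have := (isUnit_C_mul_sub_X (hQ.unit * z b) ε).neg
      rw [neg_sub, Units.val_mul, map_mul] at this
      rw [HahnSeries.algebraMap_apply]
      exact this
    apply hu.mul_right_cancel
    rw [hX, ptSeries_mul q hq0, ← hX, mul_right_comm, shuffleFactor_swap, Algebra.smul_def,
      mul_assoc, mul_assoc, hV, mul_left_comm, ← map_mul]
    have : nodeSign M i (col b) * nodeSign M i (col b) = 1 := by
      rw [nodeSign, ← mul_pow]; simp
    rw [this, map_one, mul_one]
  refine ⟨fun S => HahnSeries.ofPowerSeries ℤ B (phiValue q ϖ col z ε i ∅) * ∏ b ∈ S, V b, ?_⟩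
  intro m S y
  suffices h : ∀ w S, shuffle q col z (raiseHalf q ϖ ε i m (word w)) S =
      (HahnSeries.ofPowerSeries ℤ B (phiValue q ϖ col z ε i ∅) * (∏ b ∈ S, V b) *
        shuffle q (addColor col i) (addPoint z ε) (word w : FreeVerma M N A)
          (insert none (S.map Function.Embedding.some))).coeff ((ε : ℤ) * m) by
    let e : LaurentSeries B →ₗ[A] B :=
      { toFun := fun x => (HahnSeries.ofPowerSeries ℤ B (phiValue q ϖ col z ε i ∅) *
          (∏ b ∈ S, V b) * x).coeff ((ε : ℤ) * m)
        map_add' := fun x y => by rw [mul_add]; rfl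
        map_smul' := fun r x => by rw [mul_smul_comm]; rfl }
    have : LinearMap.proj S ∘ₗ shuffle q col z ∘ₗ raiseHalf q ϖ ε i m =
        e ∘ₗ LinearMap.proj (insert none (S.map Function.Embedding.some)) ∘ₗ
          shuffle (A := A) q (addColor col i) (addPoint z ε) :=
      end_ext_word fun w => h w S
    exact LinearMap.congr_fun this y
  intro w
  induction w with
  | nil =>
    intro S
    rw [raiseHalf_nil, map_zero, shuffle_nil, Pi.single_apply, if_neg (by simp), mul_zero]
    rfl
  | cons x w ih =>
    intro S
    have hnone : none ∉ S.map Function.Embedding.some := by simp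
    rw [← consOp_word, raiseHalf_consOp, shuffle_consOp, lowPt_apply, Finset.sum_insert hnone,
      Finset.erase_insert hnone, shuffle_addPoint, map_add, LinearMap.map_smul_of_tower,
      shuffle_consOp, Pi.add_apply, Pi.smul_apply, lowPt_apply, mul_add, add_comm,
      HahnSeries.coeff_add, Finset.sum_map]
    congr 1
    · by_cases hx : x.1 = i
      · have hx' : addColor col (i : ℕ) none = x.1 := by rw [hx]; rfl
        rw [if_pos hx, if_pos hx', shuffle_phiOp q ϖ col z hq0, phiValue_eq q ϖ col z hq2,
          Finset.prod_map]
        have e1 : ((addPoint z ε none ^ x.2 : (LaurentSeries B)ˣ) : LaurentSeries B) =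
          HahnSeries.single (x.2 * -(ε : ℤ)) 1 := laurentX_zpow _ _
        have e2 : (∏ b ∈ S, V b) * ∏ b ∈ S, ptFactor q M (addColor col i) (addPoint z ε) none
            (Function.Embedding.some b) = ∏ b ∈ S, HahnSeries.ofPowerSeries ℤ B
              (ptSeries q (M := M) i (col b) ε (z b)) := by
          rw [← Finset.prod_mul_distrib]
          refine Finset.prod_congr rfl fun b _ => ?_
          rw [← hV', mul_comm]
          rfl
        have e3 : (ε : ℤ) * m = (ε : ℤ) * (m + x.2) + x.2 * -(ε : ℤ) := by ring
        have e4 : ∀ Φ v s f : LaurentSeries B, Φ * v * (s * f) = f * (Φ * (v * s)) := by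
          intros; ring
        rw [e1, mul_left_comm, e3, HahnSeries.coeff_single_mul_add, one_mul, map_mul, map_prod, ← e2,
          e4, HahnSeries.C_mul_eq_smul, HahnSeries.coeff_smul, smul_eq_mul, mul_comm]
      · have hx' : addColor col (i : ℕ) none ≠ x.1 := fun h => hx (Subtype.ext h.symm)
        rw [if_neg hx, if_neg hx', mul_zero, map_zero]
        rfl
    · rw [Finset.mul_sum, HahnSeries.coeff_sum, Finset.smul_sum]
      refine Finset.sum_congr rfl fun b hb => ?_
      change _ • (if col b = x.1 then _ else _) =
        HahnSeries.coeff (_ * if col b = x.1 then _ else _) _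
      by_cases hx : col b = x.1
      · have hT : (insert none (S.map Function.Embedding.some)).erase (Function.Embedding.some b) =
            insert none ((S.erase b).map Function.Embedding.some) := by
          rw [Finset.erase_insert_of_ne (by simp), Finset.map_erase]
        have hnone' : none ∉ (S.erase b).map Function.Embedding.some := by simp
        rw [if_pos hx, if_pos hx, hT, Finset.prod_insert hnone', Finset.prod_map,
          ← Finset.mul_prod_erase S V hb, ih]
        have e1 : ((addPoint z ε (Function.Embedding.some b) ^ x.2 : (LaurentSeries B)ˣ) :
            LaurentSeries B) = HahnSeries.C ((z b ^ x.2 : Bˣ) : B) := by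
          change ((laurentC (z b) ^ x.2 : (LaurentSeries B)ˣ) : LaurentSeries B) = _
          rw [← map_zpow]
          rfl
        have e2 : ∏ c ∈ S.erase b, ptFactor q M (addColor col i) (addPoint z ε)
            (Function.Embedding.some b) (Function.Embedding.some c) =
            HahnSeries.C (∏ c ∈ S.erase b, ptFactor q M col z b c) := by
          rw [map_prod]
          refine Finset.prod_congr rfl fun c _ => ?_
          simp only [ptFactor, shuffleFactor, addColor, addPoint, Function.Embedding.some_apply,
            HahnSeries.algebraMap_apply, Units.coe_map, MonoidHom.coe_coe]
          split_ifs <;> simp only [map_mul, map_sub, map_neg, map_one]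
        have e3 : ptFactor q M (addColor col i) (addPoint z ε) (Function.Embedding.some b) none *
            V b = algebraMap ℂ _ (nodeSign M i x.1) := by
          rw [← hx]; exact hV b
        rw [e1, e2]
        set F := shuffle q (addColor col i) (addPoint z ε) (word w : FreeVerma M N A)
          (insert none ((S.erase b).map Function.Embedding.some))
        set f := ptFactor q M (addColor col i) (addPoint z ε) (Function.Embedding.some b) none
        set Φ := HahnSeries.ofPowerSeries ℤ B (phiValue q ϖ col z ε i ∅)
        set W := ∏ c ∈ S.erase b, V c
        have e4 : Φ * (V b * W) * (HahnSeries.C ((z b ^ x.2 : Bˣ) : B) *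
            (f * HahnSeries.C (∏ c ∈ S.erase b, ptFactor q M col z b c) * F)) =
            HahnSeries.C (((z b ^ x.2 : Bˣ) : B) * (∏ c ∈ S.erase b, ptFactor q M col z b c) *
              algebraMap ℂ B (nodeSign M i x.1)) * (Φ * W * F) := by
          rw [map_mul, map_mul, ← HahnSeries.algebraMap_apply (R := ℂ), ← e3]
          ring
        rw [e4, HahnSeries.C_mul_eq_smul, HahnSeries.coeff_smul, smul_eq_mul, Algebra.smul_def]
        ring
      · rw [if_neg hx, if_neg hx, mul_zero, smul_zero]
        rfl

end ShuffleRealization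

section ShuffleKer

universe u

variable (q : ℂ) {M N : ℕ} {A : Type u} [CommRing A] [Algebra ℂ A] (ϖ : CartanWeight M N A)

variable (M N A) in
/-- The common kernel of the shuffle realizations. -/
def shuffleKer : Submodule A (FreeVerma M N A) where
  carrier := {y | ∀ (ι : Type) (_ : Fintype ι) (_ : DecidableEq ι) (B : Type u) (_ : CommRing B)
    (_ : Algebra ℂ B) (_ : Algebra A B) (_ : IsScalarTower ℂ A B) (col : ι → ℕ) (z : ι → Bˣ),
    shuffle q col z y = 0}
  add_mem' hx hy ι _ _ B _ _ _ _ col z := by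
    rw [map_add, hx ι _ _ B _ _ _ ‹_›, hy ι _ _ B _ _ _ ‹_›, add_zero]
  zero_mem' ι _ _ B _ _ _ _ col z := map_zero _
  smul_mem' r x hx ι _ _ B _ _ _ _ col z := by
    rw [map_smul, hx ι _ _ B _ _ _ ‹_›, smul_zero]

variable {q}

theorem shuffleKer_raiseOp (hq0 : q ≠ 0) (hq2 : q - q⁻¹ ≠ 0) (i : Node M N) (m : ℤ)
    {y : FreeVerma M N A} (hy : y ∈ shuffleKer q M N A) :
    raiseOp q ϖ i m y ∈ shuffleKer q M N A := by
  have key : ∀ ε, raiseHalf q ϖ ε i m y ∈ shuffleKer q M N A := by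
    intro ε ι _ _ B _ _ _ _ col z
    funext S
    obtain ⟨G, hG⟩ := exists_shuffle_raiseHalf q ϖ col z hq0 hq2 ε i
    rw [hG, hy _ _ _ (LaurentSeries B) _ _ _ inferInstance, Pi.zero_apply, mul_zero]
    rfl
  rw [raiseOp, LinearMap.smul_apply, LinearMap.sub_apply, ← algebraMap_smul A]
  exact Submodule.smul_mem _ _ (Submodule.sub_mem _ (key 1) (key (-1)))

theorem shuffleKer_apply_nil {y : FreeVerma M N A} (hy : y ∈ shuffleKer q M N A) : y [] = 0 := by
  have h := congrFun (hy Empty inferInstance inferInstance A inferInstance inferInstance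
    inferInstance inferInstance (fun _ => 0) (fun _ => 1)) ∅
  rw [shuffle_apply_empty] at h
  exact h

theorem pairing_shuffleKer (hq0 : q ≠ 0) (hq2 : q - q⁻¹ ≠ 0) {y : FreeVerma M N A}
    (hy : y ∈ shuffleKer q M N A) (w : FreeVerma M N A) : pairing q ϖ w y = 0 := by
  suffices h : ∀ w, ∀ y ∈ shuffleKer q M N A, pairing q ϖ (word w) y = 0 by
    have : (pairing q ϖ).flip y = 0 := end_ext_word fun w => h w y hy
    exact LinearMap.congr_fun this w
  intro w
  induction w with
  | nil =>
    intro y hy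
    rw [pairing_nil, shuffleKer_apply_nil hy]
  | cons x w ih =>
    intro y hy
    rw [← consOp_word, pairing_consOp]
    exact ih _ (shuffleKer_raiseOp ϖ hq0 hq2 _ _ hy)

end ShuffleKer

end QAffine

end

noncomputable section
set_option linter.unusedSectionVars false
namespace QAffine

/-! ## The simple quotient of the free highest weight module -/

theorem sbr_mem {E : Type*} [Ring E] [Algebra ℂ E] (S : Subalgebra ℂ E) (p p' : ZMod 2) (u : ℂ)
    {a b : E} (ha : a ∈ S) (hb : b ∈ S) : sbr p p' u a b ∈ S :=
  S.sub_mem (S.mul_mem ha hb) (S.smul_mem (S.mul_mem hb ha) _)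

theorem map_sbr {E E' : Type*} [Ring E] [Algebra ℂ E] [Ring E'] [Algebra ℂ E'] (f : E →ₐ[ℂ] E')
    (p p' : ZMod 2) (u : ℂ) (a b : E) : f (sbr p p' u a b) = sbr p p' u (f a) (f b) := by
  simp only [sbr, map_sub, map_smul, map_mul]

theorem sbr_serre {E : Type*} [Ring E] [Algebra ℂ E] {q : ℂ} (hq0 : q ≠ 0) (p : ZMod 2)
    (x y w : E) : sbr 0 p q x (sbr 0 p q⁻¹ y w) + sbr 0 p q y (sbr 0 p q⁻¹ x w) =
      x * (y * w) - (q + q⁻¹) • (x * (w * y)) + w * (x * y) +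
    (y * (x * w) - (q + q⁻¹) • (y * (w * x)) + w * (y * x)) := by
  have hv : (0 : ZMod 2).val = 0 := rfl
  simp only [sbr, hv, zero_mul, pow_zero, one_mul, mul_sub, sub_mul, mul_smul_comm,
    smul_mul_assoc, smul_sub, smul_smul, mul_inv_cancel₀ hq0, mul_assoc]
  module

section Radical

universe u

variable (q : ℂ) {M N : ℕ} {A : Type u} [CommRing A] [Algebra ℂ A] (ϖ : CartanWeight M N A)

/-- The operators attached to the generators. -/
def genOp : Gen M N → Module.End A (FreeVerma M N A)
  | .X ε i n => if ε = 1 then raiseOp q ϖ i n else consOp (i, n)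
  | .K ε i => kOp q ϖ ε i
  | .H i s _ => hOp q ϖ i s

/-- The action of the free algebra on the free highest weight module. -/
def freeRep : FreeU M N →ₐ[ℂ] Module.End A (FreeVerma M N A) := FreeAlgebra.lift ℂ (genOp q ϖ)

theorem freeRep_X_one (i : Node M N) (n : ℤ) : freeRep q ϖ (fX 1 i n) = raiseOp q ϖ i n := by
  simp [freeRep, fX, genOp]

theorem freeRep_X_neg (i : Node M N) (n : ℤ) : freeRep q ϖ (fX (-1) i n) = consOp (i, n) := by
  have : ¬ (-1 : ℤˣ) = 1 := by decide
  simp [freeRep, fX, genOp, this]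

theorem freeRep_K (ε : ℤˣ) (i : Node M N) : freeRep q ϖ (fK ε i) = kOp q ϖ ε i := by
  simp [freeRep, fK, genOp]

theorem freeRep_H (i : Node M N) (s : ℤ) (hs : s ≠ 0) :
    freeRep q ϖ (fH i s hs) = hOp q ϖ i s := by
  simp [freeRep, fH, genOp]

theorem freeRep_phi (ε : ℤˣ) (i : Node M N) (n : ℤ) :
    freeRep q ϖ (fphi q ε i n) = phiOp q ϖ ε i n := by
  rw [fphi, phiOp]
  split_ifs
  · rw [map_mul, freeRep_K]
    refine congrArg _ ((map_expCoeff (B := Module.End A (FreeVerma M N A)) (freeRep q ϖ)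
      _ _).trans ?_)
    congr 1
    ext s
    rw [PowerSeries.coeff_map, hSeries, hOpSeries, PowerSeries.coeff_mk, PowerSeries.coeff_mk]
    split_ifs with h
    · simp
    · simp [freeRep_H]
  · exact map_zero _

/-- The flip of the generators that exchanges raising and lowering. -/
def Gen.flip : Gen M N → Gen M N
  | .X ε i n => .X (-ε) i n
  | .K ε i => .K ε i
  | .H i s hs => .H i s hs

variable (M N) in
/-- The antiautomorphism of the free algebra that exchanges raising and lowering. -/
def freeFlip : FreeU M N →ₐ[ℂ] (FreeU M N)ᵐᵒᵖ :=
  FreeAlgebra.lift ℂ fun g => MulOpposite.op (FreeAlgebra.ι ℂ g.flip)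

theorem freeFlip_X (ε : ℤˣ) (i : Node M N) (n : ℤ) :
    freeFlip M N (fX ε i n) = MulOpposite.op (fX (-ε) i n) := by
  simp [freeFlip, fX, Gen.flip]

theorem pairing_freeRep (hq0 : q ≠ 0) (a : FreeU M N) (w y : FreeVerma M N A) :
    pairing q ϖ w (freeRep q ϖ a y) = pairing q ϖ (freeRep q ϖ (freeFlip M N a).unop w) y := by
  induction a using FreeAlgebra.induction generalizing w y with
  | grade0 r => simp [Algebra.algebraMap_eq_smul_one, LinearMap.map_smul_of_tower]
  | grade1 g =>
    have h1 : freeRep q ϖ (FreeAlgebra.ι ℂ g) = genOp q ϖ g := by simp [freeRep]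
    have h2 : freeRep q ϖ (freeFlip M N (FreeAlgebra.ι ℂ g)).unop = genOp q ϖ g.flip := by
      simp [freeRep, freeFlip]
    rw [h1, h2]
    cases g with
    | X ε i n =>
      have hn : ¬ (-1 : ℤˣ) = 1 := by decide
      rcases Int.units_eq_one_or ε with rfl | rfl
      · simp only [genOp, Gen.flip, if_true, if_neg hn, pairing_consOp]
      · simp only [genOp, Gen.flip, neg_neg, if_true, if_neg hn, pairing_raiseOp q ϖ hq0]
    | K ε i => exact (pairing_kOp q ϖ hq0 ε i w y).symm
    | H i s hs => exact (pairing_hOp q ϖ hq0 i s w y).symm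
  | mul a b ha hb =>
    rw [map_mul, Module.End.mul_apply, ha, hb, map_mul, MulOpposite.unop_mul, map_mul,
      Module.End.mul_apply]
  | add a b ha hb =>
    rw [map_add, LinearMap.add_apply, map_add, ha, hb, map_add, MulOpposite.unop_add, map_add,
      LinearMap.add_apply, map_add, LinearMap.add_apply]

theorem pairing_comm (hq0 : q ≠ 0) (w y : FreeVerma M N A) :
    pairing q ϖ w y = pairing q ϖ y w := by
  suffices h : ∀ w y, pairing q ϖ (word w) y = pairing q ϖ y (word w) by
    have : pairing q ϖ = (pairing q ϖ).flip :=
      end_ext_word fun w => LinearMap.ext fun y => h w y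
    exact LinearMap.congr_fun (LinearMap.congr_fun this w) y
  intro w
  induction w with
  | nil =>
    intro y
    rw [pairing_nil]
    have : (Finsupp.lapply [] : FreeVerma M N A →ₗ[A] A) = (pairing q ϖ).flip (word []) := by
      refine end_ext_word fun w => ?_
      cases w with
      | nil => simp [pairing_nil]
      | cons x w =>
        rw [LinearMap.flip_apply, ← consOp_word, pairing_consOp, raiseOp_nil, map_zero]
        exact consOp_apply_nil _ _
    exact LinearMap.congr_fun this y
  | cons x w ih =>
    intro y
    rw [← consOp_word, pairing_consOp, ih, pairing_raiseOp q ϖ hq0]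

/-- The radical of the contravariant form. -/
def radical : Submodule A (FreeVerma M N A) := LinearMap.ker (pairing q ϖ).flip

theorem mem_radical {y : FreeVerma M N A} : y ∈ radical q ϖ ↔ ∀ w, pairing q ϖ w y = 0 := by
  rw [radical, LinearMap.mem_ker]
  exact ⟨fun h w => LinearMap.congr_fun h w, fun h => LinearMap.ext h⟩

theorem freeRep_mem_radical (hq0 : q ≠ 0) (a : FreeU M N) {y : FreeVerma M N A}
    (hy : y ∈ radical q ϖ) : freeRep q ϖ a y ∈ radical q ϖ := by
  rw [mem_radical] at hy ⊢
  intro w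
  rw [pairing_freeRep q ϖ hq0, hy]

theorem shuffleKer_le_radical (hq0 : q ≠ 0) (hq2 : q - q⁻¹ ≠ 0) :
    shuffleKer q M N A ≤ radical q ϖ := fun y hy => by
  rw [mem_radical]
  exact pairing_shuffleKer ϖ hq0 hq2 hy

/-! ### The relations between the lowering operators -/

section LowFree

variable {ι B : Type*} [Fintype ι] [DecidableEq ι] [CommRing B] [Algebra ℂ B]
  [Algebra A B] [IsScalarTower ℂ A B] (col : ι → ℕ) (z : ι → Bˣ)

/-- The shuffle operators attached to the lowering generators. -/
def genLow : Gen M N → Module.End B (Finset ι → B)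
  | .X ε i n => if ε = 1 then 0 else lowPt q M col z i n
  | .K _ _ => 0
  | .H _ _ _ => 0

variable (M N) in
/-- The shuffle action of the free algebra. -/
def freeLow : FreeU M N →ₐ[ℂ] Module.End B (Finset ι → B) := FreeAlgebra.lift ℂ (genLow q col z)

theorem freeLow_X (i : Node M N) (n : ℤ) :
    freeLow q M N col z (fX (-1) i n) = lowPt q M col z i n := by
  have : ¬ (-1 : ℤˣ) = 1 := by decide
  simp [freeLow, fX, genLow, this]

/-- The elements whose action is intertwined by the shuffle realization. -/
def shuffleSub : Subalgebra ℂ (FreeU M N) where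
  carrier := {a | ∀ y : FreeVerma M N A, shuffle q col z (freeRep q ϖ a y) =
    freeLow q M N col z a (shuffle q col z y)}
  mul_mem' {a b} ha hb y := by
    rw [map_mul, map_mul, Module.End.mul_apply, Module.End.mul_apply, ha, hb]
  add_mem' {a b} ha hb y := by
    rw [map_add, map_add, LinearMap.add_apply, LinearMap.add_apply, map_add, ha, hb]
  algebraMap_mem' r y := by
    rw [AlgHom.commutes, AlgHom.commutes, Algebra.algebraMap_eq_smul_one,
      Algebra.algebraMap_eq_smul_one, LinearMap.smul_apply, LinearMap.smul_apply,
      LinearMap.map_smul_of_tower]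
    rfl

theorem X_mem_shuffleSub (i : Node M N) (n : ℤ) : fX (-1) i n ∈ shuffleSub q ϖ col z := by
  intro y
  rw [freeRep_X_neg, freeLow_X, shuffle_consOp]

end LowFree

variable (M N) in
/-- The relations of the lowering generators that hold in all shuffle realizations. -/
structure IsLowRel (a : FreeU M N) : Prop where
  mem : a ∈ Algebra.adjoin ℂ {x | ∃ (i : Node M N) (n : ℤ), x = fX (-1) i n}
  low : ∀ (ι : Type) (_ : Fintype ι) (_ : DecidableEq ι) (B : Type u) (_ : CommRing B)
    (_ : Algebra ℂ B) (col : ι → ℕ) (z : ι → Bˣ), freeLow q M N col z a = 0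

variable {q}

theorem IsLowRel.mem_shuffleKer {a : FreeU M N} (h : IsLowRel.{u} q M N a)
    (y : FreeVerma M N A) : freeRep q ϖ a y ∈ shuffleKer q M N A := by
  intro ι _ _ B _ _ _ _ col z
  have : a ∈ shuffleSub q ϖ col z := by
    refine (Algebra.adjoin_le ?_) h.mem
    rintro _ ⟨i, n, rfl⟩
    exact X_mem_shuffleSub q ϖ col z i n
  rw [this, h.low, LinearMap.zero_apply]

theorem IsLowRel.freeRep_mem (hq0 : q ≠ 0) (hq2 : q - q⁻¹ ≠ 0) {a : FreeU M N}
    (h : IsLowRel.{u} q M N a) (y : FreeVerma M N A) : freeRep q ϖ a y ∈ radical q ϖ :=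
  shuffleKer_le_radical q ϖ hq0 hq2 (h.mem_shuffleKer ϖ y)

theorem IsLowRel.freeRep_flip_mem (hq0 : q ≠ 0) (hq2 : q - q⁻¹ ≠ 0) {a : FreeU M N}
    (h : IsLowRel.{u} q M N (freeFlip M N a).unop) (y : FreeVerma M N A) :
    freeRep q ϖ a y ∈ radical q ϖ := by
  rw [mem_radical]
  intro w
  rw [pairing_freeRep q ϖ hq0, pairing_comm q ϖ hq0]
  exact pairing_shuffleKer ϖ hq0 hq2 (h.mem_shuffleKer ϖ w) y

theorem isLowRel_comm (i j : Node M N) (m n : ℤ) (h : cartan M i j = 0) :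
    IsLowRel.{u} q M N (sbr (nodePar M i) (nodePar M j) 1 (fX (-1) i m) (fX (-1) j n)) := by
  refine ⟨sbr_mem _ _ _ _ (Algebra.subset_adjoin ⟨_, _, rfl⟩) (Algebra.subset_adjoin ⟨_, _, rfl⟩),
    fun ι _ _ B _ _ col z => ?_⟩
  rw [map_sbr, freeLow_X, freeLow_X, lowPt_comm q M col z i j m n h]

theorem isLowRel_quadratic (i j : Node M N) (m n : ℤ) (h : cartan M i j ≠ 0) :
    IsLowRel.{u} q M N (fX (-1) i (m + 1) * fX (-1) j n -
          q ^ (-cartan M i j) • (fX (-1) j n * fX (-1) i (m + 1)) -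
        (q ^ (-cartan M i j) • (fX (-1) i m * fX (-1) j (n + 1)) -
          fX (-1) j (n + 1) * fX (-1) i m)) := by
  refine ⟨?_, fun ι _ _ B _ _ col z => ?_⟩
  · have hX : ∀ (i : Node M N) (n : ℤ), fX (-1) i n ∈
        Algebra.adjoin ℂ {x | ∃ (i : Node M N) (n : ℤ), x = fX (-1) i n} :=
      fun i n => Algebra.subset_adjoin ⟨_, _, rfl⟩
    exact sub_mem (sub_mem (mul_mem (hX _ _) (hX _ _))
      (Subalgebra.smul_mem _ (mul_mem (hX _ _) (hX _ _)) _))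
      (sub_mem (Subalgebra.smul_mem _ (mul_mem (hX _ _) (hX _ _)) _) (mul_mem (hX _ _) (hX _ _)))
  · simp only [map_sub, map_mul, map_smul, freeLow_X]
    rw [lowPt_quadratic q M col z i j m n h, sub_self]

theorem isLowRel_serre (hq0 : q ≠ 0) (i j : Node M N) (m n k : ℤ)
    (h : cartan M i j = 1 ∨ cartan M i j = -1) (hi : (i : ℕ) ≠ M) :
    IsLowRel.{u} q M N (sbr 0 (nodePar M j) q (fX (-1) i m)
        (sbr 0 (nodePar M j) q⁻¹ (fX (-1) i n) (fX (-1) j k)) +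
      sbr 0 (nodePar M j) q (fX (-1) i n)
        (sbr 0 (nodePar M j) q⁻¹ (fX (-1) i m) (fX (-1) j k))) := by
  have hX : ∀ (i : Node M N) (n : ℤ), fX (-1) i n ∈
      Algebra.adjoin ℂ {x | ∃ (i : Node M N) (n : ℤ), x = fX (-1) i n} :=
    fun i n => Algebra.subset_adjoin ⟨_, _, rfl⟩
  refine ⟨add_mem (sbr_mem _ _ _ _ (hX _ _) (sbr_mem _ _ _ _ (hX _ _) (hX _ _)))
    (sbr_mem _ _ _ _ (hX _ _) (sbr_mem _ _ _ _ (hX _ _) (hX _ _))),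
    fun ι _ _ B _ _ col z => ?_⟩
  simp only [map_add, map_sbr, freeLow_X]
  exact lowPt_serre q M col z hq0 i j m n k h hi

theorem isLowRel_oscillation (hq0 : q ≠ 0) (a b d : Node M N) (m n k u : ℤ)
    (ha : (a : ℕ) + 1 = M) (hb : (b : ℕ) = M) (hd : (d : ℕ) = M + 1) :
    IsLowRel.{u} q M N
      (oscWord q (fX (-1) a m) (fX (-1) b n) (fX (-1) d k) (fX (-1) b u) +
        oscWord q (fX (-1) a m) (fX (-1) b u) (fX (-1) d k) (fX (-1) b n)) := by
  have hX : ∀ (i : Node M N) (n : ℤ), fX (-1) i n ∈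
      Algebra.adjoin ℂ {x | ∃ (i : Node M N) (n : ℤ), x = fX (-1) i n} :=
    fun i n => Algebra.subset_adjoin ⟨_, _, rfl⟩
  refine ⟨?_, fun ι _ _ B _ _ col z => ?_⟩
  · rw [← sbr_oscillation hq0, ← sbr_oscillation hq0]
    exact add_mem (sbr_mem _ _ _ _ (sbr_mem _ _ _ _ (sbr_mem _ _ _ _ (hX _ _) (hX _ _)) (hX _ _))
      (hX _ _)) (sbr_mem _ _ _ _ (sbr_mem _ _ _ _ (sbr_mem _ _ _ _ (hX _ _) (hX _ _)) (hX _ _))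
      (hX _ _))
  · rw [← sbr_oscillation hq0, ← sbr_oscillation hq0]
    simp only [map_add, map_sbr, freeLow_X, hb]
    exact lowPt_oscillation q M col z hq0 a d m n k u ha hd

theorem oscWord_inv {E : Type*} [Ring E] [Algebra ℂ E] {a b d e : E} (had : a * d = d * a)
    (hbe : b * e + e * b = 0) :
    oscWord q⁻¹ a b d e + oscWord q⁻¹ a e d b = oscWord q a b d e + oscWord q a e d b := by
  have h2 : ∀ x : E, d * (a * x) = a * (d * x) := fun x => by
    rw [← mul_assoc d, ← had, mul_assoc]
  have h3 : e * b = -(b * e) := by rw [eq_neg_iff_add_eq_zero, add_comm]; exact hbe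
  have h4 : ∀ x, e * (b * x) = -(b * (e * x)) := fun x => by
    rw [← mul_assoc, h3, neg_mul, mul_assoc]
  simp only [oscWord, inv_inv, h4, h3, h2, mul_neg, smul_neg]
  module

theorem isLowRel_oscillation_inv (hq0 : q ≠ 0) (a b d : Node M N) (m n k u : ℤ)
    (ha : (a : ℕ) + 1 = M) (hb : (b : ℕ) = M) (hd : (d : ℕ) = M + 1) :
    IsLowRel.{u} q M N
      (oscWord q⁻¹ (fX (-1) a m) (fX (-1) b n) (fX (-1) d k) (fX (-1) b u) +
        oscWord q⁻¹ (fX (-1) a m) (fX (-1) b u) (fX (-1) d k) (fX (-1) b n)) := by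
  have hX : ∀ (i : Node M N) (n : ℤ), fX (-1) i n ∈
      Algebra.adjoin ℂ {x | ∃ (i : Node M N) (n : ℤ), x = fX (-1) i n} :=
    fun i n => Algebra.subset_adjoin ⟨_, _, rfl⟩
  refine ⟨?_, fun ι _ _ B _ _ col z => ?_⟩
  · have hq0' : q⁻¹ ≠ 0 := inv_ne_zero hq0
    rw [← sbr_oscillation hq0', ← sbr_oscillation hq0']
    exact add_mem (sbr_mem _ _ _ _ (sbr_mem _ _ _ _ (sbr_mem _ _ _ _ (hX _ _) (hX _ _)) (hX _ _))
      (hX _ _)) (sbr_mem _ _ _ _ (sbr_mem _ _ _ _ (sbr_mem _ _ _ _ (hX _ _) (hX _ _)) (hX _ _))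
      (hX _ _))
  · have h1 := (isLowRel_oscillation.{u} hq0 a b d m n k u ha hb hd).low ι ‹_› ‹_› B ‹_› ‹_› col z
    have hosc : ∀ (r : ℂ) (x y v w : FreeU M N), freeLow q M N col z (oscWord r x y v w) =
        oscWord r (freeLow q M N col z x) (freeLow q M N col z y) (freeLow q M N col z v)
          (freeLow q M N col z w) := by
      intros
      simp only [oscWord, map_add, map_sub, map_smul, map_mul]
    rw [map_add, hosc, hosc] at h1 ⊢
    simp only [freeLow_X, hb] at h1 ⊢
    rw [oscWord_inv, h1]
    · have hz : cartan M a d = 0 := cartan_far (by omega) (by omega) (by omega)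
      have := lowPt_comm q M col z a d m k hz
      have hp : nodePar M a = 0 := by rw [nodePar, if_neg (by omega)]
      rw [hp] at this
      have hv : (0 : ZMod 2).val = 0 := rfl
      rw [sbr, hv, zero_mul, pow_zero, one_mul, one_smul] at this
      exact sub_eq_zero.1 this
    · have := lowPt_comm q M col z M M n u (cartan_self_odd M)
      have hp : nodePar M M = 1 := by rw [nodePar, if_pos rfl]
      have hz : (1 : ZMod 2).val = 1 := rfl
      rw [hp, sbr, hz, mul_one, pow_one, neg_smul, one_smul, sub_neg_eq_add] at this
      exact this

/-- The quotient by the radical of the contravariant form. -/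
abbrev SimpleHW : Type u := FreeVerma M N A ⧸ radical q ϖ

/-- The action of the free algebra on the quotient by the radical. -/
def quotRep (hq0 : q ≠ 0) : FreeU M N →ₐ[ℂ] Module.End A (SimpleHW (q := q) ϖ) :=
  FreeAlgebra.lift ℂ fun g => (radical q ϖ).mapQ (radical q ϖ)
    (freeRep q ϖ (FreeAlgebra.ι ℂ g)) fun _ h => freeRep_mem_radical q ϖ hq0 _ h

theorem quotRep_mk (hq0 : q ≠ 0) (a : FreeU M N) (y : FreeVerma M N A) :
    quotRep ϖ hq0 a (Submodule.Quotient.mk y) = Submodule.Quotient.mk (freeRep q ϖ a y) := by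
  induction a using FreeAlgebra.induction generalizing y with
  | grade0 r =>
    rw [AlgHom.commutes, AlgHom.commutes, Algebra.algebraMap_eq_smul_one,
      Algebra.algebraMap_eq_smul_one]
    rfl
  | grade1 g =>
    rw [quotRep, FreeAlgebra.lift_ι_apply]
    rfl
  | mul a b ha hb =>
    rw [map_mul, Module.End.mul_apply, hb, ha, map_mul, Module.End.mul_apply]
  | add a b ha hb =>
    rw [map_add, LinearMap.add_apply, ha, hb, map_add, LinearMap.add_apply,
      Submodule.Quotient.mk_add]

theorem quotRep_rel (hq0 : q ≠ 0) (hq2 : q - q⁻¹ ≠ 0) {a b : FreeU M N} (h : Rel q M N a b) :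
    quotRep ϖ hq0 a = quotRep ϖ hq0 b := by
  suffices h' : ∀ y, freeRep q ϖ (a - b) y ∈ radical q ϖ by
    refine LinearMap.ext fun x => ?_
    induction x using Submodule.Quotient.induction_on with
    | H y =>
    rw [quotRep_mk, quotRep_mk, Submodule.Quotient.eq]
    have := h' y
    rwa [map_sub, LinearMap.sub_apply] at this
  have hfree : freeRep q ϖ a = freeRep q ϖ b → ∀ y, freeRep q ϖ (a - b) y ∈ radical q ϖ := by
    intro h y
    rw [map_sub, h, sub_self]
    exact Submodule.zero_mem _
  cases h with
  | K_inv ε i =>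
    apply hfree
    rw [map_mul, freeRep_K, freeRep_K, kOp_mul_kOp_neg q ϖ hq0, map_one]
  | K_K ε ε' i j =>
    apply hfree
    rw [map_mul, map_mul, freeRep_K, freeRep_K]
    exact kOp_comm_kOp q ϖ ε ε' i j
  | K_H ε i j s hs =>
    apply hfree
    rw [map_mul, map_mul, freeRep_K, freeRep_H]
    exact kOp_comm_hOp q ϖ hq0 ε i j s
  | H_H i j s t hs ht =>
    apply hfree
    rw [map_mul, map_mul, freeRep_H, freeRep_H]
    exact hOp_comm_hOp q ϖ i j s t
  | K_X ε i j n =>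
    apply hfree
    rw [map_mul, map_mul, map_smul, freeRep_K, freeRep_K]
    refine LinearMap.ext fun y => ?_
    have hk : ∀ y, kOp q ϖ 1 i (kOp q ϖ (-1) i y) = y := fun y =>
      LinearMap.congr_fun (kOp_mul_kOp_neg q ϖ hq0 1 i) y
    rcases Int.units_eq_one_or ε with rfl | rfl
    · rw [freeRep_X_one, Module.End.mul_apply, Module.End.mul_apply, kOp_raiseOp q ϖ hq0, hk]
      rfl
    · rw [freeRep_X_neg, Module.End.mul_apply, Module.End.mul_apply, kOp_consOp q ϖ hq0, hk]
      rfl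
  | H_X ε i j s n hs =>
    apply hfree
    rw [map_sub, map_mul, map_mul, map_smul, freeRep_H]
    refine LinearMap.ext fun y => ?_
    rcases Int.units_eq_one_or ε with rfl | rfl
    · rw [freeRep_X_one, freeRep_X_one, LinearMap.sub_apply, Module.End.mul_apply,
        Module.End.mul_apply, hOp_raiseOp q ϖ hq0, add_sub_cancel_left, Units.val_one, Int.cast_one,
        one_mul]
      rfl
    · rw [freeRep_X_neg, freeRep_X_neg, LinearMap.sub_apply, Module.End.mul_apply,
        Module.End.mul_apply, hOp_consOp, sub_sub_cancel_left, Units.val_neg, Units.val_one,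
        Int.cast_neg, Int.cast_one, neg_one_mul, LinearMap.smul_apply, neg_smul]
      rfl
  | X_X_opp i j m n =>
    apply hfree
    refine (map_sbr (E' := Module.End A (FreeVerma M N A)) (freeRep q ϖ) _ _ _ _ _).trans ?_
    rw [freeRep_X_one, freeRep_X_neg]
    refine LinearMap.ext fun y => ?_
    rw [sbr, mul_one, LinearMap.sub_apply, LinearMap.smul_apply, Module.End.mul_apply,
      Module.End.mul_apply, raiseOp_consOp]
    rw [show (-1 : ℂ) ^ ((nodePar M i).val * (nodePar M j).val) = nodeSign M i j from rfl,
      add_sub_cancel_left]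
    by_cases hij : i = j
    · rw [if_pos hij.symm, if_pos hij, map_smul, map_sub, freeRep_phi, freeRep_phi]
      rfl
    · rw [if_neg (Ne.symm hij), if_neg hij, map_zero]
      rfl
  | X_X_zero ε i j m n hc =>
    intro y
    rw [sub_zero]
    rcases Int.units_eq_one_or ε with rfl | rfl
    · refine IsLowRel.freeRep_flip_mem ϖ hq0 hq2 ?_ y
      have := isLowRel_comm.{u} (q := q) j i n m (by rw [cartan_comm]; exact hc)
      convert this using 1
      simp only [sbr, map_sub, map_mul, map_smul, freeFlip_X, MulOpposite.unop_sub,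
        MulOpposite.unop_smul, MulOpposite.unop_mul, MulOpposite.unop_op,
        mul_comm (nodePar M j).val]
    · exact (isLowRel_comm.{u} i j m n hc).freeRep_mem ϖ hq0 hq2 y
  | X_X ε i j m n hc =>
    intro y
    rcases Int.units_eq_one_or ε with rfl | rfl
    · rw [Units.val_one, one_mul]
      refine IsLowRel.freeRep_flip_mem ϖ hq0 hq2 ?_ y
      have h := isLowRel_quadratic.{u} (q := q) i j m n hc
      have e : q ^ (cartan M i j) * q ^ (-cartan M i j) = 1 := by
        rw [← zpow_add₀ hq0, add_neg_cancel, zpow_zero]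
      have h2 : IsLowRel.{u} q M N ((-q ^ (cartan M i j)) • (fX (-1) i (m + 1) * fX (-1) j n -
          q ^ (-cartan M i j) • (fX (-1) j n * fX (-1) i (m + 1)) -
        (q ^ (-cartan M i j) • (fX (-1) i m * fX (-1) j (n + 1)) -
          fX (-1) j (n + 1) * fX (-1) i m))) :=
        ⟨Subalgebra.smul_mem _ h.mem _, fun ι _ _ B _ _ col z => by
          rw [map_smul, h.low ι _ _ B _ _ col z, smul_zero]⟩
      convert h2 using 1
      simp only [map_sub, map_mul, map_smul, freeFlip_X, MulOpposite.unop_sub,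
        MulOpposite.unop_smul, MulOpposite.unop_mul, MulOpposite.unop_op, smul_sub, smul_smul,
        neg_mul, e]
      module
    · rw [Units.val_neg, Units.val_one, neg_one_mul]
      exact (isLowRel_quadratic.{u} i j m n hc).freeRep_mem ϖ hq0 hq2 y
  | serre ε i j m n k hc hi =>
    intro y
    rw [sub_zero]
    rcases Int.units_eq_one_or ε with rfl | rfl
    · refine IsLowRel.freeRep_flip_mem ϖ hq0 hq2 ?_ y
      have h := isLowRel_serre.{u} (q := q) hq0 i j m n k hc hi
      rw [sbr_serre hq0] at h ⊢
      convert h using 1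
      simp only [map_sub, map_add, map_mul, map_smul, freeFlip_X, MulOpposite.unop_sub,
        MulOpposite.unop_add, MulOpposite.unop_smul, MulOpposite.unop_mul, MulOpposite.unop_op,
        mul_assoc]
      module
    · exact (isLowRel_serre.{u} hq0 i j m n k hc hi).freeRep_mem ϖ hq0 hq2 y
  | oscillation ε a b d m n k u hM hN ha hb hd =>
    intro y
    rw [sub_zero, sbr_oscillation hq0, sbr_oscillation hq0]
    rcases Int.units_eq_one_or ε with rfl | rfl
    · refine IsLowRel.freeRep_flip_mem ϖ hq0 hq2 ?_ y
      have h := isLowRel_oscillation_inv.{u} (q := q) hq0 a b d m n k u ha hb hd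
      convert h using 1
      simp only [oscWord, map_sub, map_add, map_mul, map_smul, freeFlip_X, MulOpposite.unop_sub,
        MulOpposite.unop_add, MulOpposite.unop_smul, MulOpposite.unop_mul, MulOpposite.unop_op,
        mul_assoc, inv_inv]
      module
    · exact (isLowRel_oscillation.{u} hq0 a b d m n k u ha hb hd).freeRep_mem ϖ hq0 hq2 y

/-- The action of `U_q(L sl(M, N))` on the quotient by the radical. -/
def simpleRep (hq0 : q ≠ 0) (hq2 : q - q⁻¹ ≠ 0) :
    U q M N →ₐ[ℂ] Module.End A (SimpleHW (q := q) ϖ) :=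
  RingQuot.liftAlgHom ℂ ⟨quotRep ϖ hq0, fun _ _ h => quotRep_rel ϖ hq0 hq2 h⟩

theorem simpleRep_mkU (hq0 : q ≠ 0) (hq2 : q - q⁻¹ ≠ 0) (a : FreeU M N) (y : FreeVerma M N A) :
    simpleRep ϖ hq0 hq2 (mkU q M N a) (Submodule.Quotient.mk y) =
      Submodule.Quotient.mk (freeRep q ϖ a y) := by
  rw [← quotRep_mk ϖ hq0]
  exact LinearMap.congr_fun (RingQuot.liftAlgHom_mkAlgHom_apply ℂ (quotRep ϖ hq0)
    (fun _ _ h => quotRep_rel ϖ hq0 hq2 h) a) _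

end Radical

end QAffine

end

noncomputable section
set_option linter.unusedSectionVars false
namespace QAffine

/-! ## Integrability -/

section PartialFraction

variable {ι K : Type*} [Fintype ι] [DecidableEq ι] [Field K]

/-- The numerators of the partial fraction expansion of `∏ (α_r - β_r x_r X) / (1 - x_r X)`. -/
def pfCoeff (x α β : ι → K) (r : ι) : K :=
  (α r - β r) * ∏ s ∈ Finset.univ.erase r, (α s * x r - β s * x s) / (x r - x s)

theorem prod_sub_mul_X_eq {x : ι → K} (hx : Function.Injective x) (hx0 : ∀ r, x r ≠ 0)
    (α β : ι → K) :
    ∏ r, (Polynomial.C (α r) - Polynomial.C (β r * x r) * Polynomial.X) =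
      Polynomial.C (∏ r, β r) * ∏ r, (1 - Polynomial.C (x r) * Polynomial.X) +
        ∑ r, Polynomial.C (pfCoeff x α β r) *
          ∏ s ∈ Finset.univ.erase r, (1 - Polynomial.C (x s) * Polynomial.X) := by
  have hdeg : ∀ u v : K, (Polynomial.C u - Polynomial.C v * Polynomial.X).natDegree ≤ 1 := by
    intro u v
    compute_degree
  have hdeg' : ∀ v : K, (1 - Polynomial.C v * Polynomial.X).natDegree ≤ 1 := fun v => by
    simpa using hdeg 1 v
  rw [← sub_eq_iff_eq_add']
  refine Polynomial.eq_of_degrees_lt_of_eval_index_eq (s := Finset.univ) (v := fun r => (x r)⁻¹)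
    (fun a _ b _ h => hx (inv_injective h)) ?_ ?_ ?_
  · rw [Polynomial.degree_lt_iff_coeff_zero]
    intro m hm
    have e1 : (∏ r, (Polynomial.C (α r) - Polynomial.C (β r * x r) * Polynomial.X)).natDegree ≤
        Finset.univ.card (α := ι) := by
      refine (Polynomial.natDegree_prod_le _ _).trans ?_
      refine (Finset.sum_le_sum fun r _ => hdeg (α r) (β r * x r)).trans ?_
      simp
    have e2 : (∏ r, (1 - Polynomial.C (x r) * Polynomial.X)).natDegree ≤
        Finset.univ.card (α := ι) := by
      refine (Polynomial.natDegree_prod_le _ _).trans ?_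
      refine (Finset.sum_le_sum fun r _ => hdeg' (x r)).trans ?_
      simp
    rw [Polynomial.coeff_sub, Polynomial.coeff_C_mul]
    rcases hm.eq_or_lt with rfl | hm
    · have c1 := Polynomial.coeff_prod_of_natDegree_le (s := Finset.univ)
        (f := fun r : ι => Polynomial.C (α r) - Polynomial.C (β r * x r) * Polynomial.X) 1
        fun r _ => hdeg _ _
      have c2 := Polynomial.coeff_prod_of_natDegree_le (s := Finset.univ)
        (f := fun r : ι => 1 - Polynomial.C (x r) * Polynomial.X) 1 fun r _ => hdeg' _
      rw [mul_one] at c1 c2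
      rw [c1, c2, ← Finset.prod_mul_distrib, sub_eq_zero]
      refine Finset.prod_congr rfl fun r _ => ?_
      simp [Polynomial.coeff_C, Polynomial.coeff_one]
    · rw [Polynomial.coeff_eq_zero_of_natDegree_lt (e1.trans_lt hm),
        Polynomial.coeff_eq_zero_of_natDegree_lt (e2.trans_lt hm), mul_zero, sub_zero]
  · refine (Polynomial.degree_sum_le _ _).trans_lt ?_
    rw [Finset.sup_lt_iff (by simp [bot_lt_iff_ne_bot])]
    intro r _
    refine (Polynomial.degree_le_natDegree).trans_lt ?_
    rw [Nat.cast_lt]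
    refine (Polynomial.natDegree_C_mul_le _ _).trans_lt ?_
    refine (Polynomial.natDegree_prod_le _ _).trans_lt ?_
    refine (Finset.sum_le_sum fun r _ => hdeg' (x r)).trans_lt ?_
    rw [Finset.sum_const, smul_eq_mul, mul_one]
    exact Finset.card_erase_lt_of_mem (Finset.mem_univ r)
  · intro r _
    have hz : ∀ y, y ≠ r → ∏ s ∈ Finset.univ.erase y, (1 - x s * (x r)⁻¹) = 0 := by
      intro y hy
      refine Finset.prod_eq_zero (Finset.mem_erase.2 ⟨hy.symm, Finset.mem_univ r⟩) ?_
      rw [mul_inv_cancel₀ (hx0 r), sub_self]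
    have hz' : ∏ s, (1 - x s * (x r)⁻¹) = 0 := by
      refine Finset.prod_eq_zero (Finset.mem_univ r) ?_
      rw [mul_inv_cancel₀ (hx0 r), sub_self]
    simp only [Polynomial.eval_sub, Polynomial.eval_prod, Polynomial.eval_mul, Polynomial.eval_C,
      Polynomial.eval_X, Polynomial.eval_one, Polynomial.eval_finsetSum]
    rw [hz', mul_zero, sub_zero, Finset.sum_eq_single r (fun y _ hy => by rw [hz y hy, mul_zero])
      (by simp), pfCoeff, mul_assoc, ← Finset.prod_mul_distrib,
      ← Finset.mul_prod_erase _ _ (Finset.mem_univ r)]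
    congr 1
    · rw [mul_assoc, mul_inv_cancel₀ (hx0 r), mul_one]
    · refine Finset.prod_congr rfl fun s hs => ?_
      have h1 : x r - x s ≠ 0 := sub_ne_zero.2 fun h => (Finset.mem_erase.1 hs).1 (hx h).symm
      have h2 := hx0 r
      field_simp

theorem coeff_eq_of_mul_prod_eq {x : ι → K} (hx : Function.Injective x) (hx0 : ∀ r, x r ≠ 0)
    (α β : ι → K) {Φ : PowerSeries K}
    (h : Φ * ∏ r, (1 - PowerSeries.C (x r) * PowerSeries.X) =
      ∏ r, (PowerSeries.C (α r) - PowerSeries.C (β r * x r) * PowerSeries.X)) (k : ℕ) :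
    PowerSeries.coeff k Φ =
      (if k = 0 then ∏ r, β r else 0) + ∑ r, pfCoeff x α β r * x r ^ k := by
  have h2 : ∀ x : K,
      PowerSeries.mk (fun s => x ^ s) * (1 - PowerSeries.C x * PowerSeries.X) = 1 := by
    intro x
    ext n
    rw [mul_sub, mul_one, map_sub, ← mul_assoc, mul_comm _ (PowerSeries.C x)]
    cases n with
    | zero => simp
    | succ n =>
      rw [PowerSeries.coeff_succ_mul_X, PowerSeries.coeff_C_mul, PowerSeries.coeff_mk,
        PowerSeries.coeff_mk, pow_succ', sub_self, PowerSeries.coeff_one,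
        if_neg (Nat.succ_ne_zero n)]
  have key := congrArg Polynomial.coeToPowerSeries.ringHom (prod_sub_mul_X_eq hx hx0 α β)
  simp only [map_prod, map_sub, map_mul, map_add, map_sum, map_one,
    Polynomial.coeToPowerSeries.ringHom_apply, Polynomial.coe_C, Polynomial.coe_X] at key
  have hΦ : Φ = PowerSeries.C (∏ r, β r) +
      ∑ r, PowerSeries.C (pfCoeff x α β r) * PowerSeries.mk fun s => x r ^ s := by
    have hu : IsUnit (∏ r, (1 - PowerSeries.C (x r) * PowerSeries.X) : PowerSeries K) := by
      rw [PowerSeries.isUnit_iff_constantCoeff]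
      simp
    apply hu.mul_right_cancel
    rw [h]
    simp only [map_mul, map_prod] at key ⊢
    rw [key, add_mul, Finset.sum_mul]
    congr 1
    refine Finset.sum_congr rfl fun r _ => ?_
    rw [← Finset.mul_prod_erase _ _ (Finset.mem_univ r), mul_assoc, ← mul_assoc _ (1 - _), h2,
      one_mul]
  rw [hΦ, map_add, map_sum, PowerSeries.coeff_C]
  simp only [PowerSeries.coeff_C_mul, PowerSeries.coeff_mk]

end PartialFraction

section Integrable

variable (q : ℂ) {M N : ℕ} {A : Type*} [CommRing A] [Algebra ℂ A] (ϖ : CartanWeight M N A)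
variable {ι K : Type*} [Fintype ι] [DecidableEq ι] [Field K] [Algebra ℂ K]
  [Algebra A K] [IsScalarTower ℂ A K] (i : Node M N) (z : ι → Kˣ)

theorem cartan_self_even {M i : ℕ} (hi : i ≠ M) : cartan M i i = 2 * ell M i := by
  rw [cartan_self]
  rcases ell_eq M i with h | h <;> rcases ell_eq M (i + 1) with h' | h' <;> omega

theorem nodeSign_of_ne {M i : ℕ} (hi : i ≠ M) (j : ℕ) : nodeSign M i j = 1 := by
  simp [nodeSign, nodePar, hi]

theorem algebraMap_zpow_cartan (hi : (i : ℕ) ≠ M) (n : ℤ) :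
    algebraMap ℂ K (q ^ (n * cartan M i i)) = algebraMap ℂ K (qi q M i) ^ (2 * n) := by
  rw [← map_zpow₀, qi, ← zpow_mul, cartan_self_even hi]
  congr 2
  ring

/-- The eigenvalue of `φ_i^ε` on the vacuum is the one of a product of two-dimensional
evaluation modules with parameters `z`. -/
def IsEvaluationWeight : Prop := ∀ ε : ℤˣ,
  phiValue q ϖ (fun _ => (i : ℕ)) z ε i ∅ *
      ∏ r, (1 - PowerSeries.C ((z r ^ (ε : ℤ) : Kˣ) : K) * PowerSeries.X) =
    ∏ r, (PowerSeries.C (algebraMap ℂ K (qi q M i) ^ (ε : ℤ)) -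
      PowerSeries.C ((algebraMap ℂ K (qi q M i) ^ (ε : ℤ))⁻¹ * ((z r ^ (ε : ℤ) : Kˣ) : K)) *
        PowerSeries.X)

/-- The weight of a point of a two-dimensional evaluation module. -/
def ptWeight (S : Finset ι) (r : ι) : K :=
  if r ∈ S then (algebraMap ℂ K (qi q M i))⁻¹ else algebraMap ℂ K (qi q M i)

variable {q ϖ i z}

theorem qi_ne_zero (hq0 : q ≠ 0) (M i : ℕ) : qi q M i ≠ 0 := zpow_ne_zero _ hq0

theorem IsEvaluationWeight.phiValue_mul (h : IsEvaluationWeight q ϖ i z) (hq0 : q ≠ 0)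
    (hq2 : q - q⁻¹ ≠ 0) (hi : (i : ℕ) ≠ M) (ε : ℤˣ) (S : Finset ι) :
    phiValue q ϖ (fun _ => (i : ℕ)) z ε i S *
      ∏ r, (1 - PowerSeries.C ((z r ^ (ε : ℤ) : Kˣ) : K) * PowerSeries.X) =
    ∏ r, (PowerSeries.C (ptWeight q i S r ^ (ε : ℤ)) -
      PowerSeries.C ((ptWeight q i S r ^ (ε : ℤ))⁻¹ * ((z r ^ (ε : ℤ) : Kˣ) : K)) *
        PowerSeries.X) := by
  have e : ∏ b ∈ S, ptSeries q (M := M) i i ε (z b) =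
      ∏ r, if r ∈ S then ptSeries q (M := M) i i ε (z r) else 1 := by
    rw [Finset.prod_ite_mem, Finset.univ_inter]
  rw [phiValue_eq q ϖ _ z hq2, mul_right_comm, h ε, e, ← Finset.prod_mul_distrib]
  refine Finset.prod_congr rfl fun r _ => ?_
  have hp : algebraMap ℂ K (qi q M i) ≠ 0 := by
    rw [ne_eq, map_eq_zero]; exact qi_ne_zero hq0 M i
  rw [ptWeight]
  split_ifs
  · have h1 := expSeries_powDiff
      (algebraMap ℂ K (q ^ (-(ε : ℤ) * cartan M i i)) * ((z r ^ (ε : ℤ) : Kˣ) : K))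
      (algebraMap ℂ K (q ^ ((ε : ℤ) * cartan M i i)) * ((z r ^ (ε : ℤ) : Kˣ) : K))
    rw [ptSeries]
    generalize expSeries (powDiff
      (algebraMap ℂ K (q ^ (-(ε : ℤ) * cartan M i i)) * ((z r ^ (ε : ℤ) : Kˣ) : K))
      (algebraMap ℂ K (q ^ ((ε : ℤ) * cartan M i i)) * ((z r ^ (ε : ℤ) : Kˣ) : K))) = E at h1 ⊢
    rw [algebraMap_zpow_cartan (K := K) q i hi] at h1 ⊢
    rw [algebraMap_zpow_cartan (K := K) q i hi] at h1
    rw [inv_zpow, inv_inv]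
    have e1 : algebraMap ℂ K (qi q M i) ^ (2 * -(ε : ℤ)) =
        (algebraMap ℂ K (qi q M i) ^ (ε : ℤ))⁻¹ * (algebraMap ℂ K (qi q M i) ^ (ε : ℤ))⁻¹ := by
      rw [← zpow_neg, ← zpow_add₀ hp]; congr 1; ring
    have e2 : algebraMap ℂ K (qi q M i) ^ (2 * (ε : ℤ)) =
        (algebraMap ℂ K (qi q M i) ^ (ε : ℤ)) * (algebraMap ℂ K (qi q M i) ^ (ε : ℤ)) := by
      rw [← zpow_add₀ hp]; congr 1; ring
    rw [e1, e2] at h1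
    rw [e1]
    have hP : algebraMap ℂ K (qi q M i) ^ (ε : ℤ) ≠ 0 := zpow_ne_zero _ hp
    generalize algebraMap ℂ K (qi q M i) ^ (ε : ℤ) = P at *
    generalize ((z r ^ (ε : ℤ) : Kˣ) : K) = v at *
    have hPi : PowerSeries.C P * PowerSeries.C P⁻¹ = 1 := by
      rw [← map_mul, mul_inv_cancel₀ hP, map_one]
    simp only [map_mul] at h1 ⊢
    linear_combination (PowerSeries.C P⁻¹) * h1 +
      (E * PowerSeries.C P⁻¹ - PowerSeries.C P * PowerSeries.C v * PowerSeries.X) * hPi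
  · rw [mul_one]

theorem IsEvaluationWeight.coeff_sub_coeff (h : IsEvaluationWeight q ϖ i z) (hq0 : q ≠ 0)
    (hq2 : q - q⁻¹ ≠ 0) (hi : (i : ℕ) ≠ M) (hz : Function.Injective z) (S : Finset ι) (k : ℤ) :
    (HahnSeries.ofPowerSeries ℤ K (phiValue q ϖ (fun _ => (i : ℕ)) z 1 i S)).coeff k -
      (HahnSeries.ofPowerSeries ℤ K (phiValue q ϖ (fun _ => (i : ℕ)) z (-1) i S)).coeff (-k) =
    ∑ r, pfCoeff (fun r => (z r : K)) (ptWeight q i S) (fun r => (ptWeight q i S r)⁻¹) r *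
      ((z r ^ k : Kˣ) : K) := by
  have hp : algebraMap ℂ K (qi q M i) ≠ 0 := by
    rw [ne_eq, map_eq_zero]; exact qi_ne_zero hq0 M i
  have hw : ∀ r, (ptWeight q i S r : K) ≠ 0 := by
    intro r
    rw [ptWeight]
    split_ifs
    · exact inv_ne_zero hp
    · exact hp
  have hz1 : Function.Injective fun r => (z r : K) := fun a b h => hz (Units.ext h)
  have hz2 : Function.Injective fun r => ((z r)⁻¹ : Kˣ).val := fun a b h =>
    hz (inv_injective (Units.ext h))
  have h1 := h.phiValue_mul hq0 hq2 hi 1 S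
  have h2 := h.phiValue_mul hq0 hq2 hi (-1) S
  simp only [Units.val_one, zpow_one] at h1
  simp only [Units.val_neg, Units.val_one, zpow_neg, zpow_one] at h2
  have c1 := coeff_eq_of_mul_prod_eq hz1 (fun r => (z r).ne_zero) (ptWeight q i S)
    (fun r => (ptWeight q i S r)⁻¹) h1
  have c2 := coeff_eq_of_mul_prod_eq hz2 (fun r => Units.ne_zero _)
    (fun r => (ptWeight q i S r)⁻¹) (fun r => (ptWeight q i S r)⁻¹⁻¹) h2
  have hneg : ∀ r, pfCoeff (fun r => ((z r)⁻¹ : Kˣ).val) (fun r => (ptWeight q i S r)⁻¹)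
      (fun r => (ptWeight q i S r)⁻¹⁻¹) r =
      -pfCoeff (fun r => (z r : K)) (ptWeight q i S) (fun r => (ptWeight q i S r)⁻¹) r := by
    intro r
    rw [pfCoeff, pfCoeff, inv_inv, ← neg_mul, neg_sub]
    congr 1
    refine Finset.prod_congr rfl fun s hs => ?_
    rw [inv_inv, Units.val_inv_eq_inv_val, Units.val_inv_eq_inv_val]
    have n1 := (z r).ne_zero
    have n2 := (z s).ne_zero
    have n3 := hw s
    have n4 : (z r : K) - z s ≠ 0 := sub_ne_zero.2 fun h => (Finset.mem_erase.1 hs).1 (hz1 h).symm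
    have n5 : ((z r : K))⁻¹ - (z s : K)⁻¹ ≠ 0 := by
      rw [ne_eq, sub_eq_zero, inv_inj]; exact sub_ne_zero.1 n4
    rw [div_eq_div_iff n5 n4]
    field_simp
    ring
  simp only [hneg] at c2
  rw [ofPowerSeries_coeff, ofPowerSeries_coeff]
  rcases lt_trichotomy k 0 with hk | hk | hk
  · rw [if_neg (by omega), if_pos (by omega), c2, if_neg (by omega), zero_add, zero_sub,
      ← Finset.sum_neg_distrib]
    refine Finset.sum_congr rfl fun r _ => ?_
    rw [neg_mul, neg_neg, ← Units.val_pow_eq_pow_val, inv_pow, ← zpow_natCast, ← zpow_neg,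
      Int.toNat_of_nonneg (by omega), neg_neg]
  · subst hk
    have hc0 := congrArg PowerSeries.constantCoeff h1
    simp only [map_mul, map_prod, map_sub, map_one, PowerSeries.constantCoeff_C,
      PowerSeries.constantCoeff_X, mul_zero, sub_zero, Finset.prod_const_one, mul_one] at hc0
    rw [← PowerSeries.coeff_zero_eq_constantCoeff_apply] at hc0
    have c10 := c1 0
    have c20 := c2 0
    simp only [if_true, pow_zero, mul_one, inv_inv, Finset.sum_neg_distrib] at c10 c20
    simp only [neg_zero, le_refl, if_true, Int.toNat_zero, zpow_zero, Units.val_one, mul_one]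
    rw [c20, ← hc0]
    ring
  · rw [if_pos (by omega), if_neg (by omega), c1, if_neg (by omega), zero_add, sub_zero]
    refine Finset.sum_congr rfl fun r _ => ?_
    rw [← Units.val_pow_eq_pow_val, ← zpow_natCast, Int.toNat_of_nonneg (by omega)]

variable (q i z)

/-- The coefficients of the raising operators on a product of evaluation modules. -/
def raiseCoeff (S : Finset ι) (a : ι) : K :=
  (∏ s ∈ Finset.univ.erase a, (algebraMap ℂ K (qi q M i) * z a -
    (algebraMap ℂ K (qi q M i))⁻¹ * z s) / ((z a : K) - z s)) /
    ∏ c ∈ S, ptFactor q M (fun _ => (i : ℕ)) z c a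

/-- The raising operators on a product of evaluation modules. -/
def raisePt (m : ℤ) : Module.End K (Finset ι → K) where
  toFun F S := ∑ a ∈ Sᶜ, ((z a ^ m : Kˣ) : K) * (raiseCoeff q i z S a * F (insert a S))
  map_add' F G := by
    ext S
    simp only [Pi.add_apply, mul_add, Finset.sum_add_distrib]
  map_smul' r F := by
    ext S
    simp only [Pi.smul_apply, smul_eq_mul, RingHom.id_apply, Finset.mul_sum]
    exact Finset.sum_congr rfl fun _ _ => by ring

theorem raisePt_apply (m : ℤ) (F : Finset ι → K) (S : Finset ι) : raisePt q i z m F S =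
    ∑ a ∈ Sᶜ, ((z a ^ m : Kˣ) : K) * (raiseCoeff q i z S a * F (insert a S)) := rfl

theorem raisePt_pow_apply (m : ℤ) (n : ℕ) (F : Finset ι → K) (S : Finset ι)
    (h : Fintype.card ι < S.card + n) : (raisePt q i z m ^ n) F S = 0 := by
  induction n generalizing S F with
  | zero =>
    have := Finset.card_le_univ S
    omega
  | succ n ih =>
    rw [pow_succ', Module.End.mul_apply, raisePt_apply]
    refine Finset.sum_eq_zero fun a ha => ?_
    rw [ih, mul_zero, mul_zero]
    rw [Finset.card_insert_of_notMem (Finset.mem_compl.1 ha)]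
    omega

variable {q i z}

theorem raiseCoeff_mul_ptFactor (hω : ∀ c a, c ≠ a → ptFactor q M (fun _ => (i : ℕ)) z c a ≠ 0)
    {S : Finset ι} {a b : ι} (ha : a ∉ S) (hb : b ∈ S) :
    raiseCoeff q i z S a * ptFactor q M (fun _ => (i : ℕ)) z b a =
      raiseCoeff q i z (S.erase b) a := by
  have hba : b ≠ a := fun h => ha (h ▸ hb)
  have h2 : ∏ c ∈ S.erase b, ptFactor q M (fun _ => (i : ℕ)) z c a ≠ 0 :=
    Finset.prod_ne_zero_iff.2 fun c hc => hω c a fun h => ha (h ▸ Finset.mem_of_mem_erase hc)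
  rw [raiseCoeff, raiseCoeff, ← Finset.mul_prod_erase _ _ hb]
  have := hω b a hba
  field_simp

theorem raiseCoeff_mul_prod (hq0 : q ≠ 0) (hi : (i : ℕ) ≠ M) (hz : Function.Injective z)
    (hω : ∀ c a, c ≠ a → ptFactor q M (fun _ => (i : ℕ)) z c a ≠ 0)
    {S : Finset ι} {a : ι} (ha : a ∉ S) :
    raiseCoeff q i z S a * ∏ c ∈ S, ptFactor q M (fun _ => (i : ℕ)) z a c =
      ∏ s ∈ Finset.univ.erase a,
        (ptWeight q i S s * z a - (ptWeight q i S s)⁻¹ * z s) / ((z a : K) - z s) := by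
  have hS : Finset.univ.erase a ∩ S = S := by
    rw [Finset.inter_eq_right]
    intro x hx
    exact Finset.mem_erase.2 ⟨fun h => ha (h ▸ hx), Finset.mem_univ x⟩
  have e : ∀ f : ι → K, ∏ c ∈ S, f c = ∏ c ∈ Finset.univ.erase a, if c ∈ S then f c else 1 := by
    intro f
    rw [Finset.prod_ite_mem, hS]
  rw [raiseCoeff, e, e, ← Finset.prod_div_distrib, ← Finset.prod_mul_distrib]
  refine Finset.prod_congr rfl fun s hs => ?_
  have hsa : s ≠ a := (Finset.mem_erase.1 hs).1
  have n4 : (z a : K) - z s ≠ 0 := sub_ne_zero.2 fun h => hsa (hz (Units.ext h)).symm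
  have hp : algebraMap ℂ K (qi q M i) ≠ 0 := by
    rw [ne_eq, map_eq_zero]; exact qi_ne_zero hq0 M i
  rw [ptWeight]
  split_ifs
  · have hω' := hω s a hsa
    have hQ : algebraMap ℂ K (q ^ (-cartan M i i)) = (algebraMap ℂ K (qi q M i))⁻¹ *
        (algebraMap ℂ K (qi q M i))⁻¹ := by
      have := algebraMap_zpow_cartan (K := K) q i hi (-1)
      rw [neg_one_mul] at this
      rw [this, ← zpow_neg_one, ← zpow_add₀ hp]
      rfl
    have f : ∀ x y, ptFactor q M (fun _ : ι => (i : ℕ)) z x y =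
        ((algebraMap ℂ K (qi q M i))⁻¹ * (algebraMap ℂ K (qi q M i))⁻¹ * z x - z y) *
          ((z x : K) - z y) := by
      intro x y
      simp only [ptFactor, shuffleFactor, le_refl, if_true, hi, ne_eq, not_false_eq_true,
        and_self, one_mul, hQ]
    rw [f] at hω' ⊢
    rw [f]
    generalize algebraMap ℂ K (qi q M i) = p at *
    have key : (p * z a - p⁻¹ * z s) * ((p⁻¹ * p⁻¹ * z a - z s) * ((z a : K) - z s)) =
        (p⁻¹ * z a - p⁻¹⁻¹ * z s) * ((p⁻¹ * p⁻¹ * z s - z a) * ((z s : K) - z a)) := by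
      field_simp
      ring
    rw [div_div, div_mul_eq_mul_div, div_eq_div_iff (mul_ne_zero n4 hω') n4]
    linear_combination ((z a : K) - z s) * key
  · simp

theorem raisePt_lowPt (h : IsEvaluationWeight q ϖ i z) (hq0 : q ≠ 0) (hq2 : q - q⁻¹ ≠ 0)
    (hi : (i : ℕ) ≠ M) (hz : Function.Injective z)
    (hω : ∀ c a, c ≠ a → ptFactor q M (fun _ => (i : ℕ)) z c a ≠ 0) (m k : ℤ)
    (F : Finset ι → K) (S : Finset ι) :
    raisePt q i z m (lowPt q M (fun _ => (i : ℕ)) z i k F) S =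
      lowPt q M (fun _ => (i : ℕ)) z i k (raisePt q i z m F) S +
      algebraMap ℂ K (qi q M i - (qi q M i)⁻¹)⁻¹ *
      ((HahnSeries.ofPowerSeries ℤ K (phiValue q ϖ (fun _ => (i : ℕ)) z 1 i S)).coeff (m + k) -
      (HahnSeries.ofPowerSeries ℤ K (phiValue q ϖ (fun _ => (i : ℕ)) z (-1) i S)).coeff
        (-(m + k))) * F S := by
  rw [h.coeff_sub_coeff hq0 hq2 hi hz, raisePt_apply, lowPt_apply]
  simp only [if_true, lowPt_apply, raisePt_apply]
  set Γ : ι → Finset ι → K := fun a T => ∏ c ∈ T, ptFactor q M (fun _ => (i : ℕ)) z a c with hΓ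
  have e1 : ∀ a ∈ Sᶜ, ((z a ^ m : Kˣ) : K) * (raiseCoeff q i z S a *
      ∑ b ∈ insert a S, ((z b ^ k : Kˣ) : K) * (Γ b ((insert a S).erase b) *
        F ((insert a S).erase b))) =
      ((z a ^ (m + k) : Kˣ) : K) * (raiseCoeff q i z S a * Γ a S) * F S +
      ∑ b ∈ S, ((z a ^ m : Kˣ) : K) * ((z b ^ k : Kˣ) : K) * raiseCoeff q i z (S.erase b) a *
        Γ b (S.erase b) * F (insert a (S.erase b)) := by
    intro a ha
    have ha' := Finset.mem_compl.1 ha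
    rw [Finset.sum_insert ha', Finset.erase_insert ha', mul_add, mul_add, zpow_add, Units.val_mul,
      Finset.mul_sum, Finset.mul_sum]
    congr 1
    · ring
    · refine Finset.sum_congr rfl fun b hb => ?_
      have hab : a ≠ b := fun h => ha' (h ▸ hb)
      have ha2 : a ∉ S.erase b := fun h => ha' (Finset.mem_of_mem_erase h)
      rw [Finset.erase_insert_of_ne hab, ← raiseCoeff_mul_ptFactor hω ha' hb]
      simp only [hΓ]
      rw [Finset.prod_insert ha2]
      ring
  have e2 : ∀ b ∈ S, ((z b ^ k : Kˣ) : K) * (Γ b (S.erase b) *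
      ∑ a ∈ (S.erase b)ᶜ, ((z a ^ m : Kˣ) : K) *
        (raiseCoeff q i z (S.erase b) a * F (insert a (S.erase b)))) =
      ((z b ^ (m + k) : Kˣ) : K) * (raiseCoeff q i z (S.erase b) b * Γ b (S.erase b)) * F S +
      ∑ a ∈ Sᶜ, ((z a ^ m : Kˣ) : K) * ((z b ^ k : Kˣ) : K) * raiseCoeff q i z (S.erase b) a *
        Γ b (S.erase b) * F (insert a (S.erase b)) := by
    intro b hb
    rw [Finset.compl_erase, Finset.sum_insert (by simpa using hb), Finset.insert_erase hb, mul_add,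
      mul_add, zpow_add, Units.val_mul, Finset.mul_sum, Finset.mul_sum]
    congr 1
    · ring
    · exact Finset.sum_congr rfl fun a _ => by ring
  rw [Finset.sum_congr rfl e1, Finset.sum_congr rfl e2, Finset.sum_add_distrib,
    Finset.sum_add_distrib, Finset.sum_comm (s := S)]
  have e3 : algebraMap ℂ K (qi q M i - (qi q M i)⁻¹)⁻¹ *
      (∑ r, pfCoeff (fun r => (z r : K)) (ptWeight q i S) (fun r => (ptWeight q i S r)⁻¹) r *
      ((z r ^ (m + k) : Kˣ) : K)) * F S =
      ∑ a ∈ Sᶜ, ((z a ^ (m + k) : Kˣ) : K) * (raiseCoeff q i z S a * Γ a S) * F S +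
      ∑ b ∈ S, -(((z b ^ (m + k) : Kˣ) : K) *
        (raiseCoeff q i z (S.erase b) b * Γ b (S.erase b)) * F S) := by
    have hd : algebraMap ℂ K (qi q M i - (qi q M i)⁻¹)⁻¹ *
        (algebraMap ℂ K (qi q M i) - (algebraMap ℂ K (qi q M i))⁻¹) = 1 := by
      rw [← map_inv₀, ← map_sub, ← map_mul, inv_mul_cancel₀ (qi_sub_inv_ne_zero q hq2 i), map_one]
    rw [← Finset.sum_compl_add_sum S, mul_add, add_mul, Finset.mul_sum, Finset.mul_sum,
      Finset.sum_mul, Finset.sum_mul]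
    congr 1
    · refine Finset.sum_congr rfl fun a ha => ?_
      have ha' := Finset.mem_compl.1 ha
      have := raiseCoeff_mul_prod hq0 hi hz hω ha'
      simp only [hΓ]
      have hwa : ptWeight q i S a = algebraMap ℂ K (qi q M i) := if_neg ha'
      rw [this, pfCoeff]
      simp only [hwa]
      linear_combination (((z a ^ (m + k) : Kˣ) : K) * F S * ∏ s ∈ Finset.univ.erase a,
        (ptWeight q i S s * z a - (ptWeight q i S s)⁻¹ * z s) / ((z a : K) - z s)) * hd
    · refine Finset.sum_congr rfl fun b hb => ?_
      have := raiseCoeff_mul_prod hq0 hi hz hω (Finset.notMem_erase b S)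
      simp only [hΓ]
      have hwb : ptWeight q i S b = (algebraMap ℂ K (qi q M i))⁻¹ := if_pos hb
      have hpr : ∏ s ∈ Finset.univ.erase b, (ptWeight q i (S.erase b) s * z b -
          (ptWeight q i (S.erase b) s)⁻¹ * z s) / ((z b : K) - z s) =
          ∏ s ∈ Finset.univ.erase b,
          (ptWeight q i S s * z b - (ptWeight q i S s)⁻¹ * z s) / ((z b : K) - z s) := by
        refine Finset.prod_congr rfl fun s hs => ?_
        have hsb := (Finset.mem_erase.1 hs).1
        simp only [ptWeight, Finset.mem_erase, hsb, ne_eq, not_false_eq_true, true_and]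
      rw [this, hpr, pfCoeff]
      simp only [hwb, inv_inv]
      linear_combination (-((z b ^ (m + k) : Kˣ) : K) * F S * ∏ s ∈ Finset.univ.erase b,
        (ptWeight q i S s * z b - (ptWeight q i S s)⁻¹ * z s) / ((z b : K) - z s)) * hd
  rw [e3, Finset.sum_neg_distrib]
  ring

theorem shuffle_raiseOp (h : IsEvaluationWeight q ϖ i z) (hq0 : q ≠ 0) (hq2 : q - q⁻¹ ≠ 0)
    (hi : (i : ℕ) ≠ M) (hz : Function.Injective z)
    (hω : ∀ c a, c ≠ a → ptFactor q M (fun _ => (i : ℕ)) z c a ≠ 0) (m : ℤ)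
    (y : FreeVerma M N A) :
    shuffle q (fun _ => (i : ℕ)) z (raiseOp q ϖ i m y) =
      raisePt q i z m (shuffle q (fun _ => (i : ℕ)) z y) := by
  have : shuffle q (fun _ => (i : ℕ)) z ∘ₗ raiseOp q ϖ i m =
      (raisePt q i z m).restrictScalars A ∘ₗ shuffle q (fun _ => (i : ℕ)) z := by
    refine end_ext_word fun w => ?_
    rw [LinearMap.comp_apply, LinearMap.comp_apply, LinearMap.restrictScalars_apply]
    induction w with
    | nil =>
      rw [raiseOp_nil, map_zero, shuffle_nil]
      funext S
      rw [raisePt_apply, Pi.zero_apply]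
      exact (Finset.sum_eq_zero fun a _ => by simp).symm
    | cons x w ih =>
      rw [← consOp_word, raiseOp_consOp, map_add, LinearMap.map_smul_of_tower, shuffle_consOp, ih,
        shuffle_consOp, nodeSign_of_ne hi, one_smul]
      by_cases hx : x.1 = i
      · rw [if_pos hx, hx]
        funext S
        rw [raisePt_lowPt h hq0 hq2 hi hz hω, Pi.add_apply, LinearMap.map_smul_of_tower,
          Pi.smul_apply, map_sub, Pi.sub_apply, shuffle_phiOp q ϖ _ z hq0,
          shuffle_phiOp q ϖ _ z hq0, Algebra.smul_def]
        simp only [Units.val_one, Units.val_neg, one_mul, neg_one_mul]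
        ring
      · have hl : ∀ n, lowPt q M (fun _ => (i : ℕ)) z x.1 n = 0 := by
          intro n
          rw [lowPt]
          refine Finset.sum_eq_zero fun a _ => if_neg fun e => hx (Subtype.ext e.symm)
        rw [if_neg hx, hl, LinearMap.zero_apply, LinearMap.zero_apply, map_zero, map_zero, add_zero]
  exact LinearMap.congr_fun this y

theorem lowering_pow_mem_radical (h : IsEvaluationWeight q ϖ i z) (hq0 : q ≠ 0)
    (hq2 : q - q⁻¹ ≠ 0) (hA : Function.Injective (algebraMap A K)) (hi : (i : ℕ) ≠ M)
    (hz : Function.Injective z)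
    (hω : ∀ c a, c ≠ a → ptFactor q M (fun _ => (i : ℕ)) z c a ≠ 0) :
    (consOp (i, 0) ^ (1 + Fintype.card ι) : Module.End A (FreeVerma M N A)) (word []) ∈
      radical q ϖ := by
  rw [mem_radical]
  intro w
  have key : ∀ n (u w : FreeVerma M N A), pairing q ϖ w ((consOp (i, 0) ^ n) u) =
      pairing q ϖ ((raiseOp q ϖ i 0 ^ n) w) u := by
    intro n
    induction n with
    | zero => intro u w; rfl
    | succ n ih =>
      intro u w
      rw [pow_succ', Module.End.mul_apply, ← pairing_raiseOp q ϖ hq0, ih, pow_succ,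
        Module.End.mul_apply]
  have key2 : ∀ n (w : FreeVerma M N A), shuffle q (fun _ => (i : ℕ)) z ((raiseOp q ϖ i 0 ^ n) w) =
      (raisePt q i z 0 ^ n) (shuffle q (fun _ => (i : ℕ)) z w) := by
    intro n
    induction n with
    | zero => intro w; rfl
    | succ n ih =>
      intro w
      rw [pow_succ, Module.End.mul_apply, ih, shuffle_raiseOp h hq0 hq2 hi hz hω, pow_succ,
        Module.End.mul_apply]
  rw [key, pairing_comm q ϖ hq0, pairing_nil]
  apply hA
  rw [map_zero, ← shuffle_apply_empty q (fun _ => (i : ℕ)) z, key2]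
  exact raisePt_pow_apply q i z 0 _ _ _ (by rw [Finset.card_empty]; omega)

end Integrable

end QAffine

end

noncomputable section
set_option linter.unusedSectionVars false
namespace QAffine

/-! ## Recurrent sequences -/

section Sequences

/-- The shift of a two-sided sequence. -/
def shift : Module.End ℂ (ℤ → ℂ) where
  toFun f m := f (m + 1)
  map_add' _ _ := rfl
  map_smul' _ _ := rfl

theorem shift_pow_apply (k : ℕ) (f : ℤ → ℂ) (m : ℤ) : (shift ^ k) f m = f (m + k) := by
  induction k generalizing m with
  | zero => simp
  | succ k ih =>
    rw [pow_succ', Module.End.mul_apply]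
    change (shift ^ k) f (m + 1) = _
    rw [ih]
    congr 1
    push_cast
    ring

theorem aeval_shift_apply (p : ℂ[X]) (f : ℤ → ℂ) (m : ℤ) :
    Polynomial.aeval shift p f m = p.sum fun s a => a * f (m + s) := by
  rw [Polynomial.aeval_eq_sum_range, Polynomial.sum_over_range _ (by simp)]
  simp [shift_pow_apply]

theorem aeval_shift_eq_zero_of_dvd {p r : ℂ[X]} {f : ℤ → ℂ} (h : r ∣ p)
    (hr : Polynomial.aeval shift r f = 0) : Polynomial.aeval shift p f = 0 := by
  obtain ⟨s, rfl⟩ := h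
  rw [mul_comm, map_mul, Module.End.mul_apply, hr, map_zero]

theorem coeff_reverse_of_le {Q : ℂ[X]} {s : ℕ} (h : s ≤ Q.natDegree) :
    Q.reverse.coeff s = Q.coeff (Q.natDegree - s) := by
  rw [Polynomial.coeff_reverse, Polynomial.revAt_le h]

theorem aeval_reverse_apply (Q : ℂ[X]) (f : ℤ → ℂ) (m : ℤ) :
    Polynomial.aeval shift Q.reverse f m =
      ∑ s ∈ Finset.range (Q.natDegree + 1), Q.coeff (Q.natDegree - s) * f (m + s) := by
  rw [aeval_shift_apply, Polynomial.sum_over_range' _ (by simp) (Q.natDegree + 1)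
    (Nat.lt_succ_of_le Q.reverse_natDegree_le)]
  refine Finset.sum_congr rfl fun s hs => ?_
  rw [coeff_reverse_of_le (by simpa [Nat.lt_succ_iff] using hs)]

theorem polyMul_eq_zero_iff (Q : ℂ[X]) (f : ℤ → ℂ) :
    polyMul Q f = 0 ↔ Polynomial.aeval shift Q.reverse f = 0 := by
  have h : ∀ m, Polynomial.aeval shift Q.reverse f m = polyMul Q f (m + Q.natDegree) := by
    intro m
    rw [aeval_reverse_apply, polyMul,
      ← Finset.sum_range_reflect (fun s => Q.coeff s * f (m + Q.natDegree - s))]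
    refine Finset.sum_congr rfl fun s hs => ?_
    have : s ≤ Q.natDegree := by simpa [Nat.lt_succ_iff] using hs
    rw [Nat.add_sub_cancel, Nat.cast_sub this]
    congr 2
    ring
  constructor
  · intro h0
    funext m
    rw [h, h0]
    rfl
  · intro h0
    funext m
    have := h (m - Q.natDegree)
    rw [h0, sub_add_cancel] at this
    exact this.symm

theorem natTrailingDegree_of_coeff_zero {Q : ℂ[X]} (h : Q.coeff 0 ≠ 0) :
    Q.natTrailingDegree = 0 :=
  Nat.le_zero.mp (Polynomial.natTrailingDegree_le_of_ne_zero h)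

theorem coeff_zero_ne_zero {Q : ℂ[X]} (h : Q.coeff 0 = 1) : Q.coeff 0 ≠ 0 := by
  rw [h]
  exact one_ne_zero

theorem reverse_monic {Q : ℂ[X]} (h : Q.coeff 0 = 1) : Q.reverse.Monic := by
  rw [Polynomial.Monic, Polynomial.reverse_leadingCoeff, Polynomial.trailingCoeff,
    natTrailingDegree_of_coeff_zero (coeff_zero_ne_zero h), h]

theorem natDegree_reverse {Q : ℂ[X]} (h : Q.coeff 0 ≠ 0) :
    Q.reverse.natDegree = Q.natDegree := by
  rw [Polynomial.reverse_natDegree, natTrailingDegree_of_coeff_zero h, Nat.sub_zero]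

theorem reverse_reverse {Q : ℂ[X]} (h : Q.coeff 0 ≠ 0) : Q.reverse.reverse = Q := by
  rw [Polynomial.reverse, natDegree_reverse h, Polynomial.reverse, Polynomial.reflect_reflect]

theorem dvd_of_reverse_dvd {Q₁ Q₂ : ℂ[X]} (h₁ : Q₁.coeff 0 = 1) (h₂ : Q₂.coeff 0 = 1)
    (h : Q₁.reverse ∣ Q₂.reverse) : Q₁ ∣ Q₂ := by
  obtain ⟨s, hs⟩ := h
  rw [← reverse_reverse (coeff_zero_ne_zero h₂), hs, Polynomial.reverse_mul_of_domain,
    reverse_reverse (coeff_zero_ne_zero h₁)]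
  exact dvd_mul_right _ _

theorem exists_prod_eq {P : ℂ[X]} (h : P.coeff 0 = 1) :
    ∃ b : Fin P.natDegree → ℂˣ, P = ∏ r, (1 - Polynomial.C (b r : ℂ) * Polynomial.X) := by
  have hs : P.reverse.Splits := IsAlgClosed.splits _
  have hm := reverse_monic h
  have hcard : P.reverse.roots.card = P.natDegree := by
    rw [← hs.natDegree_eq_card_roots, natDegree_reverse (coeff_zero_ne_zero h)]
  obtain ⟨l, hl⟩ : ∃ l : List ℂ, P.reverse.roots = (l : Multiset ℂ) := ⟨_, (Multiset.coe_toList _).symm⟩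
  have hlen : l.length = P.natDegree := by rw [← hcard, hl]; rfl
  have hprod : P.reverse = ∏ r : Fin l.length, (Polynomial.X - Polynomial.C (l.get r)) := by
    conv_lhs => rw [hs.eq_prod_roots_of_monic hm, hl, Multiset.map_coe, Multiset.prod_coe]
    rw [← List.prod_ofFn]
    congr 1
    apply List.ext_get <;> simp
  have h0 : ∀ r, l.get r ≠ 0 := by
    intro r h0
    have : P.reverse.coeff 0 = 0 := by
      rw [Polynomial.coeff_zero_eq_eval_zero, hprod, Polynomial.eval_prod]
      exact Finset.prod_eq_zero (Finset.mem_univ r) (by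
        rw [Polynomial.eval_sub, Polynomial.eval_X, Polynomial.eval_C, h0, sub_zero])
    rw [Polynomial.coeff_zero_reverse, Polynomial.leadingCoeff_eq_zero] at this
    rw [this] at h
    simp at h
  have hrev : ∀ S : Finset (Fin l.length),
      (∏ r ∈ S, (Polynomial.X - Polynomial.C (l.get r))).reverse =
        ∏ r ∈ S, (1 - Polynomial.C (l.get r) * Polynomial.X) := by
    intro S
    induction S using Finset.induction with
    | empty => simpa using Polynomial.reverse_C (1 : ℂ)
    | insert a S ha ih =>
      rw [Finset.prod_insert ha, Finset.prod_insert ha, Polynomial.reverse_mul_of_domain, ih]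
      congr 1
      rw [Polynomial.reverse, Polynomial.natDegree_X_sub_C, Polynomial.reflect_sub,
        Polynomial.reflect_one_X, Polynomial.reflect_C, pow_one]
  refine ⟨fun r => Units.mk0 (l.get (Fin.cast hlen.symm r)) (h0 _), ?_⟩
  refine (reverse_reverse (coeff_zero_ne_zero h)).symm.trans ?_
  rw [hprod, hrev, ← Equiv.prod_comp (finCongr hlen)]
  rfl

theorem exists_sequence {R : ℂ[X]} (hR : R.Monic) (h0 : R.coeff 0 ≠ 0) (hd : R.natDegree ≠ 0) :
    ∃ g : ℤ → ℂ, g 0 = 1 ∧ ∀ p, Polynomial.aeval shift p g = 0 ↔ R ∣ p := by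
  have hdeg : R.natDegree = R.natDegree - 1 + 1 := by omega
  set d := R.natDegree - 1
  have hunit : IsUnit (AdjoinRoot.root R) := by
    have h : R = Polynomial.X * R.divX + Polynomial.C (R.coeff 0) :=
      (Polynomial.X_mul_divX_add R).symm
    have h1 : AdjoinRoot.root R * AdjoinRoot.mk R (-R.divX * Polynomial.C (R.coeff 0)⁻¹) = 1 := by
      rw [← AdjoinRoot.mk_X, ← map_mul, ← map_one (AdjoinRoot.mk R), AdjoinRoot.mk_eq_mk]
      refine ⟨-Polynomial.C (R.coeff 0)⁻¹, ?_⟩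
      have h2 : Polynomial.C (R.coeff 0) * Polynomial.C (R.coeff 0)⁻¹ = 1 := by
        rw [← Polynomial.C_mul, mul_inv_cancel₀ h0, Polynomial.C_1]
      linear_combination Polynomial.C (R.coeff 0)⁻¹ * h + h2
    exact IsUnit.of_mul_eq_one _ h1
  obtain ⟨x, hx⟩ := hunit
  let φ : AdjoinRoot R →ₗ[ℂ] ℂ := Polynomial.lcoeff ℂ d ∘ₗ AdjoinRoot.modByMonicHom hR
  have hφ : ∀ p, φ (AdjoinRoot.mk R p) = (p %ₘ R).coeff d := by
    intro p
    change (AdjoinRoot.modByMonicHom hR (AdjoinRoot.mk R p)).coeff d = _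
    rw [AdjoinRoot.modByMonicHom_mk]
  have hpow : ∀ n : ℕ, ((x ^ (n : ℤ) : (AdjoinRoot R)ˣ) : AdjoinRoot R) =
      AdjoinRoot.mk R (Polynomial.X ^ n) := by
    intro n
    rw [zpow_natCast, Units.val_pow_eq_pow_val, hx, map_pow, AdjoinRoot.mk_X]
  have hlt : ∀ p : ℂ[X], p.natDegree ≤ d → p %ₘ R = p := by
    intro p hp
    refine (Polynomial.modByMonic_eq_self_iff hR).mpr (Polynomial.degree_lt_degree ?_)
    omega
  have hact : ∀ p m, Polynomial.aeval shift p
      (fun n => φ ((x ^ (n + d) : (AdjoinRoot R)ˣ) : AdjoinRoot R)) m =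
        φ (AdjoinRoot.mk R p * ((x ^ (m + d) : (AdjoinRoot R)ˣ) : AdjoinRoot R)) := by
    intro p m
    rw [aeval_shift_apply]
    conv_rhs => rw [p.as_sum_support, map_sum, Finset.sum_mul, map_sum]
    refine Finset.sum_congr rfl fun s _ => ?_
    rw [← Polynomial.C_mul_X_pow_eq_monomial, map_mul (AdjoinRoot.mk R), ← hpow, mul_assoc, ← Units.val_mul,
      ← zpow_add, AdjoinRoot.mk_C, ← AdjoinRoot.algebraMap_eq, ← Algebra.smul_def, map_smul,
      smul_eq_mul, show (s : ℤ) + (m + d) = m + s + d by ring]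
  refine ⟨fun n => φ ((x ^ (n + d) : (AdjoinRoot R)ˣ) : AdjoinRoot R), ?_, fun p => ⟨fun h => ?_,
    fun h => ?_⟩⟩
  · simp only [zero_add]
    rw [hpow, hφ, hlt _ (by simp)]
    simp
  · rw [← AdjoinRoot.mk_eq_zero]
    have hmod : AdjoinRoot.mk R p = AdjoinRoot.mk R (p %ₘ R) := by
      rw [AdjoinRoot.mk_eq_mk, Polynomial.modByMonic_eq_sub_mul_div]
      simp
    set r := p %ₘ R
    by_contra hr
    have hr0 : r ≠ 0 := by
      rintro e
      rw [hmod, e, map_zero] at hr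
      exact hr rfl
    have hrd : r.natDegree < R.natDegree := by
      refine Polynomial.natDegree_modByMonic_lt p hR ?_
      rintro rfl
      simp at hd
    have h1 := congrFun h (-(r.natDegree : ℤ))
    rw [hact, hmod, show -(r.natDegree : ℤ) + d = ((d - r.natDegree : ℕ) : ℤ) by omega, hpow,
      ← map_mul, hφ, hlt, Polynomial.coeff_mul_X_pow', if_pos (by omega)] at h1
    · rw [show d - (d - r.natDegree) = r.natDegree by omega] at h1
      exact hr0 (Polynomial.leadingCoeff_eq_zero.mp h1)
    · refine Polynomial.natDegree_mul_le.trans ?_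
      rw [Polynomial.natDegree_X_pow]
      omega
  · funext m
    rw [hact, AdjoinRoot.mk_eq_zero.mpr h, zero_mul, map_zero]
    rfl

/-- The action of Laurent polynomials in the shift. -/
theorem sum_shift_eq_zero {f g : ℤ → ℂ} (h : ∀ p : ℂ[X], Polynomial.aeval shift p g = 0 →
    Polynomial.aeval shift p f = 0) (S : Finset ℤ) (r : ℤ → ℂ)
    (hg : ∀ m, ∑ s ∈ S, r s * g (m + s) = 0) (m : ℤ) : ∑ s ∈ S, r s * f (m + s) = 0 := by
  obtain ⟨n, hn⟩ : ∃ n : ℕ, ∀ s ∈ S, 0 ≤ s + n := by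
    obtain ⟨b, hb⟩ := S.bddBelow
    exact ⟨b.natAbs, fun s hs => by have := hb hs; omega⟩
  have key : ∀ e : ℤ → ℂ, ∀ m, Polynomial.aeval shift
      (∑ s ∈ S, Polynomial.monomial (s + n).toNat (r s)) e (m - n) = ∑ s ∈ S, r s * e (m + s) := by
    intro e m
    rw [map_sum, LinearMap.sum_apply, Finset.sum_apply]
    refine Finset.sum_congr rfl fun s hs => ?_
    rw [aeval_shift_apply, Polynomial.sum_monomial_index _ _ (by simp), Int.toNat_of_nonneg (hn s hs)]
    congr 2
    ring
  rw [← key, h]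
  · rfl
  · funext m
    have := key g (m + n)
    rw [add_sub_cancel_right] at this
    rw [this, hg]
    rfl

end Sequences

end QAffine

end

noncomputable section
set_option linter.unusedSectionVars false
namespace QAffine

/-! ## Highest weights over a base ring -/

section HighestWeight

variable (q : ℂ) {M N : ℕ} {A : Type*} [CommRing A] [Algebra ℂ A] (ϖ : CartanWeight M N A)

/-- The exponent of the eigenvalue of `φ_i^ε` on the vector of highest weight. -/
def hwExp (ε : ℤˣ) (i : Node M N) : PowerSeries A :=
  PowerSeries.mk fun s : ℕ =>
    if s = 0 then 0
    else (((ε : ℤ) : ℂ) * (qi q M i - (qi q M i)⁻¹)) • ϖ.η i ((ε : ℤ) * (s : ℤ))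

/-- The eigenvalue of `φ_i^ε` on the vector of highest weight. -/
def hwSeries (ε : ℤˣ) (i : Node M N) : PowerSeries A :=
  PowerSeries.C ((ϖ.c i ^ (ε : ℤ) : Aˣ) : A) * expSeries (hwExp q ϖ ε i)

/-- The coefficient of `z^n` in the eigenvalue of `φ_i^ε`. -/
def hwCoeff (ε : ℤˣ) (i : Node M N) (n : ℤ) : A :=
  (HahnSeries.ofPowerSeries ℤ A (hwSeries q ϖ ε i)).coeff ((ε : ℤ) * n)

theorem phiOp_nil (ε : ℤˣ) (i : Node M N) (n : ℤ) :
    phiOp q ϖ ε i n (word []) = hwCoeff q ϖ ε i n • word [] := by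
  rw [hwCoeff, ofPowerSeries_coeff, phiOp]
  split_ifs with h
  · let e : Module.End A (FreeVerma M N A) →ₗ[ℂ] FreeVerma M N A :=
      { toFun := fun T => T (word [])
        map_add' := fun _ _ => rfl
        map_smul' := fun _ _ => rfl }
    have he : ∀ (a : Module.End A (FreeVerma M N A)) (s : ℕ),
        e (a * PowerSeries.coeff s (hOpSeries q ϖ ε i)) =
          PowerSeries.coeff s (hwExp q ϖ ε i) • e a := by
      intro a s
      change (a * PowerSeries.coeff s (hOpSeries q ϖ ε i)) (word []) =
        PowerSeries.coeff s (hwExp q ϖ ε i) • a (word [])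
      rw [hOpSeries, hwExp, PowerSeries.coeff_mk, PowerSeries.coeff_mk]
      split_ifs
      · simp
      · rw [Module.End.mul_apply, LinearMap.smul_apply, hOp_nil, LinearMap.map_smul_of_tower,
          map_smul, smul_assoc]
    have h1 := expCoeff_eigen_right e (hOpSeries q ϖ ε i) (hwExp q ϖ ε i) he ((ε : ℤ) * n).toNat
    change expCoeff (hOpSeries q ϖ ε i) ((ε : ℤ) * n).toNat (word []) =
      expCoeff (hwExp q ϖ ε i) ((ε : ℤ) * n).toNat • word [] at h1
    rw [Module.End.mul_apply, h1, map_smul, kOp_word, hwSeries, PowerSeries.coeff_C_mul,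
      coeff_expSeries, smul_smul]
    congr 1
    simp [wordWt, mul_comm]
  · simp

theorem phiOp_apply_nil (hq0 : q ≠ 0) (ε : ℤˣ) (i : Node M N) (n : ℤ) (y : FreeVerma M N A) :
    phiOp q ϖ ε i n y [] = hwCoeff q ϖ ε i n * y [] := by
  rw [← pairing_nil q ϖ, ← pairing_phiOp q ϖ hq0, phiOp_nil, map_smul, LinearMap.smul_apply,
    pairing_nil, smul_eq_mul]

theorem phiValue_empty {ι B : Type*} [Fintype ι] [DecidableEq ι] [CommRing B] [Algebra ℂ B]
    [Algebra A B] [IsScalarTower ℂ A B] (col : ι → ℕ) (z : ι → Bˣ) (ε : ℤˣ) (i : Node M N) :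
    phiValue q ϖ col z ε i ∅ = PowerSeries.map (algebraMap A B) (hwSeries q ϖ ε i) := by
  rw [hwSeries, phiValue, map_mul, PowerSeries.map_C, kValue, Finset.prod_empty, mul_one]
  congr 1
  ext n
  have h := map_expCoeff (IsScalarTower.toAlgHom ℂ A B) (hwExp q ϖ ε i) n
  rw [PowerSeries.coeff_map, coeff_expSeries, coeff_expSeries]
  refine Eq.trans ?_ h.symm
  congr 1
  ext s
  rw [hValueSeries, PowerSeries.coeff_mk, PowerSeries.coeff_map, hwExp, PowerSeries.coeff_mk]
  split_ifs
  · simp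
  · rw [hValue, Finset.sum_empty, sub_zero]
    exact (map_smul (IsScalarTower.toAlgHom ℂ A B) _ _).symm

theorem exists_hwSeries_eq (hq2 : q - q⁻¹ ≠ 0) (c : Node M N → Aˣ)
    (Θ : ℤˣ → Node M N → PowerSeries A)
    (h : ∀ ε i, PowerSeries.coeff 0 (Θ ε i) = ((c i ^ (ε : ℤ) : Aˣ) : A)) :
    ∃ ϖ : CartanWeight M N A, ϖ.c = c ∧ ∀ ε i, hwSeries q ϖ ε i = Θ ε i := by
  choose g hg using fun (ε : ℤˣ) (i : Node M N) => exists_expCoeff_eq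
    (fun n => (((c i ^ (ε : ℤ))⁻¹ : Aˣ) : A) * PowerSeries.coeff n (Θ ε i))
    (by rw [h, Units.inv_mul])
  refine ⟨⟨c, fun i s => if 0 < s then (qi q M i - (qi q M i)⁻¹)⁻¹ • g 1 i s.toNat
    else -((qi q M i - (qi q M i)⁻¹)⁻¹ • g (-1) i (-s).toNat)⟩, rfl, fun ε i => ?_⟩
  have hne := qi_sub_inv_ne_zero (q := q) (M := M) hq2 i
  have hexp : hwExp q (⟨c, fun i s => if 0 < s then (qi q M i - (qi q M i)⁻¹)⁻¹ • g 1 i s.toNat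
      else -((qi q M i - (qi q M i)⁻¹)⁻¹ • g (-1) i (-s).toNat)⟩ : CartanWeight M N A) ε i =
      PowerSeries.mk fun s => if s = 0 then 0 else g ε i s := by
    ext s
    rw [hwExp, PowerSeries.coeff_mk, PowerSeries.coeff_mk]
    split_ifs with hs
    · rfl
    rcases Int.units_eq_one_or ε with rfl | rfl
    · dsimp only
      rw [if_pos (by simp; omega)]
      simp [smul_smul, mul_inv_cancel₀ hne]
    · dsimp only
      rw [if_neg (by simp)]
      simp only [Units.val_neg, Units.val_one, Int.cast_neg, Int.cast_one, neg_mul, one_mul,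
        neg_neg, Int.toNat_natCast, smul_neg, neg_smul, smul_smul, mul_inv_cancel₀ hne, one_smul]
  ext n
  rw [hwSeries, hexp, PowerSeries.coeff_C_mul, coeff_expSeries, hg, Units.mul_inv_cancel_left]

/-- The eigenvalue of `X_{M,m}^+ X_{M,n}^-`. -/
def oddCoeff (i : Node M N) (n : ℤ) : A :=
  (qi q M i - (qi q M i)⁻¹)⁻¹ • (hwCoeff q ϖ 1 i n - hwCoeff q ϖ (-1) i n)

theorem raiseOp_lower (i j : Node M N) (m n : ℤ) :
    raiseOp q ϖ i m (word [(j, n)]) =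
      if j = i then oddCoeff q ϖ i (m + n) • word [] else (0 : FreeVerma M N A) := by
  rw [← consOp_word, raiseOp_consOp, raiseOp_nil, map_zero, smul_zero, zero_add]
  refine if_congr Iff.rfl ?_ rfl
  rw [phiOp_nil, phiOp_nil, ← sub_smul, oddCoeff, smul_assoc]

theorem raiseOp_apply_nil (hq0 : q ≠ 0) (i : Node M N) (y : FreeVerma M N A) :
    ∃ G : ℤ →₀ A, ∀ m, raiseOp q ϖ i m y [] = G.sum fun s a => a * oddCoeff q ϖ i (m + s) := by
  induction y using Finsupp.induction_linear with
  | zero => exact ⟨0, by simp⟩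
  | add y₁ y₂ h₁ h₂ =>
    obtain ⟨G₁, h₁⟩ := h₁
    obtain ⟨G₂, h₂⟩ := h₂
    refine ⟨G₁ + G₂, fun m => ?_⟩
    rw [map_add, Finsupp.add_apply, h₁, h₂, Finsupp.sum_add_index' (by simp)
      (by intros; rw [add_mul])]
  | single w a =>
    have hw : (Finsupp.single w a : FreeVerma M N A) = a • word w := by simp
    rw [hw]
    match w with
    | [] => exact ⟨0, fun m => by rw [map_smul, raiseOp_nil]; simp⟩
    | [x] =>
      refine ⟨if x.1 = i then Finsupp.single x.2 a else 0, fun m => ?_⟩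
      rw [map_smul, raiseOp_lower]
      split_ifs <;> simp
    | x :: x' :: l =>
      refine ⟨0, fun m => ?_⟩
      have h0 : ∀ ε n, phiOp q ϖ ε i n (word (x' :: l)) [] = (0 : A) := by
        intro ε n
        rw [phiOp_apply_nil q ϖ hq0]
        simp
      rw [map_smul, ← consOp_word, raiseOp_consOp, Finsupp.smul_apply, Finsupp.add_apply,
        Finsupp.smul_apply, consOp_apply_nil]
      split_ifs <;> simp [h0]

theorem sum_lower_mem_radical (i : Node M N) (d : ℕ) (a : ℕ → ℂ)
    (h : ∀ m, ∑ s ∈ Finset.range d, a s • oddCoeff q ϖ i (m + s) = 0) :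
    ∑ s ∈ Finset.range d, a s • (word [(i, (s : ℤ))] : FreeVerma M N A) ∈ radical q ϖ := by
  rw [mem_radical]
  intro w
  induction w using Finsupp.induction_linear with
  | zero => simp
  | add w₁ w₂ h₁ h₂ => rw [map_add, LinearMap.add_apply, h₁, h₂, add_zero]
  | single w b =>
    have hw : (Finsupp.single w b : FreeVerma M N A) = b • word w := by simp
    rw [hw, map_smul, LinearMap.smul_apply]
    match w with
    | [] =>
      rw [pairing_nil, Finsupp.finsetSum_apply, Finset.sum_eq_zero, smul_zero]
      intro s _
      simp
    | x :: l =>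
      rw [← consOp_word, pairing_consOp, map_sum]
      simp only [LinearMap.map_smul_of_tower, raiseOp_lower]
      by_cases hx : i = x.1
      · subst hx
        simp only [if_true, ← smul_assoc, ← Finset.sum_smul, h, zero_smul, map_zero, smul_zero]
      · simp [if_neg hx]

end HighestWeight

end QAffine

end

noncomputable section
set_option linter.unusedSectionVars false
namespace QAffine

/-! ## Deformations of highest weights -/

section Products

/-- A product of values `(p - p⁻¹ a z) / (1 - a z)`. -/
def evalSeries {A ι : Type*} [CommRing A] [Fintype ι] (p p' : A) (a : ι → A) : PowerSeries A :=
  (∏ r, (PowerSeries.C p - PowerSeries.C (p' * a r) * PowerSeries.X)) *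
    PowerSeries.invOfUnit (∏ r, (1 - PowerSeries.C (a r) * PowerSeries.X)) 1

theorem evalSeries_mul {A ι : Type*} [CommRing A] [Fintype ι] (p p' : A) (a : ι → A) :
    evalSeries p p' a * ∏ r, (1 - PowerSeries.C (a r) * PowerSeries.X) =
      ∏ r, (PowerSeries.C p - PowerSeries.C (p' * a r) * PowerSeries.X) := by
  rw [evalSeries, mul_assoc, PowerSeries.invOfUnit_mul _ _ (by simp [map_prod]), mul_one]

theorem coeff_zero_evalSeries {A ι : Type*} [CommRing A] [Fintype ι] (p p' : A) (a : ι → A) :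
    PowerSeries.coeff 0 (evalSeries p p' a) = p ^ Fintype.card ι := by
  have h := congrArg (PowerSeries.coeff 0) (evalSeries_mul p p' a)
  simpa [map_prod] using h

theorem rescale_prod {n : ℕ} (p : ℂ) (b : Fin n → ℂ) :
    rescale p (∏ r, (1 - Polynomial.C (b r) * Polynomial.X)) =
      ∏ r, (1 - Polynomial.C (p * b r) * Polynomial.X) := by
  rw [rescale, Polynomial.prod_comp]
  refine Finset.prod_congr rfl fun r _ => ?_
  simp only [Polynomial.sub_comp, Polynomial.one_comp, Polynomial.mul_comp, Polynomial.C_comp,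
    Polynomial.X_comp, Polynomial.C_mul]
  ring

theorem coe_prod {n : ℕ} (b : Fin n → ℂ) :
    ((∏ r, (1 - Polynomial.C (b r) * Polynomial.X) : ℂ[X]) : PowerSeries ℂ) =
      ∏ r, (1 - PowerSeries.C (b r) * PowerSeries.X) := by
  rw [← Polynomial.coeToPowerSeries.ringHom_apply, map_prod]
  simp

theorem reverse_prod {n : ℕ} {b : Fin n → ℂ} (hb : ∀ r, b r ≠ 0) :
    (∏ r, (1 - Polynomial.C (b r) * Polynomial.X)).reverse =
      ∏ r, (Polynomial.X - Polynomial.C (b r)) := by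
  induction (Finset.univ : Finset (Fin n)) using Finset.induction with
  | empty => simpa using Polynomial.reverse_C (1 : ℂ)
  | insert a S ha ih =>
    rw [Finset.prod_insert ha, Finset.prod_insert ha, Polynomial.reverse_mul_of_domain, ih]
    congr 1
    have h1 : (1 - Polynomial.C (b a) * Polynomial.X).natDegree = 1 := by
      rw [sub_eq_neg_add, ← neg_mul, ← Polynomial.C_neg, ← Polynomial.C_1]
      exact Polynomial.natDegree_linear (neg_ne_zero.mpr (hb a))
    rw [Polynomial.reverse, h1, Polynomial.reflect_sub, Polynomial.reflect_one,
      Polynomial.reflect_C_mul, Polynomial.reflect_one_X, pow_one, mul_one]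

theorem evenWeightZero_eq {P : ℂ[X]} {p : ℂ} {b : Fin P.natDegree → ℂˣ}
    (hP : P = ∏ r, (1 - Polynomial.C (b r : ℂ) * Polynomial.X)) {F : PowerSeries ℂ}
    (hF : F * ∏ r, (1 - PowerSeries.C (p * b r) * PowerSeries.X) =
      ∏ r, (PowerSeries.C p - PowerSeries.C (p⁻¹ * (p * b r)) * PowerSeries.X)) :
    F = evenWeightZero p P := by
  have h1 : ((rescale p P : ℂ[X]) : PowerSeries ℂ) =
      ∏ r, (1 - PowerSeries.C (p * b r) * PowerSeries.X) := by
    conv_lhs => rw [hP]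
    rw [rescale_prod, coe_prod]
  have h2 : ((rescale p⁻¹ P : ℂ[X]) : PowerSeries ℂ) =
      ∏ r, (1 - PowerSeries.C (p⁻¹ * b r) * PowerSeries.X) := by
    conv_lhs => rw [hP]
    rw [rescale_prod, coe_prod]
  have h3 : PowerSeries.constantCoeff ((rescale p P : ℂ[X]) : PowerSeries ℂ) ≠ 0 := by
    rw [h1]
    simp [map_prod]
  rw [evenWeightZero, PowerSeries.eq_mul_inv_iff_mul_eq h3, h1, hF, h2]
  have h5 : PowerSeries.C (p ^ P.natDegree) = ∏ _r : Fin P.natDegree, PowerSeries.C p := by simp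
  rw [h5, ← Finset.prod_mul_distrib]
  refine Finset.prod_congr rfl fun r _ => ?_
  rw [mul_sub, mul_one, ← mul_assoc (PowerSeries.C p), ← map_mul, mul_left_comm p⁻¹ p]

theorem evenWeightInfty_eq {P : ℂ[X]} {p : ℂ} (hp : p ≠ 0) {b : Fin P.natDegree → ℂˣ}
    (hP : P = ∏ r, (1 - Polynomial.C (b r : ℂ) * Polynomial.X)) {F : PowerSeries ℂ}
    (hF : F * ∏ r, (1 - PowerSeries.C (p * b r)⁻¹ * PowerSeries.X) =
      ∏ r, (PowerSeries.C p⁻¹ - PowerSeries.C (p * (p * b r)⁻¹) * PowerSeries.X)) :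
    F = evenWeightInfty p P := by
  have hb : ∀ r, (b r : ℂ) ≠ 0 := fun r => (b r).ne_zero
  have hX : ∀ c : Fin P.natDegree → ℂ,
      ((∏ r, (Polynomial.X - Polynomial.C (c r)) : ℂ[X]) : PowerSeries ℂ) =
      ∏ r, (PowerSeries.X - PowerSeries.C (c r)) := by
    intro c
    rw [← Polynomial.coeToPowerSeries.ringHom_apply, map_prod]
    simp
  have h1 : (((rescale p P).reverse : ℂ[X]) : PowerSeries ℂ) =
      ∏ r, (PowerSeries.X - PowerSeries.C (p * b r)) := by
    conv_lhs => rw [hP]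
    rw [rescale_prod, reverse_prod fun r => mul_ne_zero hp (hb r), hX]
  have h2 : (((rescale p⁻¹ P).reverse : ℂ[X]) : PowerSeries ℂ) =
      ∏ r, (PowerSeries.X - PowerSeries.C (p⁻¹ * b r)) := by
    conv_lhs => rw [hP]
    rw [rescale_prod, reverse_prod fun r => mul_ne_zero (inv_ne_zero hp) (hb r), hX]
  have h3 : PowerSeries.constantCoeff (((rescale p P).reverse : ℂ[X]) : PowerSeries ℂ) ≠ 0 := by
    rw [h1]
    simp [map_prod, Finset.prod_ne_zero_iff, hp]
  rw [evenWeightInfty, PowerSeries.eq_mul_inv_iff_mul_eq h3, h1, h2]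
  have h4 : ∀ r, (PowerSeries.X - PowerSeries.C (p * (b r : ℂ))) =
      PowerSeries.C (-(p * (b r : ℂ))) * (1 - PowerSeries.C (p * (b r : ℂ))⁻¹ * PowerSeries.X) := by
    intro r
    rw [mul_sub, mul_one, ← mul_assoc, ← map_mul, neg_mul,
      mul_inv_cancel₀ (mul_ne_zero hp (hb r)), map_neg, map_neg, map_one]
    ring
  rw [Finset.prod_congr rfl fun r _ => h4 r, Finset.prod_mul_distrib, mul_left_comm, hF,
    ← Finset.prod_mul_distrib]
  have h5 : PowerSeries.C (p ^ P.natDegree) = ∏ _r : Fin P.natDegree, PowerSeries.C p := by simp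
  rw [h5, ← Finset.prod_mul_distrib]
  refine Finset.prod_congr rfl fun r _ => ?_
  rw [mul_sub, mul_sub, ← mul_assoc, ← map_mul, ← map_mul, ← map_mul,
    show -(p * (b r : ℂ)) * p⁻¹ = -(p * (p⁻¹ * b r)) by ring,
    show -(p * (b r : ℂ)) * (p * (p * b r)⁻¹) = -p by field_simp [hb r], map_neg, map_neg]
  ring

end Products

section Deformation

universe u

variable (q : ℂ) {M N : ℕ} {A : Type u} [CommRing A] [Algebra ℂ A] (ϖ : CartanWeight M N A)
  (w : HW M N) (ev : A →ₐ[ℂ] ℂ)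

/-- The weight `ϖ` over `A` specializes to `w`. -/
structure IsSpecialization : Prop where
  evenZero (i : Node M N) (hi : (i : ℕ) ≠ M) :
    PowerSeries.map (ev : A →+* ℂ) (hwSeries q ϖ 1 i) = evenWeightZero (qi q M i) (w.P ⟨i, hi⟩)
  evenInfty (i : Node M N) (hi : (i : ℕ) ≠ M) :
    PowerSeries.map (ev : A →+* ℂ) (hwSeries q ϖ (-1) i) =
      evenWeightInfty (qi q M i) (w.P ⟨i, hi⟩)
  oddK (i : Node M N) (hi : (i : ℕ) = M) : ev (ϖ.c i) = w.c
  oddPhi (i : Node M N) (hi : (i : ℕ) = M) (n : ℤ) : ev (oddCoeff q ϖ i n) = w.f n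

variable {q ϖ w ev}

theorem simpleRep_phi (hq0 : q ≠ 0) (hq2 : q - q⁻¹ ≠ 0) (ε : ℤˣ) (i : Node M N) (n : ℤ) :
    simpleRep ϖ hq0 hq2 (phi q ε i n) (Submodule.Quotient.mk (word [])) =
      hwCoeff q ϖ ε i n • Submodule.Quotient.mk (word []) := by
  rw [phi, simpleRep_mkU, freeRep_phi, phiOp_nil, Submodule.Quotient.mk_smul]

theorem IsSpecialization.exists_eq_smul (h : IsSpecialization q ϖ w ev) (hq0 : q ≠ 0)
    (hq2 : q - q⁻¹ ≠ 0) {δ : A} (hδ : ∀ a, ev a = 0 → δ ∣ a) {x : U q M N}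
    (hx : VermaRel q w x) :
    ∃ y, simpleRep ϖ hq0 hq2 x (Submodule.Quotient.mk (word [])) = δ • y := by
  have key : ∀ (z : U q M N) (a : A) (r : ℂ),
      simpleRep ϖ hq0 hq2 z (Submodule.Quotient.mk (word [])) =
        a • Submodule.Quotient.mk (word []) → ev a = r →
      ∃ y, simpleRep ϖ hq0 hq2 (z - algebraMap ℂ _ r) (Submodule.Quotient.mk (word [])) =
        δ • y := by
    intro z a r hz hr
    obtain ⟨b, hb⟩ := hδ (a - algebraMap ℂ A r) (by rw [map_sub, hr, AlgHom.commutes]; simp)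
    refine ⟨b • Submodule.Quotient.mk (word []), ?_⟩
    rw [map_sub, LinearMap.sub_apply, hz, AlgHom.commutes, Module.algebraMap_end_apply,
      ← algebraMap_smul A r, ← sub_smul, hb, mul_smul]
  cases hx with
  | raise i n =>
    refine ⟨0, ?_⟩
    rw [X, simpleRep_mkU, freeRep_X_one, raiseOp_nil, smul_zero]
    rfl
  | evenZero i hi n =>
    refine key _ _ _ (simpleRep_phi hq0 hq2 1 i n) ?_
    rw [hwCoeff, ofPowerSeries_coeff, ← h.evenZero i hi, PowerSeries.coeff_map, if_pos (by simp)]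
    simp
  | evenInfty i hi n =>
    refine key _ _ _ (simpleRep_phi hq0 hq2 (-1) i (-(n : ℤ))) ?_
    rw [hwCoeff, ofPowerSeries_coeff, ← h.evenInfty i hi, PowerSeries.coeff_map, if_pos (by simp)]
    simp
  | oddK i hi =>
    refine key _ (ϖ.c i) _ ?_ (h.oddK i hi)
    rw [K, simpleRep_mkU, freeRep_K, kOp_word, Submodule.Quotient.mk_smul]
    simp [wordWt]
  | oddPhi i hi n =>
    refine key _ (oddCoeff q ϖ i n) _ ?_ (h.oddPhi i hi n)
    rw [map_smul, map_sub, LinearMap.smul_apply, LinearMap.sub_apply, simpleRep_phi, simpleRep_phi,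
      ← sub_smul, oddCoeff, ← smul_assoc, hi, qi, ell, if_pos le_rfl, zpow_one]

theorem exists_eq_smul_of_mem_weylIdeal (h : IsSpecialization q ϖ w ev) (hq0 : q ≠ 0)
    (hq2 : q - q⁻¹ ≠ 0) {δ : A} (hδ : ∀ a, ev a = 0 → δ ∣ a) {Q : ℂ[X]}
    (heven : ∀ (i : Node M N) (hi : (i : ℕ) ≠ M),
      (consOp (i, 0) ^ (1 + (w.P ⟨i, hi⟩).natDegree) : Module.End A (FreeVerma M N A)) (word []) ∈
        radical q ϖ)
    (hodd : ∀ (i : Node M N), (i : ℕ) = M → ∀ m, ∑ s ∈ Finset.range (Q.natDegree + 1),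
      Q.coeff (Q.natDegree - s) • oddCoeff q ϖ i (m + s) = 0)
    {x : U q M N} (hx : x ∈ weylIdeal q w Q) :
    ∃ y, simpleRep ϖ hq0 hq2 x (Submodule.Quotient.mk (word [])) = δ • y := by
  induction hx using Submodule.span_induction with
  | mem x hx =>
    rcases hx with hx | hx
    · exact h.exists_eq_smul hq0 hq2 hδ hx
    · refine ⟨0, ?_⟩
      rw [smul_zero]
      cases hx with
      | even i hi =>
        rw [X, ← map_pow, simpleRep_mkU, Submodule.Quotient.mk_eq_zero, map_pow, freeRep_X_neg]
        exact heven i hi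
      | odd i hi =>
        have h1 := sum_lower_mem_radical q ϖ i (Q.natDegree + 1)
          (fun s => Q.coeff (Q.natDegree - s)) (hodd i hi)
        have h2 : (∑ s ∈ Finset.range (Q.natDegree + 1),
            Q.coeff (Q.natDegree - s) • X q (-1) i s : U q M N) =
            mkU q M N (∑ s ∈ Finset.range (Q.natDegree + 1),
              Q.coeff (Q.natDegree - s) • fX (-1) i s) := by
          rw [map_sum]
          simp only [map_smul]
          rfl
        rw [h2, simpleRep_mkU, Submodule.Quotient.mk_eq_zero, map_sum, LinearMap.sum_apply]
        simpa only [map_smul, freeRep_X_neg, LinearMap.smul_apply, consOp_word] using h1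
  | zero => exact ⟨0, by simp⟩
  | add x x' _ _ hx hx' =>
    obtain ⟨y, hy⟩ := hx
    obtain ⟨y', hy'⟩ := hx'
    exact ⟨y + y', by rw [map_add, LinearMap.add_apply, hy, hy', smul_add]⟩
  | smul u x _ hx =>
    obtain ⟨y, hy⟩ := hx
    exact ⟨simpleRep ϖ hq0 hq2 u y, by
      rw [smul_eq_mul, map_mul, Module.End.mul_apply, hy, map_smul]⟩

theorem exists_sum_eq_of_mem (hq0 : q ≠ 0) (hq2 : q - q⁻¹ ≠ 0) (i : Node M N)
    {δ : A} (d : ℕ) (a : ℕ → ℂ) {y : SimpleHW (q := q) ϖ}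
    (h : simpleRep ϖ hq0 hq2 (∑ s ∈ Finset.range d, a s • X q (-1) i s)
      (Submodule.Quotient.mk (word [])) = δ • y) :
    ∃ G : ℤ →₀ A, ∀ m, ∑ s ∈ Finset.range d, a s • oddCoeff q ϖ i (m + s) =
      δ * G.sum fun s b => b * oddCoeff q ϖ i (m + s) := by
  obtain ⟨y, rfl⟩ := Submodule.Quotient.mk_surjective _ y
  obtain ⟨G, hG⟩ := raiseOp_apply_nil q ϖ hq0 i y
  refine ⟨G, fun m => ?_⟩
  have h2 : (∑ s ∈ Finset.range d, a s • X q (-1) i s : U q M N) =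
      mkU q M N (∑ s ∈ Finset.range d, a s • fX (-1) i s) := by
    rw [map_sum]
    simp only [map_smul]
    rfl
  rw [h2, simpleRep_mkU, ← Submodule.Quotient.mk_smul, Submodule.Quotient.eq, mem_radical] at h
  have h3 := h (word [(i, m)])
  rw [← consOp_word, pairing_consOp, pairing_nil, map_sub, map_sum, LinearMap.sum_apply, map_sum,
    map_smul, Finsupp.sub_apply, Finsupp.smul_apply, hG, Finsupp.finsetSum_apply, sub_eq_zero] at h3
  rw [← smul_eq_mul, ← h3]
  refine Finset.sum_congr rfl fun s _ => ?_
  rw [map_smul, freeRep_X_neg, LinearMap.smul_apply, LinearMap.map_smul_of_tower, consOp_word,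
    raiseOp_lower, if_pos rfl]
  simp

end Deformation

end QAffine

end

noncomputable section
set_option linter.unusedSectionVars false
namespace QAffine

section Laurent

open LaurentPolynomial

/-- The evaluation of Laurent polynomials. -/
def evalL (c : ℂˣ) : ℂ[T;T⁻¹] →ₐ[ℂ] ℂ where
  __ := LaurentPolynomial.eval₂ (RingHom.id ℂ) c
  commutes' r := by
    rw [← LaurentPolynomial.C_eq_algebraMap]
    exact LaurentPolynomial.eval₂_C _ _ _

theorem evalL_T (c : ℂˣ) (n : ℤ) : evalL c (T n) = ((c ^ n : ℂˣ) : ℂ) :=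
  LaurentPolynomial.eval₂_T _ _ _

theorem evalL_C (c : ℂˣ) (r : ℂ) : evalL c (C r) = r := LaurentPolynomial.eval₂_C _ _ _

theorem dvd_of_evalL_eq_zero (c : ℂˣ) {a : ℂ[T;T⁻¹]} (h : evalL c a = 0) :
    T 1 - C (c : ℂ) ∣ a := by
  obtain ⟨n, p, hp⟩ := LaurentPolynomial.exists_T_pow a
  have h1 : p.eval (c : ℂ) = 0 := by
    have h2 : evalL c (Polynomial.toLaurent p) = 0 := by rw [hp, map_mul, h, zero_mul]
    have h3 : evalL c (Polynomial.toLaurent p) = Polynomial.eval₂ (RingHom.id ℂ) (c : ℂ) p :=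
      LaurentPolynomial.eval₂_toLaurent _ _ _
    rwa [h3] at h2
  obtain ⟨r, hr⟩ := Polynomial.dvd_iff_isRoot.mpr h1
  refine ⟨Polynomial.toLaurent r * T (-n), ?_⟩
  rw [← mul_assoc, ← Polynomial.toLaurent_X, ← Polynomial.toLaurent_C, ← map_sub, ← map_mul, ← hr,
    hp, LaurentPolynomial.mul_T_assoc, add_neg_cancel, LaurentPolynomial.T_zero, mul_one]

/-- The unit `r T^n`. -/
def monoL (r : ℂˣ) (n : ℤ) : (ℂ[T;T⁻¹])ˣ where
  val := C (r : ℂ) * T n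
  inv := C ((r⁻¹ : ℂˣ) : ℂ) * T (-n)
  val_inv := by
    rw [mul_mul_mul_comm, ← map_mul, ← LaurentPolynomial.T_add, Units.mul_inv, add_neg_cancel]
    simp
  inv_val := by
    rw [mul_mul_mul_comm, ← map_mul, ← LaurentPolynomial.T_add, Units.inv_mul, neg_add_cancel]
    simp

theorem evalL_monoL (c r : ℂˣ) (n : ℤ) : evalL c (monoL r n : ℂ[T;T⁻¹]) = r * (c ^ n : ℂˣ) := by
  rw [monoL, map_mul, evalL_T, evalL_C]

theorem coeff_C_mul_T (r : ℂ) (n m : ℤ) :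
    (C r * T n : ℂ[T;T⁻¹]).coeff m = if n = m then r else 0 := by
  rw [← LaurentPolynomial.single_eq_C_mul_T]
  exact Finsupp.single_apply

theorem C_mul_T_ne {r s : ℂ} {n m : ℤ} (hr : r ≠ 0) (h : n ≠ m) :
    (C r * T n : ℂ[T;T⁻¹]) ≠ C s * T m := by
  intro e
  have := congrArg (fun a : ℂ[T;T⁻¹] => a.coeff n) e
  simp only [coeff_C_mul_T, if_true, if_neg h.symm] at this
  exact hr this

theorem coeff_mul_T (a : ℂ[T;T⁻¹]) (n m : ℤ) : (a * T n).coeff m = a.coeff (m - n) := by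
  induction a using LaurentPolynomial.induction_on' with
  | add p r hp hr =>
    rw [add_mul]
    exact congrArg₂ (· + ·) hp hr
  | C_mul_T k r =>
    rw [LaurentPolynomial.mul_T_assoc, coeff_C_mul_T, coeff_C_mul_T]
    exact if_congr (by omega) rfl rfl

theorem coeff_mul_C (a : ℂ[T;T⁻¹]) (r : ℂ) (m : ℤ) : (a * C r).coeff m = a.coeff m * r := by
  rw [mul_comm, ← LaurentPolynomial.smul_eq_C_mul, mul_comm]
  rfl

theorem evalL_eq_sum (c : ℂˣ) (a : ℂ[T;T⁻¹]) {S : Finset ℤ} (h : a.coeff.support ⊆ S) :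
    evalL c a = ∑ k ∈ S, a.coeff k * ((c ^ k : ℂˣ) : ℂ) := by
  have h1 : ∀ a : ℂ[T;T⁻¹], evalL c a = a.coeff.sum fun k r => r * ((c ^ k : ℂˣ) : ℂ) := by
    intro a
    induction a using LaurentPolynomial.induction_on' with
    | add p r hp hr =>
      rw [map_add, hp, hr]
      exact (Finsupp.sum_add_index' (by simp) (by intros; rw [add_mul])).symm
    | C_mul_T k r =>
      rw [map_mul, evalL_C, evalL_T, ← LaurentPolynomial.single_eq_C_mul_T]
      exact (Finsupp.sum_single_index (h := fun k r => r * ((c ^ k : ℂˣ) : ℂ)) (zero_mul _)).symm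
  rw [h1]
  exact Finsupp.sum_of_support_subset _ h (fun k r => r * ((c ^ k : ℂˣ) : ℂ))
    fun k _ => zero_mul _

/-- The family of sequences `f + κ (T - T⁻¹ - c + c⁻¹) g`. -/
def pencil (f g : ℤ → ℂ) (c : ℂˣ) (κ : ℂ) (m : ℤ) : ℂ[T;T⁻¹] :=
  C (f m) + (T 1 - T (-1) - C ((c : ℂ) - (c : ℂ)⁻¹)) * C (κ * g m)

theorem evalL_pencil (f g : ℤ → ℂ) (c : ℂˣ) (κ : ℂ) (m : ℤ) :
    evalL c (pencil f g c κ m) = f m := by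
  simp [pencil, evalL_T, evalL_C]

theorem sum_pencil_eq_zero {f g : ℤ → ℂ} (c : ℂˣ) {κ : ℂ} (n : ℕ) (a : ℕ → ℂ)
    (hf : ∀ m, ∑ s ∈ Finset.range n, a s * f (m + s) = 0)
    (hg : ∀ m, ∑ s ∈ Finset.range n, a s * g (m + s) = 0) (m : ℤ) :
    ∑ s ∈ Finset.range n, a s • pencil f g c κ (m + s) = 0 := by
  have h : ∑ s ∈ Finset.range n, a s • pencil f g c κ (m + s) =
      C (∑ s ∈ Finset.range n, a s * f (m + s)) + (T 1 - T (-1) - C ((c : ℂ) - (c : ℂ)⁻¹)) *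
        C (κ * ∑ s ∈ Finset.range n, a s * g (m + s)) := by
    rw [Finset.mul_sum, map_sum, map_sum, Finset.mul_sum, ← Finset.sum_add_distrib]
    refine Finset.sum_congr rfl fun s _ => ?_
    rw [LaurentPolynomial.smul_eq_C_mul, pencil, map_mul, map_mul, map_mul, map_mul]
    ring
  rw [h, hf, hg]
  simp

theorem eval_annihilates {f g : ℤ → ℂ} (hfg : ∀ p : ℂ[X], Polynomial.aeval shift p g = 0 →
    Polynomial.aeval shift p f = 0) (c : ℂˣ) {κ : ℂ} (hκ : κ ≠ 0) (G : ℤ →₀ ℂ[T;T⁻¹])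
    (h : ∀ m, (G.sum fun s a => a * pencil f g c κ (m + s)) = 0) (m : ℤ) :
    (G.sum fun s a => evalL c a * g (m + s)) = 0 := by
  obtain ⟨n, hn⟩ : ∃ n : ℕ, ∀ s ∈ G.support, ∀ k ∈ (G s).coeff.support, |k| ≤ n := by
    refine ⟨∑ s ∈ G.support, ∑ k ∈ (G s).coeff.support, k.natAbs, fun s hs k hk => ?_⟩
    have h1 : k.natAbs ≤ ∑ k ∈ (G s).coeff.support, k.natAbs :=
      Finset.single_le_sum (f := Int.natAbs) (fun _ _ => Nat.zero_le _) hk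
    have h2 : _ ≤ ∑ s ∈ G.support, ∑ k ∈ (G s).coeff.support, k.natAbs :=
      Finset.single_le_sum (f := fun s => ∑ k ∈ (G s).coeff.support, k.natAbs)
        (fun _ _ => Nat.zero_le _) hs
    have := h1.trans h2
    rw [Int.abs_eq_natAbs]
    exact_mod_cast this
  have hout : ∀ s ∈ G.support, ∀ k : ℤ, (n : ℤ) < k → (G s).coeff k = 0 := by
    intro s hs k hk
    by_contra h0
    have := hn s hs k (Finsupp.mem_support_iff.mpr h0)
    have := le_abs_self k
    omega
  have hrec : ∀ k m, (∑ s ∈ G.support, (G s).coeff k * f (m + s)) +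
      κ * ((∑ s ∈ G.support, (G s).coeff (k - 1) * g (m + s)) -
        (∑ s ∈ G.support, (G s).coeff (k + 1) * g (m + s)) -
        ((c : ℂ) - (c : ℂ)⁻¹) * ∑ s ∈ G.support, (G s).coeff k * g (m + s)) = 0 := by
    intro k m
    have h1 := congrArg (fun a : ℂ[T;T⁻¹] => a.coeff k) (h m)
    have hc : ∀ (S : Finset ℤ) (F : ℤ → ℂ[T;T⁻¹]), (∑ s ∈ S, F s).coeff k = ∑ s ∈ S, (F s).coeff k := by
      intro S F
      induction S using Finset.induction with
      | empty => rfl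
      | insert a S ha ih =>
        rw [Finset.sum_insert ha, Finset.sum_insert ha, ← ih]
        rfl
    simp only [Finsupp.sum] at h1
    rw [hc] at h1
    refine Eq.trans ?_ h1
    rw [Finset.mul_sum, ← Finset.sum_sub_distrib, ← Finset.sum_sub_distrib, Finset.mul_sum,
      ← Finset.sum_add_distrib]
    refine Finset.sum_congr rfl fun s _ => ?_
    have h2 : G s * pencil f g c κ (m + s) = G s * C (f (m + s)) + G s * T 1 * C (κ * g (m + s)) -
        G s * T (-1) * C (κ * g (m + s)) -
          G s * C (((c : ℂ) - (c : ℂ)⁻¹) * (κ * g (m + s))) := by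
      rw [pencil, map_mul C ((c : ℂ) - (c : ℂ)⁻¹)]
      ring
    rw [h2]
    change _ = (G s * C (f (m + s))).coeff k + (G s * T 1 * C (κ * g (m + s))).coeff k -
      (G s * T (-1) * C (κ * g (m + s))).coeff k -
        (G s * C (((c : ℂ) - (c : ℂ)⁻¹) * (κ * g (m + s)))).coeff k
    rw [coeff_mul_C, coeff_mul_C, coeff_mul_C, coeff_mul_C, coeff_mul_T, coeff_mul_T, sub_neg_eq_add]
    ring
  have hu : ∀ j : ℕ, ∀ k : ℤ, (n : ℤ) - j < k → ∀ m, ∑ s ∈ G.support, (G s).coeff k * g (m + s) = 0 := by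
    intro j
    induction j with
    | zero =>
      intro k hk m
      refine Finset.sum_eq_zero fun s hs => ?_
      rw [hout s hs k (by simpa using hk), zero_mul]
    | succ j ih =>
      intro k hk m
      have h1 := ih (k + 1) (by push_cast at hk; omega)
      have h2 := ih (k + 2) (by push_cast at hk; omega)
      have h3 := hrec (k + 1) m
      rw [sum_shift_eq_zero hfg G.support (fun s => (G s).coeff (k + 1)) h1, h1,
        show k + 1 + 1 = k + 2 by ring, h2, show k + 1 - 1 = k by ring] at h3
      simpa [hκ] using h3
  have hS : ∀ s ∈ G.support, (G s).coeff.support ⊆ Finset.Icc (-n : ℤ) n := by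
    intro s hs k hk
    have := hn s hs k hk
    rw [abs_le] at this
    exact Finset.mem_Icc.mpr this
  calc (G.sum fun s a => evalL c a * g (m + s))
      = ∑ s ∈ G.support, ∑ k ∈ Finset.Icc (-n : ℤ) n,
          (G s).coeff k * ((c ^ k : ℂˣ) : ℂ) * g (m + s) := by
        refine Finset.sum_congr rfl fun s hs => ?_
        change evalL c (G s) * g (m + s) = _
        rw [evalL_eq_sum c _ (hS s hs), Finset.sum_mul]
    _ = ∑ k ∈ Finset.Icc (-n : ℤ) n, ((c ^ k : ℂˣ) : ℂ) *
          ∑ s ∈ G.support, (G s).coeff k * g (m + s) := by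
        rw [Finset.sum_comm]
        refine Finset.sum_congr rfl fun k _ => ?_
        rw [Finset.mul_sum]
        exact Finset.sum_congr rfl fun s _ => by ring
    _ = 0 := by
        refine Finset.sum_eq_zero fun k hk => ?_
        rw [hu (2 * n + 1) k (by have := (Finset.mem_Icc.mp hk).1; push_cast; omega), mul_zero]

end Laurent

end QAffine

end

noncomputable section
set_option linter.unusedSectionVars false
namespace QAffine

section Specialization

theorem isEvaluationWeight_of_hwSeries {q : ℂ} {M N : ℕ} {A : Type*} [CommRing A]
    [Algebra ℂ A] {ϖ : CartanWeight M N A} {ι K : Type*} [Fintype ι] [DecidableEq ι] [Field K]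
    [Algebra ℂ K] [Algebra A K] [IsScalarTower ℂ A K] {i : Node M N} {a : ι → Aˣ}
    (h : ∀ ε : ℤˣ, hwSeries q ϖ ε i = evalSeries (algebraMap ℂ A (qi q M i ^ (ε : ℤ)))
      (algebraMap ℂ A (qi q M i ^ (-(ε : ℤ)))) fun r => ((a r ^ (ε : ℤ) : Aˣ) : A)) :
    IsEvaluationWeight q ϖ i fun r => Units.map (algebraMap A K : A →* K) (a r) := by
  intro ε
  have h1 := congrArg (PowerSeries.map (algebraMap A K)) (evalSeries_mul
    (algebraMap ℂ A (qi q M i ^ (ε : ℤ))) (algebraMap ℂ A (qi q M i ^ (-(ε : ℤ))))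
    fun r => ((a r ^ (ε : ℤ) : Aˣ) : A))
  rw [← h, map_mul, ← phiValue_empty q ϖ (fun _ => (i : ℕ))
    (fun r => Units.map (algebraMap A K : A →* K) (a r)), map_prod, map_prod] at h1
  have hz : ∀ r, (((Units.map (algebraMap A K : A →* K) (a r)) ^ (ε : ℤ) : Kˣ) : K) =
      algebraMap A K ((a r ^ (ε : ℤ) : Aˣ) : A) := by
    intro r
    rw [← map_zpow]
    rfl
  have hp : algebraMap ℂ K (qi q M i) ^ (ε : ℤ) =
      algebraMap A K (algebraMap ℂ A (qi q M i ^ (ε : ℤ))) := by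
    rw [← IsScalarTower.algebraMap_apply, map_zpow₀]
  have hp' : (algebraMap ℂ K (qi q M i) ^ (ε : ℤ))⁻¹ =
      algebraMap A K (algebraMap ℂ A (qi q M i ^ (-(ε : ℤ)))) := by
    rw [← IsScalarTower.algebraMap_apply, map_zpow₀, zpow_neg]
  simp only [hz, hp']
  simp only [hp]
  simpa only [map_sub, map_mul, map_one, PowerSeries.map_C, PowerSeries.map_X] using h1

open LaurentPolynomial

variable {q : ℂ} {M N : ℕ}

theorem algebraMap_L_injective :
    Function.Injective (algebraMap ℂ[T;T⁻¹] (FractionRing ℂ[T;T⁻¹])) :=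
  IsFractionRing.injective _ _

theorem map_evalSeries {A B ι : Type*} [CommRing A] [CommRing B] [Fintype ι] (φ : A →+* B)
    (p p' : A) (a : ι → A) :
    PowerSeries.map φ (evalSeries p p' a) * ∏ r, (1 - PowerSeries.C (φ (a r)) * PowerSeries.X) =
      ∏ r, (PowerSeries.C (φ p) - PowerSeries.C (φ p' * φ (a r)) * PowerSeries.X) := by
  have h1 := congrArg (PowerSeries.map φ) (evalSeries_mul p p' a)
  simpa only [map_mul, map_prod, map_sub, map_one, PowerSeries.map_C, PowerSeries.map_X] using h1

theorem exists_deformation (hq0 : q ≠ 0) (hq2 : q - q⁻¹ ≠ 0) {w : HW M N} (hw : w ∈ R q M N)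
    {c : ℂˣ} (hc : (c : ℂ) = w.c) {g : ℤ → ℂ} (hg : g 0 = 1) :
    ∃ ϖ : CartanWeight M N ℂ[T;T⁻¹], IsSpecialization q ϖ w (evalL c) ∧
      (∀ (i : Node M N) (hi : (i : ℕ) ≠ M),
        (consOp (i, 0) ^ (1 + (w.P ⟨i, hi⟩).natDegree) :
          Module.End ℂ[T;T⁻¹] (FreeVerma M N ℂ[T;T⁻¹])) (word []) ∈ radical q ϖ) ∧
      ∀ i : Node M N, (i : ℕ) = M → ∀ m,
        oddCoeff q ϖ i m = pencil w.f g c (q - q⁻¹)⁻¹ m := by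
  obtain ⟨-, -, hf0, hP⟩ := hw
  choose b hb using fun i => exists_prod_eq (hP i)
  let p : Node M N → ℂˣ := fun i => Units.mk0 (qi q M i) (qi_ne_zero hq0 M i)
  let a : ∀ i : {i : Node M N // (i : ℕ) ≠ M}, Fin (w.P i).natDegree → (ℂ[T;T⁻¹])ˣ :=
    fun i r => monoL (p i * b i r * c ^ (-(r : ℤ))) r
  have hea : ∀ i r (ε : ℤ), evalL c ((a i r ^ ε : (ℂ[T;T⁻¹])ˣ) : ℂ[T;T⁻¹]) =
      (qi q M i.1 * (b i r : ℂ)) ^ ε := by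
    intro i r ε
    have h1 : Units.map (evalL c : ℂ[T;T⁻¹] →* ℂ) (a i r) = p i * b i r := by
      ext
      change evalL c (monoL _ _ : ℂ[T;T⁻¹]) = _
      rw [evalL_monoL, ← Units.val_mul, mul_assoc, ← zpow_add, neg_add_cancel, zpow_zero, mul_one]
    have h2 := congrArg (Units.val) (map_zpow (Units.map (evalL c : ℂ[T;T⁻¹] →* ℂ)) (a i r) ε)
    rw [h1] at h2
    refine Eq.trans h2 ?_
    rw [Units.val_zpow_eq_zpow_val, Units.val_mul]
    rfl
  let cc : Node M N → (ℂ[T;T⁻¹])ˣ := fun i => if hi : (i : ℕ) ≠ M then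
    monoL (p i ^ (w.P ⟨i, hi⟩).natDegree) 0 else monoL 1 1
  let Θ : ℤˣ → Node M N → PowerSeries ℂ[T;T⁻¹] := fun ε i => if hi : (i : ℕ) ≠ M then
      evalSeries (algebraMap ℂ _ (qi q M i ^ (ε : ℤ))) (algebraMap ℂ _ (qi q M i ^ (-(ε : ℤ))))
        fun r => ((a ⟨i, hi⟩ r ^ (ε : ℤ) : (ℂ[T;T⁻¹])ˣ) : ℂ[T;T⁻¹])
    else PowerSeries.mk fun n => if n = 0 then T (ε : ℤ) else
      (((ε : ℤ) : ℂ) * (q - q⁻¹)) • pencil w.f g c (q - q⁻¹)⁻¹ ((ε : ℤ) * n)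
  have hmono : ∀ (r : ℂˣ) (n : ℤ) (ε : ℤˣ), ((monoL r n ^ (ε : ℤ) : (ℂ[T;T⁻¹])ˣ) : ℂ[T;T⁻¹]) =
      C ((r ^ (ε : ℤ) : ℂˣ) : ℂ) * T ((ε : ℤ) * n) := by
    intro r n ε
    rcases Int.units_eq_one_or ε with rfl | rfl
    · simp [monoL]
    · rw [Units.val_neg, Units.val_one, zpow_neg_one, zpow_neg_one, neg_one_mul]
      rfl
  obtain ⟨ϖ, hϖc, hϖ⟩ := exists_hwSeries_eq q hq2 cc Θ (by
    intro ε i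
    by_cases hi : (i : ℕ) ≠ M
    · simp only [Θ, cc, dif_pos hi]
      rw [coeff_zero_evalSeries, hmono, Fintype.card_fin, ← LaurentPolynomial.C_eq_algebraMap,
        mul_zero, LaurentPolynomial.T_zero, mul_one, ← map_pow]
      congr 1
      rw [← zpow_natCast, ← zpow_mul, mul_comm, zpow_mul, zpow_natCast, ← zpow_natCast,
        Units.val_zpow_eq_zpow_val, Units.val_pow_eq_pow_val, zpow_natCast]
      simp [p]
    · simp only [Θ, cc, dif_neg hi]
      rw [hmono, PowerSeries.coeff_mk, if_pos rfl]
      simp)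
  have hodd : ∀ i : Node M N, (i : ℕ) = M → ∀ m,
      oddCoeff q ϖ i m = pencil w.f g c (q - q⁻¹)⁻¹ m := by
    intro i hi m
    have hqi : qi q M i = q := by rw [qi, ell, if_pos hi.le, zpow_one]
    have hne : ¬ (i : ℕ) ≠ M := not_not.mpr hi
    rw [oddCoeff, hwCoeff, hwCoeff, ofPowerSeries_coeff, ofPowerSeries_coeff, hϖ, hϖ]
    simp only [Θ, dif_neg hne, PowerSeries.coeff_mk, hqi]
    rcases lt_trichotomy m 0 with hm | rfl | hm
    · rw [if_neg (by simp; omega), if_pos (by simp; omega), if_neg (by simp; omega)]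
      have : ((-1 : ℤˣ) : ℤ) * ((((-1 : ℤˣ) : ℤ) * m).toNat : ℤ) = m := by simp; omega
      rw [this, zero_sub, ← neg_smul, smul_smul]
      simp [inv_mul_cancel₀ hq2]
    · simp only [mul_zero, le_refl, if_true, Int.toNat_zero]
      rw [pencil, hg, ← hf0, hc]
      simp only [LaurentPolynomial.smul_eq_C_mul, mul_one, map_mul, map_sub, div_eq_mul_inv,
        Units.val_one, Units.val_neg]
      ring
    · rw [if_pos (by simp; omega), if_neg (by simp; omega), if_neg (by simp; omega)]
      have : ((1 : ℤˣ) : ℤ) * ((((1 : ℤˣ) : ℤ) * m).toNat : ℤ) = m := by simp; omega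
      rw [this, sub_zero, smul_smul]
      simp [inv_mul_cancel₀ hq2]
  have hmap : ∀ (ε : ℤˣ) (i : Node M N) (hi : (i : ℕ) ≠ M),
      PowerSeries.map (evalL c : ℂ[T;T⁻¹] →+* ℂ) (hwSeries q ϖ ε i) *
        ∏ r, (1 - PowerSeries.C ((qi q M i * (b ⟨i, hi⟩ r : ℂ)) ^ (ε : ℤ)) * PowerSeries.X) =
      ∏ r : Fin (w.P ⟨i, hi⟩).natDegree, (PowerSeries.C (qi q M i ^ (ε : ℤ)) -
        PowerSeries.C (qi q M i ^ (-(ε : ℤ)) * (qi q M i * (b ⟨i, hi⟩ r : ℂ)) ^ (ε : ℤ)) *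
          PowerSeries.X) := by
    intro ε i hi
    rw [hϖ]
    simp only [Θ, dif_pos hi]
    have h1 := map_evalSeries (evalL c : ℂ[T;T⁻¹] →+* ℂ)
      (algebraMap ℂ _ (qi q M i ^ (ε : ℤ))) (algebraMap ℂ _ (qi q M i ^ (-(ε : ℤ))))
        fun r => ((a ⟨i, hi⟩ r ^ (ε : ℤ) : (ℂ[T;T⁻¹])ˣ) : ℂ[T;T⁻¹])
    simpa only [RingHom.coe_coe, hea, AlgHom.commutes, Algebra.algebraMap_self, RingHom.id_apply]
      using h1
  refine ⟨ϖ, ⟨fun i hi => ?_, fun i hi => ?_, fun i hi => ?_, fun i hi n => ?_⟩, fun i hi => ?_,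
    hodd⟩
  · refine evenWeightZero_eq (hb ⟨i, hi⟩) ?_
    have := hmap 1 i hi
    simpa only [Units.val_one, zpow_one, zpow_neg_one] using this
  · refine evenWeightInfty_eq (qi_ne_zero hq0 M i) (hb ⟨i, hi⟩) ?_
    have := hmap (-1) i hi
    simpa only [Units.val_one, Units.val_neg, zpow_one, zpow_neg_one, neg_neg] using this
  · rw [hϖc]
    simp only [cc, dif_neg (not_not.mpr hi)]
    rw [evalL_monoL, zpow_one, Units.val_one, one_mul, hc]
  · rw [hodd i hi, evalL_pencil]
  · have hev := isEvaluationWeight_of_hwSeries (ϖ := ϖ) (K := FractionRing ℂ[T;T⁻¹])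
      (i := i) (a := a ⟨i, hi⟩) (by
        intro ε
        rw [hϖ]
        simp only [Θ, dif_pos hi])
    have hanz : ∀ r s, r ≠ s → ∀ x : ℂ, x ≠ 0 →
        algebraMap ℂ (FractionRing ℂ[T;T⁻¹]) x *
          algebraMap ℂ[T;T⁻¹] _ (a ⟨i, hi⟩ r : ℂ[T;T⁻¹]) ≠
          algebraMap ℂ[T;T⁻¹] _ (a ⟨i, hi⟩ s : ℂ[T;T⁻¹]) := by
      intro r s hrs x hx e
      rw [IsScalarTower.algebraMap_apply ℂ ℂ[T;T⁻¹], ← map_mul] at e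
      have e' := algebraMap_L_injective e
      rw [← LaurentPolynomial.C_eq_algebraMap] at e'
      change C x * (C _ * T _) = C _ * T _ at e'
      rw [← mul_assoc, ← map_mul] at e'
      refine C_mul_T_ne (mul_ne_zero hx (Units.ne_zero _)) ?_ e'
      exact fun h => hrs (Fin.ext (by exact_mod_cast h))
    have := lowering_pow_mem_radical hev hq0 hq2 algebraMap_L_injective hi
      (fun r s hrs => by
        by_contra hne
        refine hanz r s hne 1 one_ne_zero ?_
        rw [map_one, one_mul]
        exact congrArg Units.val hrs)
      (fun r s hrs => by
        rw [ptFactor, shuffleFactor, if_pos le_rfl, if_pos ⟨rfl, hi⟩, one_mul]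
        refine mul_ne_zero (sub_ne_zero.mpr (hanz r s hrs _ (zpow_ne_zero _ hq0))) (sub_ne_zero.mpr ?_)
        have := hanz r s hrs 1 one_ne_zero
        rwa [map_one, one_mul] at this)
    rwa [Fintype.card_fin] at this

theorem dvd_of_mem_weylIdeal (hq0 : q ≠ 0) (hq2 : q - q⁻¹ ≠ 0) {w : HW M N} {Q₁ Q₂ : ℂ[X]}
    (h₁ : (w, Q₁) ∈ Rtilde q M N) (h₂ : Q₂.coeff 0 = 1) (i : Node M N)
    (h : ∑ s ∈ Finset.range (Q₂.natDegree + 1), Q₂.coeff (Q₂.natDegree - s) • X q (-1) i s ∈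
      weylIdeal q w Q₁) (hi : (i : ℕ) = M) : Q₁ ∣ Q₂ := by
  obtain ⟨hw, hQ₁, hQf⟩ := h₁
  by_cases hd : Q₁.natDegree = 0
  · rw [Polynomial.eq_C_of_natDegree_eq_zero hd, show Q₁.coeff 0 = 1 from hQ₁, Polynomial.C_1]
    exact one_dvd _
  have hQ₁0 : Q₁ ≠ 0 := by
    rintro rfl
    simp at hd
  obtain ⟨g, hg0, hg⟩ := exists_sequence (reverse_monic hQ₁)
    (by rw [Polynomial.coeff_zero_reverse]; exact Polynomial.leadingCoeff_ne_zero.mpr hQ₁0)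
    (by rwa [natDegree_reverse (coeff_zero_ne_zero hQ₁)])
  have hQf' : Polynomial.aeval shift Q₁.reverse w.f = 0 := (polyMul_eq_zero_iff _ _).mp hQf
  have hfg : ∀ p : ℂ[X], Polynomial.aeval shift p g = 0 → Polynomial.aeval shift p w.f = 0 :=
    fun p hp => aeval_shift_eq_zero_of_dvd ((hg p).mp hp) hQf'
  set c : ℂˣ := Units.mk0 w.c hw.2.1
  obtain ⟨ϖ, hsp, heven, hodd⟩ := exists_deformation hq0 hq2 hw (c := c) rfl hg0
  have hsum : ∀ {f : ℤ → ℂ}, Polynomial.aeval shift Q₁.reverse f = 0 → ∀ m,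
      ∑ s ∈ Finset.range (Q₁.natDegree + 1), Q₁.coeff (Q₁.natDegree - s) * f (m + s) = 0 := by
    intro f hf m
    rw [← aeval_reverse_apply, hf]
    rfl
  obtain ⟨y, hy⟩ := exists_eq_smul_of_mem_weylIdeal hsp hq0 hq2
    (fun a => dvd_of_evalL_eq_zero c) heven (fun i hi m => by
      simp only [hodd i hi]
      exact sum_pencil_eq_zero c _ _ (hsum hQf') (hsum ((hg _).mpr dvd_rfl)) m) h
  obtain ⟨G, hG⟩ := exists_sum_eq_of_mem hq0 hq2 i _ (fun s => Q₂.coeff (Q₂.natDegree - s)) hy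
  set δ : ℂ[T;T⁻¹] := T 1 - C (c : ℂ)
  set G₀ : ℤ →₀ ℂ[T;T⁻¹] := ∑ s ∈ Finset.range (Q₂.natDegree + 1),
    Finsupp.single (s : ℤ) (C (Q₂.coeff (Q₂.natDegree - s)))
  have hlin : ∀ {E : Type} [CommRing E] (φ : ℂ[T;T⁻¹] →+* E) (F : ℤ → E),
      ((G₀ - δ • G).sum fun s a => φ a * F s) =
        (∑ s ∈ Finset.range (Q₂.natDegree + 1), φ (C (Q₂.coeff (Q₂.natDegree - s))) * F s) -
          φ δ * G.sum fun s a => φ a * F s := by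
    intro E _ φ F
    rw [Finsupp.sum_sub_index (by intros; rw [map_sub, sub_mul]),
      ← Finsupp.sum_finsetSum_index (by simp) (by intros; rw [map_add, add_mul]),
      Finsupp.sum_smul_index (by simp), Finsupp.mul_sum]
    congr 1
    · exact Finset.sum_congr rfl fun s _ => Finsupp.sum_single_index (by simp)
    · refine Finset.sum_congr rfl fun s _ => ?_
      dsimp only
      rw [map_mul, mul_assoc]
  have hann := eval_annihilates hfg c (inv_ne_zero hq2) (G₀ - δ • G) (by
    intro m
    have h1 := hlin (RingHom.id _) fun s => pencil w.f g c (q - q⁻¹)⁻¹ (m + s)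
    simp only [RingHom.id_apply] at h1
    rw [h1, sub_eq_zero]
    have h2 := hG m
    simp only [hodd i hi] at h2
    rw [← h2]
    exact Finset.sum_congr rfl fun s _ => (LaurentPolynomial.smul_eq_C_mul _ _).symm)
  refine dvd_of_reverse_dvd hQ₁ h₂ ((hg _).mp ?_)
  funext m
  have h1 := hlin (evalL c : ℂ[T;T⁻¹] →+* ℂ) fun s => g (m + s)
  have h3 : evalL c δ = 0 := by
    rw [map_sub, evalL_T, evalL_C, zpow_one, sub_self]
  simp only [RingHom.coe_coe, hann, evalL_C, h3, zero_mul, sub_zero] at h1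
  rw [aeval_reverse_apply, ← h1]
  rfl

end Specialization

end QAffine

end

noncomputable section
set_option linter.unusedSectionVars false
namespace QAffine

/-! ## Vectors of highest weight -/

theorem coeff_pow_mem {A : Type*} [Ring A] [Algebra ℂ A] (S : Subalgebra ℂ A) {g : PowerSeries A}
    (hg : PowerSeries.coeff 0 g = 0) {n : ℕ} (h : ∀ s < n, PowerSeries.coeff s g ∈ S) (k : ℕ) :
    (∀ m < n, PowerSeries.coeff m (g ^ k) ∈ S) ∧
      (k ≠ 1 → PowerSeries.coeff n (g ^ k) ∈ S) := by
  have hc : ∀ (m k : ℕ), PowerSeries.coeff m (g ^ 0) ∈ S := by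
    intro m k
    rw [pow_zero, PowerSeries.coeff_one]
    split_ifs
    exacts [S.one_mem, S.zero_mem]
  have hlow : ∀ k, ∀ m < n, PowerSeries.coeff m (g ^ k) ∈ S := by
    intro k
    induction k with
    | zero => exact fun m _ => hc m 0
    | succ k ih =>
      intro m hm
      rw [pow_succ, PowerSeries.coeff_mul]
      refine S.sum_mem fun p hp => S.mul_mem (ih _ ?_) (h _ ?_) <;>
        · have := Finset.HasAntidiagonal.mem_antidiagonal.mp hp
          omega
  refine ⟨hlow k, fun hk => ?_⟩
  match k with
  | 0 => exact hc n 0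
  | 1 => exact absurd rfl hk
  | k + 2 =>
    rw [pow_succ, PowerSeries.coeff_mul]
    refine S.sum_mem fun p hp => ?_
    have hp' := Finset.HasAntidiagonal.mem_antidiagonal.mp hp
    rcases Nat.eq_zero_or_pos p.2 with h2 | h2
    · rw [h2, hg, mul_zero]
      exact S.zero_mem
    rcases Nat.eq_zero_or_pos p.1 with h1 | h1
    · have : PowerSeries.coeff 0 (g ^ (k + 1)) = 0 := by
        rw [pow_succ, PowerSeries.coeff_mul]
        simp [hg]
      rw [h1, this, zero_mul]
      exact S.zero_mem
    exact S.mul_mem (hlow _ _ (by omega)) (h _ (by omega))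

theorem coeff_mem_of_expCoeff_mem {A : Type*} [Ring A] [Algebra ℂ A] (S : Subalgebra ℂ A)
    {g : PowerSeries A} (hg : PowerSeries.coeff 0 g = 0) (h : ∀ n, expCoeff g n ∈ S) (n : ℕ) :
    PowerSeries.coeff n g ∈ S := by
  induction n using Nat.strong_induction_on with
  | _ n ih =>
    rcases Nat.eq_zero_or_pos n with rfl | hn
    · rw [hg]
      exact S.zero_mem
    have h1 := h n
    rw [expCoeff, ← Finset.add_sum_erase _ _ (Finset.mem_range.mpr (by omega : 1 < n + 1))] at h1
    have h2 : ∑ k ∈ (Finset.range (n + 1)).erase 1,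
        ((Nat.factorial k : ℂ)⁻¹) • PowerSeries.coeff n (g ^ k) ∈ S :=
      S.sum_mem fun k hk => S.smul_mem ((coeff_pow_mem S hg ih k).2 (Finset.ne_of_mem_erase hk)) _
    have h3 := S.sub_mem h1 h2
    simpa using h3

section Relations

variable {q : ℂ} {M N : ℕ}

theorem mkU_rel {a b : FreeU M N} (h : Rel q M N a b) : mkU q M N a = mkU q M N b :=
  RingQuot.mkAlgHom_rel ℂ h

theorem K_mul_K_neg (ε : ℤˣ) (i : Node M N) : K q ε i * K q (-ε) i = 1 := by
  have := mkU_rel (Rel.K_inv (q := q) ε i)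
  rwa [map_mul, map_one] at this

theorem K_comm_K (ε ε' : ℤˣ) (i j : Node M N) : Commute (K q ε i) (K q ε' j) := by
  have := mkU_rel (Rel.K_K (q := q) ε ε' i j)
  rwa [map_mul, map_mul] at this

theorem K_comm_H (ε : ℤˣ) (i j : Node M N) (s : ℤ) (hs : s ≠ 0) :
    Commute (K q ε i) (H q j s hs) := by
  have := mkU_rel (Rel.K_H (q := q) ε i j s hs)
  rwa [map_mul, map_mul] at this

theorem H_comm_H (i j : Node M N) (s t : ℤ) (hs : s ≠ 0) (ht : t ≠ 0) :
    Commute (H q i s hs) (H q j t ht) := by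
  have := mkU_rel (Rel.H_H (q := q) i j s t hs ht)
  rwa [map_mul, map_mul] at this

theorem K_mul_X (hq0 : q ≠ 0) (ε' ε : ℤˣ) (i j : Node M N) (n : ℤ) :
    K q ε' i * X q ε j n = q ^ ((ε' : ℤ) * (ε : ℤ) * cartan M i j) • (X q ε j n * K q ε' i) := by
  have h1 : K q 1 i * X q ε j n * K q (-1) i = q ^ ((ε : ℤ) * cartan M i j) • X q ε j n := by
    have := mkU_rel (Rel.K_X (q := q) ε i j n)
    rwa [map_mul, map_mul, map_smul] at this
  have h2 : K q 1 i * X q ε j n = q ^ ((ε : ℤ) * cartan M i j) • (X q ε j n * K q 1 i) := by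
    have h3 : K q (-1) i * K q 1 i = 1 := by simpa using K_mul_K_neg (q := q) (-1) i
    rw [← smul_mul_assoc, ← h1, mul_assoc, h3, mul_one]
  rcases Int.units_eq_one_or ε' with rfl | rfl
  · simpa using h2
  · have h3 : K q (-1) i * (K q 1 i * X q ε j n) * K q (-1) i = X q ε j n * K q (-1) i := by
      have := K_mul_K_neg (q := q) (-1) i
      rw [neg_neg] at this
      rw [← mul_assoc, this, one_mul]
    rw [h2, mul_smul_comm, smul_mul_assoc, mul_assoc, mul_assoc, K_mul_K_neg, mul_one] at h3
    rw [← h3, smul_smul, ← zpow_add₀ hq0]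
    simp

theorem H_mul_X (ε : ℤˣ) (i j : Node M N) (s n : ℤ) (hs : s ≠ 0) :
    H q i s hs * X q ε j n = X q ε j n * H q i s hs +
      (((ε : ℤ) : ℂ) * hCoeff q M i j s) • X q ε j (n + s) := by
  have := mkU_rel (Rel.H_X (q := q) ε i j s n hs)
  rw [map_sub, map_mul, map_mul, map_smul] at this
  rw [← sub_eq_iff_eq_add']
  exact this

theorem X_mul_X_neg (i j : Node M N) (m n : ℤ) :
    X q 1 i m * X q (-1) j n = nodeSign M i j • (X q (-1) j n * X q 1 i m) +
      if i = j then (qi q M i - (qi q M i)⁻¹)⁻¹ • (phi q 1 i (m + n) - phi q (-1) i (m + n))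
      else 0 := by
  have := mkU_rel (Rel.X_X_opp (q := q) i j m n)
  rw [map_sbr, sbr, mul_one] at this
  rw [← sub_eq_iff_eq_add']
  refine Eq.trans this ?_
  split_ifs
  · rw [map_smul, map_sub]
    rfl
  · rw [map_zero]

theorem mkU_hSeries (ε : ℤˣ) (i : Node M N) (n : ℕ) :
    mkU q M N (expCoeff (hSeries q ε i) n) =
      expCoeff (PowerSeries.map (mkU q M N : FreeU M N →+* U q M N) (hSeries q ε i)) n :=
  map_expCoeff _ _ _

theorem coeff_map_hSeries (ε : ℤˣ) (i : Node M N) (s : ℕ) (hs : s ≠ 0) :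
    PowerSeries.coeff s (PowerSeries.map (mkU q M N : FreeU M N →+* U q M N) (hSeries q ε i)) =
      (((ε : ℤ) : ℂ) * (qi q M i - (qi q M i)⁻¹)) •
        H q i ((ε : ℤ) * (s : ℤ)) (mul_ne_zero ε.ne_zero (Int.natCast_ne_zero.mpr hs)) := by
  rw [PowerSeries.coeff_map, hSeries, PowerSeries.coeff_mk, dif_neg hs]
  exact map_smul (mkU q M N) _ _

theorem phi_eq (ε : ℤˣ) (i : Node M N) (n : ℕ) : phi q ε i ((ε : ℤ) * n) = K q ε i *
    expCoeff (PowerSeries.map (mkU q M N : FreeU M N →+* U q M N) (hSeries q ε i)) n := by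
  have h : (ε : ℤ) * ((ε : ℤ) * n) = n := by
    rcases Int.units_eq_one_or ε with rfl | rfl <;> simp
  rw [phi, fphi, h, if_pos (Int.natCast_nonneg n), map_mul, ← mkU_hSeries, Int.toNat_natCast]
  rfl

theorem phi_zero (ε : ℤˣ) (i : Node M N) : phi q ε i 0 = K q ε i := by
  have := phi_eq (q := q) ε i 0
  rwa [Nat.cast_zero, mul_zero, expCoeff_zero, mul_one] at this

theorem phi_of_neg (ε : ℤˣ) (i : Node M N) {n : ℤ} (h : (ε : ℤ) * n < 0) : phi q ε i n = 0 := by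
  rw [phi, fphi, if_neg (not_le.mpr h), map_zero]

theorem qInt_ne_zero {x : ℂ} (hx0 : x ≠ 0) (hx : ∀ n : ℕ, 0 < n → x ^ n ≠ 1) {n : ℤ} (hn : n ≠ 0) :
    qInt x n ≠ 0 := by
  have hz : ∀ n : ℤ, n ≠ 0 → x ^ n ≠ 1 := by
    intro n hn h
    rcases Int.natAbs_eq n with e | e
    · rw [e, zpow_natCast] at h
      exact hx _ (Int.natAbs_pos.mpr hn) h
    · rw [e, zpow_neg, inv_eq_one, zpow_natCast] at h
      exact hx _ (Int.natAbs_pos.mpr hn) h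
  have h2 : ∀ n : ℤ, n ≠ 0 → x ^ n - x ^ (-n) ≠ 0 := by
    intro n hn h
    refine hz (2 * n) (by omega) ?_
    have := sub_eq_zero.mp h
    rw [two_mul, zpow_add₀ hx0]
    nth_rewrite 1 [this]
    rw [← zpow_add₀ hx0, neg_add_cancel, zpow_zero]
  have h1 := h2 1 one_ne_zero
  rw [zpow_one, zpow_neg_one] at h1
  exact div_ne_zero (h2 n hn) h1

theorem qi_pow_ne_one (hq : ∀ n : ℕ, 0 < n → q ^ n ≠ 1) (i n : ℕ) (hn : 0 < n) :
    qi q M i ^ n ≠ 1 := by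
  rw [qi, ell]
  split_ifs
  · rw [zpow_one]
    exact hq n hn
  · rw [zpow_neg_one, inv_pow, Ne, inv_eq_one]
    exact hq n hn

theorem hCoeff_ne_zero (hq0 : q ≠ 0) (hq : ∀ n : ℕ, 0 < n → q ^ n ≠ 1) {i j : ℕ} {s : ℤ}
    (hs : s ≠ 0) (h : cartan M i j ≠ 0) : hCoeff q M i j s ≠ 0 := by
  refine div_ne_zero (qInt_ne_zero (qi_ne_zero hq0 M i) (qi_pow_ne_one hq i) ?_)
    (Int.cast_ne_zero.mpr hs)
  refine mul_ne_zero (mul_ne_zero hs ?_) h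
  rw [ell]
  split_ifs <;> decide

theorem sub_inv_ne_zero (hq0 : q ≠ 0) (hq : ∀ n : ℕ, 0 < n → q ^ n ≠ 1) : q - q⁻¹ ≠ 0 := by
  intro h
  refine hq 2 two_pos ?_
  rw [pow_two]
  nth_rewrite 1 [sub_eq_zero.mp h]
  exact inv_mul_cancel₀ hq0

theorem exists_adjacent_odd (hMN : 0 < M * N) (hne : M ≠ N) (i : Node M N) (hi : (i : ℕ) = M) :
    ∃ j : Node M N, (j : ℕ) ≠ M ∧ cartan M j i ≠ 0 := by
  have hM : 0 < M := Nat.pos_of_mul_pos_right hMN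
  have hN : 0 < N := Nat.pos_of_mul_pos_left hMN
  by_cases h : 1 < M
  · refine ⟨⟨M - 1, by omega, by omega⟩, by simp; omega, ?_⟩
    have := cartan_succ (M := M) (M - 1)
    rw [Nat.sub_add_cancel hM] at this
    rw [hi, this, ell]
    split_ifs <;> decide
  · refine ⟨⟨M + 1, by omega, by omega⟩, by simp, ?_⟩
    have := succ_cartan (M := M) M
    rw [hi, this, ell]
    split_ifs <;> decide

end Relations

end QAffine

end

noncomputable section
set_option linter.unusedSectionVars false
namespace QAffine

section HWVector

variable {q : ℂ} {M N : ℕ} {V : Type*} [AddCommGroup V] [Module ℂ V] [Module (U q M N) V]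
  [IsScalarTower ℂ (U q M N) V]

theorem smul_smul_comm' (r : ℂ) (a : U q M N) (v : V) : a • r • v = r • a • v := by
  rw [← algebraMap_smul (U q M N) r v, ← algebraMap_smul (U q M N) r (a • v), ← mul_smul, ← mul_smul,
    Algebra.commutes]

/-- The subalgebra of the elements that rescale a vector. -/
def lineStab (v : V) : Subalgebra ℂ (U q M N) where
  carrier := {a | ∃ r : ℂ, a • v = r • v}
  mul_mem' := by
    rintro a b ⟨r, hr⟩ ⟨s, hs⟩
    exact ⟨s * r, by rw [mul_smul, hs, smul_smul_comm', hr, smul_smul]⟩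
  add_mem' := by
    rintro a b ⟨r, hr⟩ ⟨s, hs⟩
    exact ⟨r + s, by rw [add_smul, hr, hs, add_smul]⟩
  algebraMap_mem' r := ⟨r, algebraMap_smul _ _ _⟩

theorem K_neg_mem_lineStab {v : V} {ε : ℤˣ} {i : Node M N} (h : K q ε i ∈ lineStab v) :
    K q (-ε) i ∈ lineStab v := by
  obtain ⟨r, hr⟩ := h
  have h1 : K q (-ε) i • K q ε i • v = v := by
    have := K_mul_K_neg (q := q) (-ε) i
    rw [neg_neg] at this
    rw [← mul_smul, this, one_smul]
  rw [hr, smul_smul_comm'] at h1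
  by_cases h0 : r = 0
  · refine ⟨0, ?_⟩
    rw [h0, zero_smul] at h1
    rw [← h1, smul_zero, smul_zero]
  · exact ⟨r⁻¹, (eq_inv_smul_iff₀ h0).mpr h1⟩

theorem H_mem_lineStab (hq2 : q - q⁻¹ ≠ 0) {v : V}
    (h : ∀ (ε : ℤˣ) (i : Node M N) (n : ℤ), phi q ε i n ∈ lineStab v)
    (i : Node M N) (s : ℤ) (hs : s ≠ 0) : H q i s hs ∈ lineStab v := by
  have key : ∀ (ε : ℤˣ) (n : ℕ) (hn : n ≠ 0),
      H q i ((ε : ℤ) * (n : ℤ)) (mul_ne_zero ε.ne_zero (Int.natCast_ne_zero.mpr hn)) ∈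
        lineStab v := by
    intro ε n hn
    have h1 := coeff_mem_of_expCoeff_mem (lineStab v)
      (g := PowerSeries.map (mkU q M N : FreeU M N →+* U q M N) (hSeries q ε i))
      (by rw [PowerSeries.coeff_map, hSeries, PowerSeries.coeff_mk, dif_pos rfl, map_zero])
      (fun n => by
        have h2 := h ε i ((ε : ℤ) * n)
        rw [phi_eq] at h2
        have h3 : K q (-ε) i ∈ lineStab v := by
          have := h (-ε) i 0
          rwa [phi_zero] at this
        have h4 := (lineStab v).mul_mem h3 h2
        have h5 := K_mul_K_neg (q := q) (-ε) i
        rw [neg_neg] at h5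
        rwa [← mul_assoc, h5, one_mul] at h4) n
    rw [coeff_map_hSeries ε i n hn] at h1
    have hne : (((ε : ℤ) : ℂ) * (qi q M i - (qi q M i)⁻¹)) ≠ 0 :=
      mul_ne_zero (Int.cast_ne_zero.mpr ε.ne_zero) (qi_sub_inv_ne_zero q hq2 i)
    have h6 := (lineStab v).smul_mem h1 (((ε : ℤ) : ℂ) * (qi q M i - (qi q M i)⁻¹))⁻¹
    rwa [smul_smul, inv_mul_cancel₀ hne, one_smul] at h6
  rcases lt_or_gt_of_ne hs with h0 | h0
  · have h1 := key (-1) (-s).toNat (by omega)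
    have e : (((-1 : ℤˣ) : ℤ) * ((-s).toNat : ℤ)) = s := by simp; omega
    simpa only [e] using h1
  · have h1 := key 1 s.toNat (by omega)
    have e : (((1 : ℤˣ) : ℤ) * (s.toNat : ℤ)) = s := by simp; omega
    simpa only [e] using h1

/-- A vector subject to the relations of the generator of the Verma module. -/
def IsHWVector (w : HW M N) (v : V) : Prop := ∀ u : U q M N, VermaRel q w u → u • v = 0

theorem qi_odd {i : ℕ} (hi : i = M) : qi q M i = q := by
  rw [qi, ell, if_pos hi.le, zpow_one]

theorem IsHWVector.phi_mem (hq2 : q - q⁻¹ ≠ 0) {w : HW M N} {v : V} (h : IsHWVector (q := q) w v)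
    (ε : ℤˣ) (i : Node M N) (n : ℤ) : phi q ε i n ∈ lineStab v := by
  have hsub : ∀ {a : U q M N} {r : ℂ}, (a - algebraMap ℂ _ r) • v = 0 → a • v = r • v := by
    intro a r h
    rwa [sub_smul, algebraMap_smul, sub_eq_zero] at h
  by_cases hneg : (ε : ℤ) * n < 0
  · rw [phi_of_neg ε i hneg]
    exact (lineStab v).zero_mem
  by_cases hi : (i : ℕ) = M
  · have hK : K q 1 i ∈ lineStab v := ⟨_, hsub (h _ (VermaRel.oddK i hi))⟩
    rcases eq_or_ne n 0 with rfl | hn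
    · rw [phi_zero]
      rcases Int.units_eq_one_or ε with rfl | rfl
      · exact hK
      · exact K_neg_mem_lineStab hK
    · have h1 := hsub (h _ (VermaRel.oddPhi i hi n))
      rcases Int.units_eq_one_or ε with rfl | rfl
      · rw [phi_of_neg (-1) i (by simp at hneg ⊢; omega), sub_zero, smul_assoc] at h1
        exact ⟨(q - q⁻¹) * w.f n, by rw [mul_smul, ← h1, smul_smul, mul_inv_cancel₀ hq2, one_smul]⟩
      · rw [phi_of_neg 1 i (by simp at hneg ⊢; omega), zero_sub, smul_assoc, neg_smul] at h1
        exact ⟨-((q - q⁻¹) * w.f n), by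
          rw [neg_smul, mul_smul, ← h1, smul_smul, mul_inv_cancel₀ hq2, one_smul, neg_neg]⟩
  · rcases Int.units_eq_one_or ε with rfl | rfl
    · obtain ⟨k, rfl⟩ := Int.eq_ofNat_of_zero_le (a := n) (by simpa using hneg)
      exact ⟨_, hsub (h _ (VermaRel.evenZero i hi k))⟩
    · obtain ⟨k, hk⟩ := Int.eq_ofNat_of_zero_le (a := -n) (by simpa using hneg)
      obtain rfl : n = -(k : ℤ) := by omega
      exact ⟨_, hsub (h _ (VermaRel.evenInfty i hi k))⟩

/-- The combination `∑ p_s X_{i,s}^-`. -/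
def lowSum (i : Node M N) : ℂ[X] →ₗ[ℂ] U q M N :=
  Polynomial.lsum fun s => LinearMap.toSpanSingleton ℂ _ (X q (-1) i s)

theorem lowSum_monomial (i : Node M N) (s : ℕ) (a : ℂ) :
    lowSum i (Polynomial.monomial s a) = a • X q (-1) i s := by
  simp [lowSum, Polynomial.lsum_apply, Polynomial.sum_monomial_index]

theorem lowSum_reverse (i : Node M N) (Q : ℂ[X]) : lowSum i Q.reverse =
    ∑ s ∈ Finset.range (Q.natDegree + 1), Q.coeff (Q.natDegree - s) • X q (-1) i s := by
  rw [lowSum, Polynomial.lsum_apply, Polynomial.sum_over_range' _ (by simp) (Q.natDegree + 1)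
    (Nat.lt_succ_of_le Q.reverse_natDegree_le)]
  refine Finset.sum_congr rfl fun s hs => ?_
  rw [coeff_reverse_of_le (by simpa [Nat.lt_succ_iff] using hs)]
  rfl

theorem H_mul_lowSum (i j : Node M N) (p : ℂ[X]) :
    H q j 1 one_ne_zero * lowSum i p = lowSum i p * H q j 1 one_ne_zero -
      hCoeff q M j i 1 • lowSum i (Polynomial.X * p) := by
  induction p using Polynomial.induction_on' with
  | add p r hp hr => rw [map_add, mul_add, hp, hr, mul_add, map_add, add_mul, smul_add]; abel
  | monomial s a =>
    rw [lowSum_monomial, Polynomial.X_mul_monomial, lowSum_monomial, mul_smul_comm, H_mul_X]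
    simp only [Units.val_neg, Units.val_one, Int.cast_neg, Int.cast_one, neg_mul, one_mul, neg_smul,
      smul_mul_assoc, ← sub_eq_add_neg, Nat.cast_add, Nat.cast_one]
    rw [smul_sub, smul_comm a]

theorem H_neg_mul_lowSum (i j : Node M N) (p : ℂ[X]) :
    H q j (-1) (by decide) * lowSum i (Polynomial.X * p) =
      lowSum i (Polynomial.X * p) * H q j (-1) (by decide) -
        hCoeff q M j i (-1) • lowSum i p := by
  induction p using Polynomial.induction_on' with
  | add p r hp hr => rw [mul_add, map_add, mul_add, hp, hr, map_add, add_mul, smul_add]; abel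
  | monomial s a =>
    rw [Polynomial.X_mul_monomial, lowSum_monomial, lowSum_monomial, mul_smul_comm, H_mul_X]
    simp only [Units.val_neg, Units.val_one, Int.cast_neg, Int.cast_one, neg_mul, one_mul, neg_smul,
      smul_mul_assoc, ← sub_eq_add_neg, Nat.cast_add, Nat.cast_one, add_sub_cancel_right]
    rw [smul_sub, smul_comm a]

theorem lowSum_X_mul_smul (hq0 : q ≠ 0) (hq : ∀ n : ℕ, 0 < n → q ^ n ≠ 1) {i j : Node M N}
    (hij : cartan M j i ≠ 0) {v : V} (hj : H q j 1 one_ne_zero ∈ lineStab v) {p : ℂ[X]}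
    (hp : lowSum (q := q) i p • v = 0) : lowSum (q := q) i (Polynomial.X * p) • v = 0 := by
  obtain ⟨r, hr⟩ := hj
  have h := congrArg (· • v) (H_mul_lowSum (q := q) i j p)
  simp only [sub_smul, mul_smul, hr, hp, smul_zero, smul_smul_comm', smul_assoc, zero_sub] at h
  exact (smul_eq_zero.mp (neg_eq_zero.mp h.symm)).resolve_left (hCoeff_ne_zero hq0 hq one_ne_zero hij)

theorem lowSum_of_X_mul_smul (hq0 : q ≠ 0) (hq : ∀ n : ℕ, 0 < n → q ^ n ≠ 1) {i j : Node M N}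
    (hij : cartan M j i ≠ 0) {v : V} (hj : H q j (-1) (by decide) ∈ lineStab v) {p : ℂ[X]}
    (hp : lowSum (q := q) i (Polynomial.X * p) • v = 0) : lowSum (q := q) i p • v = 0 := by
  obtain ⟨r, hr⟩ := hj
  have h := congrArg (· • v) (H_neg_mul_lowSum (q := q) i j p)
  simp only [sub_smul, mul_smul, hr, hp, smul_zero, smul_smul_comm', smul_assoc, zero_sub] at h
  exact (smul_eq_zero.mp (neg_eq_zero.mp h.symm)).resolve_left
    (hCoeff_ne_zero hq0 hq (by decide) hij)

theorem lowSum_mul_smul (hq0 : q ≠ 0) (hq : ∀ n : ℕ, 0 < n → q ^ n ≠ 1) {i j : Node M N}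
    (hij : cartan M j i ≠ 0) {v : V} (hj : H q j 1 one_ne_zero ∈ lineStab v) {p : ℂ[X]}
    (hp : lowSum (q := q) i p • v = 0) (r : ℂ[X]) : lowSum (q := q) i (r * p) • v = 0 := by
  induction r using Polynomial.induction_on with
  | C a => rw [← Polynomial.smul_eq_C_mul, map_smul, smul_assoc, hp, smul_zero]
  | add r s hr hs => rw [add_mul, map_add, add_smul, hr, hs, add_zero]
  | monomial n a h =>
    have := lowSum_X_mul_smul hq0 hq hij hj h
    rwa [← mul_assoc, mul_comm Polynomial.X, mul_assoc _ _ Polynomial.X, ← pow_succ] at this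

end HWVector

section Factorization

variable {q : ℂ} {M N : ℕ}

theorem isHWVector_weyl (w : HW M N) (Q : ℂ[X]) :
    IsHWVector (q := q) w (Submodule.Quotient.mk 1 : Weyl q w Q) := by
  intro u hu
  rw [← Submodule.Quotient.mk_smul, Submodule.Quotient.mk_eq_zero, smul_eq_mul, mul_one]
  exact Submodule.subset_span (Or.inl hu)

theorem weylIdeal_le_of_dvd (hq0 : q ≠ 0) (hq : ∀ n : ℕ, 0 < n → q ^ n ≠ 1) (hMN : 0 < M * N)
    (hne : M ≠ N) (w : HW M N) {Q₁ Q₂ : ℂ[X]} (h : Q₁ ∣ Q₂) :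
    weylIdeal q w Q₂ ≤ weylIdeal q w Q₁ := by
  rw [weylIdeal, Submodule.span_le]
  rintro x (hx | hx)
  · exact Submodule.subset_span (Or.inl hx)
  · cases hx with
    | even i hi => exact Submodule.subset_span (Or.inr (WeylRel.even i hi))
    | odd i hi =>
      obtain ⟨j, -, hj⟩ := exists_adjacent_odd hMN hne i hi
      obtain ⟨S, rfl⟩ := h
      have hq2 := sub_inv_ne_zero hq0 hq
      have h1 : lowSum (q := q) i Q₁.reverse • (Submodule.Quotient.mk 1 : Weyl q w Q₁) = 0 := by
        rw [← Submodule.Quotient.mk_smul, Submodule.Quotient.mk_eq_zero, smul_eq_mul, mul_one,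
          lowSum_reverse]
        exact Submodule.subset_span (Or.inr (WeylRel.odd i hi))
      have h2 := lowSum_mul_smul hq0 hq hj (H_mem_lineStab hq2
        (fun ε i n => (isHWVector_weyl w Q₁).phi_mem hq2 ε i n) j 1 one_ne_zero) h1 S.reverse
      rw [mul_comm, ← Polynomial.reverse_mul_of_domain, lowSum_reverse, ← Submodule.Quotient.mk_smul,
        Submodule.Quotient.mk_eq_zero, smul_eq_mul, mul_one] at h2
      exact h2

theorem factorization_iff (hq0 : q ≠ 0) (hq : ∀ n : ℕ, 0 < n → q ^ n ≠ 1) (hMN : 0 < M * N)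
    (hne : M ≠ N) (w : HW M N) {Q₁ Q₂ : ℂ[X]} (h₁ : (w, Q₁) ∈ Rtilde q M N)
    (h₂ : (w, Q₂) ∈ Rtilde q M N) :
    (∃ g : Weyl q w Q₂ →ₗ[U q M N] Weyl q w Q₁,
      IsEvenMap (gradWeyl q w Q₂) (gradWeyl q w Q₁) g ∧
        vermaToWeyl q w Q₁ = g ∘ₗ vermaToWeyl q w Q₂) ↔ Q₁ ∣ Q₂ := by
  have hM : 0 < M := Nat.pos_of_mul_pos_right hMN
  have hN : 0 < N := Nat.pos_of_mul_pos_left hMN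
  constructor
  · rintro ⟨g, -, hg⟩
    refine dvd_of_mem_weylIdeal hq0 (sub_inv_ne_zero hq0 hq) h₁ h₂.2.1 ⟨M, by omega, by omega⟩ ?_ rfl
    set x : U q M N := ∑ s ∈ Finset.range (Q₂.natDegree + 1),
      Q₂.coeff (Q₂.natDegree - s) • X q (-1) ⟨M, by omega, by omega⟩ s
    have h1 := LinearMap.congr_fun hg (Submodule.Quotient.mk x)
    have h2 : vermaToWeyl q w Q₂ (Submodule.Quotient.mk x) = 0 :=
      (Submodule.Quotient.mk_eq_zero _).mpr (Submodule.subset_span (Or.inr (WeylRel.odd _ rfl)))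
    rw [LinearMap.comp_apply, h2, map_zero] at h1
    exact (Submodule.Quotient.mk_eq_zero _).mp h1
  · intro h
    refine ⟨Submodule.factor (weylIdeal_le_of_dvd hq0 hq hMN hne w h), ?_, ?_⟩
    · rintro i _ ⟨x, hx, rfl⟩
      exact ⟨x, hx, rfl⟩
    · refine LinearMap.ext fun x => ?_
      obtain ⟨x, rfl⟩ := Submodule.Quotient.mk_surjective _ x
      rfl

end Factorization

end QAffine

end

noncomputable section
set_option linter.unusedSectionVars false
namespace QAffine

/-! ## Finite-dimensional quotients of Verma modules -/

section Rank1

variable {V : Type*} [AddCommGroup V] [Module ℂ V] {E F K K' : Module.End ℂ V} {x κ : ℂ} {v : V}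

/-- The relations of `U_q(sl_2)` on a vector of highest weight. -/
structure IsRankOneHW (E F K K' : Module.End ℂ V) (x κ : ℂ) (v : V) : Prop where
  K_F : K * F = x ^ (-2 : ℤ) • (F * K)
  K'_F : K' * F = x ^ (2 : ℤ) • (F * K')
  E_F : E * F = F * E + (x - x⁻¹)⁻¹ • (K - K')
  E_v : E v = 0
  K_v : K v = κ • v
  K'_v : K' v = κ⁻¹ • v

theorem IsRankOneHW.K_pow (h : IsRankOneHW E F K K' x κ v) (hx : x ≠ 0) (k : ℕ) :
    K ((F ^ k) v) = (κ * x ^ (-2 * k : ℤ)) • (F ^ k) v := by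
  induction k with
  | zero => simp [h.K_v]
  | succ k ih =>
    rw [pow_succ', ← Module.End.mul_apply, ← mul_assoc, h.K_F, smul_mul_assoc, LinearMap.smul_apply,
      mul_assoc, Module.End.mul_apply, Module.End.mul_apply, ih, map_smul, smul_smul,
      Module.End.mul_apply]
    congr 1
    rw [mul_left_comm, ← zpow_add₀ hx]
    push_cast
    ring_nf

theorem IsRankOneHW.K'_pow (h : IsRankOneHW E F K K' x κ v) (hx : x ≠ 0) (k : ℕ) :
    K' ((F ^ k) v) = (κ⁻¹ * x ^ (2 * k : ℤ)) • (F ^ k) v := by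
  induction k with
  | zero => simp [h.K'_v]
  | succ k ih =>
    rw [pow_succ', ← Module.End.mul_apply, ← mul_assoc, h.K'_F, smul_mul_assoc,
      LinearMap.smul_apply, mul_assoc, Module.End.mul_apply, Module.End.mul_apply, ih, map_smul,
      smul_smul, Module.End.mul_apply]
    congr 1
    rw [mul_left_comm, ← zpow_add₀ hx]
    push_cast
    ring_nf

theorem IsRankOneHW.E_pow (h : IsRankOneHW E F K K' x κ v) (hx : x ≠ 0) (hx2 : x - x⁻¹ ≠ 0)
    (k : ℕ) : E ((F ^ (k + 1)) v) =
      (qInt x (k + 1) * ((κ * x ^ (-k : ℤ) - κ⁻¹ * x ^ (k : ℤ)) / (x - x⁻¹))) • (F ^ k) v := by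
  induction k with
  | zero =>
    rw [pow_succ', ← Module.End.mul_apply, ← mul_assoc, h.E_F, pow_zero, mul_one,
      LinearMap.add_apply, Module.End.mul_apply, h.E_v, map_zero, zero_add, LinearMap.smul_apply,
      LinearMap.sub_apply, h.K_v, h.K'_v, ← sub_smul, smul_smul]
    congr 1
    simp only [qInt, Nat.cast_zero, zero_add, zpow_one, zpow_neg_one, neg_zero, zpow_zero, mul_one]
    rw [div_self hx2]
    field_simp
  | succ k ih =>
    rw [pow_succ', ← Module.End.mul_apply, ← mul_assoc, h.E_F, Module.End.mul_apply,
      LinearMap.add_apply, Module.End.mul_apply, ih, LinearMap.smul_apply, LinearMap.sub_apply,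
      h.K_pow hx, h.K'_pow hx, map_smul, ← Module.End.mul_apply, ← pow_succ', ← sub_smul, smul_smul,
      ← add_smul]
    congr 1
    have e1 : x ^ (-(k + 1 : ℕ) : ℤ) = x ^ (-k : ℤ) * x⁻¹ := by
      rw [← zpow_neg_one, ← zpow_add₀ hx]
      push_cast
      ring_nf
    have e2 : x ^ ((k + 1 : ℕ) : ℤ) = x ^ (k : ℤ) * x := by
      rw [← zpow_add_one₀ hx]
      push_cast
      rfl
    have e3 : x ^ (-2 * (k + 1 : ℕ) : ℤ) = x ^ (-k : ℤ) * x ^ (-k : ℤ) * x⁻¹ * x⁻¹ := by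
      rw [← zpow_neg_one, ← zpow_add₀ hx, ← zpow_add₀ hx, ← zpow_add₀ hx]
      push_cast
      ring_nf
    have e4 : x ^ (2 * (k + 1 : ℕ) : ℤ) = x ^ (k : ℤ) * x ^ (k : ℤ) * x * x := by
      rw [← zpow_add₀ hx, ← zpow_add_one₀ hx, ← zpow_add_one₀ hx]
      push_cast
      ring_nf
    have e6 : x⁻¹ * x = 1 := inv_mul_cancel₀ hx
    have e7 : x ^ (((k + 1 : ℕ) : ℤ) + 1) = x ^ (k : ℤ) * x * x := by
      rw [zpow_add_one₀ hx, e2]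
    have e8 : x ^ (-(((k + 1 : ℕ) : ℤ) + 1)) = x ^ (-k : ℤ) * x⁻¹ * x⁻¹ := by
      rw [neg_add, zpow_add₀ hx, e1, zpow_neg_one]
    have e9 : x ^ ((k : ℤ) + 1) = x ^ (k : ℤ) * x := zpow_add_one₀ hx _
    have e10 : x ^ (-((k : ℤ) + 1)) = x ^ (-k : ℤ) * x⁻¹ := by
      rw [neg_add, zpow_add₀ hx, zpow_neg_one]
    simp only [qInt]
    rw [e7, e8, e9, e10, e1, e2, e3, e4]
    have hd : (x - x⁻¹) * (x - x⁻¹)⁻¹ = 1 := mul_inv_cancel₀ hx2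
    simp only [div_eq_mul_inv]
    clear e1 e2 e3 e4 e7 e8 e9 e10 ih hx2 h
    generalize (x - x⁻¹)⁻¹ = d at *
    generalize x⁻¹ = y at *
    generalize x ^ (k : ℤ) = a
    generalize x ^ (-k : ℤ) = b
    generalize κ⁻¹ = l
    linear_combination d * d * (-κ * a * b * x + κ * b * b * y + l * a * a * x - l * a * b * y) * e6 -
      d * (κ * b * b * y * y - l * a * a * x * x) * hd

theorem IsRankOneHW.exists_pow_eq_zero [FiniteDimensional ℂ V] (h : IsRankOneHW E F K K' x κ v)
    (hx : x ≠ 0) (hx1 : ∀ n : ℕ, 0 < n → x ^ n ≠ 1) (hκ : κ ≠ 0) : ∃ k, (F ^ k) v = 0 := by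
  by_contra! hne
  have hinj : Function.Injective fun k : ℕ => κ * x ^ (-2 * k : ℤ) := by
    have key : ∀ k l : ℕ, κ * x ^ (-2 * k : ℤ) = κ * x ^ (-2 * l : ℤ) → ¬ k < l := by
      intro k l hkl hlt
      have h1 := mul_left_cancel₀ hκ hkl
      refine hx1 (2 * (l - k)) (by omega) ?_
      rw [← zpow_natCast, show ((2 * (l - k) : ℕ) : ℤ) = -2 * k - -2 * l by push_cast; omega,
        zpow_sub₀ hx, h1, div_self (zpow_ne_zero _ hx)]
    intro k l hkl
    rcases lt_trichotomy k l with h1 | h1 | h1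
    · exact absurd h1 (key k l hkl)
    · exact h1
    · exact absurd h1 (key l k hkl.symm)
  have hsub : Set.range (fun k : ℕ => κ * x ^ (-2 * k : ℤ)) ⊆ {μ | K.HasEigenvalue μ} := by
    rintro _ ⟨k, rfl⟩
    exact Module.End.hasEigenvalue_of_hasEigenvector
      ⟨Module.End.mem_eigenspace_iff.mpr (h.K_pow hx k), hne k⟩
  exact Set.infinite_range_of_injective hinj ((Module.End.finite_hasEigenvalue K).subset hsub)

theorem IsRankOneHW.pow_eq_zero [FiniteDimensional ℂ V] {n : ℕ}
    (h : IsRankOneHW E F K K' x (x ^ n) v) (hx : x ≠ 0) (hx1 : ∀ n : ℕ, 0 < n → x ^ n ≠ 1) :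
    (F ^ (n + 1)) v = 0 := by
  by_contra hne
  obtain ⟨k, hk⟩ := h.exists_pow_eq_zero hx hx1 (pow_ne_zero n hx)
  have hx2 := sub_inv_ne_zero hx hx1
  have key : ∀ j, (F ^ (n + 1 + j)) v ≠ 0 := by
    intro j
    induction j with
    | zero => exact hne
    | succ j ih =>
      intro h0
      have h1 := h.E_pow hx hx2 (n + 1 + j)
      rw [← add_assoc] at h0
      rw [h0, map_zero] at h1
      refine (smul_ne_zero (mul_ne_zero (qInt_ne_zero hx hx1 (by omega)) ?_) ih) h1.symm
      have h2 := qInt_ne_zero hx hx1 (n := (n : ℤ) - (n + 1 + j : ℕ)) (by push_cast; omega)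
      rw [qInt, neg_sub, zpow_sub₀ hx, zpow_sub₀ hx] at h2
      rwa [← zpow_natCast x n, zpow_neg, ← div_eq_mul_inv, inv_mul_eq_div]
  refine key k ?_
  rw [pow_add, Module.End.mul_apply, hk, map_zero]

end Rank1

end QAffine

end

noncomputable section
set_option linter.unusedSectionVars false
namespace QAffine

section Quotient

variable {q : ℂ} {M N : ℕ} {V : Type*} [AddCommGroup V] [Module ℂ V] [Module (U q M N) V]
  [IsScalarTower ℂ (U q M N) V]

variable (V) in
/-- The action of an element, as a linear map. -/
abbrev act : U q M N →ₐ[ℂ] Module.End ℂ V := Algebra.lsmul ℂ ℂ V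

theorem K_neg_smul {v : V} {ε : ℤˣ} {i : Node M N} {κ : ℂ} (hκ : κ ≠ 0) (h : K q ε i • v = κ • v) :
    K q (-ε) i • v = κ⁻¹ • v := by
  have h1 : K q (-ε) i • K q ε i • v = v := by
    have := K_mul_K_neg (q := q) (-ε) i
    rw [neg_neg] at this
    rw [← mul_smul, this, one_smul]
  rw [h, smul_smul_comm'] at h1
  exact (eq_inv_smul_iff₀ hκ).mpr h1

theorem isRankOneHW_raise (hq0 : q ≠ 0) {i : Node M N} (hi : (i : ℕ) ≠ M) (m : ℤ) {v : V} {κ : ℂ}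
    (hκ : κ ≠ 0) (hv : X q 1 i m • v = 0) (hK : K q 1 i • v = κ • v) :
    IsRankOneHW (act V (X q 1 i m)) (act V (X q (-1) i (-m))) (act V (K q 1 i))
      (act V (K q (-1) i)) (qi q M i) κ v where
  K_F := by
    rw [← map_mul, ← map_mul, ← map_smul, K_mul_X hq0, cartan_self_even hi, qi, ← zpow_mul]
    congr 2
    simp [mul_comm]
  K'_F := by
    rw [← map_mul, ← map_mul, ← map_smul, K_mul_X hq0, cartan_self_even hi, qi, ← zpow_mul]
    congr 2
    simp [mul_comm]
  E_F := by
    rw [← map_mul, ← map_mul, ← map_sub, ← map_smul, ← map_add, X_mul_X_neg, if_pos rfl,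
      nodeSign_of_ne hi, one_smul, add_neg_cancel, phi_zero, phi_zero]
  E_v := hv
  K_v := hK
  K'_v := K_neg_smul hκ hK

theorem IsHWVector.K_even {w : HW M N} {v : V} (h : IsHWVector (q := q) w v)
    {i : Node M N} (hi : (i : ℕ) ≠ M) (hP : (w.P ⟨i, hi⟩).coeff 0 = 1) :
    K q 1 i • v = (qi q M i ^ (w.P ⟨i, hi⟩).natDegree) • v := by
  have h1 := h _ (VermaRel.evenZero i hi 0)
  rw [sub_smul, algebraMap_smul, sub_eq_zero, Nat.cast_zero, phi_zero] at h1
  rw [h1]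
  congr 1
  have hr : ∀ a : ℂ, PowerSeries.constantCoeff ((rescale a (w.P ⟨i, hi⟩) : ℂ[X]) : PowerSeries ℂ) =
      1 := by
    intro a
    rw [← PowerSeries.coeff_zero_eq_constantCoeff_apply, Polynomial.coeff_coe, rescale,
      Polynomial.coeff_zero_eq_eval_zero, Polynomial.eval_comp]
    simp [← Polynomial.coeff_zero_eq_eval_zero, hP]
  rw [evenWeightZero, PowerSeries.coeff_zero_eq_constantCoeff_apply, map_mul, map_mul, hr,
    PowerSeries.constantCoeff_inv, hr]
  simp

variable [FiniteDimensional ℂ V]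

theorem IsHWVector.X_pow_smul (hq0 : q ≠ 0) (hq : ∀ n : ℕ, 0 < n → q ^ n ≠ 1) {w : HW M N} {v : V}
    (h : IsHWVector (q := q) w v) {i : Node M N} (hi : (i : ℕ) ≠ M)
    (hP : (w.P ⟨i, hi⟩).coeff 0 = 1) :
    X q (-1) i 0 ^ (1 + (w.P ⟨i, hi⟩).natDegree) • v = 0 := by
  have h1 := isRankOneHW_raise hq0 hi 0 (pow_ne_zero _ (qi_ne_zero hq0 M i)) (h _ (VermaRel.raise i 0))
    (h.K_even hi hP)
  have h2 := h1.pow_eq_zero (qi_ne_zero hq0 M i) (qi_pow_ne_one hq i)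
  rw [← map_pow, neg_zero] at h2
  rw [add_comm]
  exact h2

theorem exists_lowSum_smul_eq_zero (v : V) (i : Node M N) :
    ∃ p : ℂ[X], p ≠ 0 ∧ lowSum (q := q) i p • v = 0 := by
  let L : ℂ[X] →ₗ[ℂ] V := ((act V : U q M N →ₐ[ℂ] _).toLinearMap ∘ₗ lowSum i).flip v
  have : ¬ Function.Injective L := fun hinj => Polynomial.not_finite (R := ℂ) (Module.Finite.of_injective L hinj)
  obtain ⟨p, hp, hp0⟩ := Submodule.ne_bot_iff _ |>.mp (mt LinearMap.ker_eq_bot.mp this)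
  exact ⟨p, hp0, hp⟩

theorem exists_Q (hq0 : q ≠ 0) (hq : ∀ n : ℕ, 0 < n → q ^ n ≠ 1) (hMN : 0 < M * N) (hne : M ≠ N)
    {w : HW M N} (hw : w ∈ R q M N) {v : V} (h : IsHWVector (q := q) w v) :
    ∃ Q : ℂ[X], (w, Q) ∈ Rtilde q M N ∧ ∀ u ∈ weylIdeal q w Q, u • v = 0 := by
  have hM : 0 < M := Nat.pos_of_mul_pos_right hMN
  have hN : 0 < N := Nat.pos_of_mul_pos_left hMN
  have hq2 := sub_inv_ne_zero hq0 hq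
  set i : Node M N := ⟨M, by omega, by omega⟩
  obtain ⟨j, -, hj⟩ := exists_adjacent_odd hMN hne i rfl
  have hH : ∀ s hs, H q j s hs ∈ lineStab v :=
    H_mem_lineStab hq2 (fun ε i n => h.phi_mem hq2 ε i n) j
  obtain ⟨p, hp0, hp⟩ := exists_lowSum_smul_eq_zero (q := q) v i
  obtain ⟨p₁, hp1, hp10⟩ : ∃ p₁ : ℂ[X], lowSum (q := q) i p₁ • v = 0 ∧ p₁.coeff 0 ≠ 0 := by
    obtain ⟨p₁, hpp, hndvd⟩ := (FiniteMultiplicity.of_not_isUnit (a := (Polynomial.X : ℂ[X]))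
      Polynomial.not_isUnit_X hp0).exists_eq_pow_mul_and_not_dvd
    refine ⟨p₁, ?_, fun h0 => hndvd (Polynomial.X_dvd_iff.mpr h0)⟩
    have key : ∀ k, lowSum (q := q) i (Polynomial.X ^ k * p₁) • v = 0 →
        lowSum (q := q) i p₁ • v = 0 := by
      intro k
      induction k with
      | zero => simp
      | succ k ih =>
        intro hk
        rw [pow_succ', mul_assoc] at hk
        exact ih (lowSum_of_X_mul_smul hq0 hq hj (hH _ _) hk)
    exact key _ (hpp ▸ hp)
  obtain ⟨⟨F, hF0, hF⟩, hc, hcf, hP⟩ := hw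
  set r : ℂ[X] := F.reverse * p₁
  have hr : r.coeff 0 ≠ 0 := by
    rw [Polynomial.mul_coeff_zero, Polynomial.coeff_zero_reverse]
    exact mul_ne_zero (Polynomial.leadingCoeff_ne_zero.mpr hF0) hp10
  have hr0 : r ≠ 0 := by
    rintro e
    rw [e] at hr
    simp at hr
  have hl : r.leadingCoeff⁻¹ ≠ 0 := inv_ne_zero (Polynomial.leadingCoeff_ne_zero.mpr hr0)
  set Q : ℂ[X] := Polynomial.C r.leadingCoeff⁻¹ * r.reverse
  have hQr : Q.reverse = Polynomial.C r.leadingCoeff⁻¹ * r := by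
    rw [Polynomial.reverse_mul_of_domain, Polynomial.reverse_C, reverse_reverse hr]
  have hQ0 : Q.coeff 0 = 1 := by
    rw [Polynomial.mul_coeff_zero, Polynomial.coeff_zero_reverse, Polynomial.coeff_C_zero,
      inv_mul_cancel₀ (Polynomial.leadingCoeff_ne_zero.mpr hr0)]
  refine ⟨Q, ⟨⟨⟨F, hF0, hF⟩, hc, hcf, hP⟩, hQ0, ?_⟩, fun u hu => ?_⟩
  · rw [polyMul_eq_zero_iff, hQr]
    exact aeval_shift_eq_zero_of_dvd (Dvd.intro_left (Polynomial.C r.leadingCoeff⁻¹ * p₁)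
      (by simp only [r]; ring)) ((polyMul_eq_zero_iff _ _).mp hF)
  · induction hu using Submodule.span_induction with
    | mem u hu =>
      rcases hu with hu | hu
      · exact h u hu
      · cases hu with
        | even k hk => exact h.X_pow_smul hq0 hq hk (hP _)
        | odd k hk =>
          obtain rfl : k = i := Subtype.ext hk
          rw [← lowSum_reverse, hQr]
          have := lowSum_mul_smul hq0 hq hj (hH _ _) hp1
            (Polynomial.C r.leadingCoeff⁻¹ * F.reverse)
          rwa [mul_assoc] at this
    | zero => exact zero_smul _ _
    | add a b _ _ ha hb => rw [add_smul, ha, hb, add_zero]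
    | smul a b _ hb => rw [smul_eq_mul, mul_smul, hb, smul_zero]

theorem exists_factorization (hq0 : q ≠ 0) (hq : ∀ n : ℕ, 0 < n → q ^ n ≠ 1) (hMN : 0 < M * N)
    (hne : M ≠ N) {w : HW M N} (hw : w ∈ R q M N) (𝒱 : ZMod 2 → Submodule ℂ V)
    (θ : Verma q w →ₗ[U q M N] V) (hθ : IsEvenMap (gradVerma q w) 𝒱 θ) :
    ∃ Q : ℂ[X], (w, Q) ∈ Rtilde q M N ∧ ∃ θ' : Weyl q w Q →ₗ[U q M N] V,
      IsEvenMap (gradWeyl q w Q) 𝒱 θ' ∧ θ = θ' ∘ₗ vermaToWeyl q w Q := by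
  set v : V := θ (Submodule.Quotient.mk 1)
  have hsmul : ∀ u : U q M N, u • v = θ (Submodule.Quotient.mk u) := by
    intro u
    rw [← map_smul, ← Submodule.Quotient.mk_smul, smul_eq_mul, mul_one]
  have hv : IsHWVector (q := q) w v := by
    intro u hu
    have h0 : (Submodule.Quotient.mk u : Verma q w) = 0 :=
      (Submodule.Quotient.mk_eq_zero _).mpr (Submodule.subset_span hu)
    rw [hsmul, h0, map_zero]
  obtain ⟨Q, hQ, hQv⟩ := exists_Q hq0 hq hMN hne hw hv
  refine ⟨Q, hQ, (weylIdeal q w Q).liftQ (LinearMap.toSpanSingleton (U q M N) V v)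
    (fun u hu => hQv u hu), ?_, ?_⟩
  · rintro i _ ⟨u, hu, rfl⟩
    change u • v ∈ _
    rw [hsmul]
    exact hθ i _ ⟨u, hu, rfl⟩
  · refine LinearMap.ext fun x => ?_
    obtain ⟨u, rfl⟩ := Submodule.Quotient.mk_surjective _ x
    exact (hsmul u).symm

end Quotient

end QAffine

end

noncomputable section
set_option linter.unusedSectionVars false
namespace QAffine

/-! ## Gradings and tori -/

section Grading

variable {A G : Type*} [Ring A] [Algebra ℂ A] {gen : G → A} {par : G → ZMod 2}

theorem gen_mem_wordGrading (g : G) : gen g ∈ wordGrading gen par (par g) :=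
  Submodule.subset_span ⟨[g], by simp, by simp⟩

theorem one_mem_wordGrading : (1 : A) ∈ wordGrading gen par 0 :=
  Submodule.subset_span ⟨[], by simp, by simp⟩

theorem mul_mem_wordGrading {i j : ZMod 2} {a b : A} (ha : a ∈ wordGrading gen par i)
    (hb : b ∈ wordGrading gen par j) : a * b ∈ wordGrading gen par (i + j) := by
  induction ha using Submodule.span_induction with
  | zero => rw [zero_mul]; exact Submodule.zero_mem _
  | add x y _ _ hx hy => rw [add_mul]; exact Submodule.add_mem _ hx hy
  | smul r x _ hx => rw [smul_mul_assoc]; exact Submodule.smul_mem _ _ hx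
  | mem x hx =>
    induction hb using Submodule.span_induction with
    | zero => rw [mul_zero]; exact Submodule.zero_mem _
    | add y z _ _ hy hz => rw [mul_add]; exact Submodule.add_mem _ hy hz
    | smul r y _ hy => rw [mul_smul_comm]; exact Submodule.smul_mem _ _ hy
    | mem y hy =>
      obtain ⟨l, hl, rfl⟩ := hx
      obtain ⟨l', hl', rfl⟩ := hy
      exact Submodule.subset_span ⟨l ++ l', by simp [hl, hl'], by simp⟩

theorem exists_wordGrading_add {f : FreeAlgebra ℂ G →ₐ[ℂ] A} (hf : Function.Surjective f) (a : A) :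
    ∃ b ∈ wordGrading (fun g => f (FreeAlgebra.ι ℂ g)) par 0,
      ∃ c ∈ wordGrading (fun g => f (FreeAlgebra.ι ℂ g)) par 1, a = b + c := by
  obtain ⟨x, rfl⟩ := hf a
  induction x using FreeAlgebra.induction with
  | grade0 r =>
    refine ⟨f (algebraMap ℂ _ r), ?_, 0, Submodule.zero_mem _, (add_zero _).symm⟩
    rw [AlgHom.commutes, Algebra.algebraMap_eq_smul_one]
    exact Submodule.smul_mem _ _ one_mem_wordGrading
  | grade1 g =>
    have h := gen_mem_wordGrading (gen := fun g => f (FreeAlgebra.ι ℂ g)) (par := par) g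
    have h2 : ∀ i : ZMod 2, i = 0 ∨ i = 1 := by decide
    rcases h2 (par g) with h3 | h3 <;> rw [h3] at h
    · exact ⟨_, h, 0, Submodule.zero_mem _, (add_zero _).symm⟩
    · exact ⟨0, Submodule.zero_mem _, _, h, (zero_add _).symm⟩
  | mul x y hx hy =>
    obtain ⟨b, hb, c, hc, h⟩ := hx
    obtain ⟨b', hb', c', hc', h'⟩ := hy
    have h00 := mul_mem_wordGrading hb hb'
    have h11 := mul_mem_wordGrading hc hc'
    have h01 := mul_mem_wordGrading hb hc'
    have h10 := mul_mem_wordGrading hc hb'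
    rw [add_zero] at h00 h10
    rw [zero_add] at h01
    rw [show (1 : ZMod 2) + 1 = 0 from by decide] at h11
    refine ⟨b * b' + c * c', Submodule.add_mem _ h00 h11, b * c' + c * b',
      Submodule.add_mem _ h01 h10, ?_⟩
    rw [map_mul, h, h']
    noncomm_ring
  | add x y hx hy =>
    obtain ⟨b, hb, c, hc, h⟩ := hx
    obtain ⟨b', hb', c', hc', h'⟩ := hy
    refine ⟨b + b', Submodule.add_mem _ hb hb', c + c', Submodule.add_mem _ hc hc', ?_⟩
    rw [map_add, h, h']
    abel

end Grading

section Stab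

variable {A V : Type*} [Ring A] [Algebra ℂ A] [AddCommGroup V] [Module ℂ V] [Module A V]
  [IsScalarTower ℂ A V]

variable (A) in
/-- The subalgebra of the elements that preserve a subspace. -/
def stabSub (S : Submodule ℂ V) : Subalgebra ℂ A where
  carrier := {a | ∀ x ∈ S, a • x ∈ S}
  mul_mem' ha hb x hx := by rw [mul_smul]; exact ha _ (hb _ hx)
  add_mem' ha hb x hx := by rw [add_smul]; exact S.add_mem (ha _ hx) (hb _ hx)
  algebraMap_mem' r x hx := by rw [algebraMap_smul]; exact S.smul_mem _ hx

end Stab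

section Torus

variable {q : ℂ} {M N : ℕ}

theorem mkU_surjective : Function.Surjective (mkU q M N) :=
  RingQuot.mkAlgHom_surjective ℂ _

theorem eq_top_of_gen_mem {S : Subalgebra ℂ (U q M N)} (hX : ∀ ε i n, X q ε i n ∈ S)
    (hK : ∀ ε i, K q ε i ∈ S) (hH : ∀ i s hs, H q i s hs ∈ S) (a : U q M N) : a ∈ S := by
  obtain ⟨x, rfl⟩ := mkU_surjective a
  induction x using FreeAlgebra.induction with
  | grade0 r => rw [AlgHom.commutes]; exact S.algebraMap_mem r
  | grade1 g =>
    cases g with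
    | X ε i n => exact hX ε i n
    | K ε i => exact hK ε i
    | H i s hs => exact hH i s hs
  | mul x y hx hy => rw [map_mul]; exact S.mul_mem hx hy
  | add x y hx hy => rw [map_add]; exact S.add_mem hx hy

theorem phi_mem {S : Subalgebra ℂ (U q M N)} (hK : ∀ ε i, K q ε i ∈ S)
    (hH : ∀ i s hs, H q i s hs ∈ S) (ε : ℤˣ) (i : Node M N) (n : ℤ) : phi q ε i n ∈ S := by
  by_cases hn : (ε : ℤ) * n < 0
  · rw [phi_of_neg ε i hn]
    exact S.zero_mem
  have h1 : ∀ s, PowerSeries.coeff s (PowerSeries.map (mkU q M N : FreeU M N →+* U q M N)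
      (hSeries q ε i)) ∈ S := by
    intro s
    by_cases hs : s = 0
    · rw [PowerSeries.coeff_map, hSeries, PowerSeries.coeff_mk, dif_pos hs, map_zero]
      exact S.zero_mem
    · rw [coeff_map_hSeries ε i s hs]
      exact S.smul_mem (hH _ _ _) _
  have h2 : ∀ k s, PowerSeries.coeff s ((PowerSeries.map (mkU q M N : FreeU M N →+* U q M N)
      (hSeries q ε i)) ^ k) ∈ S := by
    intro k
    induction k with
    | zero =>
      intro s
      rw [pow_zero, PowerSeries.coeff_one]
      split_ifs
      exacts [S.one_mem, S.zero_mem]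
    | succ k ih =>
      intro s
      rw [pow_succ, PowerSeries.coeff_mul]
      exact S.sum_mem fun p _ => S.mul_mem (ih _) (h1 _)
  obtain ⟨k, hk⟩ := Int.eq_ofNat_of_zero_le (not_lt.mp hn)
  have hk' : n = (ε : ℤ) * (k : ℤ) := by
    rw [← hk, ← mul_assoc]
    rcases Int.units_eq_one_or ε with rfl | rfl <;> simp
  rw [hk', phi_eq]
  exact S.mul_mem (hK _ _) (S.sum_mem fun k _ => S.smul_mem (h2 _ _) _)

variable (q M N) in
/-- The subalgebra generated by the `K_i^{±1}`. -/
def torusAlg : Subalgebra ℂ (U q M N) :=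
  Algebra.adjoin ℂ (Set.range fun a : ℤˣ × Node M N => K q a.1 a.2)

theorem torusAlg_le {S : Subalgebra ℂ (U q M N)} (hK : ∀ ε i, K q ε i ∈ S) : torusAlg q M N ≤ S :=
  Algebra.adjoin_le (by rintro _ ⟨a, rfl⟩; exact hK _ _)

theorem K_mem_torusAlg (ε : ℤˣ) (i : Node M N) : K q ε i ∈ torusAlg q M N :=
  Algebra.subset_adjoin ⟨(ε, i), rfl⟩

theorem torusAlg_comm {d : U q M N} (hd : d ∈ torusAlg q M N) :
    (∀ ε i, Commute d (K q ε i)) ∧ ∀ i s hs, Commute d (H q i s hs) := by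
  have h : torusAlg q M N ≤ Subalgebra.centralizer ℂ
      (Set.range (fun a : ℤˣ × Node M N => K q a.1 a.2) ∪ {x | ∃ i s hs, x = H q i s hs}) := by
    refine torusAlg_le fun ε i => ?_
    rw [Subalgebra.mem_centralizer_iff]
    rintro _ (⟨a, rfl⟩ | ⟨j, s, hs, rfl⟩)
    · exact K_comm_K _ _ _ _
    · exact (K_comm_H ε i j s hs).symm
  have h2 := Subalgebra.mem_centralizer_iff ℂ |>.mp (h hd)
  exact ⟨fun ε i => (h2 _ (Or.inl ⟨(ε, i), rfl⟩)).symm,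
    fun i s hs => (h2 _ (Or.inr ⟨i, s, hs, rfl⟩)).symm⟩

/-- The weights `t` for which some element of the torus rescales `X_{j,n}^±` by `q^{± t_j}`. -/
def torusWeights (hq0 : q ≠ 0) : AddSubgroup (Node M N → ℤ) where
  carrier := {t | ∃ d d' : U q M N, d ∈ torusAlg q M N ∧ d' ∈ torusAlg q M N ∧ d * d' = 1 ∧
    d' * d = 1 ∧ ∀ (ε : ℤˣ) j n, d * X q ε j n = q ^ ((ε : ℤ) * t j) • (X q ε j n * d)}
  zero_mem' := ⟨1, 1, Subalgebra.one_mem _, Subalgebra.one_mem _, by simp, by simp, by simp⟩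
  add_mem' := by
    rintro t t' ⟨d, d', hd, hd', h1, h2, h3⟩ ⟨e, e', he, he', h1', h2', h3'⟩
    refine ⟨d * e, e' * d', Subalgebra.mul_mem _ hd he, Subalgebra.mul_mem _ he' hd', ?_, ?_,
      fun ε j n => ?_⟩
    · rw [mul_assoc, ← mul_assoc e, h1', one_mul, h1]
    · rw [mul_assoc, ← mul_assoc d', h2, one_mul, h2']
    · rw [mul_assoc, h3', mul_smul_comm, ← mul_assoc, h3, smul_mul_assoc, smul_smul,
        ← zpow_add₀ hq0, mul_assoc]
      congr 2
      rw [Pi.add_apply]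
      ring
  neg_mem' := by
    rintro t ⟨d, d', hd, hd', h1, h2, h3⟩
    refine ⟨d', d, hd', hd, h2, h1, fun ε j n => ?_⟩
    have : d' * (d * X q ε j n) * d' = X q ε j n * d' := by rw [← mul_assoc, h2, one_mul]
    rw [← this, h3, mul_smul_comm, smul_mul_assoc, smul_smul, ← zpow_add₀ hq0, mul_assoc, mul_assoc,
      h1, mul_one]
    simp

theorem cartan_mem_torusWeights (hq0 : q ≠ 0) (i : Node M N) :
    (fun j : Node M N => cartan M i j) ∈ torusWeights (q := q) hq0 := by
  refine ⟨K q 1 i, K q (-1) i, K_mem_torusAlg _ _, K_mem_torusAlg _ _, K_mul_K_neg _ _, ?_,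
    fun ε j n => ?_⟩
  · simpa using K_mul_K_neg (q := q) (-1) i
  · rw [K_mul_X hq0, Units.val_one, one_mul]

/-- The partial sums of the signs `l_i`. -/
def ellSum (M k : ℕ) : ℤ := ∑ l ∈ Finset.range k, ell M (l + 1)

theorem ellSum_top (M N : ℕ) : ellSum M (M + N) = (M : ℤ) - N := by
  have h1 : ∀ l ∈ Finset.range M, ell M (l + 1) = 1 := fun l hl => by
    rw [ell, if_pos (by have := Finset.mem_range.mp hl; omega)]
  have h2 : ∀ l ∈ Finset.range N, ell M (M + l + 1) = -1 := fun l _ => by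
    rw [ell, if_neg (by omega)]
  rw [ellSum, Finset.sum_range_add, Finset.sum_congr rfl h1, Finset.sum_congr rfl h2]
  simp [sub_eq_add_neg]

/-- The coefficients of `M - N` times the fundamental weights. -/
def fundCoeff (M N k i : ℕ) : ℤ := ((M : ℤ) - N) * ellSum M (min k i) - ellSum M k * ellSum M i

theorem sum_fundCoeff_mul_cartan {M N k j : ℕ} (hj : 1 ≤ j ∧ j ≤ M + N - 1) (hk : k < M + N) :
    ∑ i ∈ Finset.range (M + N), fundCoeff M N k i * cartan M i j =
      if j = k then (M : ℤ) - N else 0 := by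
  let B : ℕ → ℤ := fun l => epsForm M l j - epsForm M l (j + 1)
  have habel : ∀ m, ∑ i ∈ Finset.range m, fundCoeff M N k i * cartan M i j =
      ∑ i ∈ Finset.range m, (fundCoeff M N k (i + 1) - fundCoeff M N k i) * B (i + 1) -
        fundCoeff M N k m * B m := by
    intro m
    induction m with
    | zero => simp [fundCoeff, ellSum]
    | succ m ih =>
      rw [Finset.sum_range_succ, Finset.sum_range_succ, ih]
      simp only [B, cartan]
      ring
  have hsucc : ∀ i, ellSum M (i + 1) = ellSum M i + ell M (i + 1) := fun i =>
    Finset.sum_range_succ _ _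
  have hterm : ∀ i, (fundCoeff M N k (i + 1) - fundCoeff M N k i) * B (i + 1) =
      (if i + 1 = j then (((M : ℤ) - N) * (if i + 1 ≤ k then 1 else 0) - ellSum M k) else 0) -
        (if i = j then (((M : ℤ) - N) * (if i + 1 ≤ k then 1 else 0) - ellSum M k) else 0) := by
    intro i
    have h1 : fundCoeff M N k (i + 1) - fundCoeff M N k i =
        ell M (i + 1) * (((M : ℤ) - N) * (if i + 1 ≤ k then 1 else 0) - ellSum M k) := by
      rw [fundCoeff, fundCoeff, hsucc]
      split_ifs with h
      · rw [min_eq_right h, min_eq_right (by omega), hsucc]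
        ring
      · rw [min_eq_left (by omega), min_eq_left (by omega)]
        ring
    have h2 : ell M (i + 1) * ell M (i + 1) = 1 := by
      rcases ell_eq M (i + 1) with ⟨_, h⟩ | ⟨_, h⟩ <;> rw [h] <;> rfl
    rw [h1]
    by_cases h3 : i + 1 = j
    · simp only [B, epsForm, h3, if_true, show i ≠ j by omega, show j ≠ j + 1 by omega, if_false]
      rw [h3] at h2
      linear_combination (((M : ℤ) - N) * (if j ≤ k then 1 else 0) - ellSum M k) * h2
    · by_cases h4 : i = j
      · subst h4
        simp only [B, epsForm, h3, if_true, if_false]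
        linear_combination -(((M : ℤ) - N) * (if i + 1 ≤ k then 1 else 0) - ellSum M k) * h2
      · simp only [B, epsForm, h3, h4, add_left_inj, if_false]
        ring
  have htop : fundCoeff M N k (M + N) = 0 := by
    rw [fundCoeff, min_eq_left hk.le, ellSum_top]
    ring
  rw [habel, htop, zero_mul, sub_zero, Finset.sum_congr rfl fun i _ => hterm i,
    Finset.sum_sub_distrib]
  obtain ⟨j, rfl⟩ : ∃ j', j = j' + 1 := ⟨j - 1, by omega⟩
  simp only [add_left_inj]
  rw [Finset.sum_ite_eq', Finset.sum_ite_eq', if_pos (Finset.mem_range.mpr (by omega)),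
    if_pos (Finset.mem_range.mpr (by omega))]
  split_ifs <;> omega

theorem fund_mem_torusWeights (hq0 : q ≠ 0) {k : ℕ} (hk : k < M + N) :
    (fun j : Node M N => if (j : ℕ) = k then (M : ℤ) - N else 0) ∈ torusWeights (q := q) hq0 := by
  have h : (fun j : Node M N => if (j : ℕ) = k then (M : ℤ) - N else 0) =
      ∑ i ∈ Finset.range (M + N), fundCoeff M N k i • fun j : Node M N => cartan M i j := by
    funext j
    rw [← sum_fundCoeff_mul_cartan j.2 hk, Finset.sum_apply]
    rfl
  rw [h]
  refine sum_mem fun i hi => ?_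
  rcases Nat.eq_zero_or_pos i with rfl | h0
  · have : fundCoeff M N k 0 = 0 := by simp [fundCoeff, ellSum]
    rw [this, zero_smul]
    exact zero_mem _
  · have := Finset.mem_range.mp hi
    exact zsmul_mem (cartan_mem_torusWeights hq0 ⟨i, by omega, by omega⟩) _

theorem height_mem_torusWeights (hq0 : q ≠ 0) :
    (fun _ : Node M N => (M : ℤ) - N) ∈ torusWeights (q := q) hq0 := by
  have h : (fun _ : Node M N => (M : ℤ) - N) = ∑ k ∈ Finset.range (M + N),
      fun j : Node M N => if (j : ℕ) = k then (M : ℤ) - N else 0 := by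
    funext j
    have := j.2
    rw [Finset.sum_apply, Finset.sum_ite_eq, if_pos (Finset.mem_range.mpr (by omega))]
  rw [h]
  exact sum_mem fun k hk => fund_mem_torusWeights hq0 (Finset.mem_range.mp hk)

end Torus

end QAffine

end

noncomputable section
set_option linter.unusedSectionVars false
namespace QAffine

/-! ## Highest weight vectors and the levels below them -/

section Weights

variable {q : ℂ} {M N : ℕ} {V : Type*} [AddCommGroup V] [Module ℂ V] [Module (U q M N) V]
  [IsScalarTower ℂ (U q M N) V]

theorem exists_forall_mem_lineStab [FiniteDimensional ℂ V] (T : Set (U q M N))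
    (hT : ∀ a ∈ T, ∀ b ∈ T, Commute a b) {S : Submodule ℂ V} (hS : S ≠ ⊥)
    (hst : ∀ a ∈ T, a ∈ stabSub (U q M N) S) :
    ∃ v ∈ S, v ≠ 0 ∧ ∀ a ∈ T, a ∈ lineStab v := by
  obtain ⟨S', ⟨hle, hne, hs⟩, hmin⟩ := WellFounded.has_min (wellFounded_lt (α := Submodule ℂ V))
    {S' | S' ≤ S ∧ S' ≠ ⊥ ∧ ∀ a ∈ T, a ∈ stabSub (U q M N) S'} ⟨S, le_rfl, hS, hst⟩
  obtain ⟨v, hv, hv0⟩ := Submodule.ne_bot_iff _ |>.mp hne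
  refine ⟨v, hle hv, hv0, fun a ha => ?_⟩
  have : Nontrivial S' := Submodule.nontrivial_iff_ne_bot.mpr hne
  obtain ⟨r, hr⟩ := Module.End.exists_eigenvalue ((act V a).restrict (p := S') (hs a ha))
  obtain ⟨x, hx⟩ := hr.exists_hasEigenvector
  have hx1 : a • (x : V) = r • (x : V) := congrArg Subtype.val hx.apply_eq_smul
  let S'' : Submodule ℂ V := S' ⊓ LinearMap.ker (act V a - r • 1)
  have hmem : ∀ y, y ∈ S'' ↔ y ∈ S' ∧ a • y = r • y := by
    intro y
    rw [Submodule.mem_inf, LinearMap.mem_ker, LinearMap.sub_apply, sub_eq_zero]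
    rfl
  have h1 : ¬ S'' < S' := hmin S'' ⟨inf_le_left.trans hle, Submodule.ne_bot_iff _ |>.mpr
    ⟨x, (hmem _).mpr ⟨x.2, hx1⟩, fun h => hx.2 (Subtype.ext h)⟩, fun b hb y hy => by
      rw [hmem] at hy ⊢
      refine ⟨hs b hb _ hy.1, ?_⟩
      rw [← mul_smul, (hT a ha b hb).eq, mul_smul, hy.2, smul_smul_comm']⟩
  have h2 : S'' = S' := (inf_le_left.lt_or_eq).resolve_left h1
  rw [← h2, hmem] at hv
  exact ⟨r, hv.2⟩

theorem exists_not_hasEigenvalue_pow_mul [FiniteDimensional ℂ V] (T : Module.End ℂ V) {c μ : ℂ}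
    (hc0 : c ≠ 0) (hc : ∀ n : ℕ, 0 < n → c ^ n ≠ 1) (hμ : μ ≠ 0) :
    ∃ k : ℕ, ¬ T.HasEigenvalue (c ^ k * μ) := by
  by_contra! hall
  have hinj : Function.Injective fun k : ℕ => c ^ k * μ := by
    have key : ∀ k l : ℕ, c ^ k * μ = c ^ l * μ → ¬ k < l := by
      intro k l hkl hlt
      have h1 := mul_right_cancel₀ hμ hkl
      refine hc (l - k) (by omega) ?_
      rw [pow_sub₀ _ hc0 hlt.le, ← h1, mul_inv_cancel₀ (pow_ne_zero _ hc0)]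
    intro k l hkl
    rcases lt_trichotomy k l with h1 | h1 | h1
    · exact absurd h1 (key k l hkl)
    · exact h1
    · exact absurd h1 (key l k hkl.symm)
  refine Set.infinite_range_of_injective hinj ((Module.End.finite_hasEigenvalue T).subset ?_)
  rintro _ ⟨k, rfl⟩
  exact hall k

theorem exists_eigenvector_of_mul_not [FiniteDimensional ℂ V] [Nontrivial V] {d d' : U q M N}
    (hd : d' * d = 1) {c : ℂ} (hc0 : c ≠ 0) (hc : ∀ n : ℕ, 0 < n → c ^ n ≠ 1) :
    ∃ μ : ℂ, μ ≠ 0 ∧ (∃ x : V, x ≠ 0 ∧ d • x = μ • x) ∧ ∀ x : V, d • x = (c * μ) • x → x = 0 := by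
  obtain ⟨μ, hμ⟩ := Module.End.exists_eigenvalue (act V d)
  obtain ⟨x, hx⟩ := hμ.exists_hasEigenvector
  have hμ0 : μ ≠ 0 := by
    rintro rfl
    have h1 : d • x = (0 : ℂ) • x := hx.apply_eq_smul
    apply hx.2
    rw [← one_smul (U q M N) x, ← hd, mul_smul, h1, zero_smul, smul_zero]
  by_contra! hcon
  have hall : ∀ k : ℕ, Module.End.HasEigenvalue (act V d) (c ^ k * μ) := by
    intro k
    induction k with
    | zero => simpa using hμ
    | succ k ih =>
      obtain ⟨y, hy⟩ := ih.exists_hasEigenvector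
      obtain ⟨z, hz, hz0⟩ := hcon (c ^ k * μ) (mul_ne_zero (pow_ne_zero _ hc0) hμ0)
        ⟨y, hy.2, hy.apply_eq_smul⟩
      refine Module.End.hasEigenvalue_of_hasEigenvector (x := z) ⟨?_, hz0⟩
      rw [Module.End.mem_eigenspace_iff, pow_succ', mul_assoc]
      exact hz
  obtain ⟨k, hk⟩ := exists_not_hasEigenvalue_pow_mul (act V d) hc0 hc hμ0
  exact hk (hall k)

/-- The span of the `X_{i_1,m_1}^- ⋯ X_{i_k,m_k}^- v` with `i_1, …, i_k ∈ I`. -/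
def lvl (I : Set (Node M N)) (v : V) : ℕ → Submodule ℂ V
  | 0 => ℂ ∙ v
  | k + 1 => Submodule.span ℂ {x | ∃ i ∈ I, ∃ m, ∃ y ∈ lvl I v k, x = X q (-1) i m • y}

theorem lvl_zero (I : Set (Node M N)) (v : V) : lvl (q := q) I v 0 = ℂ ∙ v := rfl

theorem X_smul_mem_lvl {I : Set (Node M N)} {v y : V} {k : ℕ} {i : Node M N} (hi : i ∈ I) (m : ℤ)
    (hy : y ∈ lvl (q := q) I v k) : X q (-1) i m • y ∈ lvl (q := q) I v (k + 1) :=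
  Submodule.subset_span ⟨i, hi, m, y, hy, rfl⟩

theorem lvl_succ_le {I : Set (Node M N)} {v : V} {k : ℕ} {S : Submodule ℂ V}
    (h : ∀ i ∈ I, ∀ m, ∀ y ∈ lvl (q := q) I v k, X q (-1) i m • y ∈ S) :
    lvl (q := q) I v (k + 1) ≤ S :=
  Submodule.span_le.mpr (by rintro _ ⟨i, hi, m, y, hy, rfl⟩; exact h i hi m y hy)

theorem lvl_eigen {I : Set (Node M N)} {v : V} {d : U q M N} {c μ : ℂ}
    (hd : ∀ i ∈ I, ∀ m, d * X q (-1) i m = c • (X q (-1) i m * d)) (hv : d • v = μ • v) (k : ℕ) :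
    ∀ y ∈ lvl (q := q) I v k, d • y = (c ^ k * μ) • y := by
  induction k with
  | zero =>
    intro y hy
    obtain ⟨r, rfl⟩ := Submodule.mem_span_singleton.mp hy
    rw [smul_smul_comm', hv, pow_zero, one_mul, smul_comm]
  | succ k ih =>
    have : lvl (q := q) I v (k + 1) ≤ LinearMap.ker (act V d - (c ^ (k + 1) * μ) • 1) := by
      refine lvl_succ_le fun i hi m y hy => ?_
      rw [LinearMap.mem_ker, LinearMap.sub_apply, sub_eq_zero]
      change d • X q (-1) i m • y = (c ^ (k + 1) * μ) • X q (-1) i m • y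
      rw [← mul_smul, hd i hi, smul_assoc, mul_smul, ih y hy, smul_smul_comm', smul_smul, pow_succ',
        mul_assoc]
    intro y hy
    have := this hy
    rwa [LinearMap.mem_ker, LinearMap.sub_apply, sub_eq_zero] at this

/-- A vector killed by the `X_{i,n}^+` on which the `K_i^{±1}` and the `h_{i,s}` act by scalars. -/
structure IsSingular (v : V) : Prop where
  raise : ∀ (i : Node M N) n, X q 1 i n • v = 0
  K_mem : ∀ ε (i : Node M N), K q ε i ∈ lineStab v
  H_mem : ∀ (i : Node M N) s hs, H q i s hs ∈ lineStab v

theorem IsSingular.K_mem_stab {v : V} (h : IsSingular (q := q) (M := M) (N := N) v) (hq0 : q ≠ 0)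
    (I : Set (Node M N)) (ε : ℤˣ) (j : Node M N) (k : ℕ) :
    K q ε j ∈ stabSub (U q M N) (lvl (q := q) I v k) := by
  induction k with
  | zero =>
    intro y hy
    obtain ⟨r, rfl⟩ := Submodule.mem_span_singleton.mp hy
    obtain ⟨s, hs⟩ := h.K_mem ε j
    rw [smul_smul_comm', hs]
    exact Submodule.smul_mem _ _ (Submodule.smul_mem _ _ (Submodule.mem_span_singleton_self v))
  | succ k ih =>
    have : lvl (q := q) I v (k + 1) ≤ (lvl (q := q) I v (k + 1)).comap (act V (K q ε j)) := by
      refine lvl_succ_le fun i hi m y hy => ?_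
      change K q ε j • X q (-1) i m • y ∈ lvl (q := q) I v (k + 1)
      rw [← mul_smul, K_mul_X hq0, smul_assoc, mul_smul]
      exact Submodule.smul_mem _ _ (X_smul_mem_lvl hi m (ih _ hy))
    exact this

theorem IsSingular.H_mem_stab {v : V} (h : IsSingular (q := q) (M := M) (N := N) v)
    (I : Set (Node M N)) (j : Node M N) (s : ℤ) (hs : s ≠ 0) (k : ℕ) :
    H q j s hs ∈ stabSub (U q M N) (lvl (q := q) I v k) := by
  induction k with
  | zero =>
    intro y hy
    obtain ⟨r, rfl⟩ := Submodule.mem_span_singleton.mp hy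
    obtain ⟨s, hs⟩ := h.H_mem j s hs
    rw [smul_smul_comm', hs]
    exact Submodule.smul_mem _ _ (Submodule.smul_mem _ _ (Submodule.mem_span_singleton_self v))
  | succ k ih =>
    have : lvl (q := q) I v (k + 1) ≤ (lvl (q := q) I v (k + 1)).comap (act V (H q j s hs)) := by
      refine lvl_succ_le fun i hi m y hy => ?_
      change H q j s hs • X q (-1) i m • y ∈ lvl (q := q) I v (k + 1)
      rw [← mul_smul, H_mul_X, add_smul, smul_assoc, mul_smul]
      exact Submodule.add_mem _ (X_smul_mem_lvl hi m (ih _ hy))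
        (Submodule.smul_mem _ _ (X_smul_mem_lvl hi _ hy))
    exact this

theorem IsSingular.raise_lvl {v : V} (h : IsSingular (q := q) (M := M) (N := N) v) (hq0 : q ≠ 0)
    (I : Set (Node M N)) (j : Node M N) (n : ℤ) (k : ℕ) :
    ∀ y ∈ lvl (q := q) I v (k + 1), X q 1 j n • y ∈ lvl (q := q) I v k := by
  have h0 : ∀ y ∈ lvl (q := q) I v 0, X q 1 j n • y = 0 := by
    intro y hy
    obtain ⟨r, rfl⟩ := Submodule.mem_span_singleton.mp hy
    rw [smul_smul_comm', h.raise, smul_zero]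
  induction k with
  | zero =>
    have : lvl (q := q) I v 1 ≤ (lvl (q := q) I v 0).comap (act V (X q 1 j n)) := by
      refine lvl_succ_le fun i hi m y hy => ?_
      change X q 1 j n • X q (-1) i m • y ∈ lvl (q := q) I v 0
      rw [← mul_smul, X_mul_X_neg, add_smul, smul_assoc, mul_smul, h0 y hy, smul_zero, smul_zero,
        zero_add]
      split_ifs
      · have hphi : ∀ ε, phi q ε j (n + m) ∈ stabSub (U q M N) (lvl (q := q) I v 0) := fun ε =>
          phi_mem (fun _ _ => h.K_mem_stab hq0 I _ _ _) (fun _ _ _ => h.H_mem_stab I _ _ _ _) ε j _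
        exact Subalgebra.smul_mem _ (Subalgebra.sub_mem _ (hphi _) (hphi _)) _ _ hy
      · rw [zero_smul]
        exact Submodule.zero_mem _
    exact this
  | succ k ih =>
    have : lvl (q := q) I v (k + 2) ≤ (lvl (q := q) I v (k + 1)).comap (act V (X q 1 j n)) := by
      refine lvl_succ_le fun i hi m y hy => ?_
      change X q 1 j n • X q (-1) i m • y ∈ lvl (q := q) I v (k + 1)
      rw [← mul_smul, X_mul_X_neg, add_smul, smul_assoc, mul_smul]
      refine Submodule.add_mem _ ?_ ?_
      · have h1 := X_smul_mem_lvl (q := q) hi m (ih y hy)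
        exact Submodule.smul_mem _ _ h1
      split_ifs
      · have hphi : ∀ ε, phi q ε j (n + m) ∈ stabSub (U q M N) (lvl (q := q) I v (k + 1)) :=
          fun ε => phi_mem (fun _ _ => h.K_mem_stab hq0 I _ _ _)
            (fun _ _ _ => h.H_mem_stab I _ _ _ _) ε j _
        exact Subalgebra.smul_mem _ (Subalgebra.sub_mem _ (hphi _) (hphi _)) _ _ hy
      · rw [zero_smul]
        exact Submodule.zero_mem _
    exact this

theorem IsSingular.mem_stabSub_iSup_lvl {v : V} (h : IsSingular (q := q) (M := M) (N := N) v)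
    (hq0 : q ≠ 0) (a : U q M N) :
    a ∈ stabSub (U q M N) (⨆ k, lvl (q := q) (M := M) (N := N) Set.univ v k) := by
  have key : ∀ b : U q M N, (∀ k, ∃ l, ∀ y ∈ lvl (q := q) (M := M) (N := N) Set.univ v k,
      b • y ∈ lvl (q := q) (M := M) (N := N) Set.univ v l) →
      b ∈ stabSub (U q M N) (⨆ k, lvl (q := q) (M := M) (N := N) Set.univ v k) := by
    intro b hb
    have : (⨆ k, lvl (q := q) (M := M) (N := N) Set.univ v k) ≤ (⨆ k, lvl (q := q) (M := M) (N := N) Set.univ v k).comap (act V b) := by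
      refine iSup_le fun k y hy => ?_
      obtain ⟨l, hl⟩ := hb k
      exact Submodule.mem_iSup_of_mem l (hl y hy)
    exact this
  refine eq_top_of_gen_mem (fun ε i n => ?_) (fun ε i => ?_) (fun i s hs => ?_) a
  · rcases Int.units_eq_one_or ε with rfl | rfl
    · refine key _ fun k => ?_
      cases k with
      | zero =>
        refine ⟨0, fun y hy => ?_⟩
        obtain ⟨r, rfl⟩ := Submodule.mem_span_singleton.mp hy
        rw [smul_smul_comm', h.raise, smul_zero]
        exact Submodule.zero_mem _
      | succ k => exact ⟨k, h.raise_lvl hq0 _ i n k⟩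
    · exact key _ fun k => ⟨k + 1, fun y hy => X_smul_mem_lvl (Set.mem_univ i) n hy⟩
  · exact key _ fun k => ⟨k, h.K_mem_stab hq0 _ ε i k⟩
  · exact key _ fun k => ⟨k, h.H_mem_stab _ i s hs k⟩

theorem exists_lvl_ne_bot [FiniteDimensional ℂ V] {v : V} (hv0 : v ≠ 0) {I : Set (Node M N)}
    {d : U q M N} {c μ : ℂ}
    (hd : ∀ i ∈ I, ∀ m, d * X q (-1) i m = c • (X q (-1) i m * d)) (hv : d • v = μ • v)
    (hc0 : c ≠ 0) (hc : ∀ n : ℕ, 0 < n → c ^ n ≠ 1) (hμ : μ ≠ 0) :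
    ∃ n, lvl (q := q) I v n ≠ ⊥ ∧ lvl (q := q) I v (n + 1) = ⊥ := by
  classical
  have hex : ∃ k, lvl (q := q) I v k = ⊥ := by
    obtain ⟨k, hk⟩ := exists_not_hasEigenvalue_pow_mul (act V d) hc0 hc hμ
    refine ⟨k, ?_⟩
    by_contra hne
    obtain ⟨y, hy, hy0⟩ := Submodule.ne_bot_iff _ |>.mp hne
    exact hk (Module.End.hasEigenvalue_of_hasEigenvector
      ⟨Module.End.mem_eigenspace_iff.mpr (lvl_eigen hd hv k y hy), hy0⟩)
  have h0 : Nat.find hex ≠ 0 := by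
    intro h0
    have := Nat.find_spec hex
    rw [h0, lvl_zero, Submodule.span_singleton_eq_bot] at this
    exact hv0 this
  obtain ⟨n, hn⟩ := Nat.exists_eq_succ_of_ne_zero h0
  exact ⟨n, Nat.find_min hex (by omega), by rw [← Nat.succ_eq_add_one, ← hn]; exact Nat.find_spec hex⟩

end Weights

section Simple

variable {q : ℂ} {M N : ℕ} {V : Type*} [AddCommGroup V] [Module ℂ V] [Module (U q M N) V]
  [IsScalarTower ℂ (U q M N) V] {𝒱 : ZMod 2 → Submodule ℂ V}

theorem IsSuperModule.exists_smul_eq (h : IsSuperModule (gradU q M N) 𝒱)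
    (hs : IsSimpleSuper (U q M N) 𝒱) {p : ZMod 2} {v : V} (hv : v ∈ 𝒱 p) (hv0 : v ≠ 0) (y : V) :
    ∃ a : U q M N, y = a • v := by
  have h1 := hs.2 (Submodule.span (U q M N) {v}) (by
    intro x hx
    obtain ⟨a, rfl⟩ := Submodule.mem_span_singleton.mp hx
    obtain ⟨b, hb, c, hc, rfl⟩ := exists_wordGrading_add (par := Gen.par) mkU_surjective a
    have hb' := h.smul_mem 0 p b v hb hv
    have hc' := h.smul_mem 1 p c v hc hv
    have hmem : ∀ u : U q M N, u • v ∈ Submodule.span (U q M N) {v} := fun u =>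
      Submodule.smul_mem _ _ (Submodule.mem_span_singleton_self v)
    have h2 : ∀ i : ZMod 2, i = 0 ∨ i = 1 := by decide
    rcases h2 p with rfl | rfl
    · exact ⟨b • v, hmem b, c • v, hmem c, by simpa using hb', by simpa using hc', add_smul _ _ _⟩
    · refine ⟨c • v, hmem c, b • v, hmem b, ?_, by simpa using hb', ?_⟩
      · rwa [show (1 : ZMod 2) + 1 = 0 from by decide] at hc'
      · rw [add_smul, add_comm])
  rcases h1 with h1 | h1
  · exact absurd (Submodule.span_singleton_eq_bot.mp h1) hv0
  · have : y ∈ Submodule.span (U q M N) {v} := h1 ▸ Submodule.mem_top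
    obtain ⟨a, ha⟩ := Submodule.mem_span_singleton.mp this
    exact ⟨a, ha.symm⟩

theorem IsSuperModule.exists_add (h : IsSuperModule (gradU q M N) 𝒱) (x : V) :
    ∃ y ∈ 𝒱 0, ∃ z ∈ 𝒱 1, x = y + z := by
  have h1 := h.isInternal.submodule_iSup_eq_top
  have h2 : (⨆ i, 𝒱 i) ≤ 𝒱 0 ⊔ 𝒱 1 := by
    refine iSup_le fun i => ?_
    have h2 : ∀ i : ZMod 2, i = 0 ∨ i = 1 := by decide
    rcases h2 i with rfl | rfl
    exacts [le_sup_left, le_sup_right]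
  have h3 : x ∈ 𝒱 0 ⊔ 𝒱 1 := h2 (h1 ▸ Submodule.mem_top)
  obtain ⟨y, hy, z, hz, e⟩ := Submodule.mem_sup.mp h3
  exact ⟨y, hy, z, hz, e.symm⟩

theorem IsSuperModule.eq_of_add_eq_add (h : IsSuperModule (gradU q M N) 𝒱) {y y' z z' : V}
    (hy : y ∈ 𝒱 0) (hy' : y' ∈ 𝒱 0) (hz : z ∈ 𝒱 1) (hz' : z' ∈ 𝒱 1) (e : y + z = y' + z') :
    y = y' ∧ z = z' := by
  have h1 := h.isInternal.submodule_iSupIndep.pairwiseDisjoint (show (0 : ZMod 2) ≠ 1 by decide)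
  have h2 : y - y' = z' - z := by
    rw [sub_eq_sub_iff_add_eq_add, e, add_comm]
  have h3 : y - y' = 0 := Submodule.disjoint_def.mp h1 _ (Submodule.sub_mem _ hy hy')
    (h2 ▸ Submodule.sub_mem _ hz' hz)
  rw [h3] at h2
  exact ⟨sub_eq_zero.mp h3, (sub_eq_zero.mp h2.symm).symm⟩

theorem IsSuperModule.torus_smul_mem (h : IsSuperModule (gradU q M N) 𝒱) (p : ZMod 2)
    {d : U q M N} (hd : d ∈ torusAlg q M N) : d ∈ stabSub (U q M N) (𝒱 p) := by
  refine torusAlg_le (fun ε i x hx => ?_) hd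
  have h1 := h.smul_mem 0 p (K q ε i) x
    (gen_mem_wordGrading (gen := fun g : Gen M N => mkU q M N (FreeAlgebra.ι ℂ g)) (par := Gen.par)
      (Gen.K ε i)) hx
  rwa [zero_add] at h1

theorem IsSuperModule.H_smul_mem (h : IsSuperModule (gradU q M N) 𝒱) (p : ZMod 2)
    (i : Node M N) (s : ℤ) (hs : s ≠ 0) : H q i s hs ∈ stabSub (U q M N) (𝒱 p) := by
  intro x hx
  have h1 := h.smul_mem 0 p (H q i s hs) x
    (gen_mem_wordGrading (gen := fun g : Gen M N => mkU q M N (FreeAlgebra.ι ℂ g)) (par := Gen.par)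
      (Gen.H i s hs)) hx
  rwa [zero_add] at h1

theorem zpow_pow_ne_one (hq : ∀ n : ℕ, 0 < n → q ^ n ≠ 1) {a : ℤ} (ha : a ≠ 0) (n : ℕ)
    (hn : 0 < n) : (q ^ a) ^ n ≠ 1 := by
  rcases Int.natAbs_eq a with h | h <;> rw [h]
  · rw [zpow_natCast, ← pow_mul]
    exact hq _ (Nat.mul_pos (Int.natAbs_pos.mpr ha) hn)
  · rw [zpow_neg, zpow_natCast, inv_pow, ← pow_mul, Ne, inv_eq_one]
    exact hq _ (Nat.mul_pos (Int.natAbs_pos.mpr ha) hn)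

theorem IsSuperModule.exists_isSingular [FiniteDimensional ℂ V] [Nontrivial V]
    (h : IsSuperModule (gradU q M N) 𝒱) (hq0 : q ≠ 0) (hq : ∀ n : ℕ, 0 < n → q ^ n ≠ 1)
    (hne : M ≠ N) : ∃ (p : ZMod 2) (v : V), v ∈ 𝒱 p ∧ v ≠ 0 ∧ IsSingular (q := q) (M := M) (N := N) v := by
  obtain ⟨d, d', hd, -, -, hdd, hX⟩ := height_mem_torusWeights (M := M) (N := N) hq0
  have hMN : (M : ℤ) - N ≠ 0 := by omega
  obtain ⟨μ, hμ0, ⟨x, hx0, hx⟩, hμ⟩ := exists_eigenvector_of_mul_not (V := V) hdd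
    (zpow_ne_zero ((M : ℤ) - N) hq0) (zpow_pow_ne_one hq hMN)
  obtain ⟨p, y, hy, hy0, hyd⟩ : ∃ (p : ZMod 2) (y : V), y ∈ 𝒱 p ∧ y ≠ 0 ∧ d • y = μ • y := by
    obtain ⟨y, hy, z, hz, rfl⟩ := h.exists_add x
    rw [smul_add, smul_add] at hx
    obtain ⟨h1, h2⟩ := h.eq_of_add_eq_add (h.torus_smul_mem 0 hd y hy) (Submodule.smul_mem _ _ hy)
      (h.torus_smul_mem 1 hd z hz) (Submodule.smul_mem _ _ hz) hx
    by_cases h0 : y = 0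
    · refine ⟨1, z, hz, ?_, h2⟩
      rintro rfl
      exact hx0 (by rw [h0, add_zero])
    · exact ⟨0, y, hy, h0, h1⟩
  let S : Submodule ℂ V := 𝒱 p ⊓ LinearMap.ker (act V d - μ • 1)
  have hmem : ∀ y, y ∈ S ↔ y ∈ 𝒱 p ∧ d • y = μ • y := by
    intro y
    rw [Submodule.mem_inf, LinearMap.mem_ker, LinearMap.sub_apply, sub_eq_zero]
    rfl
  obtain ⟨v, hv, hv0, hvT⟩ := exists_forall_mem_lineStab (V := V)
    (Set.range (fun a : ℤˣ × Node M N => K q a.1 a.2) ∪ {x | ∃ i s hs, x = H q i s hs})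
    (by
      rintro _ (⟨a, rfl⟩ | ⟨i, s, hs, rfl⟩) _ (⟨b, rfl⟩ | ⟨j, t, ht, rfl⟩)
      · exact K_comm_K _ _ _ _
      · exact K_comm_H _ _ _ _ _
      · exact (K_comm_H _ _ _ _ _).symm
      · exact H_comm_H _ _ _ _ _ _)
    (S := S) (Submodule.ne_bot_iff _ |>.mpr ⟨y, (hmem y).mpr ⟨hy, hyd⟩, hy0⟩)
    (by
      rintro _ (⟨a, rfl⟩ | ⟨i, s, hs, rfl⟩) z hz
      · rw [hmem] at hz ⊢
        refine ⟨h.torus_smul_mem p (K_mem_torusAlg _ _) z hz.1, ?_⟩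
        rw [← mul_smul, ((torusAlg_comm hd).1 _ _).eq, mul_smul, hz.2, smul_smul_comm']
      · rw [hmem] at hz ⊢
        refine ⟨h.H_smul_mem p i s hs z hz.1, ?_⟩
        rw [← mul_smul, ((torusAlg_comm hd).2 _ _ _).eq, mul_smul, hz.2, smul_smul_comm'])
  rw [hmem] at hv
  refine ⟨p, v, hv.1, hv0, fun i n => hμ _ ?_, fun ε i => hvT _ (Or.inl ⟨(ε, i), rfl⟩),
    fun i s hs => hvT _ (Or.inr ⟨i, s, hs, rfl⟩)⟩
  rw [← mul_smul, hX, smul_assoc, mul_smul, hv.2, smul_smul_comm', smul_smul, Units.val_one, one_mul]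

end Simple

end QAffine

end

noncomputable section
set_option linter.unusedSectionVars false
namespace QAffine

/-! ## Series of raising operators -/

section Raising

variable {A : Type*} [Ring A] [Algebra ℂ A]

/-- The coefficients of `exp (∑_{s > 0} g_s z^s)`, by Newton's identities. -/
def newtonSeq (g : ℕ → A) : ℕ → A
  | 0 => 1
  | k + 1 => ((k : ℂ) + 1)⁻¹ • ∑ s : Fin (k + 1), ((s : ℂ) + 1) • (g (s + 1) * newtonSeq g (k - s))
decreasing_by omega

theorem newtonSeq_zero (g : ℕ → A) : newtonSeq g 0 = 1 := by rw [newtonSeq]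

theorem newtonSeq_succ (g : ℕ → A) (k : ℕ) : ((k : ℂ) + 1) • newtonSeq g (k + 1) =
    ∑ s ∈ Finset.range (k + 1), ((s : ℂ) + 1) • (g (s + 1) * newtonSeq g (k - s)) := by
  rw [newtonSeq, smul_smul, mul_inv_cancel₀ (Nat.cast_add_one_ne_zero k), one_smul,
    Finset.sum_range]

theorem newtonSeq_mem {S : Subalgebra ℂ A} {g : ℕ → A} (h : ∀ s, g (s + 1) ∈ S) (k : ℕ) :
    newtonSeq g k ∈ S := by
  induction k using Nat.strong_induction_on with
  | _ k ih =>
    cases k with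
    | zero => rw [newtonSeq_zero]; exact S.one_mem
    | succ k =>
      rw [newtonSeq]
      exact S.smul_mem (S.sum_mem fun s _ => S.smul_mem (S.mul_mem (h _) (ih _ (by omega))) _) _

theorem newtonSeq_mul {g : ℕ → A} {x : ℤ → A}
    (hg : ∀ (s : ℕ) (m : ℤ), ((s : ℂ) + 1) • (g (s + 1) * x m) =
      ((s : ℂ) + 1) • (x m * g (s + 1)) + (-1 : ℂ) ^ s • x (m + (s + 1)))
    (k : ℕ) (m : ℤ) : newtonSeq g (k + 1) * x m =
      x m * newtonSeq g (k + 1) + x (m + 1) * newtonSeq g k := by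
  induction k using Nat.strong_induction_on generalizing m with
  | _ k ih =>
    have hk : ((k : ℂ) + 1) ≠ 0 := Nat.cast_add_one_ne_zero k
    have hterm : ∀ (s : ℕ) (y : A) (m : ℤ), (((s : ℂ) + 1) • (g (s + 1) * x m)) * y =
        x m * (((s : ℂ) + 1) • (g (s + 1) * y)) + (-1 : ℂ) ^ s • (x (m + (s + 1)) * y) := by
      intro s y m
      rw [hg, add_mul, smul_mul_assoc, smul_mul_assoc, mul_smul_comm, mul_assoc]
    have hlast : ((k : ℂ) + 1) • (newtonSeq g (k + 1) * x m) =
        ∑ s ∈ Finset.range k, (((s : ℂ) + 1) • (g (s + 1) * x m)) * newtonSeq g (k - s) +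
          ∑ s ∈ Finset.range k, (((s : ℂ) + 1) • (g (s + 1) * x (m + 1))) * newtonSeq g (k - 1 - s) +
          (((k : ℂ) + 1) • (g (k + 1) * x m)) * newtonSeq g 0 := by
      rw [← smul_mul_assoc, newtonSeq_succ, Finset.sum_range_succ, add_mul, Nat.sub_self,
        newtonSeq_zero, mul_one, mul_one, smul_mul_assoc, Finset.sum_mul, ← Finset.sum_add_distrib]
      congr 1
      refine Finset.sum_congr rfl fun s hs => ?_
      have hs' := Finset.mem_range.mp hs
      obtain ⟨j, hj⟩ : ∃ j, k - s = j + 1 := ⟨k - s - 1, by omega⟩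
      have hj' : k - 1 - s = j := by omega
      rw [hj', hj, smul_mul_assoc, mul_assoc, ih j (by omega), mul_add, smul_add, smul_mul_assoc,
        smul_mul_assoc, mul_assoc, mul_assoc]
    have h1 : ((k : ℂ) + 1) • (x m * newtonSeq g (k + 1)) =
        ∑ s ∈ Finset.range (k + 1), x m * (((s : ℂ) + 1) • (g (s + 1) * newtonSeq g (k - s))) := by
      rw [← mul_smul_comm, newtonSeq_succ, Finset.mul_sum]
    have h2 : (k : ℂ) • (x (m + 1) * newtonSeq g k) = ∑ s ∈ Finset.range k,
        x (m + 1) * (((s : ℂ) + 1) • (g (s + 1) * newtonSeq g (k - 1 - s))) := by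
      cases k with
      | zero => simp
      | succ k =>
        rw [Nat.cast_add, Nat.cast_one, ← mul_smul_comm, newtonSeq_succ, Finset.mul_sum]
        rfl
    have h3 : x (m + 1) * newtonSeq g k =
        ∑ s ∈ Finset.range (k + 1), (-1 : ℂ) ^ s • (x (m + (s + 1)) * newtonSeq g (k - s)) +
          ∑ s ∈ Finset.range k, (-1 : ℂ) ^ s • (x (m + 1 + (s + 1)) * newtonSeq g (k - 1 - s)) := by
      rw [Finset.sum_range_succ']
      have : ∀ s ∈ Finset.range k,
          (-1 : ℂ) ^ (s + 1) • (x (m + ((s + 1 : ℕ) + 1)) * newtonSeq g (k - (s + 1))) =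
          -((-1 : ℂ) ^ s • (x (m + 1 + (s + 1)) * newtonSeq g (k - 1 - s))) := by
        intro s _
        rw [pow_succ, mul_neg_one, neg_smul, show k - (s + 1) = k - 1 - s by omega]
        congr 4
        push_cast
        ring
      rw [Finset.sum_congr rfl this, Finset.sum_neg_distrib]
      simp
    refine smul_right_injective A hk ?_
    change ((k : ℂ) + 1) • _ = ((k : ℂ) + 1) • _
    rw [hlast, smul_add, h1, add_smul ((k : ℂ)) 1 (x (m + 1) * _), one_smul, h2, h3,
      Finset.sum_congr rfl fun s _ => hterm s (newtonSeq g (k - s)) m,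
      Finset.sum_congr rfl fun s _ => hterm s (newtonSeq g (k - 1 - s)) (m + 1), hterm,
      Finset.sum_range_succ _ k, Finset.sum_range_succ _ k, Finset.sum_add_distrib,
      Finset.sum_add_distrib, Nat.sub_self]
    abel

/-- The linear series `a + b z`. -/
def linSeries (a b : A) : PowerSeries A := PowerSeries.C a + PowerSeries.C b * PowerSeries.X

theorem coeff_zero_mul_linSeries (f : PowerSeries A) (a b : A) :
    PowerSeries.coeff 0 (f * linSeries a b) = PowerSeries.coeff 0 f * a := by
  rw [linSeries, mul_add, map_add, PowerSeries.coeff_mul_C, ← mul_assoc,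
    PowerSeries.coeff_zero_mul_X, add_zero]

theorem coeff_succ_mul_linSeries (f : PowerSeries A) (a b : A) (k : ℕ) :
    PowerSeries.coeff (k + 1) (f * linSeries a b) =
      PowerSeries.coeff (k + 1) f * a + PowerSeries.coeff k f * b := by
  rw [linSeries, mul_add, map_add, PowerSeries.coeff_mul_C, ← mul_assoc,
    PowerSeries.coeff_succ_mul_X, PowerSeries.coeff_mul_C]

theorem coeff_zero_linSeries_mul (f : PowerSeries A) (a b : A) :
    PowerSeries.coeff 0 (linSeries a b * f) = a * PowerSeries.coeff 0 f := by
  rw [linSeries, add_mul, map_add, PowerSeries.coeff_C_mul, mul_assoc, PowerSeries.coeff_C_mul,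
    PowerSeries.coeff_zero_X_mul, mul_zero, add_zero]

theorem coeff_succ_linSeries_mul (f : PowerSeries A) (a b : A) (k : ℕ) :
    PowerSeries.coeff (k + 1) (linSeries a b * f) =
      a * PowerSeries.coeff (k + 1) f + b * PowerSeries.coeff k f := by
  rw [linSeries, add_mul, map_add, PowerSeries.coeff_C_mul, mul_assoc, PowerSeries.coeff_C_mul,
    PowerSeries.coeff_succ_X_mul]

theorem coeff_linSeries_pow_of_lt (a b : A) (n k : ℕ) (h : n < k) :
    PowerSeries.coeff k (linSeries a b ^ n) = 0 := by
  induction n generalizing k with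
  | zero => rw [pow_zero, PowerSeries.coeff_one, if_neg (by omega)]
  | succ n ih =>
    obtain ⟨j, rfl⟩ : ∃ j, k = j + 1 := ⟨k - 1, by omega⟩
    rw [pow_succ, coeff_succ_mul_linSeries, ih _ (by omega), ih _ (by omega), zero_mul, zero_mul,
      add_zero]

theorem coeff_linSeries_pow_self (a b : A) (n : ℕ) :
    PowerSeries.coeff n (linSeries a b ^ n) = b ^ n := by
  induction n with
  | zero => rw [pow_zero, pow_zero, PowerSeries.coeff_one, if_pos rfl]
  | succ n ih =>
    rw [pow_succ, coeff_succ_mul_linSeries, coeff_linSeries_pow_of_lt _ _ _ _ (Nat.lt_succ_self n),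
      ih, zero_mul, zero_add, pow_succ]

theorem coeff_zero_linSeries_pow (a b : A) (n : ℕ) :
    PowerSeries.coeff 0 (linSeries a b ^ n) = a ^ n := by
  induction n with
  | zero => rw [pow_zero, pow_zero, PowerSeries.coeff_one, if_pos rfl]
  | succ n ih => rw [pow_succ, coeff_zero_mul_linSeries, ih, pow_succ]

theorem coeff_linSeries_smul_pow (a b : A) (c : ℂ) (n k : ℕ) :
    PowerSeries.coeff k (linSeries a (c • b) ^ n) =
      c ^ k • PowerSeries.coeff k (linSeries a b ^ n) := by
  induction n generalizing k with
  | zero =>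
    rw [pow_zero, pow_zero, PowerSeries.coeff_one]
    split_ifs with h
    · rw [h, pow_zero, one_smul]
    · rw [smul_zero]
  | succ n ih =>
    rw [pow_succ, pow_succ]
    cases k with
    | zero => rw [coeff_zero_mul_linSeries, coeff_zero_mul_linSeries, ih, pow_zero, one_smul, one_smul]
    | succ k =>
      rw [coeff_succ_mul_linSeries, coeff_succ_mul_linSeries, ih, ih, smul_mul_assoc,
        smul_mul_assoc, mul_smul_comm, smul_smul, smul_add, pow_succ]

theorem coeff_linSeries_pow_succ {a b : A} {p : ℂ} (hp : p ≠ 0) (hab : b * a = p ^ 2 • (a * b))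
    (n k : ℕ) : p⁻¹ ^ (2 * (k + 1)) • PowerSeries.coeff (k + 1) (linSeries a b ^ (n + 1)) =
      a * PowerSeries.coeff (k + 1) (linSeries a b ^ n) +
        p⁻¹ ^ (2 * (n + 1)) • (b * PowerSeries.coeff k (linSeries a b ^ n)) := by
  have hpp : p⁻¹ ^ 2 * p ^ 2 = 1 := by rw [← mul_pow, inv_mul_cancel₀ hp, one_pow]
  have hab' : a * b = p⁻¹ ^ 2 • (b * a) := by rw [hab, smul_smul, hpp, one_smul]
  have key : ∀ n, (∀ k, PowerSeries.coeff k (linSeries a (p⁻¹ ^ 2 • b) ^ n) * a =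
        a * PowerSeries.coeff k (linSeries a b ^ n)) ∧
      ∀ k, PowerSeries.coeff k (linSeries a (p⁻¹ ^ 2 • b) ^ n) * b =
        (p⁻¹ ^ 2) ^ n • (b * PowerSeries.coeff k (linSeries a b ^ n)) := by
    intro n
    induction n with
    | zero => simp [PowerSeries.coeff_one]
    | succ n ih =>
      obtain ⟨ih1, ih2⟩ := ih
      refine ⟨fun k => ?_, fun k => ?_⟩ <;> rw [pow_succ, pow_succ (linSeries a b)] <;> cases k
      · rw [coeff_zero_mul_linSeries, coeff_zero_mul_linSeries, ih1, mul_assoc]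
      · rw [coeff_succ_mul_linSeries, coeff_succ_mul_linSeries, add_mul, ih1, mul_smul_comm,
          smul_mul_assoc, mul_assoc _ b a, hab, mul_smul_comm, smul_smul, hpp, one_smul,
          ← mul_assoc, ih1, mul_add, mul_assoc, mul_assoc]
      · rw [coeff_zero_mul_linSeries, coeff_zero_mul_linSeries, mul_assoc _ a b, hab',
          mul_smul_comm, ← mul_assoc, ih2, smul_mul_assoc, smul_smul, mul_assoc, ← pow_succ']
      · rw [coeff_succ_mul_linSeries, coeff_succ_mul_linSeries, add_mul, mul_assoc _ a b, hab',
          mul_smul_comm, ← mul_assoc, ih2, mul_smul_comm, ih2, smul_mul_assoc, smul_mul_assoc,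
          smul_mul_assoc, smul_smul, smul_smul, mul_add, smul_add, mul_assoc, mul_assoc, ← pow_succ']
  rw [pow_mul, ← coeff_linSeries_smul_pow, pow_succ, coeff_succ_mul_linSeries, (key n).1,
    mul_smul_comm, (key n).2, smul_smul, pow_mul, pow_succ' (p⁻¹ ^ 2)]

/-- The series that result from letting a product of raising operators act. -/
theorem exists_coeff_of_raising {x : ℤ → A} {p : ℂ} (hp0 : p ≠ 0)
    (hx : x 1 * x 0 = p ^ 2 • (x 0 * x 1)) {E : ℕ → A} (hE0 : E 0 = 1)
    (hE : ∀ k m, E (k + 1) * x m = x m * E (k + 1) + x (m + 1) * E k) {χ : A →ₗ[ℂ] ℂ} {n : ℕ}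
    {e e' : ℕ → ℂ} (he : ∀ s k, χ (E k * (x s * x 0 ^ n)) = e k * χ (x s * x 0 ^ n))
    (he' : ∀ a k, χ (a * E k) = e' k * χ a)
    (h0 : χ (x 0 ^ (n + 1)) ≠ 0) (h1 : χ (x 1 ^ (n + 1)) ≠ 0) :
    ∃ b : ℕ → ℂ, b 0 = 1 ∧ b (n + 1) ≠ 0 ∧ (∀ k, n + 1 < k → b k = 0) ∧
      (∀ m : ℤ, ∑ r ∈ Finset.range (n + 2), b r * χ (x (m - r) * x 0 ^ n) = 0) ∧
      ∀ k, (1 - p⁻¹ ^ (2 * (n + 1))) * ∑ r ∈ Finset.range k, b r * χ (x ((k - r : ℕ) : ℤ) * x 0 ^ n) =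
        -(χ (x 0 ^ (n + 1)) * b k * (1 - p⁻¹ ^ (2 * k))) := by
  set F : ℤ → ℂ := fun s => χ (x s * x 0 ^ n) with hF
  set C : PowerSeries A := linSeries (x 0) (x 1) with hC
  let a : ℤ → ℕ → ℂ := fun s k => χ (x s * PowerSeries.coeff k (C ^ n))
  have hF0 : F 0 = χ (x 0 ^ (n + 1)) := by rw [hF, pow_succ']
  have hχ1 : e 0 = 1 ∧ e' 0 = 1 := by
    have h2 := he 0 0
    have h3 := he' (x 0 ^ (n + 1)) 0
    rw [hE0, one_mul, ← pow_succ'] at h2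
    rw [hE0, mul_one] at h3
    exact ⟨(mul_right_cancel₀ h0 (by rw [one_mul]; exact h2)).symm,
      (mul_right_cancel₀ h0 (by rw [one_mul]; exact h3)).symm⟩
  -- commutation of the generating series of the `E k` with the raising operators
  set 𝓢 : PowerSeries A := PowerSeries.mk E
  have hcomm : ∀ s, 𝓢 * PowerSeries.C (x s) = linSeries (x s) (x (s + 1)) * 𝓢 := by
    intro s
    ext k
    rw [PowerSeries.coeff_mul_C]
    cases k with
    | zero => rw [coeff_zero_linSeries_mul, PowerSeries.coeff_mk, hE0, one_mul, mul_one]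
    | succ k =>
      rw [coeff_succ_linSeries_mul, PowerSeries.coeff_mk, PowerSeries.coeff_mk, hE]
  have hpow : ∀ j, 𝓢 * PowerSeries.C (x 0 ^ j) = C ^ j * 𝓢 := by
    intro j
    induction j with
    | zero => rw [pow_zero, pow_zero, map_one, mul_one, one_mul]
    | succ j ih =>
      have h2 := hcomm 0
      rw [zero_add] at h2
      rw [pow_succ, map_mul, ← mul_assoc, ih, mul_assoc, h2, ← mul_assoc, pow_succ]
  have hser : ∀ s, 𝓢 * PowerSeries.C (x s * x 0 ^ n) =
      linSeries (x s) (x (s + 1)) * C ^ n * 𝓢 := by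
    intro s
    rw [map_mul, ← mul_assoc, hcomm, mul_assoc, hpow, mul_assoc]
  -- the quotient of the two eigenvalue series
  let T : PowerSeries ℂ := PowerSeries.mk e
  let T' : PowerSeries ℂ := PowerSeries.mk e'
  have hT' : PowerSeries.constantCoeff T' ≠ 0 := by
    rw [← PowerSeries.coeff_zero_eq_constantCoeff_apply, PowerSeries.coeff_mk, hχ1.2]
    exact one_ne_zero
  let T₀ : PowerSeries ℂ := T * T'⁻¹
  let L : ℤ → PowerSeries ℂ := fun s => PowerSeries.mk fun k =>
    χ (PowerSeries.coeff k (linSeries (x s) (x (s + 1)) * C ^ n))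
  have hL : ∀ s, PowerSeries.C (F s) * T = L s * T' := by
    intro s
    ext k
    have h2 := congrArg (fun f => χ (PowerSeries.coeff k f)) (hser s)
    simp only [PowerSeries.coeff_mul_C, 𝓢, PowerSeries.coeff_mk, he] at h2
    rw [PowerSeries.coeff_mul, map_sum] at h2
    simp only [PowerSeries.coeff_mk, he'] at h2
    rw [PowerSeries.coeff_C_mul, PowerSeries.coeff_mul, PowerSeries.coeff_mk, mul_comm, h2]
    refine Finset.sum_congr rfl fun i _ => ?_
    rw [PowerSeries.coeff_mk, PowerSeries.coeff_mk, mul_comm]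
  have hLH : ∀ s, PowerSeries.C (F s) * T₀ = L s := by
    intro s
    rw [← mul_assoc, hL, mul_assoc, PowerSeries.mul_inv_cancel _ hT', mul_one]
  let Ê : ℕ → ℂ := fun k => PowerSeries.coeff k T₀
  have ha0 : ∀ s, F s * Ê 0 = a s 0 := by
    intro s
    rw [← PowerSeries.coeff_C_mul, hLH, PowerSeries.coeff_mk, coeff_zero_linSeries_mul]
  have ha : ∀ s k, F s * Ê (k + 1) = a s (k + 1) + a (s + 1) k := by
    intro s k
    rw [← PowerSeries.coeff_C_mul, hLH, PowerSeries.coeff_mk, coeff_succ_linSeries_mul, map_add]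
  have han : ∀ s k, n < k → a s k = 0 := by
    intro s k hk
    change χ (_ * PowerSeries.coeff k (C ^ n)) = 0
    rw [hC, coeff_linSeries_pow_of_lt _ _ _ _ hk, mul_zero, map_zero]
  have has : ∀ s, a s 0 = F s := by
    intro s
    change χ (_ * PowerSeries.coeff 0 (C ^ n)) = _
    rw [hC, coeff_zero_linSeries_pow]
  have hE1 : Ê 0 = 1 := by
    have h2 := ha0 0
    rw [has, hF0] at h2
    exact mul_left_cancel₀ h0 (by rw [h2, mul_one])
  have hL0 : ∀ k, F 0 * Ê k = χ (PowerSeries.coeff k (C ^ (n + 1))) := by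
    intro k
    rw [← PowerSeries.coeff_C_mul, hLH, PowerSeries.coeff_mk, zero_add, pow_succ']
  have hq : ∀ k, p⁻¹ ^ (2 * (k + 1)) * (F 0 * Ê (k + 1)) =
      a 0 (k + 1) + p⁻¹ ^ (2 * (n + 1)) * a 1 k := by
    intro k
    have h2 := congrArg χ (coeff_linSeries_pow_succ hp0 hx n k)
    rw [map_smul, map_add, map_smul, smul_eq_mul, smul_eq_mul] at h2
    rw [hL0, h2]
  have htel : ∀ (m : ℤ) (k : ℕ), ∑ r ∈ Finset.range (k + 1), (-1) ^ r * Ê r * F (m - r) =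
      (-1) ^ k * a (m - k) k := by
    intro m k
    induction k with
    | zero => simp [hE1, has]
    | succ k ih =>
      have h2 := ha (m - (k + 1 : ℕ)) k
      rw [show m - (k + 1 : ℕ) + 1 = m - k by push_cast; ring] at h2
      rw [Finset.sum_range_succ, ih, pow_succ]
      linear_combination (-1) ^ k * (-1) * h2
  refine ⟨fun r => (-1) ^ r * Ê r, by simp [hE1], ?_, ?_, ?_, ?_⟩
  · refine mul_ne_zero (pow_ne_zero _ (by norm_num)) fun h2 => h1 ?_
    have h3 := hL0 (n + 1)
    rw [h2, mul_zero, hC, coeff_linSeries_pow_self] at h3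
    exact h3.symm
  · intro k hk
    have h3 := hL0 k
    rw [hC, coeff_linSeries_pow_of_lt _ _ _ _ hk, map_zero, hF0] at h3
    simp only [(mul_eq_zero.mp h3).resolve_left h0, mul_zero]
  · intro m
    rw [htel, han _ _ (Nat.lt_succ_self n), mul_zero]
  · intro k
    cases k with
    | zero => simp
    | succ k =>
      have h2 := htel (k + 1 : ℕ) (k + 1)
      rw [Finset.sum_range_succ, sub_self] at h2
      have h3 : ∀ r ∈ Finset.range (k + 1), (-1) ^ r * Ê r * F (((k + 1 : ℕ) : ℤ) - r) =
          (-1) ^ r * Ê r * χ (x ((k + 1 - r : ℕ) : ℤ) * x 0 ^ n) := by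
        intro r hr
        rw [Nat.cast_sub (Finset.mem_range.mp hr).le]
      rw [Finset.sum_congr rfl h3] at h2
      have h4 := ha 0 k
      rw [zero_add] at h4
      have h5 := hq k
      rw [← hF0]
      linear_combination (1 - p⁻¹ ^ (2 * (n + 1))) * h2 - (-1) ^ (k + 1) * h5 +
        p⁻¹ ^ (2 * (n + 1)) * (-1) ^ (k + 1) * h4

end Raising

end QAffine

end

noncomputable section
set_option linter.unusedSectionVars false
namespace QAffine

/-! ## Drinfeld polynomials -/

section Drinfeld

theorem coeff_rescale (a : ℂ) (P : ℂ[X]) (k : ℕ) : (rescale a P).coeff k = a ^ k * P.coeff k := by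
  rw [rescale, Polynomial.comp_C_mul_X_coeff, mul_comm]

theorem natDegree_rescale {a : ℂ} (ha : a ≠ 0) (P : ℂ[X]) :
    (rescale a P).natDegree = P.natDegree := by
  rw [rescale, Polynomial.natDegree_comp, Polynomial.natDegree_C_mul_X _ ha, mul_one]

theorem sum_range_eq_of_vanish {b : ℕ → ℂ} {n : ℕ} (hb : ∀ k, n < k → b k = 0) {u : ℤ → ℂ}
    (hu : ∀ m, m < 0 → u m = 0) (k : ℕ) :
    ∑ r ∈ Finset.range (n + 1), b r * u (k - r) = ∑ r ∈ Finset.range (k + 1), b r * u (k - r) := by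
  rw [Finset.sum_subset (s₂ := Finset.range (n + k + 1)) (Finset.range_mono (by omega)),
    ← Finset.sum_subset (s₁ := Finset.range (k + 1)) (Finset.range_mono (by omega))]
  · intro r _ hr
    rw [Finset.mem_range, not_lt] at hr
    rw [hu _ (by omega), mul_zero]
  · intro r _ hr
    rw [Finset.mem_range, not_lt] at hr
    rw [hb _ (by omega), zero_mul]

theorem exists_drinfeld_of_recurrence {p : ℂ} (hp : p ≠ 0) {n : ℕ} {b : ℕ → ℂ} (hb0 : b 0 = 1)
    (hbn : b n ≠ 0) (hb : ∀ k, n < k → b k = 0) {σ : ℂ} {u d : ℤ → ℂ} (hu : ∀ m, m < 0 → u m = 0)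
    (hd : ∀ m, 0 < m → d m = 0)
    (h1 : ∀ k : ℕ, ∑ r ∈ Finset.range (k + 1), b r * u (k - r) = σ * p ^ n * (p⁻¹ ^ (2 * k) * b k))
    (h2 : ∀ m : ℤ, ∑ r ∈ Finset.range (n + 1), b r * (u (m - r) - d (m - r)) = 0) :
    ∃ P : ℂ[X], P.coeff 0 = 1 ∧
      (∀ k : ℕ, u k = σ * PowerSeries.coeff k (evenWeightZero p P)) ∧
      ∀ k : ℕ, d (-k) = σ * PowerSeries.coeff k (evenWeightInfty p P) := by
  set B : ℂ[X] := ∑ r ∈ Finset.range (n + 1), Polynomial.monomial r (b r) with hB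
  have hBc : ∀ k, B.coeff k = b k := by
    intro k
    rw [hB, Polynomial.finsetSum_coeff]
    simp only [Polynomial.coeff_monomial]
    rw [Finset.sum_ite_eq']
    split_ifs with h
    · rfl
    · rw [Finset.mem_range, not_lt] at h
      rw [hb k (by omega)]
  have hBn : B.natDegree = n := by
    refine Polynomial.natDegree_eq_of_le_of_coeff_ne_zero ?_ (by rw [hBc]; exact hbn)
    rw [Polynomial.natDegree_le_iff_coeff_eq_zero]
    intro k hk
    rw [hBc, hb k hk]
  have hp' := inv_ne_zero hp
  have hPn : (rescale p⁻¹ B).natDegree = n := by rw [natDegree_rescale hp', hBn]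
  have hPB : rescale p (rescale p⁻¹ B) = B := by
    ext k
    rw [coeff_rescale, coeff_rescale, ← mul_assoc, ← mul_pow, mul_inv_cancel₀ hp, one_pow, one_mul]
  have hNc : ∀ k, (rescale p⁻¹ (rescale p⁻¹ B)).coeff k = p⁻¹ ^ (2 * k) * b k := by
    intro k
    rw [coeff_rescale, coeff_rescale, ← mul_assoc, ← pow_add, hBc, two_mul]
  have hrev : ∀ Q : ℂ[X], Q.natDegree = n → ∀ k, Q.reverse.coeff k =
      if k ≤ n then Q.coeff (n - k) else 0 := by
    intro Q hQ k
    split_ifs with h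
    · rw [coeff_reverse_of_le (by omega), hQ]
    · rw [Polynomial.coeff_eq_zero_of_natDegree_lt
        ((Polynomial.reverse_natDegree_le Q).trans_lt (by omega))]
  have key : ∀ (S T W : PowerSeries ℂ), PowerSeries.constantCoeff S ≠ 0 →
      S * T = PowerSeries.C (σ * p ^ n) * W → ∀ k, PowerSeries.coeff k T =
        σ * PowerSeries.coeff k (PowerSeries.C (p ^ n) * W * S⁻¹) := by
    intro S T W hS h k
    rw [← PowerSeries.coeff_C_mul]
    congr 1
    rw [← mul_assoc, PowerSeries.eq_mul_inv_iff_mul_eq hS, mul_comm, h, map_mul, mul_assoc]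
  refine ⟨rescale p⁻¹ B, by rw [coeff_rescale, hBc, hb0]; simp, fun k => ?_, fun k => ?_⟩
  · rw [evenWeightZero, hPn, hPB, ← key (B : PowerSeries ℂ) (PowerSeries.mk fun k : ℕ => u k)]
    · rw [PowerSeries.coeff_mk]
    · rw [← PowerSeries.coeff_zero_eq_constantCoeff_apply, Polynomial.coeff_coe, hBc, hb0]
      exact one_ne_zero
    · ext k
      rw [PowerSeries.coeff_C_mul, Polynomial.coeff_coe, hNc, ← h1, PowerSeries.coeff_mul,
        Finset.Nat.sum_antidiagonal_eq_sum_range_succ_mk]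
      refine Finset.sum_congr rfl fun r hr => ?_
      rw [Polynomial.coeff_coe, hBc, PowerSeries.coeff_mk,
        Nat.cast_sub (Nat.lt_succ_iff.mp (Finset.mem_range.mp hr))]
  · rw [evenWeightInfty, hPn, hPB, ← key (B.reverse : PowerSeries ℂ)
      (PowerSeries.mk fun k : ℕ => d (-k))]
    · rw [PowerSeries.coeff_mk]
    · rw [← PowerSeries.coeff_zero_eq_constantCoeff_apply, Polynomial.coeff_coe, hrev _ hBn,
        if_pos (Nat.zero_le _), hBc]
      exact hbn
    · ext k
      have hsum : ∑ r ∈ Finset.range (k + 1), B.reverse.coeff r * d (-(k - r)) =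
          ∑ r ∈ Finset.range (n + 1), b r * u ((n - k : ℤ) - r) := by
        rw [← sum_range_eq_of_vanish (n := n) (u := fun m => d (-m)) (fun r hr => by
          rw [hrev _ hBn, if_neg (by omega)]) (fun m hm => hd _ (by omega)),
          ← Finset.sum_range_reflect]
        refine sub_eq_zero.mp ?_
        rw [← neg_eq_zero, ← h2 (n - k), ← Finset.sum_sub_distrib, ← Finset.sum_neg_distrib]
        refine Finset.sum_congr rfl fun r hr => ?_
        have hr' := Finset.mem_range.mp hr
        rw [hrev _ hBn, if_pos (by omega), hBc, show n - (n + 1 - 1 - r) = r by omega,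
          show -((k : ℤ) - ((n + 1 - 1 - r : ℕ) : ℤ)) = n - k - r by omega]
        ring
      rw [PowerSeries.coeff_C_mul, Polynomial.coeff_coe, hrev _ (by
        rw [natDegree_rescale hp', hPn]), hNc, PowerSeries.coeff_mul,
        Finset.Nat.sum_antidiagonal_eq_sum_range_succ_mk]
      have hc : ∀ r ∈ Finset.range (k + 1), PowerSeries.coeff r (B.reverse : PowerSeries ℂ) *
          PowerSeries.coeff (k - r) (PowerSeries.mk fun k : ℕ => d (-k)) =
          B.reverse.coeff r * d (-(k - r)) := by
        intro r hr
        rw [Polynomial.coeff_coe, PowerSeries.coeff_mk,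
          Nat.cast_sub (Nat.lt_succ_iff.mp (Finset.mem_range.mp hr))]
      refine (Finset.sum_congr rfl hc).trans ?_
      rw [hsum]
      split_ifs with h
      · rw [← h1, ← sum_range_eq_of_vanish hb hu, Nat.cast_sub h]
      · rw [mul_zero]
        refine Finset.sum_eq_zero fun r _ => ?_
        rw [hu _ (by omega), mul_zero]

end Drinfeld

end QAffine

end

noncomputable section
set_option linter.unusedSectionVars false
namespace QAffine

section RankOne

variable {V : Type*} [AddCommGroup V] [Module ℂ V] {E F K K' : Module.End ℂ V} {x κ : ℂ} {v : V}

theorem IsRankOneHW.exists_sq [FiniteDimensional ℂ V] (h : IsRankOneHW E F K K' x κ v)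
    (hx : x ≠ 0) (hx1 : ∀ n : ℕ, 0 < n → x ^ n ≠ 1) (hκ : κ ≠ 0) (hv : v ≠ 0) :
    ∃ m, (F ^ m) v ≠ 0 ∧ (F ^ (m + 1)) v = 0 ∧ κ ^ 2 = x ^ (2 * m) := by
  classical
  have hex := h.exists_pow_eq_zero hx hx1 hκ
  have h0 : Nat.find hex ≠ 0 := by
    intro h0
    have := Nat.find_spec hex
    rw [h0, pow_zero] at this
    exact hv this
  obtain ⟨m, hm⟩ := Nat.exists_eq_succ_of_ne_zero h0
  have h1 : (F ^ m) v ≠ 0 := Nat.find_min hex (by omega)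
  have h2 : (F ^ (m + 1)) v = 0 := by rw [← Nat.succ_eq_add_one, ← hm]; exact Nat.find_spec hex
  refine ⟨m, h1, h2, ?_⟩
  have hx2 := sub_inv_ne_zero hx hx1
  have h3 := h.E_pow hx hx2 m
  rw [h2, map_zero, eq_comm, smul_eq_zero] at h3
  have h4 := (mul_eq_zero.mp (h3.resolve_right h1)).resolve_left
    (qInt_ne_zero hx hx1 (by omega))
  rw [div_eq_zero_iff, or_iff_left hx2, sub_eq_zero, zpow_neg, zpow_natCast] at h4
  have hxm := pow_ne_zero m hx
  field_simp at h4
  rw [pow_mul', ← h4]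

theorem IsRankOneHW.exists_E_pow (h : IsRankOneHW E F K K' x κ v) (hx : x ≠ 0)
    (hx1 : ∀ n : ℕ, 0 < n → x ^ n ≠ 1) (hκ : κ ≠ 0) {n : ℕ} (hκ2 : κ ^ 2 = x ^ (2 * n)) (k j : ℕ)
    (hkj : k + j ≤ n) : ∃ c : ℂ, c ≠ 0 ∧ (E ^ k) ((F ^ (k + j)) v) = c • (F ^ j) v := by
  induction k with
  | zero => exact ⟨1, one_ne_zero, by simp⟩
  | succ k ih =>
    obtain ⟨c, hc, h1⟩ := ih (by omega)
    have hx2 := sub_inv_ne_zero hx hx1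
    refine ⟨qInt x ((k + j : ℕ) + 1) *
      ((κ * x ^ (-((k + j : ℕ) : ℤ)) - κ⁻¹ * x ^ ((k + j : ℕ) : ℤ)) / (x - x⁻¹)) * c,
      mul_ne_zero (mul_ne_zero (qInt_ne_zero hx hx1 (by omega)) (div_ne_zero ?_ hx2)) hc, ?_⟩
    · rw [sub_ne_zero, zpow_neg, zpow_natCast]
      intro h4
      have hxm := pow_ne_zero (k + j) hx
      field_simp at h4
      rw [hκ2, ← pow_mul'] at h4
      refine hx1 (2 * n - 2 * (k + j)) (by omega) ?_
      rw [pow_sub₀ _ hx (by omega), h4, mul_inv_cancel₀ (pow_ne_zero _ hx)]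
    · rw [pow_succ, Module.End.mul_apply, show k + 1 + j = (k + j) + 1 by omega,
        h.E_pow hx hx2, map_smul, h1, smul_smul]

end RankOne

section DrinfeldPolynomial

variable {q : ℂ} {M N : ℕ} {V : Type*} [AddCommGroup V] [Module ℂ V] [Module (U q M N) V]
  [IsScalarTower ℂ (U q M N) V]

theorem isRankOneHW_lower (hq0 : q ≠ 0) {i : Node M N} (hi : (i : ℕ) ≠ M) (m : ℤ) {v : V} {κ : ℂ}
    (hκ : κ ≠ 0) (hv : X q (-1) i (-m) • v = 0) (hK : K q 1 i • v = κ • v) :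
    IsRankOneHW (act V (X q (-1) i (-m))) (act V (X q 1 i m)) (act V (K q (-1) i))
      (act V (K q 1 i)) (qi q M i) κ⁻¹ v where
  K_F := by
    rw [← map_mul, ← map_mul, ← map_smul, K_mul_X hq0, cartan_self_even hi, qi, ← zpow_mul]
    congr 2
    simp [mul_comm]
  K'_F := by
    rw [← map_mul, ← map_mul, ← map_smul, K_mul_X hq0, cartan_self_even hi, qi, ← zpow_mul]
    congr 2
    simp [mul_comm]
  E_F := by
    rw [← map_mul, ← map_mul, ← map_sub, ← map_smul, ← map_add, X_mul_X_neg, if_pos rfl,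
      nodeSign_of_ne hi, one_smul, add_neg_cancel, phi_zero, phi_zero, smul_sub, smul_sub]
    congr 1
    abel
  E_v := hv
  K_v := K_neg_smul hκ hK
  K'_v := by rw [inv_inv]; exact hK

theorem X_one_mul_X_zero {i : Node M N} (hi : (i : ℕ) ≠ M) :
    X q 1 i 1 * X q 1 i 0 = qi q M i ^ 2 • (X q 1 i 0 * X q 1 i 1) := by
  have hc := cartan_self_even hi
  have hell : ell M i ≠ 0 := by rcases ell_eq M i with ⟨_, h⟩ | ⟨_, h⟩ <;> rw [h] <;> decide
  have h1 := mkU_rel (Rel.X_X (q := q) 1 i i 0 0 (by rw [hc]; omega))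
  rw [map_sub, map_sub, map_smul, map_mul, map_mul, hc, Units.val_one, one_mul,
    zero_add, mul_comm 2, zpow_mul, ← qi, zpow_ofNat] at h1
  change X q 1 i 1 * X q 1 i 0 - _ • (X q 1 i 0 * X q 1 i 1) = _ • (X q 1 i 0 * X q 1 i 1) -
    X q 1 i 1 * X q 1 i 0 at h1
  have h2 : (2 : ℂ) • (X q 1 i 1 * X q 1 i 0) =
      (2 : ℂ) • (qi q M i ^ 2 • (X q 1 i 0 * X q 1 i 1)) := by
    rw [two_smul, two_smul]
    rw [sub_eq_sub_iff_add_eq_add] at h1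
    exact h1
  exact smul_right_injective _ two_ne_zero h2

variable (q) in
/-- The multiples of the `h_{i,s}` that shift the `X_{i,m}^+` by `(-1)^{s-1} / s`. -/
def hShift (i : Node M N) (s : ℕ) : U q M N :=
  if hs : (s : ℤ) = 0 then 0 else
    ((-1 : ℂ) ^ (s - 1) / ((s : ℂ) * hCoeff q M i i s)) • H q i s hs

theorem hShift_mul_X (hq0 : q ≠ 0) (hq : ∀ n : ℕ, 0 < n → q ^ n ≠ 1) {i : Node M N}
    (hi : (i : ℕ) ≠ M) (s : ℕ) (m : ℤ) :
    ((s : ℂ) + 1) • (hShift q i (s + 1) * X q 1 i m) =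
      ((s : ℂ) + 1) • (X q 1 i m * hShift q i (s + 1)) + (-1 : ℂ) ^ s • X q 1 i (m + (s + 1)) := by
  have hs : ((s + 1 : ℕ) : ℤ) ≠ 0 := by omega
  have hell : ell M i ≠ 0 := by rcases ell_eq M i with ⟨_, h⟩ | ⟨_, h⟩ <;> rw [h] <;> decide
  have hc : hCoeff q M i i ((s + 1 : ℕ) : ℤ) ≠ 0 := hCoeff_ne_zero hq0 hq hs
    (by rw [cartan_self_even hi]; omega)
  have hs' : ((s : ℂ) + 1) ≠ 0 := Nat.cast_add_one_ne_zero s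
  rw [hShift, dif_neg hs, smul_mul_assoc, mul_smul_comm, H_mul_X, smul_add, smul_add, smul_smul _ _ (X q 1 i _),
    smul_smul _ _ (X q 1 i _)]
  congr 2
  · push_cast
    push_cast at hc
    field_simp

theorem IsSingular.raise_pow_mem {v : V} (h : IsSingular (q := q) (M := M) (N := N) v) (hq0 : q ≠ 0)
    (I : Set (Node M N)) (j : Node M N) (m : ℤ) (k l : ℕ) :
    ∀ y ∈ lvl (q := q) I v (k + l), X q 1 j m ^ k • y ∈ lvl (q := q) I v l := by
  induction k with
  | zero => intro y hy; rwa [pow_zero, one_smul, ← Nat.zero_add l]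
  | succ k ih =>
    intro y hy
    rw [pow_succ, mul_smul]
    refine ih _ (h.raise_lvl hq0 I j m _ y ?_)
    rwa [show k + l + 1 = k + 1 + l by omega]

theorem exists_dual_eq_one {v : V} (hv : v ≠ 0) : ∃ χ : V →ₗ[ℂ] ℂ, χ v = 1 := by
  obtain ⟨χ, hχ⟩ := not_forall.mp (mt (Module.forall_dual_apply_eq_zero_iff ℂ v).mp hv)
  exact ⟨(χ v)⁻¹ • χ, by rw [LinearMap.smul_apply, smul_eq_mul, inv_mul_cancel₀ hχ]⟩

theorem exists_drinfeldPolynomial [FiniteDimensional ℂ V] (hq0 : q ≠ 0)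
    (hq : ∀ n : ℕ, 0 < n → q ^ n ≠ 1) {v : V} (hv0 : v ≠ 0)
    (h : IsSingular (q := q) (M := M) (N := N) v) {i : Node M N} (hi : (i : ℕ) ≠ M) :
    ∃ (σ : ℤˣ) (P : ℂ[X]), P.coeff 0 = 1 ∧
      (∀ k : ℕ, phi q 1 i k • v =
        (((σ : ℤ) : ℂ) * PowerSeries.coeff k (evenWeightZero (qi q M i) P)) • v) ∧
      ∀ k : ℕ, phi q (-1) i (-(k : ℤ)) • v =
        (((σ : ℤ) : ℂ) * PowerSeries.coeff k (evenWeightInfty (qi q M i) P)) • v := by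
  set p := qi q M i with hpdef
  have hp0 : p ≠ 0 := qi_ne_zero hq0 M i
  have hp1 : ∀ n : ℕ, 0 < n → p ^ n ≠ 1 := qi_pow_ne_one hq i
  have hp2 : p - p⁻¹ ≠ 0 := sub_inv_ne_zero hp0 hp1
  -- the eigenvalues on `v`
  have hphi : ∀ ε n, ∃ r : ℂ, phi q ε i n • v = r • v := fun ε n =>
    phi_mem (S := lineStab v) h.K_mem h.H_mem ε i n
  choose φ hφ using hphi
  have hinj : ∀ {r s : ℂ}, r • v = s • v → r = s := fun {r s} e => smul_left_injective ℂ hv0 e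
  have hφ0 : ∀ (ε : ℤˣ) n, (ε : ℤ) * n < 0 → φ ε n = 0 := by
    intro ε n hn
    refine hinj ?_
    rw [← hφ, phi_of_neg ε i hn, zero_smul, zero_smul]
  obtain ⟨κ, hK⟩ := h.K_mem 1 i
  have hκ0 : κ ≠ 0 := by
    rintro rfl
    have h1 := K_mul_K_neg (q := q) (-1) i
    rw [neg_neg] at h1
    apply hv0
    rw [← one_smul (U q M N) v, ← h1, mul_smul, hK, zero_smul, smul_zero]
  have hφK : φ 1 0 = κ := hinj (by rw [← hφ, phi_zero, hK])
  have hφK' : φ (-1) 0 = κ⁻¹ := hinj (by rw [← hφ, phi_zero, K_neg_smul hκ0 hK])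
  -- the lowest level
  have hd : ∀ j ∈ ({i} : Set (Node M N)), ∀ m, K q 1 i * X q (-1) j m =
      (p ^ (2 : ℕ))⁻¹ • (X q (-1) j m * K q 1 i) := by
    rintro j rfl m
    rw [K_mul_X hq0, cartan_self_even hi, hpdef, qi, ← zpow_natCast, ← zpow_mul, ← zpow_neg]
    congr 2
    simp [mul_comm]
  obtain ⟨n, hn, hn1⟩ := exists_lvl_ne_bot hv0 hd hK (inv_ne_zero (pow_ne_zero 2 hp0))
    (fun k hk => by
      rw [inv_pow, Ne, inv_eq_one, ← pow_mul]
      exact hp1 _ (by omega)) hκ0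
  obtain ⟨u, hu, hu0, huT⟩ := exists_forall_mem_lineStab (V := V)
    {a : U q M N | ∃ s hs, a = H q i s hs} (by
      rintro _ ⟨s, hs, rfl⟩ _ ⟨t, ht, rfl⟩
      exact H_comm_H _ _ _ _ _ _) hn (by
      rintro _ ⟨s, hs, rfl⟩
      exact h.H_mem_stab _ _ _ _ _)
  have huK : K q 1 i • u = (((p ^ 2)⁻¹) ^ n * κ) • u := lvl_eigen hd hK n u hu
  have huL : ∀ m, X q (-1) i m • u = 0 := fun m => by
    have := X_smul_mem_lvl (Set.mem_singleton i) m hu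
    rwa [hn1, Submodule.mem_bot] at this
  have hκ' : ((p ^ 2)⁻¹) ^ n * κ ≠ 0 := mul_ne_zero (pow_ne_zero _ (inv_ne_zero (pow_ne_zero _ hp0))) hκ0
  have hrV := fun m => isRankOneHW_raise hq0 hi m hκ0 (h.raise i m) hK
  have hrU := fun m => isRankOneHW_lower hq0 hi m hκ' (huL (-m)) huK
  -- powers of the raising operators map `u` to the line of `v`
  have hsq : ∀ m, X q 1 i m ^ n • u ≠ 0 ∧ κ ^ 2 = p ^ (2 * n) := by
    intro m
    obtain ⟨a, ha, ha', hκa⟩ := (hrU m).exists_sq hp0 hp1 (inv_ne_zero hκ') hu0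
    obtain ⟨b, hb, -, hκb⟩ := (hrV m).exists_sq hp0 hp1 hκ0 hv0
    rw [← map_pow] at ha hb
    have han : a ≤ n := by
      by_contra hlt
      have h1 := h.raise_pow_mem hq0 {i} i m n 0 u hu
      obtain ⟨r, hr⟩ := Submodule.mem_span_singleton.mp h1
      apply ha
      change X q 1 i m ^ a • u = 0
      rw [show a = (a - n - 1) + 1 + n by omega, pow_add, mul_smul, ← hr, pow_succ, mul_smul,
        smul_smul_comm', h.raise, smul_zero, smul_zero]
    have hbn : b ≤ n := by
      by_contra hlt
      have h1 : ∀ k, X q (-1) i (-m) ^ k • v ∈ lvl (q := q) {i} v k := by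
        intro k
        induction k with
        | zero => rw [pow_zero, one_smul]; exact Submodule.mem_span_singleton_self v
        | succ k ih => rw [pow_succ', mul_smul]; exact X_smul_mem_lvl (Set.mem_singleton i) _ ih
      apply hb
      change X q (-1) i (-m) ^ b • v = 0
      have h2 := h1 (n + 1)
      rw [hn1, Submodule.mem_bot] at h2
      rw [show b = (b - (n + 1)) + (n + 1) by omega, pow_add, mul_smul, h2, smul_zero]
    have h3 : p ^ (4 * n) = p ^ (2 * (a + b)) := by
      rw [mul_add, pow_add, ← hκa, ← hκb, inv_pow, mul_pow, mul_inv, ← pow_mul, inv_pow, inv_inv,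
        ← pow_mul, mul_assoc, inv_mul_cancel₀ (pow_ne_zero _ hκ0), mul_one]
      congr 1
      ring
    have h4 : 4 * n = 2 * (a + b) := by
      by_contra hne
      refine hp1 (4 * n - 2 * (a + b)) (by omega) ?_
      rw [pow_sub₀ _ hp0 (by omega), h3, mul_inv_cancel₀ (pow_ne_zero _ hp0)]
    have h5 : a = n := by omega
    have h6 : b = n := by omega
    exact ⟨by rw [← h5]; exact ha, by rw [hκb, h6]⟩
  have hκ2 := (hsq 0).2
  obtain ⟨σ, hσ⟩ : ∃ σ : ℤˣ, κ = ((σ : ℤ) : ℂ) * p ^ n := by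
    rw [pow_mul', sq_eq_sq_iff_eq_or_eq_neg] at hκ2
    rcases hκ2 with e | e
    · exact ⟨1, by rw [e]; simp⟩
    · exact ⟨-1, by rw [e]; simp⟩
  have hσ2 : ((σ : ℤ) : ℂ) * ((σ : ℤ) : ℂ) = 1 := by
    rcases Int.units_eq_one_or σ with rfl | rfl <;> simp
  have hσ' : κ⁻¹ = ((σ : ℤ) : ℂ) * (p ^ n)⁻¹ := by
    rw [hσ, mul_inv, inv_eq_of_mul_eq_one_right hσ2]
  suffices hb : ∃ b : ℕ → ℂ, b 0 = 1 ∧ b n ≠ 0 ∧ (∀ k, n < k → b k = 0) ∧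
      (∀ k : ℕ, ∑ r ∈ Finset.range (k + 1), b r * φ 1 (k - r) =
        ((σ : ℤ) : ℂ) * p ^ n * (p⁻¹ ^ (2 * k) * b k)) ∧
      ∀ m : ℤ, ∑ r ∈ Finset.range (n + 1), b r * (φ 1 (m - r) - φ (-1) (m - r)) = 0 by
    obtain ⟨b, hb0, hbn, hb, h1, h2⟩ := hb
    obtain ⟨P, hP, hP1, hP2⟩ := exists_drinfeld_of_recurrence hp0 hb0 hbn hb
      (fun m hm => hφ0 1 m (by simpa using hm)) (fun m hm => hφ0 (-1) m (by simpa using hm)) h1 h2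
    exact ⟨σ, P, hP, fun k => by rw [hφ, hP1], fun k => by rw [hφ, hP2]⟩
  have hxy : ∀ s m, X q 1 i s • X q (-1) i m • v =
      ((p - p⁻¹)⁻¹ * (φ 1 (s + m) - φ (-1) (s + m))) • v := by
    intro s m
    rw [← mul_smul, X_mul_X_neg, if_pos rfl, add_smul, smul_assoc, mul_smul, h.raise, smul_zero,
      smul_zero, zero_add, smul_assoc, sub_smul, hφ, hφ, ← sub_smul, smul_smul]
  cases n with
  | zero =>
    have hφφ : ∀ m, φ 1 m = φ (-1) m := by
      intro m
      have h1 : X q (-1) i 0 • v = 0 := by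
        have hv : v ∈ lvl (q := q) {i} v 0 := Submodule.mem_span_singleton_self v
        have := X_smul_mem_lvl (q := q) (Set.mem_singleton i) 0 hv
        rwa [hn1, Submodule.mem_bot] at this
      have h2 := hxy m 0
      rw [h1, smul_zero, eq_comm, smul_eq_zero, or_iff_left hv0, add_zero, mul_eq_zero,
        or_iff_right (inv_ne_zero hp2), sub_eq_zero] at h2
      exact h2
    refine ⟨fun r => if r = 0 then 1 else 0, by simp, by simp, fun k hk => if_neg (by omega),
      fun k => ?_, fun m => ?_⟩
    · rw [Finset.sum_range_succ']
      cases k with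
      | zero => simp [hφK, hσ]
      | succ k =>
        have h3 : φ 1 ((k + 1 : ℕ) : ℤ) = 0 := by
          rw [hφφ]
          exact hφ0 (-1) _ (by simp; omega)
        push_cast at h3
        simp [h3]
    · simp [hφφ]
  | succ n =>
    have hpn : 1 - p⁻¹ ^ (2 * (n + 1)) ≠ 0 := by
      rw [sub_ne_zero, inv_pow, ne_comm, Ne, inv_eq_one]
      exact hp1 _ (by omega)
    have hup : ∀ m, ∃ r : ℂ, X q 1 i m ^ (n + 1) • u = r • v := fun m => by
      obtain ⟨r, hr⟩ := Submodule.mem_span_singleton.mp (h.raise_pow_mem hq0 {i} i m (n + 1) 0 u hu)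
      exact ⟨r, hr.symm⟩
    obtain ⟨β, hβ⟩ : ∃ β : ℂ, X q 1 i 0 ^ n • u = β • X q (-1) i 0 • v := by
      obtain ⟨c, hc, h1⟩ := (hrU 0).exists_E_pow hp0 hp1 (inv_ne_zero hκ') (n := n + 1) (by
        rw [inv_pow, mul_pow, hκ2, ← pow_mul, inv_pow, ← pow_mul, mul_inv, inv_inv,
          show 2 * ((n + 1) * 2) = 2 * (n + 1) + 2 * (n + 1) by ring, pow_add, mul_assoc,
          mul_inv_cancel₀ (pow_ne_zero _ hp0), mul_one]) (n + 1) 0 (by omega)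
      obtain ⟨c', -, h2⟩ := (hrV 0).exists_E_pow hp0 hp1 hκ0 hκ2 n 1 (by omega)
      obtain ⟨α, hα⟩ := hup 0
      rw [← map_pow, ← map_pow, pow_zero, neg_zero] at h1
      rw [← map_pow, ← map_pow, pow_one, neg_zero] at h2
      change X q (-1) i 0 ^ (n + 1) • X q 1 i 0 ^ (n + 1) • u = c • u at h1
      change X q 1 i 0 ^ n • X q (-1) i 0 ^ (n + 1) • v = c' • X q (-1) i 0 • v at h2
      refine ⟨c⁻¹ * (α * c'), ?_⟩
      rw [mul_smul, eq_inv_smul_iff₀ hc, ← smul_smul_comm', ← h1, hα, smul_smul_comm',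
        smul_smul_comm', h2, smul_smul]
    obtain ⟨χ, hχ⟩ := exists_dual_eq_one hv0
    let χ' : U q M N →ₗ[ℂ] ℂ := χ ∘ₗ (act V : U q M N →ₐ[ℂ] _).toLinearMap.flip u
    have hχ' : ∀ a, χ' a = χ (a • u) := fun _ => rfl
    have hF : ∀ s, χ' (X q 1 i s * X q 1 i 0 ^ n) =
        β * (p - p⁻¹)⁻¹ * (φ 1 s - φ (-1) s) := by
      intro s
      rw [hχ', mul_smul, hβ, smul_smul_comm', hxy, map_smul, map_smul, hχ, add_zero, smul_eq_mul,
        smul_eq_mul, mul_one, mul_assoc]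
    have hpow : ∀ m, χ' (X q 1 i m ^ (n + 1)) ≠ 0 := by
      intro m h1
      obtain ⟨r, hr⟩ := hup m
      rw [hχ', hr, map_smul, hχ, smul_eq_mul, mul_one] at h1
      rw [h1, zero_smul] at hr
      exact (hsq m).1 hr
    have hEv : ∀ k, newtonSeq (hShift q i) k ∈ lineStab v := newtonSeq_mem fun s => by
      rw [hShift, dif_neg (by omega)]
      exact Subalgebra.smul_mem _ (h.H_mem _ _ _) _
    have hEu : ∀ k, newtonSeq (hShift q i) k ∈ lineStab u := newtonSeq_mem fun s => by
      rw [hShift, dif_neg (by omega)]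
      exact Subalgebra.smul_mem _ (huT _ ⟨_, _, rfl⟩) _
    choose e he using hEv
    choose e' he' using hEu
    obtain ⟨b, hb0, hbn, hb, h1, h2⟩ := exists_coeff_of_raising (x := X q 1 i) hp0
      (X_one_mul_X_zero hi) (newtonSeq_zero (hShift q i))
      (newtonSeq_mul (x := X q 1 i) (hShift_mul_X hq0 hq hi)) (χ := χ') (n := n) (e := e) (e' := e')
      (fun s k => by
        rw [hχ', hχ', mul_smul, mul_smul, hβ, smul_smul_comm', hxy, smul_smul_comm',
          smul_smul_comm', he, map_smul, map_smul, map_smul, map_smul, map_smul]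
        simp only [smul_eq_mul]
        ring)
      (fun a k => by rw [hχ', hχ', mul_smul, he', smul_smul_comm', map_smul, smul_eq_mul])
      (hpow 0) (hpow 1)
    have hF0 := hpow 0
    rw [pow_succ', hF] at h2 hF0
    obtain ⟨hγ, hφ'⟩ := mul_ne_zero_iff.mp hF0
    simp only [hF] at h1 h2
    refine ⟨b, hb0, hbn, hb, fun k => ?_, fun m => ?_⟩
    · have h3 : ∑ r ∈ Finset.range k, b r * (β * (p - p⁻¹)⁻¹ *
          (φ 1 ((k - r : ℕ) : ℤ) - φ (-1) ((k - r : ℕ) : ℤ))) =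
          β * (p - p⁻¹)⁻¹ * ∑ r ∈ Finset.range k, b r * φ 1 (k - r) := by
        rw [Finset.mul_sum]
        refine Finset.sum_congr rfl fun r hr => ?_
        have hr' := Finset.mem_range.mp hr
        rw [hφ0 (-1) ((k - r : ℕ) : ℤ) (by simp; omega), Nat.cast_sub hr'.le]
        ring
      have h4 := h2 k
      rw [h3, hφK, hφK', hσ', hσ] at h4
      rw [Finset.sum_range_succ, sub_self, hφK, hσ]
      refine mul_left_cancel₀ (mul_ne_zero hγ hpn) ?_
      have h5 : (p ^ (n + 1))⁻¹ = p ^ (n + 1) * p⁻¹ ^ (2 * (n + 1)) := by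
        rw [two_mul, pow_add p⁻¹, ← mul_assoc, ← mul_pow, mul_inv_cancel₀ hp0, one_pow, one_mul,
          inv_pow]
      rw [h5] at h4
      linear_combination h4
    · refine mul_left_cancel₀ hγ ?_
      rw [mul_zero, ← h1 m, Finset.mul_sum]
      refine Finset.sum_congr rfl fun r _ => ?_
      ring

end DrinfeldPolynomial

end QAffine

end

noncomputable section
set_option linter.unusedSectionVars false
namespace QAffine

/-! ## Sign automorphisms -/

section Twist

variable {q : ℂ} {M N : ℕ} (σ : Node M N → ℤˣ)

/-- The scalars by which the sign automorphism rescales the generators. -/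
def Gen.twist : Gen M N → ℂ
  | .X ε i _ => if ε = 1 then ((σ i : ℤ) : ℂ) else 1
  | .K _ i => ((σ i : ℤ) : ℂ)
  | .H _ _ _ => 1

theorem sign_mul_self (i : Node M N) : ((σ i : ℤ) : ℂ) * ((σ i : ℤ) : ℂ) = 1 := by
  rcases Int.units_eq_one_or (σ i) with h | h <;> rw [h] <;> simp

theorem Gen.twist_mul_self (g : Gen M N) : g.twist σ * g.twist σ = 1 := by
  cases g with
  | X ε i n =>
    rw [Gen.twist]
    split_ifs
    exacts [sign_mul_self σ i, one_mul 1]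
  | K ε i => exact sign_mul_self σ i
  | H i s hs => exact one_mul 1

/-- The sign automorphism on the free algebra. -/
def freeTwist : FreeU M N →ₐ[ℂ] FreeU M N :=
  FreeAlgebra.lift ℂ fun g => g.twist σ • FreeAlgebra.ι ℂ g

theorem freeTwist_ι (g : Gen M N) :
    freeTwist σ (FreeAlgebra.ι ℂ g) = g.twist σ • FreeAlgebra.ι ℂ g :=
  FreeAlgebra.lift_ι_apply _ _

theorem freeTwist_X (ε : ℤˣ) (i : Node M N) (n : ℤ) :
    freeTwist σ (fX ε i n) = (if ε = 1 then ((σ i : ℤ) : ℂ) else 1) • fX ε i n := freeTwist_ι σ _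

theorem freeTwist_K (ε : ℤˣ) (i : Node M N) :
    freeTwist σ (fK ε i) = ((σ i : ℤ) : ℂ) • fK ε i := freeTwist_ι σ _

theorem freeTwist_H (i : Node M N) (s : ℤ) (hs : s ≠ 0) :
    freeTwist σ (fH i s hs) = fH i s hs := (freeTwist_ι σ _).trans (one_smul _ _)

theorem freeTwist_phi (ε : ℤˣ) (i : Node M N) (n : ℤ) :
    freeTwist σ (fphi q ε i n) = ((σ i : ℤ) : ℂ) • fphi q ε i n := by
  rw [fphi]
  split_ifs
  · have : PowerSeries.map (freeTwist σ : FreeU M N →+* FreeU M N) (hSeries q ε i) =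
        hSeries q ε i := by
      ext s
      rw [PowerSeries.coeff_map, hSeries, PowerSeries.coeff_mk]
      split_ifs
      · exact map_zero _
      · refine (map_smul (freeTwist σ) _ _).trans ?_
        rw [freeTwist_H]
    rw [map_mul, freeTwist_K, map_expCoeff, this, smul_mul_assoc]
  · rw [map_zero, smul_zero]

theorem sbr_smul_smul {A : Type*} [Ring A] [Algebra ℂ A] (p p' : ZMod 2) (u c d : ℂ) (a b : A) :
    sbr p p' u (c • a) (d • b) = (c * d) • sbr p p' u a b := by
  simp only [sbr, smul_mul_smul_comm, smul_sub, smul_smul]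
  congr 2
  ring

theorem mkU_freeTwist_rel {a b : FreeU M N} (h : Rel q M N a b) :
    mkU q M N (freeTwist σ a) = mkU q M N (freeTwist σ b) := by
  have h' := mkU_rel h
  cases h with
  | K_inv ε i =>
    rw [map_mul, freeTwist_K, freeTwist_K, smul_mul_smul_comm, sign_mul_self, one_smul, h', map_one (freeTwist σ)]
  | K_K ε ε' i j =>
    simp only [map_mul, freeTwist_K, smul_mul_smul_comm, map_smul]
    rw [← map_mul, h', map_mul, mul_comm]
  | K_H ε i j s hs =>
    simp only [map_mul, freeTwist_K, freeTwist_H, smul_mul_assoc, mul_smul_comm, map_smul]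
    rw [← map_mul, h', map_mul]
  | H_H i j s t hs ht => simpa only [map_mul, freeTwist_H] using h'
  | K_X ε i j n =>
    simp only [map_mul, freeTwist_K, freeTwist_X, smul_mul_smul_comm, map_smul]
    rw [← map_mul, ← map_mul, h', map_smul, smul_comm, mul_right_comm, sign_mul_self, one_mul]
  | H_X ε i j s n hs =>
    simp only [map_sub, map_mul, freeTwist_H, freeTwist_X, smul_mul_assoc, mul_smul_comm, map_smul,
      ← smul_sub]
    rw [← map_mul, ← map_mul, ← map_sub, h', map_smul, smul_comm]
  | X_X_opp i j m n =>
    rw [map_sbr, freeTwist_X, freeTwist_X, sbr_smul_smul, map_smul, h', if_pos rfl,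
      if_neg (by decide), mul_one]
    split_ifs with h1
    · simp only [map_smul, map_sub, freeTwist_phi, ← smul_sub]
      rw [smul_comm]
    · rw [map_zero, map_zero, smul_zero, map_zero]
  | X_X_zero ε i j m n hc =>
    rw [map_sbr, freeTwist_X, freeTwist_X, sbr_smul_smul, map_smul, h', map_zero (freeTwist σ), map_zero,
      smul_zero]
  | X_X ε i j m n hc =>
    simp only [map_sub, map_smul, map_mul, freeTwist_X, smul_mul_smul_comm] at h' ⊢
    set c : ℂ := (if ε = 1 then ((σ i : ℤ) : ℂ) else 1) * (if ε = 1 then ((σ j : ℤ) : ℂ) else 1)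
    rw [mul_comm (if ε = 1 then ((σ j : ℤ) : ℂ) else 1), smul_comm _ c, smul_comm _ c,
      ← smul_sub, ← smul_sub, h']
  | serre ε i j m n k hc hi =>
    simp only [map_add, map_sbr, freeTwist_X, sbr_smul_smul, ← smul_add, map_smul] at h' ⊢
    rw [h', map_zero, map_zero, map_zero, smul_zero]
  | oscillation ε a b d m n k u h1 h2 ha hb hd =>
    simp only [map_add, map_sbr, freeTwist_X, sbr_smul_smul, ← smul_add, map_smul] at h' ⊢
    rw [h', map_zero, map_zero, map_zero, smul_zero]

variable (q) in
/-- The sign endomorphism. -/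
def twistHom : U q M N →ₐ[ℂ] U q M N :=
  RingQuot.liftAlgHom ℂ ⟨(mkU q M N).comp (freeTwist σ), fun _ _ h => mkU_freeTwist_rel σ h⟩

theorem twistHom_mkU (x : FreeU M N) : twistHom q σ (mkU q M N x) = mkU q M N (freeTwist σ x) :=
  RingQuot.liftAlgHom_mkAlgHom_apply ℂ ((mkU q M N).comp (freeTwist σ))
    (fun _ _ h => mkU_freeTwist_rel σ h) x

theorem twistHom_gen (g : Gen M N) : twistHom q σ (mkU q M N (FreeAlgebra.ι ℂ g)) =
    g.twist σ • mkU q M N (FreeAlgebra.ι ℂ g) := by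
  rw [twistHom_mkU, freeTwist_ι, map_smul]

theorem hom_ext {B : Type*} [Ring B] [Algebra ℂ B] {f f' : U q M N →ₐ[ℂ] B}
    (h : ∀ g, f (mkU q M N (FreeAlgebra.ι ℂ g)) = f' (mkU q M N (FreeAlgebra.ι ℂ g))) : f = f' := by
  have : f.comp (mkU q M N) = f'.comp (mkU q M N) := FreeAlgebra.hom_ext (funext h)
  refine AlgHom.ext fun a => ?_
  obtain ⟨x, rfl⟩ := mkU_surjective a
  exact AlgHom.congr_fun this x

theorem twistHom_comp_self : (twistHom q σ).comp (twistHom q σ) = AlgHom.id ℂ _ :=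
  hom_ext fun g => by
    rw [AlgHom.comp_apply, twistHom_gen, map_smul, twistHom_gen, smul_smul, Gen.twist_mul_self,
      one_smul, AlgHom.id_apply]

variable (q) in
/-- The sign automorphism. -/
def twistEquiv : U q M N ≃ₐ[ℂ] U q M N :=
  AlgEquiv.ofAlgHom (twistHom q σ) (twistHom q σ) (twistHom_comp_self σ) (twistHom_comp_self σ)

theorem mkU'_surjective : Function.Surjective (mkU' q M N) :=
  RingQuot.mkAlgHom_surjective ℂ _

theorem mkU'_rel {a b : FreeAlgebra ℂ (Gen' M N)} (h : Rel' q M N a b) :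
    mkU' q M N a = mkU' q M N b :=
  RingQuot.mkAlgHom_rel ℂ h

theorem iota_mkU (x : FreeU M N) : iota q M N (mkU q M N x) = mkU' q M N (freeIncl M N x) :=
  RingQuot.liftAlgHom_mkAlgHom_apply ℂ ((mkU' q M N).comp (freeIncl M N))
    (fun _ _ h => RingQuot.mkAlgHom_rel ℂ (Rel'.base _ _ h)) x

theorem iota_gen (g : Gen M N) : iota q M N (mkU q M N (FreeAlgebra.ι ℂ g)) =
    mkU' q M N (FreeAlgebra.ι ℂ (Sum.inl g)) := by
  rw [iota_mkU, freeIncl, FreeAlgebra.lift_ι_apply]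

theorem hom_ext' {B : Type*} [Ring B] [Algebra ℂ B] {f f' : U' q M N →ₐ[ℂ] B}
    (h : ∀ g, f (mkU' q M N (FreeAlgebra.ι ℂ g)) = f' (mkU' q M N (FreeAlgebra.ι ℂ g))) : f = f' := by
  have : f.comp (mkU' q M N) = f'.comp (mkU' q M N) := FreeAlgebra.hom_ext (funext h)
  refine AlgHom.ext fun a => ?_
  obtain ⟨x, rfl⟩ := mkU'_surjective a
  exact AlgHom.congr_fun this x

/-- A homomorphism on the enlarged algebra is given by one on the original algebra and by the images
of the `K_0^{±1}`. -/
theorem exists_hom_of_K0 {B : Type*} [Ring B] [Algebra ℂ B] (f : U q M N →ₐ[ℂ] B) (t : ℤˣ → B)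
    (ht : ∀ ε, t ε * t (-ε) = 1)
    (hc : ∀ g : Gen M N, t 1 * f (mkU q M N (FreeAlgebra.ι ℂ g)) =
      q ^ g.wt0 • (f (mkU q M N (FreeAlgebra.ι ℂ g)) * t 1)) :
    ∃ F : U' q M N →ₐ[ℂ] B, (∀ a, F (iota q M N a) = f a) ∧ ∀ ε, F (K0 q M N ε) = t ε := by
  let F₀ : FreeAlgebra ℂ (Gen' M N) →ₐ[ℂ] B := FreeAlgebra.lift ℂ
    (Sum.elim (fun g => f (mkU q M N (FreeAlgebra.ι ℂ g))) t)
  have hF₀ : ∀ g, F₀ (FreeAlgebra.ι ℂ g) =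
      Sum.elim (fun g => f (mkU q M N (FreeAlgebra.ι ℂ g))) t g := fun g =>
    FreeAlgebra.lift_ι_apply _ _
  have hincl : ∀ x, F₀ (freeIncl M N x) = f (mkU q M N x) := by
    intro x
    have : F₀.comp (freeIncl M N) = f.comp (mkU q M N) := FreeAlgebra.hom_ext (funext fun g => by
      change F₀ (freeIncl M N (FreeAlgebra.ι ℂ g)) = _
      rw [freeIncl, FreeAlgebra.lift_ι_apply, hF₀]
      rfl)
    exact AlgHom.congr_fun this x
  have hrel : ∀ a b, Rel' q M N a b → F₀ a = F₀ b := by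
    intro a b hab
    cases hab with
    | base a b h => rw [hincl, hincl, mkU_rel h]
    | K0_inv ε => rw [map_mul, hF₀, hF₀, map_one]; exact ht ε
    | K0_conj g =>
      rw [map_mul, map_mul, map_smul, hF₀, hF₀, hF₀]
      change t 1 * f _ * t (-1) = _ • f _
      rw [hc, smul_mul_assoc, mul_assoc, ht, mul_one]
  have hF : ∀ x, RingQuot.liftAlgHom ℂ ⟨F₀, fun _ _ h => hrel _ _ h⟩ (mkU' q M N x) = F₀ x :=
    RingQuot.liftAlgHom_mkAlgHom_apply ℂ F₀ (fun _ _ h => hrel _ _ h)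
  refine ⟨RingQuot.liftAlgHom ℂ ⟨F₀, fun _ _ h => hrel _ _ h⟩, fun a => ?_, fun ε => ?_⟩
  · obtain ⟨x, rfl⟩ := mkU_surjective a
    rw [iota_mkU, ← hincl]
    exact hF _
  · exact (hF _).trans (hF₀ (Sum.inr ε))

theorem K0_mul_K0 (ε : ℤˣ) : K0 q M N ε * K0 q M N (-ε) = 1 := by
  have := mkU'_rel (q := q) (Rel'.K0_inv (M := M) (N := N) ε)
  rwa [map_mul, map_one] at this

theorem K0_mul_iota (g : Gen M N) : K0 q M N 1 * iota q M N (mkU q M N (FreeAlgebra.ι ℂ g)) =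
    q ^ g.wt0 • (iota q M N (mkU q M N (FreeAlgebra.ι ℂ g)) * K0 q M N 1) := by
  have h1 := mkU'_rel (q := q) (Rel'.K0_conj g)
  rw [map_mul, map_mul, map_smul, ← iota_gen] at h1
  have h2 := K0_mul_K0 (q := q) (M := M) (N := N) (-1)
  rw [neg_neg] at h2
  rw [← smul_mul_assoc, ← h1, mul_assoc]
  change _ = _ * (K0 q M N (-1) * K0 q M N 1)
  rw [h2, mul_one]
  rfl

theorem twistEquiv_mem_D (hσ : ∀ i : Node M N, (i : ℕ) = M → σ i = 1) : twistEquiv q σ ∈ D q M N := by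
  obtain ⟨F, hF, hF0⟩ := exists_hom_of_K0 ((iota q M N).comp (twistHom q σ)) (K0 q M N) K0_mul_K0
    (fun g => by
      rw [AlgHom.comp_apply, twistHom_gen, map_smul, mul_smul_comm, K0_mul_iota, smul_mul_assoc,
        smul_comm])
  have hFF : F.comp F = AlgHom.id ℂ _ := hom_ext' fun g => by
    cases g with
    | inl g =>
      rw [← iota_gen, AlgHom.comp_apply, hF, AlgHom.comp_apply, hF, ← AlgHom.comp_apply,
        AlgHom.comp_assoc, twistHom_comp_self]
      rfl
    | inr ε =>
      change F (F (K0 q M N ε)) = K0 q M N ε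
      rw [hF0, hF0]
  have hgen : ∀ g : Gen M N, F (iota q M N (mkU q M N (FreeAlgebra.ι ℂ g))) =
      g.twist σ • iota q M N (mkU q M N (FreeAlgebra.ι ℂ g)) := fun g => by
    rw [hF, AlgHom.comp_apply, twistHom_gen, map_smul]
  refine ⟨AlgEquiv.ofAlgHom F F hFF hFF, ⟨1, σ, one_ne_zero, hσ, ?_, fun i => hgen (Gen.K 1 i),
    fun i s hs => ?_, fun i n => hgen (Gen.X 1 i n), fun i n => ?_⟩, fun x => (hF x).symm⟩
  · rw [one_smul]
    exact hF0 1
  · exact (hgen (Gen.H i s hs)).trans (one_smul _ _)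
  · refine (hgen (Gen.X (-1) i n)).trans ?_
    rw [Gen.twist, if_neg (by decide), one_smul]
    rfl

end Twist

end QAffine

end

noncomputable section
set_option linter.unusedSectionVars false
namespace QAffine

/-! ## The simple modules -/

section HighestWeight

variable {q : ℂ} {M N : ℕ} {V : Type*} [AddCommGroup V] [Module ℂ V] [Module (U q M N) V]
  [IsScalarTower ℂ (U q M N) V]

theorem exists_polyMul_eq_zero [FiniteDimensional ℂ V] {v : V} (hv0 : v ≠ 0) {i : Node M N}
    (hX : ∀ n, X q 1 i n • v = 0) {f : ℤ → ℂ}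
    (hf : ∀ n, ((qi q M i - (qi q M i)⁻¹)⁻¹ • (phi q 1 i n - phi q (-1) i n)) • v = f n • v) :
    ∃ Q : ℂ[X], Q ≠ 0 ∧ polyMul Q f = 0 := by
  obtain ⟨p, hp0, hp⟩ := exists_lowSum_smul_eq_zero (q := q) v i
  refine ⟨p.reverse, mt Polynomial.reverse_eq_zero.mp hp0, funext fun n => ?_⟩
  have key : ∀ (r : ℂ[X]) (m : ℤ), X q 1 i m • lowSum (q := q) i r • v =
      (r.sum fun s a => a * f (m + s)) • v := by
    intro r m
    induction r using Polynomial.induction_on' with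
    | add r r' hr hr' =>
      rw [map_add, add_smul, smul_add, hr, hr', ← add_smul, Polynomial.sum_add_index]
      · simp
      · intro s a b
        rw [add_mul]
    | monomial s a =>
      rw [lowSum_monomial, smul_assoc, smul_smul_comm', ← mul_smul, X_mul_X_neg, if_pos rfl,
        add_smul, smul_assoc, mul_smul, hX, smul_zero, smul_zero, zero_add, hf, smul_smul,
        Polynomial.sum_monomial_index _ _ (by simp)]
  have h1 := key p (n - p.natDegree)
  rw [hp, smul_zero, eq_comm, smul_eq_zero, or_iff_left hv0,
    Polynomial.sum_over_range _ (by simp)] at h1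
  rw [polyMul, Pi.zero_apply, ← h1, Finset.sum_subset
    (Finset.range_mono (Nat.succ_le_succ p.reverse_natDegree_le)), ← Finset.sum_range_reflect]
  · refine Finset.sum_congr rfl fun s hs => ?_
    have hs' := Finset.mem_range.mp hs
    rw [coeff_reverse_of_le (by omega)]
    congr 2 <;> omega
  · intro s _ hs
    rw [Finset.mem_range, not_lt] at hs
    rw [Polynomial.coeff_eq_zero_of_natDegree_lt (by omega), zero_mul]

theorem exists_hw [FiniteDimensional ℂ V] (hq0 : q ≠ 0) (hq : ∀ n : ℕ, 0 < n → q ^ n ≠ 1)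
    (hMN : 0 < M * N) {v : V} (hv0 : v ≠ 0) (h : IsSingular (q := q) (M := M) (N := N) v) :
    ∃ w ∈ R q M N, ∃ σ : Node M N → ℤˣ, (∀ i : Node M N, (i : ℕ) = M → σ i = 1) ∧
      ∀ a, VermaRel q w a → twistHom q σ a • v = 0 := by
  classical
  have hM : 0 < M := Nat.pos_of_mul_pos_right hMN
  have hN : 0 < N := Nat.pos_of_mul_pos_left hMN
  set o : Node M N := ⟨M, by omega, by omega⟩
  have ho : (o : ℕ) = M := rfl
  have hqo : qi q M o = q := qi_odd rfl
  choose τ P hP hP1 hP2 using fun i : {i : Node M N // (i : ℕ) ≠ M} =>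
    exists_drinfeldPolynomial hq0 hq hv0 h i.2
  obtain ⟨c, hc⟩ := h.K_mem 1 o
  have hphi : ∀ ε n, phi q ε o n ∈ lineStab v := fun ε n => phi_mem h.K_mem h.H_mem ε o n
  have hf : ∀ n, ∃ r : ℂ, ((q - q⁻¹)⁻¹ • (phi q 1 o n - phi q (-1) o n)) • v = r • v := fun n =>
    Subalgebra.smul_mem _ (Subalgebra.sub_mem _ (hphi 1 n) (hphi (-1) n)) _
  choose f hf using hf
  have hc0 : c ≠ 0 := by
    rintro rfl
    have h1 := K_mul_K_neg (q := q) (-1) o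
    rw [neg_neg] at h1
    apply hv0
    rw [← one_smul (U q M N) v, ← h1, mul_smul, hc, zero_smul, smul_zero]
  have hcf : (c - c⁻¹) / (q - q⁻¹) = f 0 := by
    refine smul_left_injective ℂ hv0 ?_
    change _ • v = _ • v
    rw [← hf, phi_zero, phi_zero, smul_assoc, sub_smul, hc, K_neg_smul hc0 hc, ← sub_smul,
      smul_smul, div_eq_inv_mul]
  let σ : Node M N → ℤˣ := fun i => if hi : (i : ℕ) = M then 1 else τ ⟨i, hi⟩
  have hσ1 : ∀ i : Node M N, (i : ℕ) = M → σ i = 1 := fun i hi => dif_pos hi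
  have hσ2 : ∀ (i : Node M N) (hi : (i : ℕ) ≠ M), σ i = τ ⟨i, hi⟩ := fun i hi => dif_neg hi
  have htwist : ∀ ε i n, twistHom q σ (phi q ε i n) = ((σ i : ℤ) : ℂ) • phi q ε i n := fun ε i n => by
    rw [phi, twistHom_mkU, freeTwist_phi, map_smul]
  refine ⟨⟨P, f, c⟩, ⟨exists_polyMul_eq_zero hv0 (h.raise o) (by rw [hqo]; exact hf), hc0, hcf, hP⟩,
    σ, hσ1, fun a ha => ?_⟩
  cases ha with
  | raise i n =>
    have : twistHom q σ (X q 1 i n) = _ := twistHom_gen σ (Gen.X 1 i n)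
    rw [this, smul_assoc]
    have h1 : X q 1 i n • v = 0 := h.raise i n
    exact (congrArg _ h1).trans (smul_zero _)
  | evenZero i hi n =>
    rw [map_sub, htwist, AlgHom.commutes, sub_smul, algebraMap_smul, smul_assoc, hP1 ⟨i, hi⟩,
      smul_smul, ← hσ2 i hi, ← mul_assoc, sign_mul_self, one_mul, sub_self]
  | evenInfty i hi n =>
    rw [map_sub, htwist, AlgHom.commutes, sub_smul, algebraMap_smul, smul_assoc, hP2 ⟨i, hi⟩,
      smul_smul, ← hσ2 i hi, ← mul_assoc, sign_mul_self, one_mul, sub_self]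
  | oddK i hi =>
    obtain rfl : i = o := Subtype.ext hi
    have h1 := htwist 1 o 0
    rw [phi_zero, hσ1 o ho] at h1
    rw [map_sub, h1, AlgHom.commutes, sub_smul, algebraMap_smul]
    simp [hc]
  | oddPhi i hi n =>
    obtain rfl : i = o := Subtype.ext hi
    rw [map_sub, map_smul, map_sub, htwist, htwist, AlgHom.commutes, hσ1 o ho, sub_smul,
      algebraMap_smul]
    simp [hf]

end HighestWeight

section K0

variable {q : ℂ} {M N : ℕ} {V : Type*} [AddCommGroup V] [Module ℂ V] [Module (U q M N) V]
  [IsScalarTower ℂ (U q M N) V]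

/-- The generators shift the eigenvalues of the torus elements. -/
theorem torus_mul_gen {k : ℤ} {d : U q M N} (hd : d ∈ torusAlg q M N)
    (hX : ∀ (ε : ℤˣ) (j : Node M N) n, d * X q ε j n =
      q ^ ((ε : ℤ) * if (j : ℕ) = 1 then k else 0) • (X q ε j n * d)) (g : Gen M N) :
    d * mkU q M N (FreeAlgebra.ι ℂ g) = (q ^ k) ^ g.wt0 • (mkU q M N (FreeAlgebra.ι ℂ g) * d) := by
  cases g with
  | X ε i n =>
    refine (hX ε i n).trans ?_
    rw [Gen.wt0, ← zpow_mul]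
    congr 2
    split_ifs <;> ring
  | K ε i => rw [Gen.wt0, zpow_zero, one_smul]; exact (torusAlg_comm hd).1 ε i
  | H i s hs => rw [Gen.wt0, zpow_zero, one_smul]; exact (torusAlg_comm hd).2 i s hs

/-- The action of `K_0`, through elements of the torus. -/
theorem exists_K0_action [FiniteDimensional ℂ V] (hq0 : q ≠ 0) (hq : ∀ n : ℕ, 0 < n → q ^ n ≠ 1)
    (hMN : 0 < M * N) (hne : M ≠ N) {v : V} (hv0 : v ≠ 0) (hgen : ∀ y : V, ∃ a : U q M N, y = a • v)
    (hK : ∀ ε (i : Node M N), K q ε i ∈ lineStab v) :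
    ∃ t : ℤˣ → U q M N, (∀ ε, t ε ∈ torusAlg q M N) ∧ t 1 • v = v ∧
      (∀ ε (y : V), t ε • t (-ε) • y = y) ∧
      ∀ (g : Gen M N) (y : V), t 1 • mkU q M N (FreeAlgebra.ι ℂ g) • y =
        q ^ g.wt0 • mkU q M N (FreeAlgebra.ι ℂ g) • t 1 • y := by
  classical
  have hM : 0 < M := Nat.pos_of_mul_pos_right hMN
  have hN : 0 < N := Nat.pos_of_mul_pos_left hMN
  obtain ⟨d, d', hd, -, -, hdd, hX⟩ := fund_mem_torusWeights (M := M) (N := N) hq0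
    (show 1 < M + N by omega)
  have hMN' : (M : ℤ) - N ≠ 0 := by omega
  set r : ℂ := q ^ ((M : ℤ) - N)
  have hr0 : r ≠ 0 := zpow_ne_zero _ hq0
  have hr1 : ∀ n : ℕ, 0 < n → r ^ n ≠ 1 := zpow_pow_ne_one hq hMN'
  have hr2 : ∀ n : ℤ, n ≠ 0 → r ^ n ≠ 1 := by
    intro n hn h1
    rcases Int.natAbs_eq n with h | h <;> rw [h] at h1
    · rw [zpow_natCast] at h1
      exact hr1 _ (Int.natAbs_pos.mpr hn) h1
    · rw [zpow_neg, zpow_natCast, inv_eq_one] at h1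
      exact hr1 _ (Int.natAbs_pos.mpr hn) h1
  have hg := torus_mul_gen hd hX
  obtain ⟨δ, hδ⟩ : d ∈ lineStab v := torusAlg_le hK hd
  have hδ0 : δ ≠ 0 := by
    rintro rfl
    apply hv0
    rw [← one_smul (U q M N) v, ← hdd, mul_smul, hδ, zero_smul, smul_zero]
  have hinj : Function.Injective fun m : ℤ => δ * r ^ m := by
    intro m n hmn
    by_contra hne
    refine hr2 (m - n) (sub_ne_zero.mpr hne) ?_
    rw [zpow_sub₀ hr0, mul_left_cancel₀ hδ0 hmn, div_self (zpow_ne_zero _ hr0)]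
  let W : ℤ → Submodule ℂ V := fun m => Module.End.eigenspace (act V d) (δ * r ^ m)
  have hW : ∀ m y, y ∈ W m ↔ d • y = (δ * r ^ m) • y := fun m y => Module.End.mem_eigenspace_iff
  have hgW : ∀ (g : Gen M N) m y, y ∈ W m → mkU q M N (FreeAlgebra.ι ℂ g) • y ∈ W (m + g.wt0) := by
    intro g m y hy
    rw [hW] at hy ⊢
    rw [← mul_smul, hg, smul_assoc, mul_smul, hy, smul_smul_comm', smul_smul, zpow_add₀ hr0]
    congr 1
    ring
  have htop : ⨆ m, W m = ⊤ := by
    rw [eq_top_iff]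
    intro y _
    obtain ⟨a, rfl⟩ := hgen y
    have hstab : ∀ g : Gen M N, mkU q M N (FreeAlgebra.ι ℂ g) ∈ stabSub (U q M N) (⨆ m, W m) := by
      intro g
      have : (⨆ m, W m) ≤ (⨆ m, W m).comap (act V (mkU q M N (FreeAlgebra.ι ℂ g))) :=
        iSup_le fun m y hy => Submodule.mem_iSup_of_mem _ (hgW g m y hy)
      exact this
    suffices h1 : a ∈ stabSub (U q M N) (⨆ m, W m) from
      h1 v (Submodule.mem_iSup_of_mem 0 ((hW _ _).mpr (by rw [zpow_zero, mul_one, hδ])))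
    exact eq_top_of_gen_mem (fun ε i n => hstab (Gen.X ε i n)) (fun ε i => hstab (Gen.K ε i))
      (fun i s hs => hstab (Gen.H i s hs)) a
  have hfin : {m : ℤ | W m ≠ ⊥}.Finite := by
    refine Set.Finite.of_finite_image (f := fun m : ℤ => δ * r ^ m)
      ((Module.End.finite_hasEigenvalue (act V d)).subset ?_) hinj.injOn
    rintro _ ⟨m, hm, rfl⟩
    exact hm
  let L : ℤˣ → ℂ[X] := fun ε => Lagrange.interpolate hfin.toFinset (fun m : ℤ => δ * r ^ m)
    fun m => q ^ ((ε : ℤ) * m)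
  have hL : ∀ ε m y, y ∈ W m → Polynomial.aeval d (L ε) • y = q ^ ((ε : ℤ) * m) • y := by
    intro ε m y hy
    by_cases hy0 : y = 0
    · rw [hy0, smul_zero, smul_zero]
    have h1 : act V (Polynomial.aeval d (L ε)) y = q ^ ((ε : ℤ) * m) • y := by
      rw [← Polynomial.aeval_algHom_apply, Module.End.aeval_apply_of_hasEigenvector ⟨hy, hy0⟩,
        Lagrange.eval_interpolate_at_node _ hinj.injOn]
      rw [Set.Finite.mem_toFinset]
      exact Submodule.ne_bot_iff _ |>.mpr ⟨y, hy, hy0⟩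
    exact h1
  have hext : ∀ f f' : V →ₗ[ℂ] V, (∀ m, ∀ y ∈ W m, f y = f' y) → ∀ y, f y = f' y := by
    intro f f' hff y
    have hy : y ∈ ⨆ m, W m := htop ▸ Submodule.mem_top
    have : (⨆ m, W m) ≤ LinearMap.eqLocus f f' := iSup_le fun m y hy => hff m y hy
    exact this hy
  refine ⟨fun ε => Polynomial.aeval d (L ε), fun ε => ?_, ?_, fun ε => ?_, fun g => ?_⟩
  · exact Algebra.adjoin_le (Set.singleton_subset_iff.mpr hd)
      (Polynomial.aeval_mem_adjoin_singleton ℂ d)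
  · rw [hL 1 0 v ((hW _ _).mpr (by rw [zpow_zero, mul_one, hδ]))]
    simp
  · refine hext (act V (Polynomial.aeval d (L ε)) * act V (Polynomial.aeval d (L (-ε)))) 1
      fun m y hy => ?_
    change Polynomial.aeval d (L ε) • Polynomial.aeval d (L (-ε)) • y = y
    rw [hL _ m y hy, smul_smul_comm', hL _ m y hy, smul_smul, ← zpow_add₀ hq0]
    simp
  · refine hext (act V (Polynomial.aeval d (L 1)) * act V (mkU q M N (FreeAlgebra.ι ℂ g)))
      (q ^ g.wt0 • (act V (mkU q M N (FreeAlgebra.ι ℂ g)) * act V (Polynomial.aeval d (L 1))))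
      fun m y hy => ?_
    change Polynomial.aeval d (L 1) • mkU q M N (FreeAlgebra.ι ℂ g) • y =
      q ^ g.wt0 • mkU q M N (FreeAlgebra.ι ℂ g) • Polynomial.aeval d (L 1) • y
    rw [hL _ m y hy, hL _ _ _ (hgW g m y hy), smul_smul_comm', smul_smul, ← zpow_add₀ hq0]
    congr 2
    simp [add_comm]

end K0

end QAffine

end

noncomputable section
set_option linter.unusedSectionVars false
namespace QAffine

section Weights

variable {q : ℂ} {M N : ℕ} {V : Type*} [AddCommGroup V] [Module ℂ V] [Module (U q M N) V]
  [IsScalarTower ℂ (U q M N) V]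

theorem IsSingular.mem_of_map_eq (hq0 : q ≠ 0) (hq : ∀ n : ℕ, 0 < n → q ^ n ≠ 1) (hne : M ≠ N)
    {v : V} (h : IsSingular (q := q) (M := M) (N := N) v) {S : Submodule ℂ V}
    (hS : ∀ (d : U q M N), ∀ x ∈ S, d • x ∈ S) {W : Type*} [AddCommGroup W] [Module ℂ W]
    {ψ : V →ₗ[ℂ] W} (hψ : ∀ d : U q M N, ∃ T : Module.End ℂ W, ∀ x, ψ (d • x) = T (ψ x))
    (hψv : ψ v ≠ 0) {x : V} (hx : x ∈ ⨆ k, lvl (q := q) (M := M) (N := N) Set.univ v k)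
    (hxS : x ∈ S) (hxv : ψ x = ψ v) : v ∈ S := by
  obtain ⟨d, d', hd, -, -, hdd, hX⟩ := height_mem_torusWeights (M := M) (N := N) hq0
  have hMN : (M : ℤ) - N ≠ 0 := by omega
  set c : ℂ := (q ^ ((M : ℤ) - N))⁻¹ with hc
  have hc0 : c ≠ 0 := inv_ne_zero (zpow_ne_zero _ hq0)
  have hc1 : ∀ n : ℕ, 0 < n → c ^ n ≠ 1 := fun n hn => by
    rw [hc, inv_pow, Ne, inv_eq_one]
    exact zpow_pow_ne_one hq hMN n hn
  have hX' : ∀ i ∈ (Set.univ : Set (Node M N)), ∀ m, d * X q (-1) i m = c • (X q (-1) i m * d) := by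
    intro i _ m
    rw [hX, hc, ← zpow_neg]
    congr 2
    simp
  obtain ⟨μ, hμ⟩ : d ∈ lineStab v := torusAlg_le h.K_mem hd
  have hv0 : v ≠ 0 := fun h0 => hψv (by rw [h0, map_zero])
  have hμ0 : μ ≠ 0 := by
    rintro rfl
    apply hv0
    rw [← one_smul (U q M N) v, ← hdd, mul_smul, hμ, zero_smul, smul_zero]
  have hlvl := lvl_eigen hX' hμ
  obtain ⟨T, hT⟩ := hψ d
  have hTv : T (ψ v) = μ • ψ v := by rw [← hT, hμ, map_smul]
  have key : ∀ n x, x ∈ partialSups (lvl (q := q) (M := M) (N := N) Set.univ v) n → x ∈ S →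
      (∃ β : ℂ, β ≠ 0 ∧ ψ x = β • ψ v) → v ∈ S := by
    intro n
    induction n with
    | zero =>
      rintro x hx hxS ⟨β, hβ, hxβ⟩
      rw [partialSups_zero, lvl_zero] at hx
      obtain ⟨r, rfl⟩ := Submodule.mem_span_singleton.mp hx
      rw [map_smul] at hxβ
      have hr : r = β := smul_left_injective ℂ hψv hxβ
      have := S.smul_mem r⁻¹ hxS
      rwa [smul_smul, inv_mul_cancel₀ (hr ▸ hβ), one_smul] at this
    | succ n ih =>
      rintro x hx hxS ⟨β, hβ, hxβ⟩
      rw [partialSups_add_one] at hx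
      obtain ⟨y, hy, z, hz, rfl⟩ := Submodule.mem_sup.mp hx
      refine ih (d • (y + z) - (c ^ (n + 1) * μ) • (y + z)) ?_
        (S.sub_mem (hS _ _ hxS) (S.smul_mem _ hxS)) ⟨(μ - c ^ (n + 1) * μ) * β,
          mul_ne_zero (fun h0 => hc1 (n + 1) (Nat.succ_pos n) ?_) hβ, ?_⟩
      · rw [smul_add, smul_add, hlvl _ z hz, add_sub_add_right_eq_sub]
        refine Submodule.sub_mem _ ?_ (Submodule.smul_mem _ _ hy)
        have hstab : partialSups (lvl (q := q) (M := M) (N := N) Set.univ v) n ≤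
            (partialSups (lvl (q := q) (M := M) (N := N) Set.univ v) n).comap (act V d) := by
          refine partialSups_le _ _ _ fun k hk y hy => ?_
          refine (le_partialSups_of_le (lvl (q := q) (M := M) (N := N) Set.univ v) hk :) ?_
          change d • y ∈ lvl (q := q) (M := M) (N := N) Set.univ v k
          rw [hlvl _ y hy]
          exact Submodule.smul_mem _ _ hy
        exact hstab hy
      · refine mul_right_cancel₀ hμ0 ?_
        rw [one_mul]
        exact (sub_eq_zero.mp h0).symm
      · rw [map_sub, hT, map_smul, hxβ, map_smul, hTv, smul_smul, smul_smul, ← sub_smul]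
        congr 1
        ring
  rw [← iSup_partialSups_eq, Submodule.mem_iSup_of_chain] at hx
  obtain ⟨n, hn⟩ := hx
  exact key n x hn hxS ⟨1, one_ne_zero, by rw [hxv, one_smul]⟩

theorem IsHWVector.isSingular (hq2 : q - q⁻¹ ≠ 0) {w : HW M N} {v : V}
    (h : IsHWVector (q := q) w v) : IsSingular (q := q) (M := M) (N := N) v where
  raise i n := h _ (VermaRel.raise i n)
  K_mem ε i := by rw [← phi_zero]; exact h.phi_mem hq2 ε i 0
  H_mem i s hs := H_mem_lineStab hq2 (fun ε i n => h.phi_mem hq2 ε i n) i s hs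

end Weights

section VermaEnlarged

variable {q : ℂ} {M N : ℕ}

theorem eq_top_of_gen_mem' {S : Subalgebra ℂ (U' q M N)} (hU : ∀ a, iota q M N a ∈ S)
    (hK0 : ∀ ε, K0 q M N ε ∈ S) (a : U' q M N) : a ∈ S := by
  obtain ⟨x, rfl⟩ := mkU'_surjective a
  induction x using FreeAlgebra.induction with
  | grade0 r => rw [AlgHom.commutes]; exact S.algebraMap_mem r
  | grade1 g =>
    cases g with
    | inl g => rw [← iota_gen]; exact hU _
    | inr ε => exact hK0 ε
  | mul x y hx hy => rw [map_mul]; exact S.mul_mem hx hy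
  | add x y hx hy => rw [map_add]; exact S.add_mem hx hy

theorem K0_mul_iota' (hq0 : q ≠ 0) (ε : ℤˣ) (g : Gen M N) :
    K0 q M N ε * iota q M N (mkU q M N (FreeAlgebra.ι ℂ g)) =
      q ^ ((ε : ℤ) * g.wt0) • (iota q M N (mkU q M N (FreeAlgebra.ι ℂ g)) * K0 q M N ε) := by
  rcases Int.units_eq_one_or ε with rfl | rfl
  · rw [K0_mul_iota, Units.val_one, one_mul]
  · have h1 := K0_mul_iota (q := q) g
    have h2 := K0_mul_K0 (q := q) (M := M) (N := N) 1
    have h3 := K0_mul_K0 (q := q) (M := M) (N := N) (-1)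
    rw [neg_neg] at h3
    set x := iota q M N (mkU q M N (FreeAlgebra.ι ℂ g))
    have h4 : K0 q M N (-1) * (K0 q M N 1 * x) * K0 q M N (-1) = x * K0 q M N (-1) := by
      rw [← mul_assoc, h3, one_mul]
    rw [← h4, h1, mul_smul_comm, smul_mul_assoc, smul_smul, ← zpow_add₀ hq0, mul_assoc, mul_assoc,
      h2, mul_one]
    simp

theorem eq_top_of_map_eq (hq0 : q ≠ 0) (hq : ∀ n : ℕ, 0 < n → q ^ n ≠ 1) (hne : M ≠ N)
    {w : HW M N} {W : Type*} [AddCommGroup W] [Module ℂ W] {ψ : Verma' q w →ₗ[ℂ] W}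
    (hψ : ∀ d : U q M N, ∃ T : Module.End ℂ W, ∀ x, ψ (iota q M N d • x) = T (ψ x))
    (hψ1 : ψ (Submodule.Quotient.mk 1) ≠ 0) {S : Submodule (U' q M N) (Verma' q w)}
    {x : Verma' q w} (hxS : x ∈ S) (hx : ψ x = ψ (Submodule.Quotient.mk 1)) : S = ⊤ := by
  let _ : Module (U q M N) (Verma' q w) := Module.compHom _ (iota q M N : U q M N →+* U' q M N)
  have hsmul : ∀ (a : U q M N) (y : Verma' q w), a • y = iota q M N a • y := fun _ _ => rfl
  have _ : IsScalarTower ℂ (U q M N) (Verma' q w) :=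
    ⟨fun r a y => by rw [hsmul, hsmul, map_smul, smul_assoc]⟩
  set v : Verma' q w := Submodule.Quotient.mk 1
  have hmk : ∀ a : U' q M N, a • v = Submodule.Quotient.mk a := fun a => by
    rw [← Submodule.Quotient.mk_smul, smul_eq_mul, mul_one]
  have hhw : IsHWVector (q := q) w v := fun u hu => by
    rw [hsmul, hmk, Submodule.Quotient.mk_eq_zero]
    exact Submodule.subset_span (Or.inl ⟨u, hu, rfl⟩)
  have hsing := hhw.isSingular (sub_inv_ne_zero hq0 hq)
  have hK1 : K0 q M N 1 • v = v := by
    rw [← sub_eq_zero]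
    have : K0 q M N 1 • v - v = (K0 q M N 1 - 1) • v := by rw [sub_smul, one_smul]
    rw [this, hmk, Submodule.Quotient.mk_eq_zero]
    exact Submodule.subset_span (Or.inr rfl)
  have hK0 : ∀ ε, K0 q M N ε • v = v := by
    intro ε
    rcases Int.units_eq_one_or ε with rfl | rfl
    · exact hK1
    · have h3 := K0_mul_K0 (q := q) (M := M) (N := N) (-1)
      rw [neg_neg] at h3
      nth_rewrite 1 [← hK1]
      rw [← mul_smul, h3, one_smul]
  have hlvl : ∀ ε k, K0 q M N ε ∈ stabSub (U' q M N) (lvl (q := q) (M := M) (N := N) Set.univ v k) := by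
    intro ε k
    induction k with
    | zero =>
      intro y hy
      obtain ⟨r, rfl⟩ := Submodule.mem_span_singleton.mp hy
      rw [smul_comm, hK0]
      exact hy
    | succ k ih =>
      have : lvl (q := q) (M := M) (N := N) Set.univ v (k + 1) ≤
          (lvl (q := q) (M := M) (N := N) Set.univ v (k + 1)).comap
            (Algebra.lsmul ℂ ℂ (Verma' q w) (K0 q M N ε)) := by
        refine lvl_succ_le fun i hi m y hy => ?_
        change K0 q M N ε • iota q M N (mkU q M N (FreeAlgebra.ι ℂ (Gen.X (-1) i m))) • y ∈
          lvl (q := q) (M := M) (N := N) Set.univ v (k + 1)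
        rw [← mul_smul, K0_mul_iota' hq0, smul_assoc, mul_smul]
        exact Submodule.smul_mem _ _ (X_smul_mem_lvl hi m (ih _ hy))
      exact this
  have htop : ∀ y : Verma' q w, y ∈ ⨆ k, lvl (q := q) (M := M) (N := N) Set.univ v k := by
    intro y
    obtain ⟨a, rfl⟩ := Submodule.Quotient.mk_surjective _ y
    rw [← hmk]
    have hv : v ∈ ⨆ k, lvl (q := q) (M := M) (N := N) Set.univ v k :=
      Submodule.mem_iSup_of_mem 0 (Submodule.mem_span_singleton_self v)
    suffices h1 : a ∈ stabSub (U' q M N) (⨆ k, lvl (q := q) (M := M) (N := N) Set.univ v k) from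
      h1 v hv
    refine eq_top_of_gen_mem' (fun b => ?_) (fun ε => ?_) a
    · exact hsing.mem_stabSub_iSup_lvl hq0 b
    · have : (⨆ k, lvl (q := q) (M := M) (N := N) Set.univ v k) ≤
          (⨆ k, lvl (q := q) (M := M) (N := N) Set.univ v k).comap
            (Algebra.lsmul ℂ ℂ (Verma' q w) (K0 q M N ε)) :=
        iSup_le fun k y hy => Submodule.mem_iSup_of_mem k (hlvl ε k y hy)
      exact this
  have hvS : v ∈ S := hsing.mem_of_map_eq hq0 hq hne (S := S.restrictScalars ℂ)
    (fun d x hx => S.smul_mem _ hx) hψ hψ1 (htop x) hxS hx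
  rw [eq_top_iff]
  intro y _
  obtain ⟨a, rfl⟩ := Submodule.Quotient.mk_surjective _ y
  rw [← hmk]
  exact S.smul_mem a hvS

end VermaEnlarged

end QAffine

end

noncomputable section
set_option linter.unusedSectionVars false
namespace QAffine

section Isomorphism

variable {q : ℂ} {M N : ℕ} {V : Type*} [AddCommGroup V] [Module ℂ V] [Module (U q M N) V]
  [IsScalarTower ℂ (U q M N) V] {𝒱 : ZMod 2 → Submodule ℂ V}

theorem IsSuperModule.twist_smul_mem (h : IsSuperModule (gradU q M N) 𝒱) (σ : Node M N → ℤˣ)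
    (g : Gen M N) {j : ZMod 2} {y : V} (hy : y ∈ 𝒱 j) :
    twistHom q σ (mkU q M N (FreeAlgebra.ι ℂ g)) • y ∈ 𝒱 (g.par + j) := by
  rw [twistHom_gen, smul_assoc]
  exact Submodule.smul_mem _ _ (h.smul_mem _ _ _ _
    (gen_mem_wordGrading (gen := fun g : Gen M N => mkU q M N (FreeAlgebra.ι ℂ g)) (par := Gen.par)
      g) hy)

theorem gradU'_apply_mem (h : IsSuperModule (gradU q M N) 𝒱) {F : U' q M N →ₐ[ℂ] Module.End ℂ V}
    {σ : Node M N → ℤˣ} (hF : ∀ a y, F (iota q M N a) y = twistHom q σ a • y) {t : ℤˣ → U q M N}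
    (ht : ∀ ε, t ε ∈ torusAlg q M N) (hF0 : ∀ ε y, F (K0 q M N ε) y = t ε • y) {i j : ZMod 2}
    {a : U' q M N} (ha : a ∈ gradU' q M N i) {y : V} (hy : y ∈ 𝒱 j) : F a y ∈ 𝒱 (i + j) := by
  induction ha using Submodule.span_induction with
  | zero => rw [map_zero]; exact Submodule.zero_mem _
  | add a b _ _ ha hb => rw [map_add]; exact Submodule.add_mem _ ha hb
  | smul r a _ ha => rw [map_smul]; exact Submodule.smul_mem _ _ ha
  | mem a ha =>
    obtain ⟨l, rfl, rfl⟩ := ha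
    induction l with
    | nil => simpa using hy
    | cons g l ih =>
      rw [List.map_cons, List.map_cons, List.sum_cons, List.prod_cons, map_mul,
        Module.End.mul_apply, add_assoc]
      cases g with
      | inl g =>
        rw [← iota_gen, hF]
        exact h.twist_smul_mem σ g ih
      | inr ε =>
        refine (congrArg (· ∈ _) (hF0 ε _)).mpr ?_
        rw [Sum.elim_inr, zero_add]
        exact h.torus_smul_mem _ (ht ε) _ ih

theorem IsSuperModule.eq_zero_of_add_eq (h : IsSuperModule (gradU q M N) 𝒱) {i : ZMod 2}
    {y z x : V} (hy : y ∈ 𝒱 i) (hz : z ∈ 𝒱 (i + 1)) (hx : x ∈ 𝒱 i) (e : x = y + z) : z = 0 := by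
  have h1 := h.isInternal.submodule_iSupIndep.pairwiseDisjoint
    ((by decide : ∀ i : ZMod 2, i ≠ i + 1) i)
  refine Submodule.disjoint_def.mp h1 z ?_ hz
  have : z = x - y := by rw [e, add_sub_cancel_left]
  rw [this]
  exact Submodule.sub_mem _ hx hy

theorem isoPullback_simpleQ (hq0 : q ≠ 0) (hq : ∀ n : ℕ, 0 < n → q ^ n ≠ 1) (hne : M ≠ N)
    (h : IsSuperModule (gradU q M N) 𝒱) (hs : IsSimpleSuper (U q M N) 𝒱) {p : ZMod 2} {v : V}
    (hv : v ∈ 𝒱 p) (hv0 : v ≠ 0) {w : HW M N} {σ : Node M N → ℤˣ}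
    (hw : ∀ a, VermaRel q w a → twistHom q σ a • v = 0) {t : ℤˣ → U q M N}
    (ht : ∀ ε, t ε ∈ torusAlg q M N) (htv : t 1 • v = v)
    (htt : ∀ ε (y : V), t ε • t (-ε) • y = y)
    (htg : ∀ (g : Gen M N) (y : V), t 1 • mkU q M N (FreeAlgebra.ι ℂ g) • y =
      q ^ g.wt0 • mkU q M N (FreeAlgebra.ι ℂ g) • t 1 • y) :
    IsoPullback ((iota q M N).comp (twistEquiv q σ : U q M N →ₐ[ℂ] U q M N)) 𝒱
      (gradSimpleQ q w) := by
  have h01 : ∀ i : ZMod 2, i = 0 ∨ i = 1 := by decide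
  have hpp : ∀ i p : ZMod 2, i + p + p = i := by decide
  obtain ⟨F, hF, hF0⟩ := exists_hom_of_K0 ((act V).comp (twistHom q σ)) (fun ε => act V (t ε))
    (fun ε => LinearMap.ext fun y => htt ε y) (fun g => LinearMap.ext fun y => by
      rw [AlgHom.comp_apply, twistHom_gen, map_smul, mul_smul_comm, smul_mul_assoc, smul_comm]
      exact congrArg (g.twist σ • ·) (htg g y))
  replace hF : ∀ a y, F (iota q M N a) y = twistHom q σ a • y := fun a y =>
    LinearMap.congr_fun (hF a) y
  replace hF0 : ∀ ε y, F (K0 q M N ε) y = t ε • y := fun ε y => LinearMap.congr_fun (hF0 ε) y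
  have hgr : ∀ {i j : ZMod 2} {a : U' q M N} {y : V}, a ∈ gradU' q M N i → y ∈ 𝒱 j →
      F a y ∈ 𝒱 (i + j) := fun ha hy => gradU'_apply_mem h hF ht hF0 ha hy
  let _ : Module (U' q M N) V := Module.compHom V (F : U' q M N →+* Module.End ℂ V)
  have hsmul : ∀ (a : U' q M N) (y : V), a • y = F a y := fun _ _ => rfl
  have _ : IsScalarTower ℂ (U' q M N) V := ⟨fun r a y => by
    rw [hsmul, hsmul, map_smul, LinearMap.smul_apply]⟩
  let ψ : Verma' q w →ₗ[U' q M N] V := (vermaIdeal' q w).liftQ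
    (LinearMap.toSpanSingleton (U' q M N) V v) (Submodule.span_le.mpr (by
      rintro _ (⟨a, ha, rfl⟩ | rfl)
      · change iota q M N a • v = 0
        rw [hsmul, hF]
        exact hw a ha
      · change (K0 q M N 1 - 1) • v = 0
        rw [sub_smul, one_smul, hsmul, hF0, htv, sub_self]))
  have hψ : ∀ a, ψ (Submodule.Quotient.mk a) = F a v := fun _ => rfl
  have hψ1 : ψ (Submodule.Quotient.mk 1) = v := by rw [hψ, map_one, Module.End.one_apply]
  -- every element splits
  have hsplit : ∀ a : U' q M N, ∃ b ∈ gradU' q M N 0, ∃ c ∈ gradU' q M N 1, a = b + c := fun a =>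
    exists_wordGrading_add mkU'_surjective a
  have hψgr : ∀ {i : ZMod 2} {x : Verma' q w}, x ∈ gradVerma' q w i → ψ x ∈ 𝒱 (i + p) := by
    rintro i _ ⟨a, ha, rfl⟩
    exact hgr ha hv
  have hker : LinearMap.ker ψ = maxSub q w := by
    refine le_antisymm (le_sSup ⟨fun x hx => ?_, fun htop => ?_⟩) (sSup_le fun S hS => ?_)
    · obtain ⟨a, rfl⟩ := Submodule.Quotient.mk_surjective _ x
      obtain ⟨b, hb, c, hc, rfl⟩ := hsplit a
      have hx' : ψ (Submodule.Quotient.mk b) + ψ (Submodule.Quotient.mk c) = 0 := by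
        rw [← map_add]; exact hx
      have hb' : F b v ∈ 𝒱 p := by simpa using hgr hb hv
      have hc' : F c v ∈ 𝒱 (p + 1) := by simpa [add_comm] using hgr hc hv
      have hc0 : ψ (Submodule.Quotient.mk c) = 0 :=
        h.eq_zero_of_add_eq hb' hc' (Submodule.zero_mem _) hx'.symm
      rw [hc0, add_zero] at hx'
      exact ⟨Submodule.Quotient.mk b, hx', Submodule.Quotient.mk c, hc0, ⟨b, hb, rfl⟩, ⟨c, hc, rfl⟩,
        rfl⟩
    · have : (Submodule.Quotient.mk 1 : Verma' q w) ∈ LinearMap.ker ψ := htop ▸ Submodule.mem_top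
      exact hv0 (hψ1.symm.trans this)
    · obtain ⟨hShom, hStop⟩ := hS
      let S' : Submodule (U q M N) V :=
        { carrier := {y | ∃ x ∈ S, ψ x = y}
          add_mem' := by
            rintro _ _ ⟨x, hx, rfl⟩ ⟨y, hy, rfl⟩
            exact ⟨x + y, S.add_mem hx hy, map_add _ _ _⟩
          zero_mem' := ⟨0, S.zero_mem, map_zero _⟩
          smul_mem' := by
            rintro a _ ⟨x, hx, rfl⟩
            refine ⟨iota q M N (twistHom q σ a) • x, S.smul_mem _ hx, ?_⟩
            rw [map_smul, hsmul, hF, ← AlgHom.comp_apply, twistHom_comp_self, AlgHom.id_apply] }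
      have hS' : IsHomogeneousSub 𝒱 S' := by
        rintro _ ⟨x, hx, rfl⟩
        obtain ⟨y, hy, z, hz, hy0, hz1, rfl⟩ := hShom x hx
        have hy' := hψgr hy0
        have hz' := hψgr hz1
        rcases h01 p with rfl | rfl
        · exact ⟨ψ y, ⟨y, hy, rfl⟩, ψ z, ⟨z, hz, rfl⟩, hy', hz', map_add _ _ _⟩
        · exact ⟨ψ z, ⟨z, hz, rfl⟩, ψ y, ⟨y, hy, rfl⟩, hz', hy', by rw [map_add, add_comm]⟩
      rcases hs.2 S' hS' with h1 | h1
      · intro x hx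
        have : ψ x ∈ S' := ⟨x, hx, rfl⟩
        rw [h1] at this
        exact this
      · exfalso
        have : v ∈ S' := h1 ▸ Submodule.mem_top
        obtain ⟨x, hx, hxv⟩ := this
        refine hStop (eq_top_of_map_eq hq0 hq hne (ψ := ψ.restrictScalars ℂ)
          (fun d => ⟨F (iota q M N d), fun x => map_smul ψ _ _⟩) ?_ hx (hxv.trans hψ1.symm))
        exact hψ1 ▸ hv0
  have hsurj : Function.Surjective ψ := by
    intro y
    obtain ⟨a, rfl⟩ := h.exists_smul_eq hs hv hv0 y
    refine ⟨Submodule.Quotient.mk (iota q M N (twistHom q σ a)), ?_⟩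
    rw [hψ, hF, ← AlgHom.comp_apply, twistHom_comp_self, AlgHom.id_apply]
  let e' : SimpleQ q w ≃ₗ[U' q M N] V :=
    (Submodule.quotEquivOfEq _ _ hker.symm).trans (ψ.quotKerEquivOfSurjective hsurj)
  have he' : ∀ x, e' (Submodule.Quotient.mk x) = ψ x := fun _ => rfl
  refine ⟨(e'.restrictScalars ℂ).symm, p, fun a y => ?_, fun i y => ⟨fun hy => ?_, fun hy => ?_⟩⟩
  · change e'.symm (a • y) = iota q M N (twistHom q σ a) • e'.symm y
    rw [← map_smul, hsmul, hF, ← AlgHom.comp_apply, twistHom_comp_self, AlgHom.id_apply]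
  · change e'.symm y ∈ _
    obtain ⟨x, rfl⟩ := hsurj y
    obtain ⟨a, rfl⟩ := Submodule.Quotient.mk_surjective _ x
    obtain ⟨b, hb, c, hc, rfl⟩ := hsplit a
    rw [← he', LinearEquiv.symm_apply_apply]
    have hbv := hgr hb hv
    have hcv := hgr hc hv
    have hsum : ψ (Submodule.Quotient.mk (b + c)) = F b v + F c v := by
      rw [hψ, map_add, LinearMap.add_apply]
    have hmem : ∀ (j : ZMod 2) (d d' : U' q M N), d ∈ gradU' q M N j → F d' v = 0 →
        (Submodule.Quotient.mk (Submodule.Quotient.mk (d + d')) : SimpleQ q w) ∈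
          gradSimpleQ q w j := by
      intro j d d' hd hd'
      refine ⟨Submodule.Quotient.mk d, ⟨d, hd, rfl⟩, ?_⟩
      change (Submodule.Quotient.mk (Submodule.Quotient.mk d) : SimpleQ q w) = _
      rw [Submodule.Quotient.eq, ← hker, LinearMap.mem_ker, map_sub, hψ, hψ, map_add,
        LinearMap.add_apply, hd', add_zero, sub_self]
    rcases h01 (i + p) with h1 | h1
    · have hi : i = p := by rw [← hpp i p, h1, zero_add]
      subst hi
      rw [zero_add] at hbv
      rw [add_comm] at hcv
      rw [h1]
      exact hmem 0 b c hb (h.eq_zero_of_add_eq hbv hcv hy hsum)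
    · have hi : i = 1 + p := by rw [← hpp i p, h1]
      subst hi
      rw [zero_add] at hbv
      rw [h1, add_comm b c]
      refine hmem 1 c b hc (h.eq_zero_of_add_eq hcv ?_ hy (hsum.trans (add_comm _ _)))
      rwa [(by decide : ∀ p : ZMod 2, 1 + p + 1 = p) p]
  · obtain ⟨_, ⟨a, ha, rfl⟩, hx⟩ := hy
    have h1 : y = F a v := by
      have h2 : e' (e'.symm y) = F a v := by
        change e' ((e'.restrictScalars ℂ).symm y) = F a v
        rw [← hx]
        rfl
      rwa [LinearEquiv.apply_symm_apply] at h2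
    rw [h1, ← hpp i p]
    exact hgr ha hv

theorem exists_isoPullback [FiniteDimensional ℂ V] (hq0 : q ≠ 0)
    (hq : ∀ n : ℕ, 0 < n → q ^ n ≠ 1) (hMN : 0 < M * N) (hne : M ≠ N)
    (h : IsSuperModule (gradU q M N) 𝒱) (hs : IsSimpleSuper (U q M N) 𝒱) :
    ∃ w ∈ R q M N, ∃ π ∈ D q M N,
      IsoPullback ((iota q M N).comp (π : U q M N →ₐ[ℂ] U q M N)) 𝒱 (gradSimpleQ q w) := by
  have : Nontrivial V := hs.1
  obtain ⟨p, v, hv, hv0, hsing⟩ := h.exists_isSingular hq0 hq hne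
  obtain ⟨w, hw, σ, hσ, hrel⟩ := exists_hw hq0 hq hMN hv0 hsing
  obtain ⟨t, ht, htv, htt, htg⟩ := exists_K0_action hq0 hq hMN hne hv0
    (h.exists_smul_eq hs hv hv0) hsing.K_mem
  exact ⟨w, hw, twistEquiv q σ, twistEquiv_mem_D σ hσ,
    isoPullback_simpleQ hq0 hq hne h hs hv hv0 hrel ht htv htt htg⟩

end Isomorphism

end QAffine

end

theorem mainTheorem4 (q : ℂ) (hq0 : q ≠ 0) (hq : ∀ n : ℕ, 0 < n → q ^ n ≠ 1)
    (M N : ℕ) (hMN : 0 < M * N) (hne : M ≠ N) :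
    -- (a)
    (∀ (V : Type*) [AddCommGroup V] [Module ℂ V] [Module (U q M N) V]
      [IsScalarTower ℂ (U q M N) V] (𝒱 : ZMod 2 → Submodule ℂ V),
      IsSuperModule (gradU q M N) 𝒱 → FiniteDimensional ℂ V → IsSimpleSuper (U q M N) 𝒱 →
      ∃ w ∈ R q M N, ∃ π ∈ D q M N,
        IsoPullback ((iota q M N).comp (π : U q M N →ₐ[ℂ] U q M N)) 𝒱 (gradSimpleQ q w)) ∧
    -- (b)
    (∀ w ∈ R q M N, ∀ (V : Type*) [AddCommGroup V] [Module ℂ V] [Module (U q M N) V]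
      [IsScalarTower ℂ (U q M N) V] (𝒱 : ZMod 2 → Submodule ℂ V),
      IsSuperModule (gradU q M N) 𝒱 → FiniteDimensional ℂ V →
      ∀ θ : Verma q w →ₗ[U q M N] V, Function.Surjective θ →
        IsEvenMap (gradVerma q w) 𝒱 θ →
        ∃ Q : ℂ[X], (w, Q) ∈ Rtilde q M N ∧
          ∃ θ' : Weyl q w Q →ₗ[U q M N] V, IsEvenMap (gradWeyl q w Q) 𝒱 θ' ∧
            θ = θ' ∘ₗ vermaToWeyl q w Q) ∧
    -- (c)
    (∀ (w : HW M N) (Q₁ Q₂ : ℂ[X]), (w, Q₁) ∈ Rtilde q M N → (w, Q₂) ∈ Rtilde q M N →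
      ((∃ g : Weyl q w Q₂ →ₗ[U q M N] Weyl q w Q₁,
          IsEvenMap (gradWeyl q w Q₂) (gradWeyl q w Q₁) g ∧
            vermaToWeyl q w Q₁ = g ∘ₗ vermaToWeyl q w Q₂) ↔ Q₁ ∣ Q₂)) := by
  refine ⟨?_, ?_, fun w Q₁ Q₂ h₁ h₂ => factorization_iff hq0 hq hMN hne w h₁ h₂⟩
  · intro V _ _ _ _ 𝒱 h _ hs
    exact exists_isoPullback hq0 hq hMN hne h hs
  · intro w hw V _ _ _ _ 𝒱 _ hV θ _ hθ
    exact exists_factorization hq0 hq hMN hne hw 𝒱 θ hθ
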